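/- **Setting.** Let $\lambda\ge 1$, $\mathbb T_\lambda=\mathbb R/2\pi\lambda\mathbb Z$, $\mathbb Z_\lambda=\{n/\lambda:n\in\mathbb Z\}$ with the measure $\int_{\mathbb Z_\lambda}a(k)\,dk^\lambda=\frac1\lambda\sum_{k\in\mathbb Z_\lambda}a(k)$, and $\langle x\rangle=1+|x|$. For $w$ on $\mathbb T_\lambda\times\mathbb R$ let $\hat w(k,\tau)=\int_{\mathbb R}\int_0^{2\pi\lambda}e^{-i(\tau t+kx)}w(x,t)\,dx\,dt$, $(k,\tau)\in\mathbb Z_\lambda\times\mathbb R$. For $\alpha\ne0$ and $\beta,s,b\in\mathbb R$ put $\phi^{\alpha,\beta}(k)=\alpha k^3-\beta k$. The space $X^{\alpha,\beta}_{s,b,\lambda}$ is the completion of the Schwartz space on $\mathbb T_\lambda\times\mathbb R$ in the norm $$\|w\|_{X^{\alpha,\beta}_{s,b,\lambda}}=\big\|\langle k\rangle^s\langle\tau-\phi^{\alpha,\beta}(k)\rangle^b\,\hat w(k,\tau)\big\|_{L^2(\mathbb Z_\lambda\times\mathbb R)},$$ identified, through the Fourier transform, with the corresponding weighted $L^2$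 space of measurable functions $\hat w$ on $\mathbb Z_\lambda\times\mathbb R$. Further $$\|w\|_{Z^{\alpha,\beta}_{s,\lambda}}=\|w\|_{X^{\alpha,\beta}_{s,-1/2,\lambda}}+\Big\|\frac{\langle k\rangle^s\hat w(k,\tau)}{\langle\tau-\phi^{\alpha,\beta}(k)\rangle}\Big\|_{L^2(\mathbb Z_\lambda)L^1(\mathbb R)} .$$ For elements $w_1,w_2$ of these spaces the product is defined by $\widehat{w_1w_2}(k,\tau)=\frac1{4\pi^2}\int_{\mathbb Z_\lambda}\int_{\mathbb R}\hat w_1(k_1,\tau_1)\hat w_2(k-k_1,\tau-\tau_1)\,d\tau_1\,dk_1^\lambda$, and $\partial_x$ is multiplication of the transform by $ik$ (so the frequency $k=0$ of $w_1w_2$ plays no role in $\partial_x(w_1w_2)$); for Schwartz functions these are the pointwise product and derivative. For $\rho\in\mathbb R$ let $\mu(\rho)\in[-\infty,\infty]$ be the irrationality exponent, that is the supremum of those $\mu\in\mathbb R$ for which $0<|\rho-\frac mn|<|n|^{-\mu}$ has infinitely many solutions $(m,n)\in\mathbb Z\times(\mathbb Z\setminus\{0\})$. For $r\ge\frac14$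 let $\sigma_r=\mu(\sqrt{12r-3})$, and let $s_r=1$ if $\sigma_r=1$ or $\sigma_r\ge3$, and $s_r=\frac{\sigma_r-1}2$ if $2\le\sigma_r<3$. **Statement.** Let $\alpha_1,\alpha_2\in\mathbb R\setminus\{0\}$ and $r=\alpha_2/\alpha_1$. There is $\epsilon=\epsilon(\alpha_1,\alpha_2)>0$, and for all $s,p\in\mathbb R$ there is $C=C(\alpha_1,\alpha_2,s,p)>0$, such that for all $\lambda\ge1$ and all $\beta_1,\beta_2\in\mathbb R$ with $|\beta_1|+|\beta_2|\le\lambda^{-1/2}\epsilon$ the four assertions below hold. Here (R) denotes the condition that $r\in[\frac14,\infty)\setminus\{1\}$ and either * $s\ge1$ and $p>0$; or * $\beta_1=\beta_2$ and: $s\ge1$, $p>0$ if $s_r=1$; $s>s_r$, $p>s_r$ if $s_r<1$. 1. (Divergence form 1) For all $w_1,w_2\in X^{\alpha_1,\beta_1}_{s,1/2,\lambda}$, $$\|\partial_x(w_1w_2)\|_{Z^{\alpha_2,\beta_2}_{s,\lambda}}\le C\lambda^p\|w_1\|_{X^{\alpha_1,\beta_1}_{s,1/2,\lambda}}\|w_2\|_{X^{\alpha_1,\beta_1}_{s,1/2,\lambda}}$$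 provided that one of the following holds: (a) $r<\frac14$, $s\ge-\frac12$, $p>0$; (b) $r=1$, $s\ge-\frac12$, $p>0$, $\hat w_1(0,\cdot)=\hat w_2(0,\cdot)=0$; (c) condition (R). 2. (Divergence form 2) For all $w_1\in X^{\alpha_1,\beta_1}_{s,1/2,\lambda}$ and $w_2\in X^{\alpha_2,\beta_2}_{s,1/2,\lambda}$ with $\hat w_2(0,\cdot)=0$, $$\|\partial_x(w_1w_2)\|_{Z^{\alpha_1,\beta_1}_{s,\lambda}}\le C\lambda^p\|w_1\|_{X^{\alpha_1,\beta_1}_{s,1/2,\lambda}}\|w_2\|_{X^{\alpha_2,\beta_2}_{s,1/2,\lambda}}$$ provided that one of the following holds: (a) $r<\frac14$, $s\ge-\frac12$, $p>0$; (b) $r=1$, $s\ge-\frac12$, $p>0$, $\hat w_1(0,\cdot)=0$; (c) condition (R). 3. (Non-divergence form 1) For all $w_1\in X^{\alpha_1,\beta_1}_{s,1/2,\lambda}$ and $w_2\in X^{\alpha_2,\beta_2}_{s,1/2,\lambda}$ with $\hat w_2(0,\cdot)=0$, $$\|(\partial_xw_1)w_2\|_{Z^{\alpha_1,\beta_1}_{s,\lambda}}\le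 C\lambda^p\|w_1\|_{X^{\alpha_1,\beta_1}_{s,1/2,\lambda}}\|w_2\|_{X^{\alpha_2,\beta_2}_{s,1/2,\lambda}}$$ provided that one of the following holds: (a) $r<\frac14$, $s\ge-\frac14$, $p>0$; (b) $r=1$, $s\ge\frac12$, $p>0$; (c) condition (R). 4. (Non-divergence form 2) For all $w_1\in X^{\alpha_1,\beta_1}_{s,1/2,\lambda}$ and $w_2\in X^{\alpha_2,\beta_2}_{s,1/2,\lambda}$, $$\|w_1(\partial_xw_2)\|_{Z^{\alpha_1,\beta_1}_{s,\lambda}}\le C\lambda^p\|w_1\|_{X^{\alpha_1,\beta_1}_{s,1/2,\lambda}}\|w_2\|_{X^{\alpha_2,\beta_2}_{s,1/2,\lambda}}$$ provided that one of the following holds: (a) $r<\frac14$, $s\ge-\frac14$, $p>0$; (b) $r=1$, $s\ge\frac12$, $p>0$, $\hat w_1(0,\cdot)=0$; (c) condition (R). Moreover, in each case the convolution integral that defines the product converges absolutely for every $k\in\mathbb Z_\lambda$ (every $k\neq0$ in 1 and 2) and almost every $\tau$; and the four estimates hold for Schwartz functions $w_1,w_2$ with the pointwise products and derivatives. -/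

import Mathlib

open MeasureTheory
open scoped ENNReal

noncomputable section

namespace CoupledKdV

/-! ### Diophantine approximation -/

/-- `ρ` is approximable with power `μ`: the inequality `0 < |ρ - m/n| < 1/|n|^μ` has infinitely
many solutions `(m, n)` with `n ≠ 0`. -/
def ApproximableWithPower (ρ μ : ℝ) : Prop :=
  {q : ℤ × ℤ | q.2 ≠ 0 ∧ 0 < |ρ - (q.1 : ℝ) / (q.2 : ℝ)| ∧
    |ρ - (q.1 : ℝ) / (q.2 : ℝ)| < 1 / |(q.2 : ℝ)| ^ μ}.Infinite

/-- The irrationality exponent of `ρ`, as an extended real number. -/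
def irrationalityExponent (ρ : ℝ) : EReal :=
  sSup ((fun μ : ℝ => (μ : EReal)) '' {μ : ℝ | ApproximableWithPower ρ μ})

/-- `σ_r`, the irrationality exponent of `√(12 r - 3)`, for `r ≥ 1/4`. -/
def sigmaIndex (r : ℝ) : EReal := irrationalityExponent (Real.sqrt (12 * r - 3))

open Classical in
/-- The index `s_r`, for `r ≥ 1/4`: it is `1` if `σ_r = 1` or `σ_r ≥ 3`, and `(σ_r - 1)/2` in the
remaining case `2 ≤ σ_r < 3`. -/
def sIndex (r : ℝ) : ℝ :=
  if sigmaIndex r = 1 ∨ 3 ≤ sigmaIndex r then 1 else ((sigmaIndex r).toReal - 1) / 2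

/-! ### Functions on `𝕋_λ × ℝ` and their transforms on `ℤ_λ × ℝ`

A function on `𝕋_λ × ℝ` is a function `w x t` on `ℝ × ℝ` that is `2πλ`-periodic in `x`.
A function on `ℤ_λ × ℝ`, where `ℤ_λ = {n / λ : n ∈ ℤ}`, is written `f n τ` with `n : ℤ`; its
frequency is `k = n / λ`. -/

/-- The Japanese bracket `⟨x⟩ = 1 + |x|`. -/
def bracket (x : ℝ) : ℝ := 1 + |x|

/-- The phase function `φ^{α,β}(k) = α k³ - β k`. -/
def phase (α β k : ℝ) : ℝ := α * k ^ 3 - β * k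

/-- The measure `dk^λ` on `ℤ_λ`: every point has mass `1/λ`. -/
def latticeMeasure (lam : ℝ) : Measure ℤ := ENNReal.ofReal (1 / lam) • Measure.count

/-- The Schwartz space on `𝕋_λ × ℝ`: smooth functions, `2πλ`-periodic in `x`, all of whose
derivatives decay faster than any power of `t`, uniformly in `x`. -/
structure IsSchwartz (lam : ℝ) (w : ℝ → ℝ → ℂ) : Prop where
  smooth : ContDiff ℝ (⊤ : ℕ∞) (fun q : ℝ × ℝ => w q.1 q.2)
  periodic : ∀ x t, w (x + 2 * Real.pi * lam) t = w x t
  decay : ∀ m j : ℕ, ∃ K : ℝ, ∀ x t,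
    |t| ^ m * ‖iteratedFDeriv ℝ j (fun q : ℝ × ℝ => w q.1 q.2) (x, t)‖ ≤ K

/-- The space-time Fourier transform
`(ℱ w)(k, τ) = ∫_ℝ ∫_0^{2πλ} e^{-i(τ t + k x)} w(x, t) dx dt`, at `k = n / λ`. -/
def spaceTimeFT (lam : ℝ) (w : ℝ → ℝ → ℂ) (n : ℤ) (τ : ℝ) : ℂ :=
  ∫ t : ℝ, ∫ x in (0 : ℝ)..(2 * Real.pi * lam),
    Complex.exp (-Complex.I * ((τ * t + (n : ℝ) / lam * x : ℝ) : ℂ)) * w x t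

/-- The derivative in the space variable `x`. -/
def dx (w : ℝ → ℝ → ℂ) (x t : ℝ) : ℂ := deriv (fun y => w y t) x

/-- The norm `‖⟨k⟩^s ⟨τ - φ^{α,β}(k)⟩^b f(k, τ)‖_{L²(ℤ_λ × ℝ)}`: the `X^{α,β}_{s,b,λ}` norm of the
distribution with space-time Fourier transform `f`. -/
def xNorm (lam α β s b : ℝ) (f : ℤ → ℝ → ℂ) : ℝ≥0∞ :=
  (∫⁻ n : ℤ, (∫⁻ τ : ℝ,
    ENNReal.ofReal (bracket ((n : ℝ) / lam) ^ s *
      bracket (τ - phase α β ((n : ℝ) / lam)) ^ b * ‖f n τ‖) ^ (2 : ℝ))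
    ∂(latticeMeasure lam)) ^ (1 / 2 : ℝ)

/-- The norm `‖⟨k⟩^s f(k, τ) / ⟨τ - φ^{α,β}(k)⟩‖_{L²(ℤ_λ) L¹(ℝ)}`. -/
def l2l1Norm (lam α β s : ℝ) (f : ℤ → ℝ → ℂ) : ℝ≥0∞ :=
  (∫⁻ n : ℤ, (∫⁻ τ : ℝ,
    ENNReal.ofReal (bracket ((n : ℝ) / lam) ^ s * ‖f n τ‖ /
      bracket (τ - phase α β ((n : ℝ) / lam)))) ^ (2 : ℝ)
    ∂(latticeMeasure lam)) ^ (1 / 2 : ℝ)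

/-- The `Z^{α,β}_{s,λ}` norm of the distribution with space-time Fourier transform `f`. -/
def zNorm (lam α β s : ℝ) (f : ℤ → ℝ → ℂ) : ℝ≥0∞ :=
  xNorm lam α β s (-(1 / 2)) f + l2l1Norm lam α β s f

/-- The elements of the Fourier restriction space `X^{α,β}_{s,b,λ}`, given by their space-time
Fourier transforms. The Fourier transform identifies the completion of the Schwartz space in the
`X` norm with this weighted `L²` space: it contains the transforms of all Schwartz functions as a
dense subspace, and it is complete (functions that agree almost everywhere being the same). -/
structure MemX (lam α β s b : ℝ) (f : ℤ → ℝ → ℂ) : Prop where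
  measurable : ∀ n, AEStronglyMeasurable (f n) volume
  finite : xNorm lam α β s b f < ⊤

/-- The mean-zero condition `ŵ(0, ·) = 0`, for `w` with space-time Fourier transform `f`. -/
def ZeroMean (f : ℤ → ℝ → ℂ) : Prop := ∀ᵐ τ : ℝ, f 0 τ = 0

/-- The space derivative `∂_x` on the Fourier side. -/
def fourierDx (lam : ℝ) (f : ℤ → ℝ → ℂ) (n : ℤ) (τ : ℝ) : ℂ :=
  Complex.I * (((n : ℝ) / lam : ℝ) : ℂ) * f n τ

/-- Absolute convergence of the convolution of `f` and `g` at the point `(n / λ, τ)`. -/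
def ConvConverges (lam : ℝ) (f g : ℤ → ℝ → ℂ) (n : ℤ) (τ : ℝ) : Prop :=
  Integrable (fun q : ℤ × ℝ => f q.1 q.2 * g (n - q.1) (τ - q.2))
    ((latticeMeasure lam).prod volume)

/-- The product `w₁ w₂` on the Fourier side:
`(ℱ(w₁ w₂))(k, τ) = (1 / 4π²) ∫_{ℤ_λ} ∫_ℝ ŵ₁(k₁, τ₁) ŵ₂(k - k₁, τ - τ₁) dτ₁ dk₁^λ`. -/
def fourierMul (lam : ℝ) (f g : ℤ → ℝ → ℂ) (n : ℤ) (τ : ℝ) : ℂ :=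
  ((1 / (4 * Real.pi ^ 2) : ℝ) : ℂ) *
    ∫ q : ℤ × ℝ, f q.1 q.2 * g (n - q.1) (τ - q.2) ∂((latticeMeasure lam).prod volume)

/-! ### The ranges of the parameters -/

/-- The conditions in the range `r ∈ [1/4, ∞)` with `r ≠ 1`. -/
def ResonantRange (r s p β₁ β₂ : ℝ) : Prop :=
  1 / 4 ≤ r ∧ r ≠ 1 ∧
    ((1 ≤ s ∧ 0 < p) ∨
      (β₁ = β₂ ∧
        ((sIndex r = 1 ∧ 1 ≤ s ∧ 0 < p) ∨ (sIndex r < 1 ∧ sIndex r < s ∧ sIndex r < p))))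

/-- The conditions for `∂_x (w₁ w₂)` with both factors in the space of `(α₁, β₁)`. -/
def Div1Cond (r s p β₁ β₂ : ℝ) (f g : ℤ → ℝ → ℂ) : Prop :=
  (r < 1 / 4 ∧ -(1 / 2) ≤ s ∧ 0 < p) ∨
  (r = 1 ∧ -(1 / 2) ≤ s ∧ 0 < p ∧ ZeroMean f ∧ ZeroMean g) ∨
  ResonantRange r s p β₁ β₂

/-- The conditions for `∂_x (w₁ w₂)` with factors in the spaces of `(α₁, β₁)` and `(α₂, β₂)`. -/
def Div2Cond (r s p β₁ β₂ : ℝ) (f g : ℤ → ℝ → ℂ) : Prop :=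
  ZeroMean g ∧
  ((r < 1 / 4 ∧ -(1 / 2) ≤ s ∧ 0 < p) ∨
   (r = 1 ∧ -(1 / 2) ≤ s ∧ 0 < p ∧ ZeroMean f) ∨
   ResonantRange r s p β₁ β₂)

/-- The conditions for `(∂_x w₁) w₂`. -/
def Nondiv1Cond (r s p β₁ β₂ : ℝ) (g : ℤ → ℝ → ℂ) : Prop :=
  ZeroMean g ∧
  ((r < 1 / 4 ∧ -(1 / 4) ≤ s ∧ 0 < p) ∨
   (r = 1 ∧ 1 / 2 ≤ s ∧ 0 < p) ∨
   ResonantRange r s p β₁ β₂)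

/-- The conditions for `w₁ (∂_x w₂)`. -/
def Nondiv2Cond (r s p β₁ β₂ : ℝ) (f : ℤ → ℝ → ℂ) : Prop :=
  (r < 1 / 4 ∧ -(1 / 4) ≤ s ∧ 0 < p) ∨
  (r = 1 ∧ 1 / 2 ≤ s ∧ 0 < p ∧ ZeroMean f) ∨
  ResonantRange r s p β₁ β₂

end CoupledKdV

end

/-!
On the Fourier side all four products are convolutions, and the estimates become bilinear estimates
for nonnegative functions on `ℤ_λ × ℝ`, whose kernel is a weight in the frequencies divided by
powers of the three modulations (`ZBdd`, `ZBdd.zNorm_le`). After a reflection of the output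
frequency they are instances of two symmetric estimates (`SymZ`), for frequencies
`k₁ + k₂ + k₃ = 0` of which the first two belong to waves with the phase of `(α₁, β₁)` and the third
to a wave with the phase of `(α₂, β₂)`. The largest of the three modulations dominates the
resonance function (`bracket_resonance_le`, `symResonance_wave`)
`H = (α₂ - α₁) k₃³ + 3 α₁ k₁ k₂ k₃ + (β₁ - β₂) k₃`.
If the largest modulation is removed, the Cauchy–Schwarz inequality reduces the estimates to sums
over slices of fixed frequency, with a weight `V` and `θ < 1` close to `1`: sums of `V² ⟨H⟩^{-θ}`
with one of the three frequencies fixed (`SymZ.of_triv`), or sums of `V² ⟨H⟩^{-1} ⟨H - a⟩^{-θ}`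
uniformly in `a`, with each of the three frequencies fixed in turn (`SymZ.of_kpv`). If `V²` is dominated by
`⟨H⟩` the latter count the lattice points where `H` is close to `a`; they are bounded because the
values of quadratic and cubic polynomials on the lattice are separated
(`exists_tsum_separated_le`). Harmonic sums over the lattice cost an arbitrarily small power of `λ`,
which is the reason for the factor `λ^p`.

The frequency plane is divided as follows.

* Bounded frequencies: the weight is bounded (`exists_symZ_of_bounded`).
* One frequency `k` with `0 < |k| ≤ 1`: the square of the weight, divided by `⟨H⟩`, is of order
  `1 / |k|`, which leads to a harmonic sum (`exists_symZ_of_weak`, `exists_symZ_low_third`). If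
  `α₁ = α₂` and `k` is the frequency `k₁` or `k₂`, then `H` may vanish. The condition
  `|β₁| + |β₂| ≤ ε λ^{-1/2}` confines its zeros to a region where the square of the weight is of
  order `1 / |k|` by itself (`exists_symZ_low_input`).
* High frequencies without resonance: the square of the weight is dominated by `⟨H⟩`, because of
  `|H| ≳ |k₃| N²` with `N` the size of the largest frequency. If `α₂ / α₁ < 1 / 4`
  then `H / k₃` is a definite quadratic form, apart from the constant `β₁ - β₂`, so that this is the
  only case (`exists_resonance_lower`). For `α₁ = α₂` it is replaced by `|H| ≳ |k₁ k₂ k₃|`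
  (`exists_symZ_high_eq`).
* Resonant frequencies, for `α₂ / α₁ ≥ 1 / 4` and `α₁ ≠ α₂`: here all three frequencies are
  comparable to `N` (`exists_resonance_lower_or`), and the weight is of order `N^{1-s}`. For `s ≥ 1`
  it is bounded. For `s < 1` and `β₁ = β₂` the resonance function is a product of linear factors
  that vanish on the lines `3 (k₁ - k₂) = ± ρ k₃`, `ρ = √(12 α₂ / α₁ - 3)` (`wave_resonance_eq`).
  Lattice points cannot be too close to these lines: the irrationality exponent of `ρ` gives
  `|H| ≳ N^{3-μ} λ^{-μ}`, with an exponent `μ ≤ 3` that is also less than `2 s + 1` and `2 p + 1`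
  (`exists_exponent_of_sIndex_lt`). Together with the separation of the values of `H` at
  consecutive lattice points this bounds the sums near the lines (`exists_symZ_resonant`).

For Schwartz functions the transforms decay rapidly and lie in all of the spaces
(`IsSchwartz.memX`); Fourier inversion (`IsSchwartz.eq_integral_spaceTimeFT`) turns pointwise
products into convolutions (`IsSchwartz.spaceTimeFT_mul`).
-/

noncomputable section

namespace CoupledKdV

/-! ### Bilinear integral operators on `ℤ_λ × ℝ` -/

/-- The measure `dk^λ dτ` on `ℤ_λ × ℝ`. -/
abbrev phaseMeasure (lam : ℝ) : Measure (ℤ × ℝ) := (latticeMeasure lam).prod volume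

instance latticeMeasure_isAddLeftInvariant (lam : ℝ) :
    (latticeMeasure lam).IsAddLeftInvariant := by
  unfold latticeMeasure; infer_instance

theorem lintegral_latticeMeasure (lam : ℝ) (f : ℤ → ℝ≥0∞) :
    ∫⁻ n, f n ∂(latticeMeasure lam) = ENNReal.ofReal (1 / lam) * ∑' n, f n := by
  rw [latticeMeasure, lintegral_smul_measure, lintegral_count, smul_eq_mul]

theorem lintegral_phaseMeasure (lam : ℝ) {f : ℤ × ℝ → ℝ≥0∞} (hf : Measurable f) :
    ∫⁻ x, f x ∂(phaseMeasure lam) = ENNReal.ofReal (1 / lam) * ∑' n, ∫⁻ τ, f (n, τ) := by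
  rw [lintegral_prod _ hf.aemeasurable, lintegral_latticeMeasure]

instance phaseMeasure_isNegInvariant (lam : ℝ) : (phaseMeasure lam).IsNegInvariant := by
  have h1 : (latticeMeasure lam).map Neg.neg = latticeMeasure lam := by
    ext s hs
    rw [Measure.map_apply measurable_neg hs, latticeMeasure, Measure.smul_apply,
      Measure.smul_apply, Measure.count_apply (measurable_neg hs), Measure.count_apply hs]
    congr 2
    exact Set.encard_preimage_of_bijective neg_involutive.bijective s
  have h2 : (volume : Measure ℝ).map Neg.neg = volume := Measure.map_neg_eq_self _
  constructor
  have h := Measure.map_prod_map (latticeMeasure lam) (volume : Measure ℝ)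
    (measurable_neg (G := ℤ)) (measurable_neg (G := ℝ))
  rw [h1, h2] at h
  exact h.symm

theorem sq_lintegral_mul_le {α : Type*} [MeasurableSpace α] (μ : Measure α) {f g : α → ℝ≥0∞}
    (hf : AEMeasurable f μ) (hg : AEMeasurable g μ) :
    (∫⁻ a, f a * g a ∂μ) ^ 2 ≤ (∫⁻ a, f a ^ 2 ∂μ) * ∫⁻ a, g a ^ 2 ∂μ := by
  have h := ENNReal.lintegral_mul_le_Lp_mul_Lq μ Real.HolderConjugate.two_two hf hg
  simp only [ENNReal.rpow_two, Pi.mul_apply] at h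
  calc _ ≤ ((∫⁻ a, f a ^ 2 ∂μ) ^ (1 / 2 : ℝ) * (∫⁻ a, g a ^ 2 ∂μ) ^ (1 / 2 : ℝ)) ^ 2 := by
        gcongr
    _ = _ := by
        rw [mul_pow, ← ENNReal.rpow_natCast, ← ENNReal.rpow_natCast, ← ENNReal.rpow_mul,
          ← ENNReal.rpow_mul]
        norm_num

/-- The bilinear operator `z ↦ ∫ κ(x, z - x) F₁(x) F₂(z - x) dx` with kernel `κ`. -/
def bil (lam : ℝ) (κ : ℤ × ℝ → ℤ × ℝ → ℝ≥0∞) (F₁ F₂ : ℤ × ℝ → ℝ≥0∞) (z : ℤ × ℝ) : ℝ≥0∞ :=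
  ∫⁻ x, κ x (z - x) * (F₁ x * F₂ (z - x)) ∂(phaseMeasure lam)

theorem bil_mono (lam : ℝ) {κ κ' : ℤ × ℝ → ℤ × ℝ → ℝ≥0∞} (h : ∀ x y, κ x y ≤ κ' x y)
    (F₁ F₂ : ℤ × ℝ → ℝ≥0∞) (z : ℤ × ℝ) : bil lam κ F₁ F₂ z ≤ bil lam κ' F₁ F₂ z :=
  lintegral_mono fun x => by gcongr; exact h _ _

theorem measurable_comp_sub {H : ℤ × ℝ → ℤ × ℝ → ℝ≥0∞} (hH : Measurable (Function.uncurry H)) :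
    Measurable fun q : (ℤ × ℝ) × (ℤ × ℝ) => H q.2 (q.1 - q.2) :=
  hH.comp (measurable_snd.prodMk (measurable_fst.sub measurable_snd))

section Bilinear

variable {lam : ℝ} {κ : ℤ × ℝ → ℤ × ℝ → ℝ≥0∞} {F₁ F₂ : ℤ × ℝ → ℝ≥0∞}

theorem measurable_bil_integrand (hκ : Measurable (Function.uncurry κ)) (h₁ : Measurable F₁)
    (h₂ : Measurable F₂) :
    Measurable fun q : (ℤ × ℝ) × (ℤ × ℝ) => κ q.2 (q.1 - q.2) * (F₁ q.2 * F₂ (q.1 - q.2)) :=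
  measurable_comp_sub (H := fun x y => κ x y * (F₁ x * F₂ y))
    (hκ.mul ((h₁.comp measurable_fst).mul (h₂.comp measurable_snd)))

theorem measurable_bil (hκ : Measurable (Function.uncurry κ)) (h₁ : Measurable F₁)
    (h₂ : Measurable F₂) : Measurable (bil lam κ F₁ F₂) :=
  (measurable_bil_integrand hκ h₁ h₂).lintegral_prod_right'

theorem bil_add (hκ : Measurable (Function.uncurry κ)) (h₁ : Measurable F₁)
    (h₂ : Measurable F₂) (κ' : ℤ × ℝ → ℤ × ℝ → ℝ≥0∞) (z : ℤ × ℝ) :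
    bil lam (fun x y => κ x y + κ' x y) F₁ F₂ z = bil lam κ F₁ F₂ z + bil lam κ' F₁ F₂ z := by
  unfold bil
  have hm : Measurable fun x => κ x (z - x) * (F₁ x * F₂ (z - x)) :=
    (measurable_bil_integrand hκ h₁ h₂).comp (measurable_const.prodMk measurable_id)
  rw [← lintegral_add_left hm]
  simp only [add_mul]

/-- Tonelli for the substitution `(z, x) ↦ (x, z - x)`. -/
theorem lintegral_lintegral_comp_sub {H : ℤ × ℝ → ℤ × ℝ → ℝ≥0∞}
    (hH : Measurable (Function.uncurry H)) :
    ∫⁻ z, ∫⁻ x, H x (z - x) ∂(phaseMeasure lam) ∂(phaseMeasure lam)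
      = ∫⁻ x, ∫⁻ y, H x y ∂(phaseMeasure lam) ∂(phaseMeasure lam) := by
  rw [lintegral_lintegral_swap (f := fun z x => H x (z - x))
    (measurable_comp_sub hH).aemeasurable]
  exact lintegral_congr fun x => lintegral_sub_right_eq_self (fun y => H x y) x

/-- The squared kernel is integrable uniformly for fixed output variable. -/
theorem bil_sq_le_of_out (hκ : Measurable (Function.uncurry κ)) (h₁ : Measurable F₁)
    (h₂ : Measurable F₂) {A : ℝ≥0∞}
    (hA : ∀ z, ∫⁻ x, κ x (z - x) ^ 2 ∂(phaseMeasure lam) ≤ A) :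
    ∫⁻ z, bil lam κ F₁ F₂ z ^ 2 ∂(phaseMeasure lam) ≤
      A * ((∫⁻ x, F₁ x ^ 2 ∂(phaseMeasure lam)) * ∫⁻ x, F₂ x ^ 2 ∂(phaseMeasure lam)) := by
  have hF : Measurable (Function.uncurry fun x y : ℤ × ℝ => F₁ x ^ 2 * F₂ y ^ 2) :=
    ((h₁.comp measurable_fst).pow_const 2).mul ((h₂.comp measurable_snd).pow_const 2)
  calc ∫⁻ z, bil lam κ F₁ F₂ z ^ 2 ∂(phaseMeasure lam)
      ≤ ∫⁻ z, A * ∫⁻ x, F₁ x ^ 2 * F₂ (z - x) ^ 2 ∂(phaseMeasure lam) ∂(phaseMeasure lam) := by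
        refine lintegral_mono fun z => ?_
        have hz : Measurable fun x : ℤ × ℝ => z - x := measurable_const.sub measurable_id
        refine (sq_lintegral_mul_le _ (hκ.comp (measurable_id.prodMk hz)).aemeasurable
          (h₁.mul (h₂.comp hz)).aemeasurable).trans ?_
        refine mul_le_mul' (hA z) (le_of_eq (lintegral_congr fun x => ?_))
        rw [← mul_pow]; rfl
    _ = _ := by
        rw [lintegral_const_mul _ (measurable_comp_sub hF).lintegral_prod_right',
          lintegral_lintegral_comp_sub hF]
        simp only [lintegral_const_mul _ (h₂.pow_const 2),
          lintegral_mul_const _ (h₁.pow_const 2)]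

/-- The squared kernel is integrable uniformly for fixed first input variable. -/
theorem bil_sq_le_of_fst (hκ : Measurable (Function.uncurry κ)) (h₁ : Measurable F₁)
    (h₂ : Measurable F₂) {A : ℝ≥0∞}
    (hA : ∀ x, ∫⁻ y, κ x y ^ 2 ∂(phaseMeasure lam) ≤ A) :
    ∫⁻ z, bil lam κ F₁ F₂ z ^ 2 ∂(phaseMeasure lam) ≤
      A * ((∫⁻ x, F₁ x ^ 2 ∂(phaseMeasure lam)) * ∫⁻ x, F₂ x ^ 2 ∂(phaseMeasure lam)) := by
  have hF : Measurable (Function.uncurry fun x y : ℤ × ℝ => F₁ x ^ 2 * κ x y ^ 2) :=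
    ((h₁.comp measurable_fst).pow_const 2).mul (hκ.pow_const 2)
  calc ∫⁻ z, bil lam κ F₁ F₂ z ^ 2 ∂(phaseMeasure lam)
      ≤ ∫⁻ z, (∫⁻ x, F₂ x ^ 2 ∂(phaseMeasure lam)) *
          ∫⁻ x, F₁ x ^ 2 * κ x (z - x) ^ 2 ∂(phaseMeasure lam) ∂(phaseMeasure lam) := by
        refine lintegral_mono fun z => ?_
        have hz : Measurable fun x : ℤ × ℝ => z - x := measurable_const.sub measurable_id
        have h := sq_lintegral_mul_le (phaseMeasure lam) (h₂.comp hz).aemeasurable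
          (h₁.mul (hκ.comp (measurable_id.prodMk hz))).aemeasurable
        refine le_trans (le_of_eq ?_) (h.trans (le_of_eq ?_))
        · congr 1
          refine lintegral_congr fun x => ?_
          simp only [Pi.mul_apply, Function.comp, Function.uncurry, id]
          ring
        · congr 1
          · exact lintegral_sub_left_eq_self (fun y => F₂ y ^ 2) z
          · refine lintegral_congr fun x => ?_
            simp only [Pi.mul_apply, Function.comp, Function.uncurry, id]
            ring
    _ = (∫⁻ x, F₂ x ^ 2 ∂(phaseMeasure lam)) *
          ∫⁻ x, F₁ x ^ 2 * ∫⁻ y, κ x y ^ 2 ∂(phaseMeasure lam) ∂(phaseMeasure lam) := by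
        rw [lintegral_const_mul _ (measurable_comp_sub hF).lintegral_prod_right',
          lintegral_lintegral_comp_sub hF]
        congr 1
        exact lintegral_congr fun x => lintegral_const_mul _
          ((hκ.comp (measurable_const.prodMk measurable_id)).pow_const 2 : Measurable fun y => _)
    _ ≤ (∫⁻ x, F₂ x ^ 2 ∂(phaseMeasure lam)) *
          ∫⁻ x, F₁ x ^ 2 * A ∂(phaseMeasure lam) := by
        gcongr with x; exact hA x
    _ = _ := by rw [lintegral_mul_const _ (h₁.pow_const 2)]; ring

/-- The squared kernel is integrable uniformly for fixed second input variable. -/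
theorem bil_sq_le_of_snd (hκ : Measurable (Function.uncurry κ)) (h₁ : Measurable F₁)
    (h₂ : Measurable F₂) {A : ℝ≥0∞}
    (hA : ∀ y, ∫⁻ x, κ x y ^ 2 ∂(phaseMeasure lam) ≤ A) :
    ∫⁻ z, bil lam κ F₁ F₂ z ^ 2 ∂(phaseMeasure lam) ≤
      A * ((∫⁻ x, F₁ x ^ 2 ∂(phaseMeasure lam)) * ∫⁻ x, F₂ x ^ 2 ∂(phaseMeasure lam)) := by
  have h := bil_sq_le_of_fst (lam := lam) (κ := fun x y => κ y x) (F₁ := F₂) (F₂ := F₁)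
    (hκ.comp measurable_swap) h₂ h₁ hA
  rw [mul_comm (∫⁻ x, F₂ x ^ 2 ∂(phaseMeasure lam))] at h
  refine le_trans (le_of_eq (lintegral_congr fun z => ?_)) h
  congr 1
  unfold bil
  rw [← lintegral_sub_left_eq_self _ z]
  exact lintegral_congr fun x => by rw [sub_sub_cancel, mul_comm (F₁ _)]

/-- The `L²(ℤ_λ) L¹(ℝ)` counterpart of `bil_sq_le_of_out`. -/
theorem bil_l2l1_le (hκ : Measurable (Function.uncurry κ)) (h₁ : Measurable F₁)
    (h₂ : Measurable F₂) {A : ℝ≥0∞}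
    (hA : ∀ n, ∫⁻ x, (∫⁻ τ, κ x (n - x.1, τ) ^ 2) ∂(phaseMeasure lam) ≤ A) :
    ∫⁻ n, (∫⁻ τ, bil lam κ F₁ F₂ (n, τ)) ^ 2 ∂(latticeMeasure lam) ≤
      A * ((∫⁻ x, F₁ x ^ 2 ∂(phaseMeasure lam)) * ∫⁻ x, F₂ x ^ 2 ∂(phaseMeasure lam)) := by
  have hsub : ∀ n : ℤ, Measurable fun q : (ℤ × ℝ) × ℝ => ((n - q.1.1, q.2) : ℤ × ℝ) := fun n =>
    (measurable_const.sub (measurable_fst.comp measurable_fst)).prodMk measurable_snd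
  have key : ∀ n : ℤ, ∫⁻ τ, bil lam κ F₁ F₂ (n, τ) =
      ∫⁻ q : (ℤ × ℝ) × ℝ, κ q.1 (n - q.1.1, q.2) * (F₁ q.1 * F₂ (n - q.1.1, q.2))
        ∂((phaseMeasure lam).prod volume) := by
    intro n
    have hm : Measurable fun q : (ℤ × ℝ) × ℝ =>
        κ q.1 (n - q.1.1, q.2) * (F₁ q.1 * F₂ (n - q.1.1, q.2)) :=
      (hκ.comp (measurable_fst.prodMk (hsub n))).mul
        ((h₁.comp measurable_fst).mul (h₂.comp (hsub n)))
    rw [lintegral_prod _ hm.aemeasurable]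
    unfold bil
    rw [lintegral_lintegral_swap]
    · refine lintegral_congr fun x => ?_
      exact lintegral_sub_right_eq_self
        (fun τ => κ x (n - x.1, τ) * (F₁ x * F₂ (n - x.1, τ))) x.2
    · exact ((measurable_bil_integrand hκ h₁ h₂).comp
        ((measurable_const.prodMk measurable_fst).prodMk measurable_snd :
          Measurable fun q : ℝ × (ℤ × ℝ) => (((n, q.1) : ℤ × ℝ), q.2))).aemeasurable
  have hF : Measurable (Function.uncurry fun x y : ℤ × ℝ => F₁ x ^ 2 * F₂ y ^ 2) :=
    ((h₁.comp measurable_fst).pow_const 2).mul ((h₂.comp measurable_snd).pow_const 2)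
  have hF2 : ∀ n : ℤ, Measurable fun q : (ℤ × ℝ) × ℝ => F₁ q.1 ^ 2 * F₂ (n - q.1.1, q.2) ^ 2 :=
    fun n => hF.comp (measurable_fst.prodMk (hsub n))
  calc ∫⁻ n, (∫⁻ τ, bil lam κ F₁ F₂ (n, τ)) ^ 2 ∂(latticeMeasure lam)
      ≤ ∫⁻ n, A * ∫⁻ x, (∫⁻ τ, F₁ x ^ 2 * F₂ (n - x.1, τ) ^ 2) ∂(phaseMeasure lam)
          ∂(latticeMeasure lam) := by
        refine lintegral_mono fun n => ?_
        dsimp only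
        rw [key n]
        refine (sq_lintegral_mul_le _ (hκ.comp (measurable_fst.prodMk (hsub n))).aemeasurable
          ((h₁.comp measurable_fst).mul (h₂.comp (hsub n))).aemeasurable).trans ?_
        refine mul_le_mul' ?_ (le_of_eq ?_)
        · rw [lintegral_prod _
            ((hκ.comp (measurable_fst.prodMk (hsub n))).pow_const 2).aemeasurable]
          exact hA n
        · rw [← lintegral_prod _ (hF2 n).aemeasurable]
          exact lintegral_congr fun q => mul_pow _ _ _
    _ = A * ∫⁻ x, ∫⁻ n, (F₁ x ^ 2 * ∫⁻ τ, F₂ (n - x.1, τ) ^ 2) ∂(latticeMeasure lam)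
          ∂(phaseMeasure lam) := by
        rw [lintegral_const_mul _ (measurable_of_countable _)]
        congr 1
        rw [lintegral_lintegral_swap]
        · refine lintegral_congr fun x => lintegral_congr fun n => ?_
          rw [lintegral_const_mul]
          exact (h₂.comp (measurable_const.prodMk measurable_id)).pow_const 2
        · refine Measurable.aemeasurable (measurable_from_prod_countable_right fun n => ?_)
          exact (hF2 n).lintegral_prod_right'
    _ = _ := by
        congr 1
        rw [← lintegral_mul_const _ (h₁.pow_const 2)]
        refine lintegral_congr fun x => ?_
        rw [lintegral_const_mul _ (measurable_of_countable _)]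
        congr 1
        rw [lintegral_prod _ (h₂.pow_const 2).aemeasurable]
        calc _ = ∫⁻ n, (fun m => ∫⁻ τ, F₂ (m, τ) ^ 2) (-x.1 + n) ∂(latticeMeasure lam) :=
              lintegral_congr fun n => by simp only [neg_add_eq_sub]
          _ = _ := lintegral_add_left_eq_self (fun m => ∫⁻ τ, F₂ (m, τ) ^ 2) (-x.1)

end Bilinear

/-! ### Weights in the modulation variables -/

theorem one_le_bracket (x : ℝ) : 1 ≤ bracket x := by unfold bracket; linarith [abs_nonneg x]

theorem bracket_pos (x : ℝ) : 0 < bracket x := by linarith [one_le_bracket x]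

theorem bracket_neg (x : ℝ) : bracket (-x) = bracket x := by unfold bracket; rw [abs_neg]

theorem bracket_sub_comm (x y : ℝ) : bracket (x - y) = bracket (y - x) := by
  unfold bracket; rw [abs_sub_comm]

theorem measurable_bracket : Measurable bracket :=
  measurable_const.add measurable_id.abs

/-- The larger of two modulations, `M`, pays for the power of `h ≤ 3 M` and makes the power of the
smaller one, `m`, integrable. -/
theorem rpow_mul_le_of_le {δ M m h : ℝ} (hδ : 0 < δ) (hδ' : δ ≤ 1 / 12) (hm : 1 ≤ m)
    (hmM : m ≤ M) (hh : 1 ≤ h) (hM : h ≤ 3 * M) :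
    (M * m) ^ (-(1 - δ)) ≤ 3 * (h ^ (-(1 - 3 * δ)) * m ^ (-1 - δ)) := by
  have hm0 : 0 < m := by linarith
  have hM0 : 0 < M := by linarith
  have h0 : 0 < h := by linarith
  have e1 : M ^ (-(1 - δ)) = M ^ (-(1 - 3 * δ)) * M ^ (-(2 * δ)) := by
    rw [← Real.rpow_add hM0]; ring_nf
  have e2 : m ^ (-1 - δ) = m ^ (-(1 - δ)) * m ^ (-(2 * δ)) := by
    rw [← Real.rpow_add hm0]; ring_nf
  have i1 : M ^ (-(2 * δ)) ≤ m ^ (-(2 * δ)) :=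
    Real.rpow_le_rpow_of_nonpos hm0 hmM (by linarith)
  have i2 : M ^ (-(1 - 3 * δ)) ≤ 3 * h ^ (-(1 - 3 * δ)) := by
    calc M ^ (-(1 - 3 * δ)) ≤ (h / 3) ^ (-(1 - 3 * δ)) :=
          Real.rpow_le_rpow_of_nonpos (by positivity) (by linarith) (by linarith)
      _ = h ^ (-(1 - 3 * δ)) * 3 ^ (1 - 3 * δ) := by
          rw [Real.div_rpow h0.le (by norm_num), div_eq_mul_inv, ← Real.rpow_neg (by norm_num),
            neg_neg]
      _ ≤ h ^ (-(1 - 3 * δ)) * 3 ^ (1 : ℝ) := by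
          gcongr
          · norm_num
          · linarith
      _ = _ := by rw [Real.rpow_one]; ring
  rw [Real.mul_rpow hM0.le hm0.le, e1, e2]
  calc M ^ (-(1 - 3 * δ)) * M ^ (-(2 * δ)) * m ^ (-(1 - δ))
      ≤ (3 * h ^ (-(1 - 3 * δ))) * m ^ (-(2 * δ)) * m ^ (-(1 - δ)) := by gcongr
    _ = _ := by ring

/-- The case of two modulations with sum at least `d`: after `⟨d⟩` is paid for, either of them can
be the one that is integrated over. -/
theorem rpow_mul_le_add {δ a b d : ℝ} (hδ : 0 < δ) (hδ' : δ ≤ 1 / 12) (ha : 1 ≤ a) (hb : 1 ≤ b)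
    (hd : 1 ≤ d) (hab : d ≤ a + b) :
    (a * b) ^ (-(1 - δ)) ≤ 3 * (d ^ (-(1 - 3 * δ)) * (a ^ (-1 - δ) + b ^ (-1 - δ))) := by
  have ha0 : 0 ≤ d ^ (-(1 - 3 * δ)) * a ^ (-1 - δ) := by positivity
  have hb0 : 0 ≤ d ^ (-(1 - 3 * δ)) * b ^ (-1 - δ) := by positivity
  rcases le_total a b with h | h
  · have := rpow_mul_le_of_le hδ hδ' ha h hd (by linarith)
    rw [mul_comm a b]; linarith
  · have := rpow_mul_le_of_le hδ hδ' hb h hd (by linarith)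
    linarith

/-- With three modulations whose sum is at least `h`, any two of them can be left to be integrated
over. -/
theorem rpow_mul_mul_le_add {δ a b c h : ℝ} (hδ : 0 < δ) (hδ' : δ ≤ 1 / 12) (ha : 1 ≤ a)
    (hb : 1 ≤ b) (hc : 1 ≤ c) (hh : 1 ≤ h) (habc : h ≤ a + b + c) :
    (a * b * c) ^ (-(1 - δ)) ≤ 3 * (h ^ (-(1 - 3 * δ)) * (b ^ (-1 - δ) + c ^ (-1 - δ))) := by
  have hb0 : 0 ≤ h ^ (-(1 - 3 * δ)) * b ^ (-1 - δ) := by positivity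
  have hc0 : 0 ≤ h ^ (-(1 - 3 * δ)) * c ^ (-1 - δ) := by positivity
  have mono : ∀ {u v : ℝ}, 1 ≤ u → 1 ≤ v → (u * v) ^ (-(1 - δ)) ≤ u ^ (-(1 - δ)) := fun hu hv =>
    Real.rpow_le_rpow_of_nonpos (by linarith) (le_mul_of_one_le_right (by linarith) hv)
      (by linarith)
  have hbc := mono (one_le_mul_of_one_le_of_one_le hb hc) ha
  have hab := mono (one_le_mul_of_one_le_of_one_le ha hb) hc
  have hac := mono (one_le_mul_of_one_le_of_one_le ha hc) hb
  rw [show b * c * a = a * b * c by ring] at hbc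
  rw [show a * c * b = a * b * c by ring] at hac
  rcases le_total b c with h2 | h2
  · rcases le_total a c with h3 | h3
    · have := rpow_mul_le_of_le hδ hδ' hb h2 hh (by linarith)
      rw [mul_comm c b] at this
      linarith
    · have := rpow_mul_le_of_le hδ hδ' hc h3 hh (by linarith)
      linarith
  · rcases le_total a b with h3 | h3
    · have := rpow_mul_le_of_le hδ hδ' hc h2 hh (by linarith)
      linarith
    · have := rpow_mul_le_of_le hδ hδ' hb h3 hh (by linarith)
      linarith

theorem rpow_neg_half_le {M h : ℝ} (hh : 0 < h) (hM : h ≤ 3 * M) :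
    M ^ (-(1 / 2) : ℝ) ≤ 2 * h ^ (-(1 / 2) : ℝ) := by
  calc M ^ (-(1 / 2) : ℝ) ≤ (h / 4) ^ (-(1 / 2) : ℝ) :=
        Real.rpow_le_rpow_of_nonpos (by positivity) (by linarith) (by norm_num)
    _ = 2 * h ^ (-(1 / 2) : ℝ) := by
        rw [Real.div_rpow hh.le (by norm_num), Real.rpow_neg (x := 4) (by norm_num),
          div_inv_eq_mul, show (4 : ℝ) = 2 ^ (2 : ℝ) by norm_num, ← Real.rpow_mul (by norm_num)]
        norm_num [mul_comm]

/-- The `X`-kernel, when the largest of the three modulations is at least `h / 3`. -/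
theorem rpow_neg_half_mul_le {δ a b c h : ℝ} (hδ : 0 < δ) (ha : 1 ≤ a)
    (hb : 1 ≤ b) (hc : 1 ≤ c) (hh : 1 ≤ h) (habc : h ≤ a + b + c) :
    (a * b * c) ^ (-(1 / 2) : ℝ) ≤ 2 * h ^ (-(1 / 2) : ℝ) * (a * c) ^ (-(1 / 2 - δ / 2)) +
      2 * h ^ (-(1 / 2) : ℝ) * (a * b) ^ (-(1 / 2 - δ / 2)) +
      2 * h ^ (-(1 / 2) : ℝ) * (b * c) ^ (-(1 / 2 - δ / 2)) := by
  have key : ∀ {M u v : ℝ}, 1 ≤ u → 1 ≤ v → h ≤ 3 * M → (M * (u * v)) ^ (-(1 / 2) : ℝ) ≤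
      2 * h ^ (-(1 / 2) : ℝ) * (u * v) ^ (-(1 / 2 - δ / 2)) := by
    intro M u v hu hv hM
    have huv : 1 ≤ u * v := by nlinarith
    rw [Real.mul_rpow (by linarith) (by linarith)]
    have := rpow_neg_half_le (by linarith) hM
    have h2 : (u * v) ^ (-(1 / 2) : ℝ) ≤ (u * v) ^ (-(1 / 2 - δ / 2)) :=
      Real.rpow_le_rpow_of_exponent_le huv (by linarith)
    gcongr
  have p1 : 0 ≤ 2 * h ^ (-(1 / 2) : ℝ) * (a * c) ^ (-(1 / 2 - δ / 2)) := by positivity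
  have p2 : 0 ≤ 2 * h ^ (-(1 / 2) : ℝ) * (a * b) ^ (-(1 / 2 - δ / 2)) := by positivity
  have p3 : 0 ≤ 2 * h ^ (-(1 / 2) : ℝ) * (b * c) ^ (-(1 / 2 - δ / 2)) := by positivity
  by_cases h1 : h ≤ 3 * a
  · have := key hb hc h1
    rw [← mul_assoc] at this; linarith
  by_cases h2 : h ≤ 3 * b
  · have := key ha hc h2
    rw [show b * (a * c) = a * b * c by ring] at this; linarith
  · have := key ha hb (by linarith : h ≤ 3 * c)
    rw [show c * (a * b) = a * b * c by ring] at this; linarith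

/-- The `L²L¹`-kernel, whose output modulation is `a`. -/
theorem rpow_neg_one_mul_le {δ a b c h : ℝ} (hδ : 0 < δ) (hδ' : δ ≤ 1 / 12) (ha : 1 ≤ a)
    (hb : 1 ≤ b) (hc : 1 ≤ c) (hh : 1 ≤ h) (habc : h ≤ a + b + c) :
    a ^ (-1 : ℝ) * (b * c) ^ (-(1 / 2) : ℝ) ≤
      a ^ (-(1 / 2) - δ / 2) * (2 * h ^ (-(1 / 2) : ℝ) * (a * c) ^ (-(1 / 2 - δ / 2))) +
      a ^ (-(1 / 2) - δ / 2) * (2 * h ^ (-(1 / 2) : ℝ) * (a * b) ^ (-(1 / 2 - δ / 2))) +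
      3 * h ^ (-(1 - δ)) * (b * c) ^ (-(1 / 2) - δ / 2) := by
  have ha0 : 0 < a := by linarith
  have hb0 : 0 < b := by linarith
  have hc0 : 0 < c := by linarith
  have p1 : 0 ≤ a ^ (-(1 / 2) - δ / 2) *
    (2 * h ^ (-(1 / 2) : ℝ) * (a * c) ^ (-(1 / 2 - δ / 2))) := by positivity
  have p2 : 0 ≤ a ^ (-(1 / 2) - δ / 2) *
    (2 * h ^ (-(1 / 2) : ℝ) * (a * b) ^ (-(1 / 2 - δ / 2))) := by positivity
  have p3 : 0 ≤ 3 * h ^ (-(1 - δ)) * (b * c) ^ (-(1 / 2) - δ / 2) := by positivity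
  have key : ∀ {M u : ℝ}, 1 ≤ M → 1 ≤ u → h ≤ 3 * M →
      a ^ (-1 : ℝ) * (M * u) ^ (-(1 / 2) : ℝ) ≤ a ^ (-(1 / 2) - δ / 2) *
        (2 * h ^ (-(1 / 2) : ℝ) * (a * u) ^ (-(1 / 2 - δ / 2))) := by
    intro M u hM1 hu hM
    have hu0 : 0 < u := by linarith
    rw [Real.mul_rpow (by linarith) (by linarith), Real.mul_rpow (by linarith) (by linarith),
      show a ^ (-1 : ℝ) = a ^ (-(1 / 2) - δ / 2) * a ^ (-(1 / 2 - δ / 2)) by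
        rw [← Real.rpow_add ha0]; ring_nf]
    have i1 := rpow_neg_half_le (by linarith) hM
    have i2 : u ^ (-(1 / 2) : ℝ) ≤ u ^ (-(1 / 2 - δ / 2)) :=
      Real.rpow_le_rpow_of_exponent_le hu (by linarith)
    calc _ = a ^ (-(1 / 2) - δ / 2) * a ^ (-(1 / 2 - δ / 2)) *
          (M ^ (-(1 / 2) : ℝ) * u ^ (-(1 / 2) : ℝ)) := by ring
      _ ≤ a ^ (-(1 / 2) - δ / 2) * a ^ (-(1 / 2 - δ / 2)) *
          ((2 * h ^ (-(1 / 2) : ℝ)) * u ^ (-(1 / 2 - δ / 2))) := by gcongr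
      _ = _ := by ring
  rcases le_total b a with hba | hba
  · rcases le_total c a with hca | hca
    · have hbc : b * c ≤ a * a := by nlinarith
      have hbc0 : 0 < b * c := by positivity
      have i1 : a ^ (-δ) ≤ (b * c) ^ (-(δ / 2)) := by
        calc a ^ (-δ) = (a * a) ^ (-(δ / 2)) := by
              rw [Real.mul_rpow ha0.le ha0.le, ← Real.rpow_add ha0]; ring_nf
          _ ≤ _ := Real.rpow_le_rpow_of_nonpos hbc0 hbc (by linarith)
      have i2 : a ^ (-(1 - δ)) ≤ 3 * h ^ (-(1 - δ)) := by
        calc a ^ (-(1 - δ)) ≤ (h / 3) ^ (-(1 - δ)) :=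
              Real.rpow_le_rpow_of_nonpos (by positivity) (by linarith) (by linarith)
          _ = h ^ (-(1 - δ)) * 3 ^ (1 - δ) := by
              rw [Real.div_rpow (by linarith) (by norm_num), div_eq_mul_inv,
                ← Real.rpow_neg (by norm_num), neg_neg]
          _ ≤ h ^ (-(1 - δ)) * 3 ^ (1 : ℝ) := by
              gcongr
              · norm_num
              · linarith
          _ = _ := by rw [Real.rpow_one]; ring
      have : a ^ (-1 : ℝ) * (b * c) ^ (-(1 / 2) : ℝ) ≤
          3 * h ^ (-(1 - δ)) * (b * c) ^ (-(1 / 2) - δ / 2) := by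
        rw [show a ^ (-1 : ℝ) = a ^ (-(1 - δ)) * a ^ (-δ) by
            rw [← Real.rpow_add ha0]; ring_nf,
          show (b * c) ^ (-(1 / 2) - δ / 2) = (b * c) ^ (-(δ / 2)) * (b * c) ^ (-(1 / 2) : ℝ) by
            rw [← Real.rpow_add hbc0]; ring_nf]
        calc _ ≤ 3 * h ^ (-(1 - δ)) * (b * c) ^ (-(δ / 2)) * (b * c) ^ (-(1 / 2) : ℝ) := by
              gcongr
          _ = _ := by ring
      linarith
    · have := key hc hb (by linarith : h ≤ 3 * c)
      rw [mul_comm c b] at this; linarith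
  · rcases le_total c b with hcb | hcb
    · have := key hb hc (by linarith : h ≤ 3 * b)
      linarith
    · have := key hc hb (by linarith : h ≤ 3 * c)
      rw [mul_comm c b] at this; linarith

/-- The integral `∫ ⟨τ⟩^{-1-δ} dτ`. -/
def modulationMass (δ : ℝ) : ℝ≥0∞ := ∫⁻ τ : ℝ, ENNReal.ofReal (bracket τ ^ (-1 - δ))

theorem modulationMass_lt_top {δ : ℝ} (hδ : 0 < δ) : modulationMass δ < ⊤ := by
  have h := integrable_one_add_norm (E := ℝ) (μ := volume) (r := 1 + δ)
    (by simp; linarith)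
  have h2 := h.hasFiniteIntegral
  rw [hasFiniteIntegral_iff_ofReal (Filter.Eventually.of_forall fun x => by positivity)] at h2
  refine lt_of_eq_of_lt (lintegral_congr fun τ => ?_) h2
  simp only [bracket, Real.norm_eq_abs]
  ring_nf

theorem lintegral_bracket_sub (δ c : ℝ) :
    ∫⁻ τ : ℝ, ENNReal.ofReal (bracket (τ - c) ^ (-1 - δ)) = modulationMass δ :=
  lintegral_sub_right_eq_self (fun τ => ENNReal.ofReal (bracket τ ^ (-1 - δ))) c

theorem measurable_ofReal_bracket_rpow (c q : ℝ) :
    Measurable fun τ : ℝ => ENNReal.ofReal (bracket (τ - c) ^ q) :=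
  ((measurable_bracket.comp (measurable_id.sub_const c)).pow_const q).ennreal_ofReal

/-! ### Criteria for the bilinear estimate -/

/-- The modulation `⟨τ - p(n)⟩` with respect to the phase `p`. -/
def modulation (p : ℤ → ℝ) (x : ℤ × ℝ) : ℝ := bracket (x.2 - p x.1)

theorem one_le_modulation (p : ℤ → ℝ) (x : ℤ × ℝ) : 1 ≤ modulation p x := one_le_bracket _

theorem modulation_pos (p : ℤ → ℝ) (x : ℤ × ℝ) : 0 < modulation p x := bracket_pos _

theorem measurable_modulation (p : ℤ → ℝ) : Measurable (modulation p) :=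
  measurable_bracket.comp (measurable_snd.sub ((measurable_of_countable p).comp measurable_fst))

/-- The resonance function of the interaction of two waves with phases `pa` and `pb` in a wave with
phase `po`. -/
def resonance (pa pb po : ℤ → ℝ) (n₁ n₂ : ℤ) : ℝ := po (n₁ + n₂) - pa n₁ - pb n₂

/-- The three modulations of an interaction cannot all be small compared with the resonance
function: `H` is a signed sum of their arguments. -/
theorem bracket_resonance_le (pa pb po : ℤ → ℝ) (x y : ℤ × ℝ) :
    bracket (resonance pa pb po x.1 y.1) ≤
      modulation po (x + y) + modulation pa x + modulation pb y := by
  have h : resonance pa pb po x.1 y.1 =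
      (x.2 - pa x.1) + (y.2 - pb y.1) - ((x + y).2 - po (x + y).1) := by
    simp only [resonance, Prod.fst_add, Prod.snd_add]; ring
  rw [h]
  simp only [modulation, bracket]
  have := abs_sub (x.2 - pa x.1 + (y.2 - pb y.1)) ((x + y).2 - po (x + y).1)
  have := abs_add_le (x.2 - pa x.1) (y.2 - pb y.1)
  linarith

/-- The kernel of the bilinear operator behind the `X_{s,-1/2}` part of the `Z` norm. -/
def xKernel (pa pb po : ℤ → ℝ) (W : ℤ → ℤ → ℝ) (x y : ℤ × ℝ) : ℝ≥0∞ :=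
  ENNReal.ofReal (W x.1 y.1 *
    (modulation po (x + y) * modulation pa x * modulation pb y) ^ (-(1 / 2) : ℝ))

/-- The kernel of the bilinear operator behind the `L²L¹` part of the `Z` norm. -/
def lKernel (pa pb po : ℤ → ℝ) (W : ℤ → ℤ → ℝ) (x y : ℤ × ℝ) : ℝ≥0∞ :=
  ENNReal.ofReal (W x.1 y.1 * (modulation po (x + y) ^ (-1 : ℝ) *
    (modulation pa x * modulation pb y) ^ (-(1 / 2) : ℝ)))

theorem measurable_weight (W : ℤ → ℤ → ℝ) :
    Measurable fun q : (ℤ × ℝ) × (ℤ × ℝ) => W q.1.1 q.2.1 :=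
  (measurable_of_countable fun q : ℤ × ℤ => W q.1 q.2).comp
    ((measurable_fst.comp measurable_fst).prodMk (measurable_fst.comp measurable_snd))

theorem measurable_modulation_add (p : ℤ → ℝ) :
    Measurable fun q : (ℤ × ℝ) × (ℤ × ℝ) => modulation p (q.1 + q.2) :=
  (measurable_modulation p).comp (measurable_fst.add measurable_snd)

theorem measurable_modulation_fst (p : ℤ → ℝ) :
    Measurable fun q : (ℤ × ℝ) × (ℤ × ℝ) => modulation p q.1 :=
  (measurable_modulation p).comp measurable_fst

theorem measurable_modulation_snd (p : ℤ → ℝ) :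
    Measurable fun q : (ℤ × ℝ) × (ℤ × ℝ) => modulation p q.2 :=
  (measurable_modulation p).comp measurable_snd

theorem measurable_xKernel (pa pb po : ℤ → ℝ) (W : ℤ → ℤ → ℝ) :
    Measurable (Function.uncurry (xKernel pa pb po W)) :=
  ((measurable_weight W).mul ((((measurable_modulation_add po).mul
    (measurable_modulation_fst pa)).mul (measurable_modulation_snd pb)).pow_const _)).ennreal_ofReal

theorem measurable_lKernel (pa pb po : ℤ → ℝ) (W : ℤ → ℤ → ℝ) :
    Measurable (Function.uncurry (lKernel pa pb po W)) :=
  ((measurable_weight W).mul (((measurable_modulation_add po).pow_const _).mul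
    (((measurable_modulation_fst pa).mul (measurable_modulation_snd pb)).pow_const
      _))).ennreal_ofReal

/-- The bilinear estimate with weight `W` in the frequencies, input phases `pa`, `pb` and output
phase `po` holds, with the square of its constant being `A`. -/
def ZBdd (lam : ℝ) (pa pb po : ℤ → ℝ) (W : ℤ → ℤ → ℝ) (A : ℝ≥0∞) : Prop :=
  ∀ F₁ F₂ : ℤ × ℝ → ℝ≥0∞, Measurable F₁ → Measurable F₂ →
    (∫⁻ z, bil lam (xKernel pa pb po W) F₁ F₂ z ^ 2 ∂(phaseMeasure lam) ≤
      A * ((∫⁻ x, F₁ x ^ 2 ∂(phaseMeasure lam)) * ∫⁻ x, F₂ x ^ 2 ∂(phaseMeasure lam))) ∧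
    (∫⁻ n, (∫⁻ τ, bil lam (lKernel pa pb po W) F₁ F₂ (n, τ)) ^ 2 ∂(latticeMeasure lam) ≤
      A * ((∫⁻ x, F₁ x ^ 2 ∂(phaseMeasure lam)) * ∫⁻ x, F₂ x ^ 2 ∂(phaseMeasure lam)))

theorem ZBdd.mono_const {lam : ℝ} {pa pb po : ℤ → ℝ} {W : ℤ → ℤ → ℝ} {A B : ℝ≥0∞}
    (h : ZBdd lam pa pb po W A) (hAB : A ≤ B) : ZBdd lam pa pb po W B := fun F₁ F₂ h₁ h₂ =>
  ⟨(h F₁ F₂ h₁ h₂).1.trans (by gcongr), (h F₁ F₂ h₁ h₂).2.trans (by gcongr)⟩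

theorem add_sq_le_two_mul (a b : ℝ≥0∞) : (a + b) ^ 2 ≤ 2 * (a ^ 2 + b ^ 2) := by
  have := ENNReal.rpow_add_le_mul_rpow_add_rpow a b (p := 2) (by norm_num)
  norm_num at this
  exact this

theorem add_add_sq_le (a b c : ℝ≥0∞) : (a + b + c) ^ 2 ≤ 4 * (a ^ 2 + b ^ 2 + c ^ 2) :=
  calc (a + b + c) ^ 2 ≤ 2 * ((a + b) ^ 2 + c ^ 2) := add_sq_le_two_mul _ _
    _ ≤ 2 * (2 * (a ^ 2 + b ^ 2) + 2 * c ^ 2) := by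
        gcongr
        · exact add_sq_le_two_mul a b
        · exact le_mul_of_one_le_left (by simp) (by norm_num)
    _ = _ := by ring

theorem bil_le_add_add {lam : ℝ} {κ κ₁ κ₂ κ₃ : ℤ × ℝ → ℤ × ℝ → ℝ≥0∞} {F₁ F₂ : ℤ × ℝ → ℝ≥0∞}
    (h₁ : Measurable (Function.uncurry κ₁)) (h₂ : Measurable (Function.uncurry κ₂))
    (m₁ : Measurable F₁) (m₂ : Measurable F₂) (h : ∀ x y, κ x y ≤ κ₁ x y + κ₂ x y + κ₃ x y)
    (z : ℤ × ℝ) :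
    bil lam κ F₁ F₂ z ≤ bil lam κ₁ F₁ F₂ z + bil lam κ₂ F₁ F₂ z + bil lam κ₃ F₁ F₂ z := by
  have h12 : Measurable (Function.uncurry fun x y => κ₁ x y + κ₂ x y) := h₁.add h₂
  rw [← bil_add h₁ m₁ m₂, ← bil_add h12 m₁ m₂]
  exact bil_mono lam h F₁ F₂ z

theorem ofReal_sq_le (k : ℝ) : ENNReal.ofReal k ^ 2 ≤ ENNReal.ofReal (k ^ 2) := by
  rcases le_total 0 k with h | h
  · rw [ENNReal.ofReal_pow h]
  · rw [ENNReal.ofReal_of_nonpos h]; simp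

theorem ZBdd.add {lam : ℝ} {pa pb po : ℤ → ℝ} {W W₁ W₂ : ℤ → ℤ → ℝ} {A₁ A₂ : ℝ≥0∞}
    (h₁ : ZBdd lam pa pb po W₁ A₁) (h₂ : ZBdd lam pa pb po W₂ A₂)
    (hW₁ : ∀ n m, 0 ≤ W₁ n m) (hW₂ : ∀ n m, 0 ≤ W₂ n m)
    (hW : ∀ n m, W n m ≤ W₁ n m + W₂ n m) : ZBdd lam pa pb po W (2 * (A₁ + A₂)) := by
  intro F₁ F₂ m₁ m₂
  have hx : ∀ x y, xKernel pa pb po W x y ≤ xKernel pa pb po W₁ x y + xKernel pa pb po W₂ x y := by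
    intro x y
    have h0 : 0 ≤ (modulation po (x + y) * modulation pa x * modulation pb y) ^ (-(1 / 2) : ℝ) :=
      Real.rpow_nonneg (mul_nonneg (mul_nonneg (modulation_pos _ _).le (modulation_pos _ _).le)
        (modulation_pos _ _).le) _
    unfold xKernel
    rw [← ENNReal.ofReal_add (mul_nonneg (hW₁ _ _) h0) (mul_nonneg (hW₂ _ _) h0), ← add_mul]
    exact ENNReal.ofReal_le_ofReal (mul_le_mul_of_nonneg_right (hW _ _) h0)
  have hl : ∀ x y, lKernel pa pb po W x y ≤ lKernel pa pb po W₁ x y + lKernel pa pb po W₂ x y := by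
    intro x y
    have h0 : 0 ≤ modulation po (x + y) ^ (-1 : ℝ) *
        (modulation pa x * modulation pb y) ^ (-(1 / 2) : ℝ) :=
      mul_nonneg (Real.rpow_nonneg (modulation_pos _ _).le _) (Real.rpow_nonneg
        (mul_nonneg (modulation_pos _ _).le (modulation_pos _ _).le) _)
    unfold lKernel
    rw [← ENNReal.ofReal_add (mul_nonneg (hW₁ _ _) h0) (mul_nonneg (hW₂ _ _) h0), ← add_mul]
    exact ENNReal.ofReal_le_ofReal (mul_le_mul_of_nonneg_right (hW _ _) h0)
  constructor
  · calc _ ≤ ∫⁻ z, 2 * (bil lam (xKernel pa pb po W₁) F₁ F₂ z ^ 2 +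
          bil lam (xKernel pa pb po W₂) F₁ F₂ z ^ 2) ∂(phaseMeasure lam) := by
          refine lintegral_mono fun z => le_trans ?_ (add_sq_le_two_mul _ _)
          gcongr
          rw [← bil_add (measurable_xKernel _ _ _ _) m₁ m₂]
          exact bil_mono lam hx F₁ F₂ z
      _ ≤ 2 * (A₁ * _ + A₂ * _) := by
          rw [lintegral_const_mul' _ _ (by simp),
            lintegral_add_left ((measurable_bil (measurable_xKernel _ _ _ _) m₁ m₂).pow_const 2)]
          gcongr
          · exact (h₁ F₁ F₂ m₁ m₂).1
          · exact (h₂ F₁ F₂ m₁ m₂).1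
      _ = _ := by ring
  · calc _ ≤ ∫⁻ n, 2 * ((∫⁻ τ, bil lam (lKernel pa pb po W₁) F₁ F₂ (n, τ)) ^ 2 +
          (∫⁻ τ, bil lam (lKernel pa pb po W₂) F₁ F₂ (n, τ)) ^ 2) ∂(latticeMeasure lam) := by
          refine lintegral_mono fun n => le_trans ?_ (add_sq_le_two_mul _ _)
          gcongr
          have hm : Measurable fun τ => bil lam (lKernel pa pb po W₁) F₁ F₂ (n, τ) :=
            (measurable_bil (measurable_lKernel _ _ _ _) m₁ m₂).comp
              (measurable_const.prodMk measurable_id)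
          rw [← lintegral_add_left hm]
          refine lintegral_mono fun τ => ?_
          dsimp only
          rw [← bil_add (measurable_lKernel _ _ _ _) m₁ m₂]
          exact bil_mono lam hl F₁ F₂ _
      _ ≤ 2 * (A₁ * _ + A₂ * _) := by
          rw [lintegral_const_mul' _ _ (by simp), lintegral_add_left (measurable_of_countable _)]
          gcongr
          · exact (h₁ F₁ F₂ m₁ m₂).2
          · exact (h₂ F₁ F₂ m₁ m₂).2
      _ = _ := by ring

/-- Integration of a squared kernel over one input: the sum over the frequencies is bounded by
hypothesis, and two shifted brackets are integrated over the modulations. -/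
theorem lintegral_le_of_slice {lam δ K : ℝ} (hlam : 0 < lam) (hK : 0 ≤ K) {g : ℤ × ℝ → ℝ≥0∞}
    {q c c' : ℤ → ℝ} {A : ℝ≥0∞} (hq : ∀ n, 0 ≤ q n)
    (hg : ∀ x, g x ≤ ENNReal.ofReal (K * (q x.1 * (bracket (x.2 - c x.1) ^ (-1 - δ) +
      bracket (x.2 - c' x.1) ^ (-1 - δ)))))
    (hA : ∑' n, ENNReal.ofReal (q n) ≤ ENNReal.ofReal lam * A) :
    ∫⁻ x, g x ∂(phaseMeasure lam) ≤ ENNReal.ofReal K * (2 * modulationMass δ) * A := by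
  have hb : ∀ c : ℤ → ℝ, Measurable fun x : ℤ × ℝ => bracket (x.2 - c x.1) ^ (-1 - δ) := fun c =>
    (measurable_modulation c).pow_const _
  have hm : Measurable fun x : ℤ × ℝ => ENNReal.ofReal (K * (q x.1 *
      (bracket (x.2 - c x.1) ^ (-1 - δ) + bracket (x.2 - c' x.1) ^ (-1 - δ)))) :=
    (((((measurable_of_countable q).comp measurable_fst)).mul
      ((hb c).add (hb c'))).const_mul K).ennreal_ofReal
  refine (lintegral_mono hg).trans ?_
  rw [lintegral_phaseMeasure lam hm]
  have hn : ∀ n, ∫⁻ τ, ENNReal.ofReal (K * (q n *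
      (bracket (τ - c n) ^ (-1 - δ) + bracket (τ - c' n) ^ (-1 - δ)))) =
      ENNReal.ofReal K * (2 * modulationMass δ) * ENNReal.ofReal (q n) := by
    intro n
    have h0 : ∀ x, 0 ≤ bracket x ^ (-1 - δ) := fun x => Real.rpow_nonneg (bracket_pos x).le _
    simp only [ENNReal.ofReal_mul hK, ENNReal.ofReal_mul (hq n),
      ENNReal.ofReal_add (h0 _) (h0 _)]
    rw [lintegral_const_mul' _ _ (by simp), lintegral_const_mul' _ _ (by simp),
      lintegral_add_left (measurable_ofReal_bracket_rpow _ _), lintegral_bracket_sub,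
      lintegral_bracket_sub]
    ring
  simp only [hn]
  rw [ENNReal.tsum_mul_left]
  calc _ ≤ ENNReal.ofReal (1 / lam) * (ENNReal.ofReal K * (2 * modulationMass δ) *
        (ENNReal.ofReal lam * A)) := by gcongr
    _ = (ENNReal.ofReal (1 / lam) * ENNReal.ofReal lam) *
        (ENNReal.ofReal K * (2 * modulationMass δ) * A) := by ring
    _ = _ := by
        rw [← ENNReal.ofReal_mul (by positivity), one_div_mul_cancel hlam.ne']; simp

/-- The weight `⟨τ - p(n)⟩^{-1/2-δ/2}` turns an `L²` bound in the modulation into an `L¹` bound. -/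
theorem bil_l2l1_le_of_weight {lam δ : ℝ} {p : ℤ → ℝ} {κ κ' : ℤ × ℝ → ℤ × ℝ → ℝ≥0∞}
    (hκ : Measurable (Function.uncurry κ)) {F₁ F₂ : ℤ × ℝ → ℝ≥0∞} (m₁ : Measurable F₁)
    (m₂ : Measurable F₂)
    (h : ∀ x y, κ' x y ≤ ENNReal.ofReal (modulation p (x + y) ^ (-(1 / 2) - δ / 2)) * κ x y) :
    ∫⁻ n, (∫⁻ τ, bil lam κ' F₁ F₂ (n, τ)) ^ 2 ∂(latticeMeasure lam) ≤
      modulationMass δ * ∫⁻ z, bil lam κ F₁ F₂ z ^ 2 ∂(phaseMeasure lam) := by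
  have hmb := measurable_bil (lam := lam) hκ m₁ m₂
  have h1 : ∀ z, bil lam κ' F₁ F₂ z ≤
      ENNReal.ofReal (modulation p z ^ (-(1 / 2) - δ / 2)) * bil lam κ F₁ F₂ z := by
    intro z
    unfold bil
    rw [← lintegral_const_mul' _ _ ENNReal.ofReal_ne_top]
    refine lintegral_mono fun x => ?_
    have := h x (z - x)
    rw [add_sub_cancel] at this
    calc _ ≤ (ENNReal.ofReal (modulation p z ^ (-(1 / 2) - δ / 2)) * κ x (z - x)) *
          (F₁ x * F₂ (z - x)) := by gcongr
      _ = _ := by ring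
  calc _ ≤ ∫⁻ n, modulationMass δ * (∫⁻ τ, bil lam κ F₁ F₂ (n, τ) ^ 2) ∂(latticeMeasure lam) := by
        refine lintegral_mono fun n => ?_
        have hm : Measurable fun τ => bil lam κ F₁ F₂ (n, τ) :=
          hmb.comp (measurable_const.prodMk measurable_id)
        have hw : Measurable fun τ : ℝ =>
            ENNReal.ofReal (modulation p (n, τ) ^ (-(1 / 2) - δ / 2)) :=
          measurable_ofReal_bracket_rpow (p n) _
        calc _ ≤ (∫⁻ τ, ENNReal.ofReal (modulation p (n, τ) ^ (-(1 / 2) - δ / 2)) *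
              bil lam κ F₁ F₂ (n, τ)) ^ 2 := by
              gcongr with τ; exact h1 _
          _ ≤ _ := sq_lintegral_mul_le _ hw.aemeasurable hm.aemeasurable
          _ = _ := by
              congr 1
              rw [← lintegral_bracket_sub δ (p n)]
              refine lintegral_congr fun τ => ?_
              rw [← ENNReal.ofReal_pow (Real.rpow_nonneg (modulation_pos _ _).le _),
                ← Real.rpow_natCast, ← Real.rpow_mul (modulation_pos _ _).le]
              unfold modulation
              congr 2
              push_cast
              ring
    _ = _ := by
        rw [lintegral_const_mul _ (measurable_of_countable _), lintegral_prod _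
          (hmb.pow_const 2).aemeasurable]

/-- The constant of the criteria below. -/
def critConst (δ : ℝ) : ℝ≥0∞ := 1000 * (1 + modulationMass δ) ^ 2

theorem critConst_ne_top {δ : ℝ} (hδ : 0 < δ) : critConst δ ≠ ⊤ := by
  have := modulationMass_lt_top hδ
  exact ENNReal.mul_ne_top (by norm_num)
    (ENNReal.pow_ne_top (ENNReal.add_ne_top.2 ⟨ENNReal.one_ne_top, this.ne⟩))

section Criteria

variable {lam δ : ℝ} {pa pb po : ℤ → ℝ} {W : ℤ → ℤ → ℝ} {A : ℝ≥0∞}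

theorem rpow_sq {x : ℝ} (hx : 0 ≤ x) (q : ℝ) : (x ^ q) ^ 2 = x ^ (2 * q) := by
  rw [← Real.rpow_natCast, ← Real.rpow_mul hx]; congr 1; push_cast; ring

/-- The kernel used for `ZBdd.of_triv`. -/
def tKernel (δ : ℝ) (pa pb po : ℤ → ℝ) (W : ℤ → ℤ → ℝ) (x y : ℤ × ℝ) : ℝ≥0∞ :=
  ENNReal.ofReal (W x.1 y.1 *
    (modulation po (x + y) * modulation pa x * modulation pb y) ^ (-(1 / 2 - δ / 2)))

theorem measurable_tKernel : Measurable (Function.uncurry (tKernel δ pa pb po W)) :=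
  ((measurable_weight W).mul ((((measurable_modulation_add po).mul
    (measurable_modulation_fst pa)).mul (measurable_modulation_snd pb)).pow_const _)).ennreal_ofReal

theorem tKernel_sq_le (x y : ℤ × ℝ) : tKernel δ pa pb po W x y ^ 2 ≤
    ENNReal.ofReal (W x.1 y.1 ^ 2 *
      (modulation po (x + y) * modulation pa x * modulation pb y) ^ (-(1 - δ))) := by
  refine (ofReal_sq_le _).trans (le_of_eq ?_)
  rw [mul_pow, rpow_sq (mul_nonneg (mul_nonneg (modulation_pos _ _).le (modulation_pos _ _).le)
        (modulation_pos _ _).le)]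
  ring_nf

/-- Both parts of the `Z` norm are controlled by the `L²` bound for the kernel in which all three
modulations carry the exponent `-(1/2 - δ/2)`: the `L²L¹` part is reduced to it by Cauchy–Schwarz in
the output modulation, at the price of `δ / 2`. -/
theorem ZBdd.of_tKernel (hδ : 0 < δ) (hδ' : δ ≤ 1 / 12) (hW : ∀ n m, 0 ≤ W n m) {B : ℝ≥0∞}
    (h : ∀ F₁ F₂ : ℤ × ℝ → ℝ≥0∞, Measurable F₁ → Measurable F₂ →
      ∫⁻ z, bil lam (tKernel δ pa pb po W) F₁ F₂ z ^ 2 ∂(phaseMeasure lam) ≤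
      B * ((∫⁻ x, F₁ x ^ 2 ∂(phaseMeasure lam)) * ∫⁻ x, F₂ x ^ 2 ∂(phaseMeasure lam))) :
    ZBdd lam pa pb po W ((1 + modulationMass δ) * B) := by
  intro F₁ F₂ m₁ m₂
  constructor
  · calc _ ≤ ∫⁻ z, bil lam (tKernel δ pa pb po W) F₁ F₂ z ^ 2 ∂(phaseMeasure lam) := by
          gcongr with z
          refine bil_mono lam (fun x y => ENNReal.ofReal_le_ofReal ?_) F₁ F₂ z
          refine mul_le_mul_of_nonneg_left (Real.rpow_le_rpow_of_exponent_le ?_ (by linarith))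
            (hW _ _)
          exact one_le_mul_of_one_le_of_one_le (one_le_mul_of_one_le_of_one_le
            (one_le_modulation _ _) (one_le_modulation _ _)) (one_le_modulation _ _)
      _ ≤ _ := h F₁ F₂ m₁ m₂
      _ ≤ _ := by gcongr; exact le_mul_of_one_le_left (by simp) (by simp)
  · calc _ ≤ modulationMass δ * ∫⁻ z, bil lam (tKernel δ pa pb po W) F₁ F₂ z ^ 2
            ∂(phaseMeasure lam) := by
          refine bil_l2l1_le_of_weight (p := po) measurable_tKernel m₁ m₂ fun x y => ?_
          have ha := one_le_modulation po (x + y)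
          have hb := one_le_modulation pa x
          have hc := one_le_modulation pb y
          unfold lKernel tKernel
          rw [← ENNReal.ofReal_mul (Real.rpow_nonneg (by linarith) _)]
          refine ENNReal.ofReal_le_ofReal ?_
          generalize modulation po (x + y) = a at *
          generalize modulation pa x = b at *
          generalize modulation pb y = c at *
          have hbc : 1 ≤ b * c := one_le_mul_of_one_le_of_one_le hb hc
          have e : a ^ (-1 : ℝ) = a ^ (-(1 / 2) - δ / 2) * a ^ (-(1 / 2 - δ / 2)) := by
            rw [← Real.rpow_add (by linarith)]; ring_nf
          have i : (b * c) ^ (-(1 / 2) : ℝ) ≤ (b * c) ^ (-(1 / 2 - δ / 2)) :=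
            Real.rpow_le_rpow_of_exponent_le hbc (by linarith)
          rw [mul_assoc a b c, Real.mul_rpow (x := a) (by linarith) (by linarith), e]
          refine (mul_le_mul_of_nonneg_left (mul_le_mul_of_nonneg_left i (by positivity))
            (hW x.1 y.1)).trans (le_of_eq (by ring))
      _ ≤ modulationMass δ * (B * _) := by gcongr; exact h F₁ F₂ m₁ m₂
      _ ≤ _ := by
          rw [← mul_assoc]
          gcongr
          simp

/-- The first criterion: the estimate holds as soon as `W² ⟨H⟩^{-1+3δ}` is summable over one of the
three slices (first input, second input or output frequency fixed), uniformly in the fixed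
frequency. By Cauchy–Schwarz with the fixed variable outside, the two other modulations are
integrated over, and the largest modulation supplies the power of `⟨H⟩`. -/
theorem ZBdd.of_triv (hlam : 0 < lam) (hδ : 0 < δ) (hδ' : δ ≤ 1 / 12) (hW : ∀ n m, 0 ≤ W n m)
    (h : (∀ n, ∑' m, ENNReal.ofReal (W n m ^ 2 *
        bracket (resonance pa pb po n m) ^ (-(1 - 3 * δ))) ≤ ENNReal.ofReal lam * A) ∨
      (∀ m, ∑' n, ENNReal.ofReal (W n m ^ 2 *
        bracket (resonance pa pb po n m) ^ (-(1 - 3 * δ))) ≤ ENNReal.ofReal lam * A) ∨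
      (∀ k, ∑' n, ENNReal.ofReal (W n (k - n) ^ 2 *
        bracket (resonance pa pb po n (k - n)) ^ (-(1 - 3 * δ))) ≤ ENNReal.ofReal lam * A)) :
    ZBdd lam pa pb po W (critConst δ * A) := by
  have hC : (1 + modulationMass δ) * (ENNReal.ofReal 3 * (2 * modulationMass δ) * A) ≤
      critConst δ * A := by
    rw [← mul_assoc, critConst, pow_two]
    refine mul_le_mul_left ?_ A
    calc (1 + modulationMass δ) * (ENNReal.ofReal 3 * (2 * modulationMass δ))
        ≤ (1 + modulationMass δ) * (ENNReal.ofReal 3 * (2 * (1 + modulationMass δ))) := by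
          gcongr; exact le_add_self
      _ = 6 * ((1 + modulationMass δ) * (1 + modulationMass δ)) := by
          rw [show ENNReal.ofReal 3 = 3 by simp]; ring
      _ ≤ _ := by gcongr; norm_num
  refine ZBdd.mono_const (ZBdd.of_tKernel hδ hδ' hW fun F₁ F₂ m₁ m₂ => ?_) hC
  have hq : ∀ n m, 0 ≤ W n m ^ 2 * bracket (resonance pa pb po n m) ^ (-(1 - 3 * δ)) := fun n m =>
    mul_nonneg (sq_nonneg _) (Real.rpow_nonneg (bracket_pos _).le _)
  rcases h with h | h | h
  · refine bil_sq_le_of_fst measurable_tKernel m₁ m₂ fun x => ?_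
    refine lintegral_le_of_slice (c := fun m => po (x.1 + m) - x.2) (c' := pb) hlam
      (by norm_num) (hq x.1) (fun y => (tKernel_sq_le x y).trans ?_) (h x.1)
    refine ENNReal.ofReal_le_ofReal ?_
    have := rpow_mul_mul_le_add hδ hδ' (one_le_modulation pa x) (one_le_modulation po (x + y))
      (one_le_modulation pb y) (one_le_bracket _)
      (by linarith [bracket_resonance_le pa pb po x y])
    rw [show modulation po (x + y) = bracket (y.2 - (po (x.1 + y.1) - x.2)) by
        simp only [modulation, Prod.fst_add, Prod.snd_add]; congr 1; ring] at this ⊢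
    rw [mul_comm (bracket _) (modulation pa x)]
    refine (mul_le_mul_of_nonneg_left this (sq_nonneg _)).trans (le_of_eq ?_)
    simp only [modulation]; ring
  · refine bil_sq_le_of_snd measurable_tKernel m₁ m₂ fun y => ?_
    refine lintegral_le_of_slice (c := fun n => po (n + y.1) - y.2) (c' := pa) hlam
      (by norm_num) (fun n => hq n y.1) (fun x => (tKernel_sq_le x y).trans ?_) (h y.1)
    refine ENNReal.ofReal_le_ofReal ?_
    have := rpow_mul_mul_le_add hδ hδ' (one_le_modulation pb y) (one_le_modulation po (x + y))
      (one_le_modulation pa x) (one_le_bracket _)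
      (by linarith [bracket_resonance_le pa pb po x y])
    rw [show modulation po (x + y) = bracket (x.2 - (po (x.1 + y.1) - y.2)) by
        simp only [modulation, Prod.fst_add, Prod.snd_add]; congr 1; ring] at this ⊢
    rw [mul_comm (_ * _) (modulation pb y), ← mul_assoc]
    refine (mul_le_mul_of_nonneg_left this (sq_nonneg _)).trans (le_of_eq ?_)
    simp only [modulation]; ring
  · refine bil_sq_le_of_out measurable_tKernel m₁ m₂ fun z => ?_
    refine lintegral_le_of_slice (c := pa) (c' := fun n => z.2 - pb (z.1 - n)) hlam
      (by norm_num) (fun n => hq n (z.1 - n)) (fun x => (tKernel_sq_le x (z - x)).trans ?_) (h z.1)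
    refine ENNReal.ofReal_le_ofReal ?_
    have := rpow_mul_mul_le_add hδ hδ' (one_le_modulation po (x + (z - x)))
      (one_le_modulation pa x) (one_le_modulation pb (z - x)) (one_le_bracket _)
      (bracket_resonance_le pa pb po x (z - x))
    rw [show modulation pb (z - x) = bracket (x.2 - (z.2 - pb (z.1 - x.1))) by
        simp only [modulation, Prod.fst_sub, Prod.snd_sub]; rw [bracket_sub_comm]; congr 1; ring]
      at this ⊢
    refine (mul_le_mul_of_nonneg_left this (sq_nonneg _)).trans (le_of_eq ?_)
    simp only [modulation, Prod.fst_sub]; ring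

/-- The kernel `W ⟨H⟩^{-1/2} (L L')^{-(1/2-δ/2)}`, where `H` is the resonance function and `L`, `L'`
are two of the three modulations, the third one having been traded for `⟨H⟩`. -/
def kKernel (δ : ℝ) (pa pb po : ℤ → ℝ) (W : ℤ → ℤ → ℝ) (L L' : ℤ × ℝ → ℤ × ℝ → ℝ)
    (x y : ℤ × ℝ) : ℝ≥0∞ :=
  ENNReal.ofReal (W x.1 y.1 * (2 * bracket (resonance pa pb po x.1 y.1) ^ (-(1 / 2) : ℝ) *
    (L x y * L' x y) ^ (-(1 / 2 - δ / 2))))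

theorem measurable_kKernel {L L' : ℤ × ℝ → ℤ × ℝ → ℝ} (hL : Measurable (Function.uncurry L))
    (hL' : Measurable (Function.uncurry L')) :
    Measurable (Function.uncurry (kKernel δ pa pb po W L L')) :=
  ((measurable_weight W).mul (((measurable_weight fun n m =>
    bracket (resonance pa pb po n m) ^ (-(1 / 2) : ℝ)).const_mul 2).mul
      ((hL.mul hL').pow_const _))).ennreal_ofReal

theorem kKernel_sq_le (hδ : 0 < δ) (hδ' : δ ≤ 1 / 12) {L L' : ℤ × ℝ → ℤ × ℝ → ℝ} {x y : ℤ × ℝ}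
    {u v d : ℝ} (hu : L x y = bracket u) (hv : L' x y = bracket v)
    (hd : bracket d ≤ bracket u + bracket v) :
    kKernel δ pa pb po W L L' x y ^ 2 ≤ ENNReal.ofReal (12 * (W x.1 y.1 ^ 2 *
      bracket (resonance pa pb po x.1 y.1) ^ (-1 : ℝ) * bracket d ^ (-(1 - 3 * δ)) *
        (bracket u ^ (-1 - δ) + bracket v ^ (-1 - δ)))) := by
  refine (ofReal_sq_le _).trans (ENNReal.ofReal_le_ofReal ?_)
  rw [hu, hv, mul_pow, mul_pow, mul_pow, rpow_sq (bracket_pos _).le,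
    rpow_sq (mul_nonneg (bracket_pos _).le (bracket_pos _).le),
    show 2 * -(1 / 2 - δ / 2) = -(1 - δ) by ring, show (2 : ℝ) * -(1 / 2) = -1 by norm_num]
  have h := rpow_mul_le_add hδ hδ' (one_le_bracket u) (one_le_bracket v) (one_le_bracket d) hd
  have h0 : 0 ≤ W x.1 y.1 ^ 2 * (2 ^ 2 * bracket (resonance pa pb po x.1 y.1) ^ (-1 : ℝ)) :=
    mul_nonneg (sq_nonneg _) (mul_nonneg (by norm_num) (Real.rpow_nonneg (bracket_pos _).le _))
  calc _ = W x.1 y.1 ^ 2 * (2 ^ 2 * bracket (resonance pa pb po x.1 y.1) ^ (-1 : ℝ)) *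
        (bracket u * bracket v) ^ (-(1 - δ)) := by ring
    _ ≤ _ := mul_le_mul_of_nonneg_left h h0
    _ = _ := by ring

/-- The kernel of the `L²L¹` part in the region where the output modulation is the largest. -/
def oKernel (δ : ℝ) (pa pb po : ℤ → ℝ) (W : ℤ → ℤ → ℝ) (x y : ℤ × ℝ) : ℝ≥0∞ :=
  ENNReal.ofReal (W x.1 y.1 * (3 * bracket (resonance pa pb po x.1 y.1) ^ (-(1 - δ)) *
    (modulation pa x * modulation pb y) ^ (-(1 / 2) - δ / 2)))

theorem measurable_oKernel : Measurable (Function.uncurry (oKernel δ pa pb po W)) :=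
  ((measurable_weight W).mul (((measurable_weight fun n m =>
    bracket (resonance pa pb po n m) ^ (-(1 - δ))).const_mul 3).mul
      (((measurable_modulation_fst pa).mul (measurable_modulation_snd pb)).pow_const
        _))).ennreal_ofReal

theorem bracket_sub_le (u v : ℝ) : bracket (u - v) ≤ bracket u + bracket v := by
  unfold bracket; linarith [abs_sub u v]

/-- The second criterion, without loss in the power of `⟨H⟩`: the variable with the largest
modulation is kept fixed in Cauchy–Schwarz. Its modulation yields `⟨H⟩^{-1}`, and the sum of the
arguments of the two other ones is `H - a`, with `a` determined by the fixed variable. Since any of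
the three modulations can be the largest, sums over all three slices are required, uniformly in `a`.
-/
theorem ZBdd.of_kpv (hlam : 0 < lam) (hδ : 0 < δ) (hδ' : δ ≤ 1 / 12) (hW : ∀ n m, 0 ≤ W n m)
    (h₁ : ∀ n a, ∑' m, ENNReal.ofReal (W n m ^ 2 * bracket (resonance pa pb po n m) ^ (-1 : ℝ) *
      bracket (resonance pa pb po n m - a) ^ (-(1 - 3 * δ))) ≤ ENNReal.ofReal lam * A)
    (h₂ : ∀ m a, ∑' n, ENNReal.ofReal (W n m ^ 2 * bracket (resonance pa pb po n m) ^ (-1 : ℝ) *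
      bracket (resonance pa pb po n m - a) ^ (-(1 - 3 * δ))) ≤ ENNReal.ofReal lam * A)
    (h₃ : ∀ k a, ∑' n, ENNReal.ofReal (W n (k - n) ^ 2 *
      bracket (resonance pa pb po n (k - n)) ^ (-1 : ℝ) *
      bracket (resonance pa pb po n (k - n) - a) ^ (-(1 - 3 * δ))) ≤ ENNReal.ofReal lam * A) :
    ZBdd lam pa pb po W (critConst δ * A) := by
  set H := resonance pa pb po with hH
  set Lo : ℤ × ℝ → ℤ × ℝ → ℝ := fun x y => modulation po (x + y) with hLo
  set La : ℤ × ℝ → ℤ × ℝ → ℝ := fun x _ => modulation pa x with hLa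
  set Lb : ℤ × ℝ → ℤ × ℝ → ℝ := fun _ y => modulation pb y with hLb
  have mo : Measurable (Function.uncurry Lo) := measurable_modulation_add po
  have ma : Measurable (Function.uncurry La) := measurable_modulation_fst pa
  have mb : Measurable (Function.uncurry Lb) := measurable_modulation_snd pb
  have hq : ∀ n m a, 0 ≤ W n m ^ 2 * bracket (H n m) ^ (-1 : ℝ) *
      bracket (H n m - a) ^ (-(1 - 3 * δ)) := fun n m a =>
    mul_nonneg (mul_nonneg (sq_nonneg _) (Real.rpow_nonneg (bracket_pos _).le _))
      (Real.rpow_nonneg (bracket_pos _).le _)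
  set M := modulationMass δ with hM
  have e12 : ENNReal.ofReal 12 = 12 := by simp
  intro F₁ F₂ m₁ m₂
  set N := (∫⁻ x, F₁ x ^ 2 ∂(phaseMeasure lam)) * ∫⁻ x, F₂ x ^ 2 ∂(phaseMeasure lam) with hN
  -- one modulation is large, and the kernel is square integrable in the two other variables
  have b1 : ∫⁻ z, bil lam (kKernel δ pa pb po W Lo Lb) F₁ F₂ z ^ 2 ∂(phaseMeasure lam) ≤
      24 * M * A * N := by
    refine (bil_sq_le_of_fst (measurable_kKernel mo mb) m₁ m₂ fun x => ?_).trans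
      (le_of_eq (by rw [show (24 : ℝ≥0∞) * M * A = ENNReal.ofReal 12 * (2 * M) * A by
        rw [e12]; ring]))
    refine lintegral_le_of_slice (c := fun m => po (x.1 + m) - x.2) (c' := pb) hlam
      (by norm_num) (fun m => hq x.1 m (x.2 - pa x.1)) (fun y => ?_) (h₁ x.1 (x.2 - pa x.1))
    refine kKernel_sq_le hδ hδ' ?_ rfl ?_
    · simp only [hLo, modulation, Prod.fst_add, Prod.snd_add]; congr 1; ring
    · rw [← bracket_neg]
      refine le_trans (le_of_eq ?_) (bracket_sub_le _ _)
      simp only [hH, resonance]; congr 1; ring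
  have b2 : ∫⁻ z, bil lam (kKernel δ pa pb po W Lo La) F₁ F₂ z ^ 2 ∂(phaseMeasure lam) ≤
      24 * M * A * N := by
    refine (bil_sq_le_of_snd (measurable_kKernel mo ma) m₁ m₂ fun y => ?_).trans
      (le_of_eq (by rw [show (24 : ℝ≥0∞) * M * A = ENNReal.ofReal 12 * (2 * M) * A by
        rw [e12]; ring]))
    refine lintegral_le_of_slice (c := fun n => po (n + y.1) - y.2) (c' := pa) hlam
      (by norm_num) (fun n => hq n y.1 (y.2 - pb y.1)) (fun x => ?_) (h₂ y.1 (y.2 - pb y.1))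
    refine kKernel_sq_le hδ hδ' ?_ rfl ?_
    · simp only [hLo, modulation, Prod.fst_add, Prod.snd_add]; congr 1; ring
    · rw [← bracket_neg]
      refine le_trans (le_of_eq ?_) (bracket_sub_le _ _)
      simp only [hH, resonance]; congr 1; ring
  have b3 : ∫⁻ z, bil lam (kKernel δ pa pb po W La Lb) F₁ F₂ z ^ 2 ∂(phaseMeasure lam) ≤
      24 * M * A * N := by
    refine (bil_sq_le_of_out (measurable_kKernel ma mb) m₁ m₂ fun z => ?_).trans
      (le_of_eq (by rw [show (24 : ℝ≥0∞) * M * A = ENNReal.ofReal 12 * (2 * M) * A by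
        rw [e12]; ring]))
    refine lintegral_le_of_slice (c := pa) (c' := fun n => z.2 - pb (z.1 - n)) hlam
      (by norm_num) (fun n => hq n (z.1 - n) (po z.1 - z.2)) (fun x => ?_)
      (h₃ z.1 (po z.1 - z.2))
    refine kKernel_sq_le (d := H x.1 (z.1 - x.1) - (po z.1 - z.2)) hδ hδ' rfl ?_ ?_
    · simp only [hLb, modulation, Prod.fst_sub, Prod.snd_sub]; rw [bracket_sub_comm]
      congr 1; ring
    · refine le_trans (le_of_eq ?_) (bracket_sub_le _ _)
      simp only [hH, resonance, add_sub_cancel]; congr 1; ring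
  -- the `L²L¹` part when the output modulation is the largest: both inputs can be integrated over,
  -- since the exponents of their modulations exceed `1` after squaring, and `⟨H⟩^{-2(1-δ)}` is
  -- stronger than the summand for `a = 0`
  have b4 : ∫⁻ n, (∫⁻ τ, bil lam (oKernel δ pa pb po W) F₁ F₂ (n, τ)) ^ 2 ∂(latticeMeasure lam) ≤
      9 * M ^ 2 * A * N := by
    refine bil_l2l1_le measurable_oKernel m₁ m₂ fun k => ?_
    have hmb : ∀ c q : ℝ, Measurable fun τ : ℝ => ENNReal.ofReal (bracket (τ - c) ^ q) :=
      measurable_ofReal_bracket_rpow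
    have pos : ∀ x q : ℝ, 0 ≤ bracket x ^ q := fun x q => Real.rpow_nonneg (bracket_pos x).le q
    set w : ℤ → ℝ := fun n => W n (k - n) ^ 2 * bracket (H n (k - n)) ^ (-1 : ℝ) *
      bracket (H n (k - n) - 0) ^ (-(1 - 3 * δ)) with hw
    have hw0 : ∀ n, 0 ≤ w n := fun n => hq n (k - n) 0
    have i1 : ∀ x : ℤ × ℝ, ∫⁻ τ, oKernel δ pa pb po W x (k - x.1, τ) ^ 2 ≤
        9 * M * (ENNReal.ofReal (w x.1) * ENNReal.ofReal (bracket (x.2 - pa x.1) ^ (-1 - δ))) := by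
      intro x
      rw [show 9 * M * (ENNReal.ofReal (w x.1) *
          ENNReal.ofReal (bracket (x.2 - pa x.1) ^ (-1 - δ))) = ENNReal.ofReal (9 * w x.1 *
          bracket (x.2 - pa x.1) ^ (-1 - δ)) * M by
        rw [ENNReal.ofReal_mul (p := 9 * w x.1) (mul_nonneg (by norm_num) (hw0 _)),
          ENNReal.ofReal_mul (p := 9) (by norm_num), ENNReal.ofReal_ofNat]
        ring, hM, ← lintegral_bracket_sub δ (pb (k - x.1)),
        ← lintegral_const_mul' _ _ ENNReal.ofReal_ne_top]
      refine lintegral_mono fun τ => (ofReal_sq_le _).trans ?_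
      dsimp only
      rw [← ENNReal.ofReal_mul (mul_nonneg (mul_nonneg (by norm_num) (hw0 _)) (pos _ _))]
      refine ENNReal.ofReal_le_ofReal ?_
      simp only [modulation]
      rw [mul_pow, mul_pow, mul_pow, rpow_sq (bracket_pos _).le,
        rpow_sq (mul_nonneg (bracket_pos _).le (bracket_pos _).le),
        Real.mul_rpow (bracket_pos _).le (bracket_pos _).le,
        show 2 * (-(1 / 2) - δ / 2) = -1 - δ by ring]
      have : bracket (resonance pa pb po x.1 (k - x.1)) ^ (2 * -(1 - δ)) ≤
          bracket (H x.1 (k - x.1)) ^ (-1 : ℝ) * bracket (H x.1 (k - x.1) - 0) ^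
            (-(1 - 3 * δ)) := by
        rw [sub_zero, ← Real.rpow_add (bracket_pos _)]
        exact Real.rpow_le_rpow_of_exponent_le (one_le_bracket _) (by linarith)
      calc _ = 9 * (W x.1 (k - x.1) ^ 2 * bracket (resonance pa pb po x.1 (k - x.1)) ^
              (2 * -(1 - δ))) * (bracket (x.2 - pa x.1) ^ (-1 - δ) *
              bracket (τ - pb (k - x.1)) ^ (-1 - δ)) := by ring
        _ ≤ 9 * (W x.1 (k - x.1) ^ 2 * (bracket (H x.1 (k - x.1)) ^ (-1 : ℝ) *
              bracket (H x.1 (k - x.1) - 0) ^ (-(1 - 3 * δ)))) *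
              (bracket (x.2 - pa x.1) ^ (-1 - δ) * bracket (τ - pb (k - x.1)) ^ (-1 - δ)) := by
            have := pos (x.2 - pa x.1) (-1 - δ)
            have := pos (τ - pb (k - x.1)) (-1 - δ)
            gcongr
        _ = _ := by simp only [hw]; ring
    refine (lintegral_mono i1).trans ?_
    have hm : Measurable fun x : ℤ × ℝ => ENNReal.ofReal (w x.1) *
        ENNReal.ofReal (bracket (x.2 - pa x.1) ^ (-1 - δ)) :=
      ((measurable_of_countable w).comp measurable_fst).ennreal_ofReal.mul
        ((measurable_modulation pa).pow_const _).ennreal_ofReal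
    rw [lintegral_const_mul _ hm, lintegral_phaseMeasure lam hm]
    have i2 : ∀ n, ∫⁻ τ, ENNReal.ofReal (w n) * ENNReal.ofReal (bracket (τ - pa n) ^ (-1 - δ)) =
        ENNReal.ofReal (w n) * M := by
      intro n
      rw [lintegral_const_mul' _ _ ENNReal.ofReal_ne_top, lintegral_bracket_sub]
    simp only [i2]
    rw [ENNReal.tsum_mul_right]
    calc _ ≤ 9 * M * (ENNReal.ofReal (1 / lam) * (ENNReal.ofReal lam * A * M)) := by
          gcongr; exact h₃ k 0
      _ = (ENNReal.ofReal (1 / lam) * ENNReal.ofReal lam) * (9 * M ^ 2 * A) := by ring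
      _ = _ := by rw [← ENNReal.ofReal_mul (by positivity), one_div_mul_cancel hlam.ne']; simp
  have hMC : ∀ c : ℝ≥0∞, c ≤ 1000 → c * M * A * N ≤ critConst δ * A * N := by
    intro c hc
    rw [critConst]
    gcongr
    calc M ≤ 1 + M := le_add_self
      _ = (1 + M) ^ 1 := (pow_one _).symm
      _ ≤ (1 + M) ^ 2 := pow_le_pow_right₀ (by simp) (by norm_num)
  have three : ∀ x y, 1 ≤ Lo x y ∧ 1 ≤ La x y ∧ 1 ≤ Lb x y := fun x y =>
    ⟨one_le_modulation _ _, one_le_modulation _ _, one_le_modulation _ _⟩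
  have pos3 : ∀ {x y u v q : ℝ}, 0 ≤ x → 0 ≤ u → 0 ≤ v → 0 ≤ x * (2 * bracket y ^ (-(1 / 2) : ℝ) *
      (u * v) ^ q) := fun hx hu hv => mul_nonneg hx (mul_nonneg (mul_nonneg (by norm_num)
        (Real.rpow_nonneg (bracket_pos _).le _)) (Real.rpow_nonneg (mul_nonneg hu hv) _))
  constructor
  -- the `X` part, split according to the largest modulation
  · calc _ ≤ ∫⁻ z, 4 * (bil lam (kKernel δ pa pb po W Lo Lb) F₁ F₂ z ^ 2 +
          bil lam (kKernel δ pa pb po W Lo La) F₁ F₂ z ^ 2 +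
          bil lam (kKernel δ pa pb po W La Lb) F₁ F₂ z ^ 2) ∂(phaseMeasure lam) := by
          refine lintegral_mono fun z => le_trans ?_ (add_add_sq_le _ _ _)
          gcongr
          refine bil_le_add_add (measurable_kKernel mo mb) (measurable_kKernel mo ma) m₁ m₂
            (fun x y => ?_) z
          obtain ⟨ho, ha, hb⟩ := three x y
          have := rpow_neg_half_mul_le hδ ho ha hb (one_le_bracket _)
            (bracket_resonance_le pa pb po x y)
          unfold xKernel kKernel
          rw [← ENNReal.ofReal_add, ← ENNReal.ofReal_add]
          · refine ENNReal.ofReal_le_ofReal ?_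
            rw [← mul_add, ← mul_add]
            exact mul_le_mul_of_nonneg_left this (hW _ _)
          · exact add_nonneg (pos3 (hW _ _) (by linarith) (by linarith))
              (pos3 (hW _ _) (by linarith) (by linarith))
          all_goals exact pos3 (hW _ _) (by linarith) (by linarith)
      _ ≤ 4 * (24 * M * A * N + 24 * M * A * N + 24 * M * A * N) := by
          rw [lintegral_const_mul' _ _ (by simp), lintegral_add_left, lintegral_add_left]
          · gcongr
          · exact (measurable_bil (measurable_kKernel mo mb) m₁ m₂).pow_const 2
          · exact ((measurable_bil (measurable_kKernel mo mb) m₁ m₂).pow_const 2).add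
              ((measurable_bil (measurable_kKernel mo ma) m₁ m₂).pow_const 2)
      _ = 288 * M * A * N := by ring
      _ ≤ _ := hMC _ (by norm_num)
  -- the `L²L¹` part: if an input modulation is the largest, a power `> 1/2` of the output
  -- modulation is left over, which reduces `K₁` and `K₂` to the `L²` bounds
  · set K₁ : ℤ × ℝ → ℤ × ℝ → ℝ≥0∞ := fun x y =>
      ENNReal.ofReal (modulation po (x + y) ^ (-(1 / 2) - δ / 2)) *
        kKernel δ pa pb po W Lo Lb x y with hK₁
    set K₂ : ℤ × ℝ → ℤ × ℝ → ℝ≥0∞ := fun x y =>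
      ENNReal.ofReal (modulation po (x + y) ^ (-(1 / 2) - δ / 2)) *
        kKernel δ pa pb po W Lo La x y with hK₂
    have mK₁ : Measurable (Function.uncurry K₁) :=
      (mo.pow_const _).ennreal_ofReal.mul (measurable_kKernel mo mb)
    have mK₂ : Measurable (Function.uncurry K₂) :=
      (mo.pow_const _).ennreal_ofReal.mul (measurable_kKernel mo ma)
    have b5 := bil_l2l1_le_of_weight (lam := lam) (κ' := K₁) (measurable_kKernel mo mb) m₁ m₂
      (fun x y => le_rfl)
    have b6 := bil_l2l1_le_of_weight (lam := lam) (κ' := K₂) (measurable_kKernel mo ma) m₁ m₂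
      (fun x y => le_rfl)
    have hmτ : ∀ {κ : ℤ × ℝ → ℤ × ℝ → ℝ≥0∞}, Measurable (Function.uncurry κ) → ∀ n : ℤ,
        Measurable fun τ => bil lam κ F₁ F₂ (n, τ) := fun hκ n =>
      (measurable_bil hκ m₁ m₂).comp (measurable_const.prodMk measurable_id)
    calc _ ≤ ∫⁻ n, 4 * ((∫⁻ τ, bil lam K₁ F₁ F₂ (n, τ)) ^ 2 +
          (∫⁻ τ, bil lam K₂ F₁ F₂ (n, τ)) ^ 2 +
          (∫⁻ τ, bil lam (oKernel δ pa pb po W) F₁ F₂ (n, τ)) ^ 2) ∂(latticeMeasure lam) := by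
          refine lintegral_mono fun n => le_trans ?_ (add_add_sq_le _ _ _)
          gcongr
          have hm12 : Measurable fun τ => bil lam K₁ F₁ F₂ (n, τ) + bil lam K₂ F₁ F₂ (n, τ) :=
            (hmτ mK₁ n).add (hmτ mK₂ n)
          rw [← lintegral_add_left (hmτ mK₁ n), ← lintegral_add_left hm12]
          refine lintegral_mono fun τ => ?_
          refine bil_le_add_add mK₁ mK₂ m₁ m₂ (fun x y => ?_) _
          obtain ⟨ho, ha, hb⟩ := three x y
          have := rpow_neg_one_mul_le hδ hδ' ho ha hb (one_le_bracket _)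
            (bracket_resonance_le pa pb po x y)
          have p0 : 0 ≤ modulation po (x + y) ^ (-(1 / 2) - δ / 2) :=
            Real.rpow_nonneg (modulation_pos _ _).le _
          simp only [hK₁, hK₂]
          unfold lKernel kKernel oKernel
          rw [← ENNReal.ofReal_mul p0, ← ENNReal.ofReal_mul p0, ← ENNReal.ofReal_add,
            ← ENNReal.ofReal_add]
          · refine ENNReal.ofReal_le_ofReal ?_
            refine (mul_le_mul_of_nonneg_left this (hW _ _)).trans (le_of_eq ?_)
            ring
          · exact add_nonneg (mul_nonneg p0 (pos3 (hW _ _) (by linarith) (by linarith)))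
              (mul_nonneg p0 (pos3 (hW _ _) (by linarith) (by linarith)))
          · exact mul_nonneg (hW _ _) (mul_nonneg (mul_nonneg (by norm_num)
              (Real.rpow_nonneg (bracket_pos _).le _)) (Real.rpow_nonneg
                (mul_nonneg (modulation_pos _ _).le (modulation_pos _ _).le) _))
          all_goals exact mul_nonneg p0 (pos3 (hW _ _) (by linarith) (by linarith))
      _ ≤ 4 * (M * (24 * M * A * N) + M * (24 * M * A * N) + 9 * M ^ 2 * A * N) := by
          rw [lintegral_const_mul' _ _ (by simp), lintegral_add_left (measurable_of_countable _),
            lintegral_add_left (measurable_of_countable _)]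
          gcongr
          · exact b5.trans (by gcongr)
          · exact b6.trans (by gcongr)
      _ = 228 * M ^ 2 * A * N := by ring
      _ ≤ _ := by
          rw [critConst]
          gcongr
          · norm_num
          · exact le_add_self

end Criteria

/-! ### The symmetric form of the criteria -/

/-- The sums of `Q` over the first of three frequencies `m₁ + m₂ + m₃ = 0` being fixed. -/
def Slice₁ (Q : ℤ → ℤ → ℝ) (B : ℝ≥0∞) : Prop := ∀ n, ∑' m, ENNReal.ofReal (Q n m) ≤ B

/-- The sums of `Q` over the second of three frequencies `m₁ + m₂ + m₃ = 0` being fixed. -/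
def Slice₂ (Q : ℤ → ℤ → ℝ) (B : ℝ≥0∞) : Prop := ∀ m, ∑' n, ENNReal.ofReal (Q n m) ≤ B

/-- The sums of `Q` over the third of three frequencies `m₁ + m₂ + m₃ = 0`, here `m₃ = -k`, being
fixed. -/
def Slice₃ (Q : ℤ → ℤ → ℝ) (B : ℝ≥0∞) : Prop := ∀ k, ∑' n, ENNReal.ofReal (Q n (k - n)) ≤ B

/-- The resonance function `p₁(m₁) + p₁(m₂) + p₂(m₃)` of three frequencies with sum zero. -/
def symResonance (p₁ p₂ : ℤ → ℝ) (m₁ m₂ : ℤ) : ℝ := p₁ m₁ + p₁ m₂ + p₂ (-m₁ - m₂)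

/-- The bilinear estimates whose trilinear form has weight `V` at the frequencies `m₁`, `m₂` with
phase `p₁` and `-m₁ - m₂` with phase `p₂`: the output is either the wave with phase `p₂` or one of
the waves with phase `p₁`. -/
def SymZ (lam : ℝ) (p₁ p₂ : ℤ → ℝ) (V : ℤ → ℤ → ℝ) (A : ℝ≥0∞) : Prop :=
  ZBdd lam p₁ p₁ p₂ V A ∧ ZBdd lam p₁ p₂ p₁ (fun n m => V n (-n - m)) A

section Sym

variable {lam δ : ℝ} {p₁ p₂ : ℤ → ℝ} {V : ℤ → ℤ → ℝ} {A : ℝ≥0∞}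

theorem SymZ.mono_const {B : ℝ≥0∞} (h : SymZ lam p₁ p₂ V A) (hAB : A ≤ B) :
    SymZ lam p₁ p₂ V B := ⟨h.1.mono_const hAB, h.2.mono_const hAB⟩

theorem SymZ.add {V₁ V₂ : ℤ → ℤ → ℝ} {A₁ A₂ : ℝ≥0∞} (h₁ : SymZ lam p₁ p₂ V₁ A₁)
    (h₂ : SymZ lam p₁ p₂ V₂ A₂) (hV₁ : ∀ n m, 0 ≤ V₁ n m) (hV₂ : ∀ n m, 0 ≤ V₂ n m)
    (hV : ∀ n m, V n m ≤ V₁ n m + V₂ n m) : SymZ lam p₁ p₂ V (2 * (A₁ + A₂)) :=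
  ⟨h₁.1.add h₂.1 hV₁ hV₂ hV, h₁.2.add h₂.2 (fun _ _ => hV₁ _ _) (fun _ _ => hV₂ _ _)
    fun _ _ => hV _ _⟩

theorem resonance_div₁ (o₂ : ∀ n, p₂ (-n) = -p₂ n) (n m : ℤ) :
    resonance p₁ p₁ p₂ n m = -symResonance p₁ p₂ n m := by
  have := o₂ (n + m)
  rw [resonance, symResonance, show -n - m = -(n + m) by ring]; linarith

theorem resonance_div₂ (o₁ : ∀ n, p₁ (-n) = -p₁ n) (n m : ℤ) :
    resonance p₁ p₂ p₁ n m = -symResonance p₁ p₂ n (-n - m) := by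
  have := o₁ (n + m)
  rw [resonance, symResonance, show -n - (-n - m) = m by ring, show -n - m = -(n + m) by ring]
  linarith

theorem tsum_comp_neg_sub (f : ℤ → ℝ≥0∞) (n : ℤ) : ∑' m, f (-n - m) = ∑' m, f m :=
  (Equiv.subLeft (-n)).tsum_eq f

/-- `ZBdd.of_triv` in symmetric form: permuting the roles of the three waves permutes the slices. -/
theorem SymZ.of_triv (o₁ : ∀ n, p₁ (-n) = -p₁ n) (o₂ : ∀ n, p₂ (-n) = -p₂ n)
    (hlam : 0 < lam) (hδ : 0 < δ) (hδ' : δ ≤ 1 / 12) (hV : ∀ n m, 0 ≤ V n m)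
    {Q : ℤ → ℤ → ℝ}
    (hQ : ∀ n m, V n m ^ 2 * bracket (symResonance p₁ p₂ n m) ^ (-(1 - 3 * δ)) ≤ Q n m)
    (h : Slice₁ Q (ENNReal.ofReal lam * A) ∨ Slice₂ Q (ENNReal.ofReal lam * A) ∨
      Slice₃ Q (ENNReal.ofReal lam * A)) : SymZ lam p₁ p₂ V (critConst δ * A) := by
  have hQ' : ∀ n m, ENNReal.ofReal (V n m ^ 2 *
      bracket (-symResonance p₁ p₂ n m) ^ (-(1 - 3 * δ))) ≤ ENNReal.ofReal (Q n m) := fun n m => by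
    rw [bracket_neg]; exact ENNReal.ofReal_le_ofReal (hQ n m)
  constructor
  · refine ZBdd.of_triv hlam hδ hδ' hV ?_
    simp only [resonance_div₁ o₂]
    rcases h with h | h | h
    · exact Or.inl fun n => (ENNReal.tsum_le_tsum fun m => hQ' _ _).trans (h n)
    · exact Or.inr (Or.inl fun n => (ENNReal.tsum_le_tsum fun m => hQ' _ _).trans (h n))
    · exact Or.inr (Or.inr fun n => (ENNReal.tsum_le_tsum fun m => hQ' _ _).trans (h n))
  · refine ZBdd.of_triv hlam hδ hδ' (fun _ _ => hV _ _) ?_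
    simp only [resonance_div₂ o₁]
    rcases h with h | h | h
    · refine Or.inl fun n => (ENNReal.tsum_le_tsum fun m => hQ' n (-n - m)).trans ?_
      rw [tsum_comp_neg_sub fun m => ENNReal.ofReal (Q n m)]
      exact h n
    · refine Or.inr (Or.inr fun k => (ENNReal.tsum_le_tsum fun n => hQ' n _).trans ?_)
      refine le_trans (le_of_eq (tsum_congr fun n => ?_)) (h (-k))
      congr 2; ring
    · refine Or.inr (Or.inl fun m => (ENNReal.tsum_le_tsum fun n => hQ' n _).trans ?_)
      refine le_trans (le_of_eq (tsum_congr fun n => ?_)) (h (-m))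
      congr 2; ring

/-- `ZBdd.of_kpv` in symmetric form: permuting the roles of the three waves permutes the slices. -/
theorem SymZ.of_kpv (o₁ : ∀ n, p₁ (-n) = -p₁ n) (o₂ : ∀ n, p₂ (-n) = -p₂ n)
    (hlam : 0 < lam) (hδ : 0 < δ) (hδ' : δ ≤ 1 / 12) (hV : ∀ n m, 0 ≤ V n m)
    {Q : ℝ → ℤ → ℤ → ℝ}
    (hQ : ∀ a n m, V n m ^ 2 * bracket (symResonance p₁ p₂ n m) ^ (-1 : ℝ) *
      bracket (symResonance p₁ p₂ n m - a) ^ (-(1 - 3 * δ)) ≤ Q a n m)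
    (h₁ : ∀ a, Slice₁ (Q a) (ENNReal.ofReal lam * A))
    (h₂ : ∀ a, Slice₂ (Q a) (ENNReal.ofReal lam * A))
    (h₃ : ∀ a, Slice₃ (Q a) (ENNReal.ofReal lam * A)) :
    SymZ lam p₁ p₂ V (critConst δ * A) := by
  have hQ' : ∀ a n m, ENNReal.ofReal (V n m ^ 2 *
      bracket (-symResonance p₁ p₂ n m) ^ (-1 : ℝ) *
      bracket (-symResonance p₁ p₂ n m - a) ^ (-(1 - 3 * δ))) ≤
      ENNReal.ofReal (Q (-a) n m) := fun a n m => by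
    rw [bracket_neg, ← bracket_neg (-symResonance p₁ p₂ n m - a),
      show -(-symResonance p₁ p₂ n m - a) = symResonance p₁ p₂ n m - (-a) by ring]
    exact ENNReal.ofReal_le_ofReal (hQ (-a) n m)
  constructor
  · refine ZBdd.of_kpv hlam hδ hδ' hV ?_ ?_ ?_ <;> simp only [resonance_div₁ o₂]
    · exact fun n a => (ENNReal.tsum_le_tsum fun m => hQ' a _ _).trans (h₁ (-a) n)
    · exact fun n a => (ENNReal.tsum_le_tsum fun m => hQ' a _ _).trans (h₂ (-a) n)
    · exact fun n a => (ENNReal.tsum_le_tsum fun m => hQ' a _ _).trans (h₃ (-a) n)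
  · refine ZBdd.of_kpv hlam hδ hδ' (fun _ _ => hV _ _) ?_ ?_ ?_ <;>
      simp only [resonance_div₂ o₁]
    · refine fun n a => (ENNReal.tsum_le_tsum fun m => hQ' a n (-n - m)).trans ?_
      rw [tsum_comp_neg_sub fun m => ENNReal.ofReal (Q (-a) n m)]
      exact h₁ (-a) n
    · refine fun m a => (ENNReal.tsum_le_tsum fun n => hQ' a n _).trans ?_
      refine le_trans (le_of_eq (tsum_congr fun n => ?_)) (h₃ (-a) (-m))
      congr 2; ring
    · refine fun k a => (ENNReal.tsum_le_tsum fun n => hQ' a n _).trans ?_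
      refine le_trans (le_of_eq (tsum_congr fun n => ?_)) (h₂ (-a) (-k))
      congr 2; ring

end Sym

/-! ### Sums over the lattice -/

theorem lintegral_bracket_mul_sub {E : ℝ} (hE : 0 < E) (y q : ℝ) :
    ∫⁻ t : ℝ, ENNReal.ofReal (bracket (E * (t - y)) ^ (-1 - q)) =
      ENNReal.ofReal (1 / E) * modulationMass q := by
  have hm : Measurable fun τ : ℝ => ENNReal.ofReal (bracket τ ^ (-1 - q)) :=
    (measurable_bracket.pow_const _).ennreal_ofReal
  rw [lintegral_sub_right_eq_self (fun t => ENNReal.ofReal (bracket (E * t) ^ (-1 - q))) y,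
    modulationMass, ← smul_eq_mul, ← lintegral_smul_measure]
  have h := Real.map_volume_mul_left hE.ne'
  rw [abs_of_pos (inv_pos.2 hE), ← one_div] at h
  rw [← h, lintegral_map hm (measurable_const_mul E)]

/-- Comparison of a sum over `ℤ` with an integral. -/
theorem tsum_bracket_le {E q : ℝ} (hE : 0 < E) (hq : 0 < q) (y : ℝ) :
    ∑' m : ℤ, ENNReal.ofReal (bracket (E * (m - y)) ^ (-1 - q)) ≤
      2 + 2 * (ENNReal.ofReal (1 / E) * modulationMass q) := by
  set g : ℝ → ℝ≥0∞ := fun t => ENNReal.ofReal (bracket (E * (t - y)) ^ (-1 - q)) with hg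
  have hmono : ∀ s t : ℝ, |s - y| ≤ |t - y| → g t ≤ g s := by
    intro s t hst
    refine ENNReal.ofReal_le_ofReal (Real.rpow_le_rpow_of_nonpos (bracket_pos _) ?_ (by linarith))
    unfold bracket
    rw [abs_mul, abs_mul]
    gcongr
  have hone : ∀ t, g t ≤ 1 := by
    intro t
    rw [← ENNReal.ofReal_one]
    exact ENNReal.ofReal_le_ofReal
      (Real.rpow_le_one_of_one_le_of_nonpos (one_le_bracket _) (by linarith))
  have hU : ∀ c : ℤ, ∑' m : ℤ, ∫⁻ t in Set.Ioc ((m + c : ℤ) : ℝ) ((m + c : ℤ) + 1), g t =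
      ∫⁻ t, g t := by
    intro c
    rw [show ∑' m : ℤ, ∫⁻ t in Set.Ioc ((m + c : ℤ) : ℝ) ((m + c : ℤ) + 1), g t =
        ∑' m : ℤ, ∫⁻ t in Set.Ioc (m : ℝ) (m + 1), g t from
        (Equiv.addRight c).tsum_eq fun m : ℤ => ∫⁻ t in Set.Ioc (m : ℝ) (m + 1), g t,
      ← lintegral_iUnion (fun _ => measurableSet_Ioc) (Set.pairwise_disjoint_Ioc_intCast ℝ),
      iUnion_Ioc_intCast, Measure.restrict_univ]
  have hI : ∫⁻ t, g t = ENNReal.ofReal (1 / E) * modulationMass q :=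
    lintegral_bracket_mul_sub hE y q
  -- away from the two integers next to `y`, the term at `m` is at most the integral over the
  -- adjacent unit interval on the side of `y`
  have key : ∀ m : ℤ, g m ≤ ((if m = ⌊y⌋ then 1 else 0) + (if m = ⌊y⌋ + 1 then 1 else 0)) +
      ((∫⁻ t in Set.Ioc ((m + 0 : ℤ) : ℝ) ((m + 0 : ℤ) + 1), g t) +
      ∫⁻ t in Set.Ioc ((m + (-1) : ℤ) : ℝ) ((m + (-1) : ℤ) + 1), g t) := by
    intro m
    have hc : ∀ a : ℝ, (∀ t ∈ Set.Ioc a (a + 1), g m ≤ g t) →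
        g m ≤ ∫⁻ t in Set.Ioc a (a + 1), g t := by
      intro a ha
      calc g m = ∫⁻ _ in Set.Ioc a (a + 1), g m := by simp
        _ ≤ _ := setLIntegral_mono' measurableSet_Ioc ha
    by_cases h1 : m = ⌊y⌋
    · simp only [h1, if_true]
      exact (hone _).trans (le_add_right (le_add_right le_rfl))
    by_cases h2 : m = ⌊y⌋ + 1
    · simp only [h2, if_true]
      exact (hone _).trans (le_add_right (le_add_left le_rfl))
    have hf := Int.floor_le y
    have hf' := Int.lt_floor_add_one y
    rcases lt_or_ge m ⌊y⌋ with h3 | h3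
    · have h4 : (m : ℝ) + 1 ≤ ⌊y⌋ := by exact_mod_cast h3
      refine le_add_left (le_add_right (hc _ fun t ht => hmono _ _ ?_))
      simp only [add_zero, Set.mem_Ioc] at ht
      rw [abs_of_nonpos (by linarith), abs_of_nonpos (by linarith)]; linarith
    · have h4 : (⌊y⌋ : ℝ) + 2 ≤ m := by
        have : ⌊y⌋ + 2 ≤ m := by omega
        exact_mod_cast this
      refine le_add_left (le_add_left (hc _ fun t ht => hmono _ _ ?_))
      push_cast at ht
      simp only [Set.mem_Ioc] at ht
      rw [abs_of_nonneg (by linarith), abs_of_nonneg (by linarith)]; linarith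
  calc _ ≤ ∑' m : ℤ, _ := ENNReal.tsum_le_tsum key
    _ = (1 + 1) + ((∫⁻ t, g t) + ∫⁻ t, g t) := by
        rw [ENNReal.tsum_add, ENNReal.tsum_add, ENNReal.tsum_add, hU, hU, tsum_ite_eq, tsum_ite_eq]
    _ = _ := by rw [hI]; ring

/-- Real form of `tsum_bracket_le`. -/
theorem exists_tsum_bracket_le {q : ℝ} (hq : 1 < q) : ∃ K : ℝ, 0 < K ∧ ∀ E y : ℝ, 0 < E →
    ∑' m : ℤ, ENNReal.ofReal (bracket (E * (m - y)) ^ (-q)) ≤ ENNReal.ofReal (K * (1 + 1 / E)) := by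
  have hfin := modulationMass_lt_top (δ := q - 1) (by linarith)
  refine ⟨2 + 2 * (modulationMass (q - 1)).toReal, by positivity, fun E y hE => ?_⟩
  have h := tsum_bracket_le hE (q := q - 1) (by linarith) y
  rw [show -1 - (q - 1) = -q by ring] at h
  refine h.trans ?_
  rw [← ENNReal.ofReal_toReal hfin.ne, ← ENNReal.ofReal_mul (by positivity),
    show (2 : ℝ≥0∞) = ENNReal.ofReal 2 by simp, ← ENNReal.ofReal_mul (by norm_num),
    ← ENNReal.ofReal_add (by norm_num) (by positivity)]
  refine ENNReal.ofReal_le_ofReal ?_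
  have : 0 ≤ (modulationMass (q - 1)).toReal := ENNReal.toReal_nonneg
  have hE' : 0 < 1 / E := by positivity
  rw [ENNReal.toReal_ofReal this]
  nlinarith

/-- If `h` separates the points of `S` at the rate `D |n - n'|^γ`, then the sum of
`⟨h(n) - a⟩^{-θ}` over `S` is bounded uniformly in `a`. -/
theorem exists_tsum_separated_le {γ θ : ℝ} (hγ : 0 < γ) (hθ : 0 < θ) (hγθ : 1 < γ * θ) :
    ∃ K : ℝ, 0 < K ∧ ∀ (S : Set ℤ) (h : ℤ → ℝ) (D a : ℝ), 0 < D →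
      (∀ n ∈ S, ∀ n' ∈ S, D * |(n : ℝ) - n'| ^ γ ≤ |h n - h n'|) →
      ∑' n, ENNReal.ofReal (S.indicator (fun n => bracket (h n - a) ^ (-θ)) n) ≤
        ENNReal.ofReal (K * (1 + D ^ (-(1 / γ)))) := by
  obtain ⟨K, hK, hsum⟩ := exists_tsum_bracket_le hγθ
  refine ⟨2 ^ ((1 + γ) * θ) * K, by positivity, fun S h D a hD hS => ?_⟩
  rcases S.eq_empty_or_nonempty with rfl | hne
  · simp
  -- a point of `S` at which `|h - a|` is within `1` of its infimum
  obtain ⟨n₀, hn₀, hmin⟩ : ∃ n₀ ∈ S, ∀ n ∈ S, |h n₀ - a| ≤ |h n - a| + 1 := by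
    have hne' : ((fun n => |h n - a|) '' S).Nonempty := hne.image _
    obtain ⟨_, ⟨n₀, hn₀, rfl⟩, hlt⟩ := exists_lt_of_csInf_lt hne'
      (lt_add_one (sInf ((fun n => |h n - a|) '' S)))
    refine ⟨n₀, hn₀, fun n hn => ?_⟩
    have : sInf ((fun n => |h n - a|) '' S) ≤ |h n - a| :=
      csInf_le ⟨0, by rintro _ ⟨m, _, rfl⟩; exact abs_nonneg _⟩ ⟨n, hn, rfl⟩
    dsimp only at hlt
    linarith
  set E := D ^ (1 / γ) with hE
  have hE0 : 0 < E := by positivity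
  have hEγ : E ^ γ = D := by rw [hE, ← Real.rpow_mul hD.le, one_div_mul_cancel hγ.ne', Real.rpow_one]
  -- since `n₀` almost minimizes `|h - a|`, the separation `|h n - h n₀| ≥ (E |n - n₀|)^γ` bounds
  -- `⟨h n - a⟩` from below
  have key : ∀ n, S.indicator (fun n => bracket (h n - a) ^ (-θ)) n ≤
      2 ^ ((1 + γ) * θ) * bracket (E * (n - (n₀ : ℝ))) ^ (-(γ * θ)) := by
    intro n
    have hpos : 0 ≤ (2 : ℝ) ^ ((1 + γ) * θ) * bracket (E * (n - (n₀ : ℝ))) ^ (-(γ * θ)) :=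
      mul_nonneg (by positivity) (Real.rpow_nonneg (bracket_pos _).le _)
    by_cases hn : n ∈ S
    · rw [Set.indicator_of_mem hn]
      set x := E * |(n : ℝ) - n₀| with hx
      have hx0 : 0 ≤ x := by positivity
      have hbx : bracket (E * (n - (n₀ : ℝ))) = 1 + x := by
        rw [bracket, abs_mul, abs_of_pos hE0]
      have h1 : x ^ γ ≤ |h n - h n₀| := by
        rw [hx, Real.mul_rpow hE0.le (abs_nonneg _), hEγ]; exact hS n hn n₀ hn₀
      have h2 : |h n - h n₀| ≤ |h n - a| + |h n₀ - a| := by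
        have := abs_sub (h n - a) (h n₀ - a)
        rwa [sub_sub_sub_cancel_right] at this
      have h3 := hmin n hn
      have h4 : 1 + x ^ γ ≤ 2 * bracket (h n - a) := by unfold bracket; linarith
      have h5 : (1 + x) ^ γ ≤ 2 ^ γ * (1 + x ^ γ) := by
        rcases le_total x 1 with hx1 | hx1
        · calc (1 + x) ^ γ ≤ 2 ^ γ := by gcongr; linarith
            _ ≤ _ := le_mul_of_one_le_right (by positivity)
                (by linarith [Real.rpow_nonneg hx0 γ])
        · calc (1 + x) ^ γ ≤ (2 * x) ^ γ := by gcongr; linarith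
            _ = 2 ^ γ * x ^ γ := Real.mul_rpow (by norm_num) hx0
            _ ≤ _ := by gcongr; linarith
      have h6 : (1 + x) ^ γ ≤ 2 ^ (1 + γ) * bracket (h n - a) := by
        calc _ ≤ _ := h5
          _ ≤ 2 ^ γ * (2 * bracket (h n - a)) := by gcongr
          _ = _ := by rw [Real.rpow_add (by norm_num), Real.rpow_one]; ring
      have h7 : (1 + x) ^ (γ * θ) ≤ 2 ^ ((1 + γ) * θ) * bracket (h n - a) ^ θ := by
        rw [Real.rpow_mul (by positivity), Real.rpow_mul (by norm_num),
          ← Real.mul_rpow (by positivity) (bracket_pos _).le]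
        gcongr
      rw [hbx, Real.rpow_neg (bracket_pos _).le, Real.rpow_neg (by positivity), ← div_eq_mul_inv,
        le_div_iff₀ (by positivity), inv_mul_le_iff₀ (Real.rpow_pos_of_pos (bracket_pos _) _),
        mul_comm (bracket _ ^ θ)]
      exact h7
    · rw [Set.indicator_of_notMem hn]; exact hpos
  calc _ ≤ ∑' n : ℤ, ENNReal.ofReal (2 ^ ((1 + γ) * θ)) *
        ENNReal.ofReal (bracket (E * (n - (n₀ : ℝ))) ^ (-(γ * θ))) := by
        refine ENNReal.tsum_le_tsum fun n => ?_
        rw [← ENNReal.ofReal_mul (by positivity)]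
        exact ENNReal.ofReal_le_ofReal (key n)
    _ ≤ ENNReal.ofReal (2 ^ ((1 + γ) * θ)) * ENNReal.ofReal (K * (1 + 1 / E)) := by
        rw [ENNReal.tsum_mul_left]
        gcongr
        exact hsum E n₀ hE0
    _ = _ := by
        rw [← ENNReal.ofReal_mul (by positivity), hE, Real.rpow_neg hD.le, one_div (D ^ _), mul_assoc]

theorem tsum_ofReal_le_of_le_add {f g h : ℤ → ℝ} (hfg : ∀ n, f n ≤ g n + h n) {A B : ℝ}
    (hA : ∑' n, ENNReal.ofReal (g n) ≤ ENNReal.ofReal A)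
    (hB : ∑' n, ENNReal.ofReal (h n) ≤ ENNReal.ofReal B) (hA0 : 0 ≤ A) (hB0 : 0 ≤ B) :
    ∑' n, ENNReal.ofReal (f n) ≤ ENNReal.ofReal (A + B) := by
  rw [ENNReal.ofReal_add hA0 hB0]
  refine le_trans ?_ (add_le_add hA hB)
  rw [← ENNReal.tsum_add]
  exact ENNReal.tsum_le_tsum fun n => (ENNReal.ofReal_le_ofReal (hfg n)).trans
    ENNReal.ofReal_add_le

theorem indicator_bracket_nonneg (S : Set ℤ) (h : ℤ → ℝ) (a θ : ℝ) (n : ℤ) :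
    0 ≤ S.indicator (fun n => bracket (h n - a) ^ (-θ)) n :=
  Set.indicator_nonneg (fun _ _ => Real.rpow_nonneg (bracket_pos _).le _) n

/-- The separated sums at the scale of the lattice `ℤ_λ`. -/
theorem exists_tsum_lattice_separated_le {γ θ c₀ : ℝ} (hγ : 0 < γ) (hθ : 0 < θ)
    (hγθ : 1 < γ * θ) (hc₀ : 0 < c₀) :
    ∃ K : ℝ, 0 < K ∧ ∀ (S : Set ℤ) (h : ℤ → ℝ) (lam a : ℝ), 1 ≤ lam →
      (∀ n ∈ S, ∀ n' ∈ S, c₀ * |(n : ℝ) / lam - n' / lam| ^ γ ≤ |h n - h n'|) →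
      ∑' n, ENNReal.ofReal (S.indicator (fun n => bracket (h n - a) ^ (-θ)) n) ≤
        ENNReal.ofReal (K * lam) := by
  obtain ⟨K, hK, hsum⟩ := exists_tsum_separated_le hγ hθ hγθ
  refine ⟨K * (1 + c₀ ^ (-(1 / γ))), by positivity, fun S h lam a hlam hS => ?_⟩
  have hl : 0 < lam := by linarith
  refine (hsum S h (c₀ / lam ^ γ) a (by positivity) fun n hn n' hn' => ?_).trans
    (ENNReal.ofReal_le_ofReal ?_)
  · refine le_trans (le_of_eq ?_) (hS n hn n' hn')
    rw [← sub_div, abs_div, abs_of_pos hl, Real.div_rpow (abs_nonneg _) hl.le]; ring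
  · have e : (c₀ / lam ^ γ) ^ (-(1 / γ)) = c₀ ^ (-(1 / γ)) * lam := by
      rw [Real.div_rpow hc₀.le (by positivity), ← Real.rpow_mul hl.le,
        show γ * -(1 / γ) = -1 by field_simp, Real.rpow_neg_one, div_inv_eq_mul]
    rw [e]
    have : 0 ≤ c₀ ^ (-(1 / γ)) := by positivity
    calc K * (1 + c₀ ^ (-(1 / γ)) * lam) ≤ K * (lam + c₀ ^ (-(1 / γ)) * lam) := by gcongr
      _ = _ := by ring

/-- Sums along a quadratic polynomial: it is quadratically separating on either side of its
vertex. -/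
theorem exists_tsum_quadratic_le {θ c₀ : ℝ} (hθ : 1 < 2 * θ) (hc₀ : 0 < c₀) :
    ∃ K : ℝ, 0 < K ∧ ∀ (lam a c b e : ℝ) (h : ℤ → ℝ), 1 ≤ lam → c₀ ≤ |c| →
      (∀ n : ℤ, h n = c * ((n : ℝ) / lam) ^ 2 + b * (n / lam) + e) →
      ∑' n : ℤ, ENNReal.ofReal (bracket (h n - a) ^ (-θ)) ≤ ENNReal.ofReal (K * lam) := by
  obtain ⟨K, hK, hsum⟩ := exists_tsum_lattice_separated_le (γ := 2) (θ := θ) (by norm_num)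
    (by linarith) hθ hc₀
  refine ⟨2 * K, by positivity, fun lam a c b e h hlam hc hh => ?_⟩
  have hl : 0 < lam := by linarith
  have hc0 : c ≠ 0 := by rintro rfl; rw [abs_zero] at hc; linarith
  -- the second factor is the distance to the reflected point, which is at least `|n - n'| / λ` on
  -- either side of the vertex
  have hdiff : ∀ n n' : ℤ, |h n - h n'| =
      |c| * (|(n : ℝ) / lam - n' / lam| * |(n / lam + b / (2 * c)) + (n' / lam + b / (2 * c))|) := by
    intro n n'
    rw [← abs_mul, ← abs_mul, hh, hh]; congr 1; field_simp; ring
  have hsep : ∀ u v w : ℝ, |u - v| ≤ w → c₀ * |u - v| ^ (2 : ℝ) ≤ |c| * (|u - v| * w) := by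
    intro u v w hw
    rw [Real.rpow_two, pow_two]
    have := abs_nonneg (u - v)
    gcongr
  set S : Set ℤ := {n | 0 ≤ (n : ℝ) / lam + b / (2 * c)} with hS
  set T : Set ℤ := {n | (n : ℝ) / lam + b / (2 * c) ≤ 0} with hT
  have s1 := hsum S h lam a hlam fun n hn n' hn' => by
    rw [hdiff]
    refine hsep _ _ _ ?_
    simp only [hS, Set.mem_ofPred_eq] at hn hn'
    rw [abs_of_nonneg (add_nonneg hn hn')]
    exact abs_le.2 ⟨by linarith, by linarith⟩
  have s2 := hsum T h lam a hlam fun n hn n' hn' => by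
    rw [hdiff]
    refine hsep _ _ _ ?_
    simp only [hT, Set.mem_ofPred_eq] at hn hn'
    rw [abs_of_nonpos (add_nonpos hn hn')]
    exact abs_le.2 ⟨by linarith, by linarith⟩
  rw [show 2 * K * lam = K * lam + K * lam by ring]
  refine tsum_ofReal_le_of_le_add (fun n => ?_) s1 s2 (by positivity) (by positivity)
  rcases le_total 0 ((n : ℝ) / lam + b / (2 * c)) with hn | hn
  · have := indicator_bracket_nonneg T h a θ n
    rw [Set.indicator_of_mem (show n ∈ S from hn)]; linarith
  · have := indicator_bracket_nonneg S h a θ n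
    rw [Set.indicator_of_mem (show n ∈ T from hn)]; linarith

/-- Sums along a cubic polynomial: it is cubically separating between its critical points. -/
theorem exists_tsum_cubic_le {θ c₀ : ℝ} (hθ : 1 < 3 * θ) (hc₀ : 0 < c₀) :
    ∃ K : ℝ, 0 < K ∧ ∀ (lam a c b d e : ℝ) (h : ℤ → ℝ), 1 ≤ lam → c₀ ≤ |c| →
      (∀ n : ℤ, h n = c * ((n : ℝ) / lam) ^ 3 + b * (n / lam) ^ 2 + d * (n / lam) + e) →
      ∑' n : ℤ, ENNReal.ofReal (bracket (h n - a) ^ (-θ)) ≤ ENNReal.ofReal (K * lam) := by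
  obtain ⟨K, hK, hsum⟩ := exists_tsum_lattice_separated_le (γ := 3) (θ := θ) (c₀ := c₀ / 4)
    (by norm_num) (by linarith) hθ (by positivity)
  refine ⟨3 * K, by positivity, fun lam a c b d e h hlam hc hh => ?_⟩
  have hl : 0 < lam := by linarith
  have hc0 : c ≠ 0 := by rintro rfl; rw [abs_zero] at hc; linarith
  -- the depressed cubic `c (u³ + p u)`, `u = n / λ + b / (3 c)`
  set p : ℝ := d / c - b ^ 2 / (3 * c ^ 2) with hp
  set u : ℤ → ℝ := fun n => (n : ℝ) / lam + b / (3 * c) with hu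
  have hdiff : ∀ n n' : ℤ, |h n - h n'| = |c| * (|(n : ℝ) / lam - n' / lam| *
      |u n ^ 2 + u n * u n' + u n' ^ 2 + p|) := by
    intro n n'
    rw [← abs_mul, ← abs_mul, hh, hh]; congr 1; simp only [hu, hp]; field_simp; ring
  have hsep : ∀ n n' : ℤ, (u n - u n') ^ 2 / 4 ≤ |u n ^ 2 + u n * u n' + u n' ^ 2 + p| →
      c₀ / 4 * |(n : ℝ) / lam - n' / lam| ^ (3 : ℝ) ≤ |h n - h n'| := by
    intro n n' hw
    rw [hdiff, show (3 : ℝ) = ((3 : ℕ) : ℝ) by norm_num, Real.rpow_natCast]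
    have h1 : (u n - u n') ^ 2 = |(n : ℝ) / lam - n' / lam| ^ 2 := by
      rw [sq_abs]; simp only [hu]; ring
    rw [h1] at hw
    have := abs_nonneg ((n : ℝ) / lam - n' / lam)
    calc _ = c₀ * (|(n : ℝ) / lam - n' / lam| * (|(n : ℝ) / lam - n' / lam| ^ 2 / 4)) := by ring
      _ ≤ _ := by gcongr
  rcases le_total 0 p with hp0 | hp0
  · have s := hsum Set.univ h lam a hlam fun n _ n' _ => by
      refine hsep n n' (le_trans ?_ (le_abs_self _))
      nlinarith [sq_nonneg (u n + u n'), sq_nonneg (u n - u n')]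
    simp only [Set.indicator_univ] at s
    exact s.trans (ENNReal.ofReal_le_ofReal (by nlinarith [mul_pos hK hl]))
  -- for `p < 0` the critical points are `± m`, and there are three monotone pieces
  · obtain ⟨m, hm0, hm⟩ : ∃ m : ℝ, 0 ≤ m ∧ p = -3 * m ^ 2 :=
      ⟨Real.sqrt (-p / 3), Real.sqrt_nonneg _, by
        rw [Real.sq_sqrt (by linarith)]; ring⟩
    set S : Set ℤ := {n | m ≤ u n} with hS
    set T : Set ℤ := {n | u n ≤ -m} with hT
    set R : Set ℤ := {n | -m ≤ u n ∧ u n ≤ m} with hR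
    have s1 := hsum S h lam a hlam fun n hn n' hn' => by
      refine hsep n n' (le_trans ?_ (le_abs_self _))
      have hn : m ≤ u n := hn
      have hn' : m ≤ u n' := hn'
      rw [hm]
      nlinarith [mul_nonneg hm0 (sub_nonneg.2 hn), mul_nonneg hm0 (sub_nonneg.2 hn'),
        mul_nonneg (sub_nonneg.2 hn) (sub_nonneg.2 hn'), sq_nonneg (u n - m), sq_nonneg (u n' - m)]
    have s2 := hsum T h lam a hlam fun n hn n' hn' => by
      refine hsep n n' (le_trans ?_ (le_abs_self _))
      have hn : u n ≤ -m := hn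
      have hn' : u n' ≤ -m := hn'
      have h1 : 0 ≤ -m - u n := by linarith
      have h2 : 0 ≤ -m - u n' := by linarith
      rw [hm]
      nlinarith [mul_nonneg hm0 h1, mul_nonneg hm0 h2, mul_nonneg h1 h2, sq_nonneg (u n + m),
        sq_nonneg (u n' + m)]
    have s3 := hsum R h lam a hlam fun n hn n' hn' => by
      refine hsep n n' (le_trans ?_ (neg_le_abs _))
      obtain ⟨h1, h2⟩ : -m ≤ u n ∧ u n ≤ m := hn
      obtain ⟨h3, h4⟩ : -m ≤ u n' ∧ u n' ≤ m := hn'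
      have i1 : u n ^ 2 ≤ m ^ 2 := sq_le_sq' h1 h2
      have i2 : u n' ^ 2 ≤ m ^ 2 := sq_le_sq' h3 h4
      rw [hm]
      nlinarith [sq_nonneg (u n - u n')]
    rw [show 3 * K * lam = (K * lam + K * lam) + K * lam by ring]
    refine tsum_ofReal_le_of_le_add (g := fun n => S.indicator (fun n => bracket (h n - a) ^ (-θ)) n
      + T.indicator (fun n => bracket (h n - a) ^ (-θ)) n) (fun n => ?_)
      (tsum_ofReal_le_of_le_add (fun n => le_rfl) s1 s2 (by positivity) (by positivity)) s3
      (by positivity) (by positivity)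
    have q1 := indicator_bracket_nonneg S h a θ n
    have q2 := indicator_bracket_nonneg T h a θ n
    have q3 := indicator_bracket_nonneg R h a θ n
    rcases le_total m (u n) with hn | hn
    · rw [Set.indicator_of_mem (show n ∈ S from hn)] at q1 ⊢; linarith
    rcases le_total (u n) (-m) with hn' | hn'
    · rw [Set.indicator_of_mem (show n ∈ T from hn')] at q2 ⊢; linarith
    · rw [Set.indicator_of_mem (show n ∈ R from ⟨hn', hn⟩)] at q3 ⊢; linarith

/-- The sum of `λ / |n|` over `0 < |n| ≤ C₀ λ` grows slower than any power of `λ`, up to the factor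
`λ`. -/
theorem exists_tsum_inv_le {η C₀ : ℝ} (hη : 0 < η) (hC₀ : 0 < C₀) :
    ∃ K : ℝ, 0 < K ∧ ∀ (lam B : ℝ) (q : ℤ → ℝ), 1 ≤ lam → 0 ≤ B →
      (∀ n : ℤ, q n ≤ 0 ∨ (n ≠ 0 ∧ |(n : ℝ) / lam| ≤ C₀ ∧ q n ≤ B / |(n : ℝ) / lam|)) →
      ∑' n : ℤ, ENNReal.ofReal (q n) ≤ ENNReal.ofReal (K * (B * lam ^ η) * lam) := by
  obtain ⟨K, hK, hsum⟩ := exists_tsum_bracket_le (q := 1 + η) (by linarith)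
  refine ⟨C₀ ^ η * 2 ^ (1 + η) * (K * 2), by positivity, fun lam B q hlam hB hq => ?_⟩
  have hl : 0 < lam := by linarith
  set M : ℝ := B * lam * (C₀ * lam) ^ η * 2 ^ (1 + η) with hM
  have hM0 : 0 ≤ M := by positivity
  -- `1 / |n|` is turned into the summable `⟨n⟩^{-1-η}` by `|n|^η ≤ (C₀ λ)^η`
  have key : ∀ n : ℤ, q n ≤ M * bracket (1 * ((n : ℝ) - 0)) ^ (-(1 + η)) := by
    intro n
    have hpos : 0 ≤ M * bracket (1 * ((n : ℝ) - 0)) ^ (-(1 + η)) :=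
      mul_nonneg hM0 (Real.rpow_nonneg (bracket_pos _).le _)
    rcases hq n with h | ⟨hn, hn', h⟩
    · exact h.trans hpos
    have hn1 : 1 ≤ |(n : ℝ)| := by exact_mod_cast Int.one_le_abs hn
    rw [abs_div, abs_of_pos hl] at hn' h
    rw [div_le_iff₀ hl] at hn'
    rw [one_mul, sub_zero, bracket]
    set x := |(n : ℝ)| with hx
    have hx0 : 0 < x := by linarith
    have h1 : (1 + x) ^ (1 + η) ≤ 2 ^ (1 + η) * (x * (C₀ * lam) ^ η) := by
      calc (1 + x) ^ (1 + η) ≤ (2 * x) ^ (1 + η) := by gcongr; linarith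
        _ = 2 ^ (1 + η) * (x * x ^ η) := by
            rw [Real.mul_rpow (by norm_num) hx0.le, Real.rpow_add hx0 1 η, Real.rpow_one]
        _ ≤ _ := by gcongr
    refine h.trans ?_
    rw [Real.rpow_neg (by positivity), ← div_eq_mul_inv, le_div_iff₀ (by positivity),
      div_div_eq_mul_div, div_mul_eq_mul_div, div_le_iff₀ hx0, hM]
    calc B * lam * (1 + x) ^ (1 + η) ≤ B * lam * (2 ^ (1 + η) * (x * (C₀ * lam) ^ η)) := by gcongr
      _ = _ := by ring
  calc _ ≤ ∑' n : ℤ, ENNReal.ofReal M *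
        ENNReal.ofReal (bracket (1 * ((n : ℝ) - 0)) ^ (-(1 + η))) := by
        refine ENNReal.tsum_le_tsum fun n => ?_
        rw [← ENNReal.ofReal_mul hM0]
        exact ENNReal.ofReal_le_ofReal (key n)
    _ ≤ ENNReal.ofReal M * ENNReal.ofReal (K * (1 + 1 / 1)) := by
        rw [ENNReal.tsum_mul_left]
        gcongr
        exact hsum 1 0 one_pos
    _ = _ := by
        rw [← ENNReal.ofReal_mul hM0, hM, Real.mul_rpow hC₀.le hl.le]; congr 1; ring

/-- A bounded sum over the lattice points of a bounded interval. -/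
theorem exists_tsum_bounded_le {C₀ : ℝ} (hC₀ : 0 < C₀) :
    ∃ K : ℝ, 0 < K ∧ ∀ (lam B : ℝ) (q : ℤ → ℝ), 1 ≤ lam → 0 ≤ B →
      (∀ n : ℤ, q n ≤ 0 ∨ (|(n : ℝ) / lam| ≤ C₀ ∧ q n ≤ B)) →
      ∑' n : ℤ, ENNReal.ofReal (q n) ≤ ENNReal.ofReal (K * B * lam) := by
  obtain ⟨K, hK, hsum⟩ := exists_tsum_bracket_le (q := 2) (by norm_num)
  refine ⟨(1 + C₀) ^ 2 * (K * 2), by positivity, fun lam B q hlam hB hq => ?_⟩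
  have hl : 0 < lam := by linarith
  have key : ∀ n : ℤ, q n ≤ B * (1 + C₀) ^ 2 * bracket (1 / lam * ((n : ℝ) - 0)) ^ (-(2 : ℝ)) := by
    intro n
    have h0 := bracket_pos (1 / lam * ((n : ℝ) - 0))
    rcases hq n with h | ⟨hn, h⟩
    · exact h.trans (by positivity)
    refine h.trans ?_
    rw [Real.rpow_neg h0.le, ← div_eq_mul_inv, le_div_iff₀ (by positivity), Real.rpow_two]
    have : bracket (1 / lam * ((n : ℝ) - 0)) ≤ 1 + C₀ := by
      rw [bracket, sub_zero, one_div_mul_eq_div]; linarith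
    gcongr
  calc _ ≤ ∑' n : ℤ, ENNReal.ofReal (B * (1 + C₀) ^ 2) *
        ENNReal.ofReal (bracket (1 / lam * ((n : ℝ) - 0)) ^ (-(2 : ℝ))) := by
        refine ENNReal.tsum_le_tsum fun n => ?_
        rw [← ENNReal.ofReal_mul (by positivity)]
        exact ENNReal.ofReal_le_ofReal (key n)
    _ ≤ ENNReal.ofReal (B * (1 + C₀) ^ 2) * ENNReal.ofReal (K * (1 + 1 / (1 / lam))) := by
        rw [ENNReal.tsum_mul_left]
        gcongr
        exact hsum _ 0 (by positivity)
    _ ≤ _ := by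
        rw [← ENNReal.ofReal_mul (by positivity)]
        refine ENNReal.ofReal_le_ofReal ?_
        rw [one_div_one_div]
        calc B * (1 + C₀) ^ 2 * (K * (1 + lam)) ≤ B * (1 + C₀) ^ 2 * (K * (lam + lam)) := by gcongr
          _ = _ := by ring

/-! ### Low frequencies -/

/-- The frequency `n / λ`. -/
def freq (lam : ℝ) (n : ℤ) : ℝ := (n : ℝ) / lam

theorem freq_neg_sub (lam : ℝ) (n m : ℤ) : freq lam (-n - m) = -freq lam n - freq lam m := by
  unfold freq; push_cast; ring

theorem freq_sub (lam : ℝ) (n m : ℤ) : freq lam (n - m) = freq lam n - freq lam m := by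
  unfold freq; push_cast; ring

/-- The nonzero frequencies are bounded away from zero; this is the only gap at low frequency. -/
theorem inv_le_abs_freq {lam : ℝ} (hlam : 0 < lam) {n : ℤ} (hn : n ≠ 0) :
    1 / lam ≤ |freq lam n| := by
  rw [freq, abs_div, abs_of_pos hlam]
  gcongr
  exact_mod_cast Int.one_le_abs hn

theorem freq_ne_zero {lam : ℝ} (hlam : 0 < lam) {n : ℤ} (hn : n ≠ 0) : freq lam n ≠ 0 := by
  rw [freq]; positivity

/-- `c` is one of the three frequencies `n`, `m`, `-n - m`, and `u` is the difference of the two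
other ones. -/
def IsCoord (lam : ℝ) (c : ℤ → ℤ → ℤ) (u : ℤ → ℤ → ℝ) : Prop :=
  (c = (fun n _ => n) ∧ u = fun n m => freq lam (-n - m) - freq lam m) ∨
  (c = (fun _ m => m) ∧ u = fun n m => freq lam (-n - m) - freq lam n) ∨
  (c = (fun n m => -n - m) ∧ u = fun n m => freq lam n - freq lam m)

section Coord

variable {lam : ℝ} {c : ℤ → ℤ → ℤ} {u : ℤ → ℤ → ℝ} {Q : ℤ → ℤ → ℝ} {S : ℝ≥0∞}

/-- A bound by a summable function of one of the three frequencies controls the slices in which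
another one is fixed. -/
theorem IsCoord.exists_slice (hc : IsCoord lam c u) {q : ℤ → ℝ} (hQ : ∀ n m, Q n m ≤ q (c n m))
    (hq : ∑' k, ENNReal.ofReal (q k) ≤ S) : Slice₁ Q S ∨ Slice₂ Q S ∨ Slice₃ Q S := by
  rcases hc with ⟨rfl, -⟩ | ⟨rfl, -⟩ | ⟨rfl, -⟩
  · exact Or.inr (Or.inl fun m =>
      (ENNReal.tsum_le_tsum fun n => ENNReal.ofReal_le_ofReal (hQ n m)).trans hq)
  · exact Or.inl fun n =>
      (ENNReal.tsum_le_tsum fun m => ENNReal.ofReal_le_ofReal (hQ n m)).trans hq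
  · refine Or.inl fun n =>
      (ENNReal.tsum_le_tsum fun m => ENNReal.ofReal_le_ofReal (hQ n m)).trans ?_
    rw [tsum_comp_neg_sub fun k => ENNReal.ofReal (q k)]
    exact hq

/-- All three slices, when `Q` is bounded by a summable function of the frequency `c`: this settles
the slices in which another frequency is fixed, and leaves the sums with `c = κ` fixed, where `u`
runs through an arithmetic progression with step `2 / λ`. -/
theorem IsCoord.slices (hc : IsCoord lam c u) {q : ℤ → ℝ} (hQ : ∀ n m, Q n m ≤ q (c n m))
    (hq : ∑' k, ENNReal.ofReal (q k) ≤ S)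
    (hown : ∀ (κ : ℤ) (f g : ℤ → ℤ), (∀ t, c (f t) (g t) = κ) →
      (∀ t t', |u (f t) (g t) - u (f t') (g t')| = 2 / lam * |(t : ℝ) - t'|) →
      ∑' t, ENNReal.ofReal (Q (f t) (g t)) ≤ S) (hlam : 0 < lam) :
    Slice₁ Q S ∧ Slice₂ Q S ∧ Slice₃ Q S := by
  have hA : ∀ n m, ENNReal.ofReal (Q n m) ≤ ENNReal.ofReal (q (c n m)) := fun n m =>
    ENNReal.ofReal_le_ofReal (hQ n m)
  have e2 : (2 : ℝ) / lam = |2 / lam| := (abs_of_pos (by positivity)).symm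
  rcases hc with ⟨rfl, rfl⟩ | ⟨rfl, rfl⟩ | ⟨rfl, rfl⟩
  · refine ⟨fun n => hown n (fun _ => n) id (fun _ => rfl) fun t t' => ?_,
      fun m => (ENNReal.tsum_le_tsum fun n => hA n m).trans hq,
      fun k => (ENNReal.tsum_le_tsum fun n => hA n (k - n)).trans hq⟩
    rw [e2, ← abs_mul, abs_sub_comm]; congr 1; simp only [freq, id]; push_cast; ring
  · refine ⟨fun n => (ENNReal.tsum_le_tsum fun m => hA n m).trans hq,
      fun m => hown m id (fun _ => m) (fun _ => rfl) fun t t' => ?_,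
      fun k => (ENNReal.tsum_le_tsum fun n => hA n (k - n)).trans ?_⟩
    · rw [e2, ← abs_mul, abs_sub_comm]; congr 1; simp only [freq, id]; push_cast; ring
    · refine le_trans (le_of_eq ?_) hq
      exact (Equiv.subLeft k).tsum_eq fun n => ENNReal.ofReal (q n)
  · refine ⟨fun n => (ENNReal.tsum_le_tsum fun m => hA n m).trans ?_,
      fun m => (ENNReal.tsum_le_tsum fun n => hA n m).trans ?_,
      fun k => hown (-k) id (fun t => k - t) (fun t => by simp only [id]; ring) fun t t' => ?_⟩
    · rw [tsum_comp_neg_sub fun k => ENNReal.ofReal (q k)]; exact hq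
    · refine le_trans (le_of_eq ?_) hq
      calc _ = ∑' n, ENNReal.ofReal (q (-m - n)) := tsum_congr fun n => by congr 2; ring
        _ = _ := tsum_comp_neg_sub (fun k => ENNReal.ofReal (q k)) m
    · rw [e2, ← abs_mul]; congr 1; simp only [freq, id]; push_cast; ring

end Coord

theorem rpow_bracket_le_one {x q : ℝ} (hq : q ≤ 0) : bracket x ^ q ≤ 1 :=
  Real.rpow_le_one_of_one_le_of_nonpos (one_le_bracket x) hq

/-- One frequency is bounded, and so is the weight. -/
theorem exists_symZ_of_bounded {δ C₀ : ℝ} (hδ : 0 < δ) (hδ' : δ ≤ 1 / 12) (hC₀ : 0 < C₀) :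
    ∃ C : ℝ, 0 < C ∧ ∀ (lam B : ℝ) (p₁ p₂ : ℤ → ℝ) (V : ℤ → ℤ → ℝ) (c : ℤ → ℤ → ℤ)
      (u : ℤ → ℤ → ℝ), 1 ≤ lam → 0 ≤ B → (∀ n, p₁ (-n) = -p₁ n) → (∀ n, p₂ (-n) = -p₂ n) →
      IsCoord lam c u → (∀ n m, 0 ≤ V n m) →
      (∀ n m, V n m = 0 ∨ (|freq lam (c n m)| ≤ C₀ ∧ V n m ^ 2 ≤ B)) →
      SymZ lam p₁ p₂ V (ENNReal.ofReal (C * B)) := by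
  obtain ⟨K, hK, hsum⟩ := exists_tsum_bounded_le hC₀
  have hfin := critConst_ne_top hδ
  refine ⟨((critConst δ).toReal + 1) * K, by positivity, fun lam B p₁ p₂ V c u hlam hB o₁ o₂ hc hV0
    hV => ?_⟩
  have hl : 0 < lam := by linarith
  have h := SymZ.of_triv (A := ENNReal.ofReal (K * B)) o₁ o₂ hl hδ hδ' hV0 (fun n m => le_rfl)
    (hc.exists_slice (q := fun k => if |freq lam k| ≤ C₀ then B else 0) (fun n m => ?_) ?_)
  · refine h.mono_const ?_
    rw [← ENNReal.ofReal_toReal hfin, ← ENNReal.ofReal_mul (by positivity)]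
    refine ENNReal.ofReal_le_ofReal ?_
    rw [ENNReal.toReal_ofReal ENNReal.toReal_nonneg, mul_assoc]
    have : 0 ≤ K * B := by positivity
    nlinarith
  · have h1 : bracket (symResonance p₁ p₂ n m) ^ (-(1 - 3 * δ)) ≤ 1 :=
      rpow_bracket_le_one (by linarith)
    have h0 : 0 ≤ bracket (symResonance p₁ p₂ n m) ^ (-(1 - 3 * δ)) :=
      Real.rpow_nonneg (bracket_pos _).le _
    rcases hV n m with h | ⟨h, h'⟩
    · simp only [h]; split_ifs <;> simp [hB]
    · rw [if_pos h]; nlinarith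
  · rw [← ENNReal.ofReal_mul hl.le, mul_comm lam]
    refine hsum lam B _ hlam hB fun n => ?_
    by_cases hn : |freq lam n| ≤ C₀
    · right; exact ⟨hn, by simp [hn]⟩
    · left; simp [hn]

/-- One frequency `k` is nonzero and bounded, and the weight, with the help of the resonance
function, is at most `|k|^{-1/2}`. -/
theorem exists_symZ_of_inv {δ C₀ : ℝ} (hδ : 0 < δ) (hδ' : δ ≤ 1 / 12) (hC₀ : 0 < C₀) :
    ∃ C : ℝ, 0 < C ∧ ∀ (lam B : ℝ) (p₁ p₂ : ℤ → ℝ) (V : ℤ → ℤ → ℝ) (c : ℤ → ℤ → ℤ)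
      (u : ℤ → ℤ → ℝ), 1 ≤ lam → 0 ≤ B → (∀ n, p₁ (-n) = -p₁ n) → (∀ n, p₂ (-n) = -p₂ n) →
      IsCoord lam c u → (∀ n m, 0 ≤ V n m) →
      (∀ n m, V n m = 0 ∨ (c n m ≠ 0 ∧ |freq lam (c n m)| ≤ C₀ ∧
        V n m ^ 2 * bracket (symResonance p₁ p₂ n m) ^ (-(1 - 3 * δ)) ≤
          B / |freq lam (c n m)|)) →
      SymZ lam p₁ p₂ V (ENNReal.ofReal (C * (B * lam ^ δ))) := by
  obtain ⟨K, hK, hsum⟩ := exists_tsum_inv_le hδ hC₀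
  have hfin := critConst_ne_top hδ
  refine ⟨((critConst δ).toReal + 1) * K, by positivity, fun lam B p₁ p₂ V c u hlam hB o₁ o₂ hc hV0
    hV => ?_⟩
  have hl : 0 < lam := by linarith
  have h := SymZ.of_triv (A := ENNReal.ofReal (K * (B * lam ^ δ))) o₁ o₂ hl hδ hδ' hV0
    (fun n m => le_rfl) (hc.exists_slice
      (q := fun k => if k ≠ 0 ∧ |freq lam k| ≤ C₀ then B / |freq lam k| else 0)
      (fun n m => ?_) ?_)
  · refine h.mono_const ?_
    rw [← ENNReal.ofReal_toReal hfin, ← ENNReal.ofReal_mul (by positivity)]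
    refine ENNReal.ofReal_le_ofReal ?_
    rw [ENNReal.toReal_ofReal ENNReal.toReal_nonneg, mul_assoc]
    have : 0 ≤ K * (B * lam ^ δ) := by positivity
    nlinarith
  · rcases hV n m with h | ⟨h, h', h''⟩
    · simp only [h]
      split_ifs
      · simp only [ne_eq, OfNat.ofNat_ne_zero, not_false_eq_true, zero_pow, zero_mul]; positivity
      · simp
    · rw [if_pos ⟨h, h'⟩]; exact h''
  · rw [← ENNReal.ofReal_mul hl.le, mul_comm lam]
    refine hsum lam B _ hlam hB fun n => ?_
    by_cases hn : n ≠ 0 ∧ |freq lam n| ≤ C₀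
    · right; exact ⟨hn.1, hn.2, by rw [if_pos hn]; rfl⟩
    · left; rw [if_neg hn]

theorem ofReal_critConst_mul {δ K : ℝ} (hδ : 0 < δ) (hK : 0 ≤ K) :
    critConst δ * ENNReal.ofReal K ≤ ENNReal.ofReal (((critConst δ).toReal + 1) * K) := by
  nth_rewrite 1 [← ENNReal.ofReal_toReal (critConst_ne_top hδ)]
  rw [← ENNReal.ofReal_mul (by positivity)]
  refine ENNReal.ofReal_le_ofReal ?_
  nlinarith

/-- Along a parabola with small leading coefficient `A κ`, `|κ| ≥ 1 / λ`, far away from the vertex,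
the sums are bounded without any loss in `λ`. -/
theorem exists_tsum_far_le {θ A : ℝ} (hθ : 1 < 3 / 2 * θ) (hA : A ≠ 0) :
    ∃ K : ℝ, 0 < K ∧ ∀ (lam κ B' g a : ℝ) (u h : ℤ → ℝ), 1 ≤ lam → 1 / lam ≤ |κ| → |B'| ≤ 1 →
      (∀ t, h t = A * κ * u t ^ 2 + B' * u t + g) →
      (∀ t t' : ℤ, |u t - u t'| = 2 / lam * |(t : ℝ) - t'|) →
      ∑' t, ENNReal.ofReal ({t | (1 + 1 / |A|) * lam ^ 5 ≤ |u t|}.indicator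
        (fun t => bracket (h t - a) ^ (-θ)) t) ≤ ENNReal.ofReal K := by
  have hA0 : 0 < |A| := abs_pos.2 hA
  obtain ⟨K, hK, hsum⟩ := exists_tsum_separated_le (γ := 3 / 2) (θ := θ) (by norm_num)
    (by linarith) hθ
  set Λ := 1 + 1 / |A| with hΛ
  have hΛ1 : 1 ≤ Λ := by rw [hΛ]; linarith [show 0 < 1 / |A| by positivity]
  have hAΛ : 1 ≤ |A| * Λ := by rw [hΛ, mul_add, mul_one_div_cancel hA0.ne']; linarith
  refine ⟨2 * (K * (1 + (|A| / 2) ^ (-(1 / (3 / 2) : ℝ)))), by positivity,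
    fun lam κ B' g a u h hlam hκ hB' hh hu => ?_⟩
  have hl : 0 < lam := by linarith
  set S : Set ℤ := {t | Λ * lam ^ 5 ≤ u t} with hS
  set T : Set ℤ := {t | Λ * lam ^ 5 ≤ -u t} with hT
  have hl4 : 1 ≤ lam ^ 4 := one_le_pow₀ hlam
  have hl5 : 1 ≤ lam ^ 5 := one_le_pow₀ hlam
  -- `w` stands for `|u + u'|`, which dominates both `λ⁵` and `|u - u'|`
  have hsep : ∀ t t' : ℤ, 2 * (Λ * lam ^ 5) ≤ |u t + u t'| → |u t - u t'| ≤ |u t + u t'| →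
      |A| / 2 * |(t : ℝ) - t'| ^ (3 / 2 : ℝ) ≤ |h t - h t'| := by
    intro t t' h1 h2
    have e1 : |h t - h t'| = |u t - u t'| * |A * κ * (u t + u t') + B'| := by
      rw [← abs_mul, hh, hh]; congr 1; ring
    set w := |u t + u t'| with hw
    have hκ0 : 0 < |κ| := lt_of_lt_of_le (by positivity) hκ
    have i1 : |A| * |κ| * w / 2 ≤ |A * κ * (u t + u t') + B'| := by
      have i2 : |A| * |κ| * w - 1 ≤ |A * κ * (u t + u t') + B'| := by
        have := abs_sub_abs_le_abs_sub (A * κ * (u t + u t')) (-B')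
        rw [sub_neg_eq_add, abs_neg, abs_mul, abs_mul] at this
        linarith
      have i3 : 2 ≤ |A| * |κ| * w := by
        have : 1 / lam * (2 * (Λ * lam ^ 5)) ≤ |κ| * w := by gcongr
        have e : 1 / lam * (2 * (Λ * lam ^ 5)) = 2 * Λ * lam ^ 4 := by field_simp
        rw [e] at this
        calc (2 : ℝ) = 2 * 1 * 1 := by norm_num
          _ ≤ 2 * (|A| * Λ) * lam ^ 4 := by gcongr
          _ = |A| * (2 * Λ * lam ^ 4) := by ring
          _ ≤ |A| * (|κ| * w) := by gcongr
          _ = _ := by ring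
      linarith
    have hd : |u t - u t'| = 2 / lam * |(t : ℝ) - t'| := hu t t'
    set d := |(t : ℝ) - t'| with hdd
    have hd0 : 0 ≤ d := abs_nonneg _
    -- this is what the threshold `λ⁵` is for: together with `|u - u'| ≤ w` it makes the separation
    -- `d^{3/2}`, with the exponent `3/2` large enough for summability and a gain over `λ` in the
    -- constant
    have i4 : d ^ (1 / 2 : ℝ) ≤ w / lam ^ 2 := by
      rw [← Real.sqrt_eq_rpow]
      refine Real.sqrt_le_iff.2 ⟨by positivity, ?_⟩
      rw [hd] at h2
      have i5 : d ≤ w * lam / 2 := by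
        rw [le_div_iff₀ (by norm_num)]
        have := mul_le_mul_of_nonneg_right h2 hl.le
        field_simp at this
        linarith
      have i6 : lam ^ 5 ≤ w := by nlinarith
      rw [div_pow, le_div_iff₀ (by positivity)]
      calc d * (lam ^ 2) ^ 2 ≤ (w * lam / 2) * (lam ^ 2) ^ 2 := by gcongr
        _ = w * lam ^ 5 / 2 := by ring
        _ ≤ w * w / 2 := by gcongr
        _ ≤ w ^ 2 := by nlinarith
    rw [e1, hd]
    have e3 : d ^ (3 / 2 : ℝ) = d * d ^ (1 / 2 : ℝ) := by
      rcases hd0.eq_or_lt with h | h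
      · rw [← h, Real.zero_rpow (by norm_num), zero_mul]
      · rw [show (3 / 2 : ℝ) = 1 + 1 / 2 by norm_num, Real.rpow_add h, Real.rpow_one]
    have hw0 : 0 ≤ w := abs_nonneg _
    calc |A| / 2 * d ^ (3 / 2 : ℝ) ≤ |A| / 2 * (d * (w / lam ^ 2)) := by rw [e3]; gcongr
      _ = 1 / 2 * (1 / lam * d) * (|A| * (1 / lam) * w) := by field_simp
      _ ≤ 1 / 2 * (1 / lam * d) * (|A| * |κ| * w) := by gcongr
      _ = 1 / lam * d * (|A| * |κ| * w / 2) := by ring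
      _ ≤ 2 / lam * d * (|A| * |κ| * w / 2) := by gcongr; norm_num
      _ ≤ _ := by gcongr
  have s1 := hsum S h (|A| / 2) a (by positivity) fun t ht t' ht' => by
    have ht : Λ * lam ^ 5 ≤ u t := ht
    have ht' : Λ * lam ^ 5 ≤ u t' := ht'
    have hp : 0 ≤ Λ * lam ^ 5 := by positivity
    have e := abs_of_nonneg (by linarith : 0 ≤ u t + u t')
    exact hsep t t' (by rw [e]; linarith) (by rw [e]; exact abs_le.2 ⟨by linarith, by linarith⟩)
  have s2 := hsum T h (|A| / 2) a (by positivity) fun t ht t' ht' => by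
    have ht : Λ * lam ^ 5 ≤ -u t := ht
    have ht' : Λ * lam ^ 5 ≤ -u t' := ht'
    have hp : 0 ≤ Λ * lam ^ 5 := by positivity
    have e := abs_of_nonpos (by linarith : u t + u t' ≤ 0)
    exact hsep t t' (by rw [e]; linarith) (by rw [e]; exact abs_le.2 ⟨by linarith, by linarith⟩)
  rw [two_mul]
  refine tsum_ofReal_le_of_le_add (fun n => ?_) s1 s2 (by positivity) (by positivity)
  have q1 := indicator_bracket_nonneg S h a θ n
  have q2 := indicator_bracket_nonneg T h a θ n
  by_cases hn : Λ * lam ^ 5 ≤ |u n|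
  · rw [Set.indicator_of_mem (show n ∈ {t | Λ * lam ^ 5 ≤ |u t|} from hn)]
    rcases le_abs.1 hn with h | h
    · rw [Set.indicator_of_mem (show n ∈ S from h)]; linarith
    · rw [Set.indicator_of_mem (show n ∈ T from h)]; linarith
  · rw [Set.indicator_of_notMem (show n ∉ {t | Λ * lam ^ 5 ≤ |u t|} from hn)]; linarith

/-- One frequency `k` is nonzero and at most `1`, the other two are large, of size `1 + |u|`; the
weight is bounded by this size, and the resonance function is bounded below by `|k| (1 + |u|)²`. -/
theorem exists_symZ_of_weak {δ A b : ℝ} (hδ : 0 < δ) (hδ' : δ ≤ 1 / 12) (hA : A ≠ 0)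
    (hb : 0 < b) :
    ∃ C : ℝ, 0 < C ∧ ∀ (lam B B' : ℝ) (g : ℤ → ℝ) (p₁ p₂ : ℤ → ℝ) (V : ℤ → ℤ → ℝ)
      (c : ℤ → ℤ → ℤ) (u : ℤ → ℤ → ℝ), 1 ≤ lam → 0 ≤ B → |B'| ≤ 1 →
      (∀ n, p₁ (-n) = -p₁ n) → (∀ n, p₂ (-n) = -p₂ n) →
      IsCoord lam c u → (∀ n m, 0 ≤ V n m) →
      (∀ n m, symResonance p₁ p₂ n m =
        A * freq lam (c n m) * u n m ^ 2 + B' * u n m + g (c n m)) →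
      (∀ n m, V n m = 0 ∨ (c n m ≠ 0 ∧ |freq lam (c n m)| ≤ 1 ∧ V n m ^ 2 ≤ B * (1 + |u n m|) ^ 2 ∧
        b * |freq lam (c n m)| * (1 + |u n m|) ^ 2 ≤ bracket (symResonance p₁ p₂ n m))) →
      SymZ lam p₁ p₂ V (ENNReal.ofReal (C * (B * lam ^ (31 * δ)))) := by
  set θ := 1 - 3 * δ with hθ
  obtain ⟨C₁, hC₁, hsmall⟩ := exists_symZ_of_inv hδ hδ' one_pos
  obtain ⟨K, hK, hsum⟩ := exists_tsum_inv_le hδ one_pos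
  obtain ⟨K', hK', hfar⟩ := exists_tsum_far_le (θ := θ) (by rw [hθ]; linarith) hA
  set Λ := 1 + 1 / |A| with hΛ
  have hA0 : 0 < |A| := abs_pos.2 hA
  have hΛ1 : 1 ≤ Λ := by rw [hΛ]; linarith [show 0 < 1 / |A| by positivity]
  have hX : 0 < (critConst δ).toReal + 1 := by positivity
  set D₁ := (1 + Λ) ^ (6 * δ) * b ^ (-θ) with hD₁
  refine ⟨2 * (C₁ * D₁ + ((critConst δ).toReal + 1) * ((K + K') / b)), by positivity,
    fun lam B B' g p₁ p₂ V c u hlam hB hB' o₁ o₂ hc hV0 hH hV => ?_⟩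
  have hl : 0 < lam := by linarith
  set H := symResonance p₁ p₂ with hHdef
  set Vs : ℤ → ℤ → ℝ := fun n m => if |u n m| < Λ * lam ^ 5 then V n m else 0 with hVs
  set Vl : ℤ → ℤ → ℝ := fun n m => if |u n m| < Λ * lam ^ 5 then 0 else V n m with hVl
  have hVs0 : ∀ n m, 0 ≤ Vs n m := fun n m => by
    simp only [hVs]; split_ifs; exacts [hV0 n m, le_rfl]
  have hVl0 : ∀ n m, 0 ≤ Vl n m := fun n m => by
    simp only [hVl]; split_ifs; exacts [le_rfl, hV0 n m]
  -- the part `|u| < Λ λ⁵`, where a power of `|u|` is a small power of `λ`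
  have part1 : SymZ lam p₁ p₂ Vs (ENNReal.ofReal (C₁ * (B * D₁ * lam ^ (30 * δ) * lam ^ δ))) := by
    refine hsmall lam (B * D₁ * lam ^ (30 * δ)) p₁ p₂ Vs c u hlam (by positivity) o₁ o₂ hc hVs0
      fun n m => ?_
    by_cases hu : |u n m| < Λ * lam ^ 5
    swap
    · left; simp [hVs, hu]
    rcases hV n m with h | ⟨h1, h2, h3, h4⟩
    · left; simp [hVs, h]
    right
    refine ⟨h1, h2, ?_⟩
    simp only [hVs, if_pos hu]
    set w := 1 + |u n m| with hw
    have hw0 : 0 < w := by positivity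
    set k := |freq lam (c n m)| with hk
    have hk0 : 0 < k := abs_pos.2 (freq_ne_zero hl h1)
    have hl5 : 1 ≤ lam ^ 5 := one_le_pow₀ hlam
    have i1 : bracket (H n m) ^ (-θ) ≤ (b * k * w ^ 2) ^ (-θ) :=
      Real.rpow_le_rpow_of_nonpos (by positivity) h4 (by rw [hθ]; linarith)
    have i2 : (b * k * w ^ 2) ^ (-θ) = b ^ (-θ) * k ^ (-θ) * (w ^ 2) ^ (-θ) := by
      rw [Real.mul_rpow (by positivity) (by positivity), Real.mul_rpow hb.le hk0.le]
    have i3 : w ^ 2 * (w ^ 2) ^ (-θ) = w ^ (6 * δ) := by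
      rw [← Real.rpow_natCast, ← Real.rpow_mul hw0.le, ← Real.rpow_add hw0, hθ]
      congr 1; push_cast; ring
    have i4 : w ^ (6 * δ) ≤ (1 + Λ) ^ (6 * δ) * lam ^ (30 * δ) := by
      calc w ^ (6 * δ) ≤ ((1 + Λ) * lam ^ 5) ^ (6 * δ) := by
            refine Real.rpow_le_rpow hw0.le ?_ (by positivity)
            rw [hw]; nlinarith
        _ = _ := by
            rw [Real.mul_rpow (by positivity) (by positivity), ← Real.rpow_natCast lam,
              ← Real.rpow_mul hl.le]
            congr 2; push_cast; ring
    have i5 : k ^ (-θ) ≤ 1 / k := by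
      rw [one_div, ← Real.rpow_neg_one]
      exact Real.rpow_le_rpow_of_exponent_ge hk0 h2 (by rw [hθ]; linarith)
    calc V n m ^ 2 * bracket (H n m) ^ (-θ)
        ≤ (B * w ^ 2) * (b ^ (-θ) * k ^ (-θ) * (w ^ 2) ^ (-θ)) := by
          rw [← i2]
          have := Real.rpow_nonneg (bracket_pos (H n m)).le (-θ)
          gcongr
      _ = B * b ^ (-θ) * k ^ (-θ) * (w ^ 2 * (w ^ 2) ^ (-θ)) := by ring
      _ ≤ B * b ^ (-θ) * (1 / k) * ((1 + Λ) ^ (6 * δ) * lam ^ (30 * δ)) := by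
          rw [i3]; gcongr
      _ = _ := by rw [hD₁]; ring
  -- the part `|u| ≥ Λ λ⁵`
  have part2 : SymZ lam p₁ p₂ Vl (critConst δ * ENNReal.ofReal ((K + K') / b * B * lam ^ δ)) := by
    have hbnd : ∀ n m, Vl n m = 0 ∨ (c n m ≠ 0 ∧ |freq lam (c n m)| ≤ 1 ∧
        Vl n m ^ 2 * bracket (H n m) ^ (-1 : ℝ) ≤ B / b / |freq lam (c n m)|) := by
      intro n m
      by_cases hu : |u n m| < Λ * lam ^ 5
      · left; simp [hVl, hu]
      rcases hV n m with h | ⟨h1, h2, h3, h4⟩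
      · left; simp [hVl, h]
      right
      refine ⟨h1, h2, ?_⟩
      simp only [hVl, if_neg hu]
      have hk0 : 0 < |freq lam (c n m)| := abs_pos.2 (freq_ne_zero hl h1)
      have hw0 : 0 < 1 + |u n m| := by positivity
      have hb0 := bracket_pos (H n m)
      rw [Real.rpow_neg_one, ← div_eq_mul_inv, div_le_iff₀ hb0, div_div]
      calc V n m ^ 2 ≤ B * (1 + |u n m|) ^ 2 := h3
        _ = B / (b * |freq lam (c n m)|) * (b * |freq lam (c n m)| * (1 + |u n m|) ^ 2) := by
            field_simp
        _ ≤ _ := by gcongr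
    -- In the slices that fix another frequency, `⟨H - a⟩` is dropped and the harmonic sum over `k`
    -- is used. In the slice that fixes `k`, the factor `1 / |k| ≤ λ` is affordable, because the sum
    -- over the far part of the parabola is bounded without the factor `λ` that the criterion
    -- allows.
    have hS : ∀ a, Slice₁ _ _ ∧ Slice₂ _ _ ∧ Slice₃ _ _ := fun a => by
      refine hc.slices (S := ENNReal.ofReal lam * ENNReal.ofReal ((K + K') / b * B * lam ^ δ))
        (Q := fun n m => Vl n m ^ 2 * bracket (H n m) ^ (-1 : ℝ) *
          bracket (H n m - a) ^ (-(1 - 3 * δ)))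
        (q := fun k => if k ≠ 0 ∧ |freq lam k| ≤ 1 then B / b / |freq lam k| else 0)
        (fun n m => ?_) ?_ (fun κ f g' hf hu => ?_) hl
      · rcases hbnd n m with h | ⟨h1, h2, h3⟩
        · simp only [h]
          split_ifs
          · simp only [ne_eq, OfNat.ofNat_ne_zero, not_false_eq_true, zero_pow, zero_mul]
            positivity
          · simp
        · rw [if_pos ⟨h1, h2⟩]
          refine le_trans ?_ h3
          exact mul_le_of_le_one_right (mul_nonneg (sq_nonneg _)
            (Real.rpow_nonneg (bracket_pos _).le _)) (rpow_bracket_le_one (by linarith))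
      · refine (hsum lam (B / b) _ hlam (by positivity) fun n => ?_).trans ?_
        · by_cases hn : n ≠ 0 ∧ |freq lam n| ≤ 1
          · right; exact ⟨hn.1, hn.2, by rw [if_pos hn]; rfl⟩
          · left; rw [if_neg hn]
        · rw [← ENNReal.ofReal_mul hl.le]
          refine ENNReal.ofReal_le_ofReal ?_
          have : 0 ≤ K' / b * B * lam ^ δ := by positivity
          calc K * (B / b * lam ^ δ) * lam = lam * (K / b * B * lam ^ δ) := by ring
            _ ≤ lam * ((K / b * B * lam ^ δ) + K' / b * B * lam ^ δ) := by gcongr; linarith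
            _ = _ := by ring
      · by_cases hκ : κ ≠ 0
        swap
        · have : ∀ t, Vl (f t) (g' t) = 0 := fun t => by
            rcases hbnd (f t) (g' t) with h | ⟨h1, -, -⟩
            · exact h
            · rw [hf t] at h1; exact absurd h1 hκ
          simp [this]
        have hκ1 := inv_le_abs_freq hl hκ
        have hff := hfar lam (freq lam κ) B' (g κ) a (fun t => u (f t) (g' t))
          (fun t => H (f t) (g' t)) hlam hκ1 hB' (fun t => by
            have := hH (f t) (g' t); rw [hf t] at this; exact this) hu
        calc _ ≤ ∑' t, ENNReal.ofReal (B / b * lam) * ENNReal.ofReal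
              ({t | Λ * lam ^ 5 ≤ |u (f t) (g' t)|}.indicator
                (fun t => bracket (H (f t) (g' t) - a) ^ (-θ)) t) := by
              refine ENNReal.tsum_le_tsum fun t => ?_
              rw [← ENNReal.ofReal_mul (by positivity)]
              refine ENNReal.ofReal_le_ofReal ?_
              have hi := indicator_bracket_nonneg {t | Λ * lam ^ 5 ≤ |u (f t) (g' t)|}
                (fun t => H (f t) (g' t)) a θ t
              rcases hbnd (f t) (g' t) with h | ⟨h1, h2, h3⟩
              · rw [h]
                simp only [ne_eq, OfNat.ofNat_ne_zero, not_false_eq_true, zero_pow, zero_mul]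
                positivity
              by_cases hu : |u (f t) (g' t)| < Λ * lam ^ 5
              · simp only [hVl, if_pos hu, ne_eq, OfNat.ofNat_ne_zero, not_false_eq_true, zero_pow,
                  zero_mul]
                positivity
              rw [Set.indicator_of_mem (show t ∈ {t | Λ * lam ^ 5 ≤ |u (f t) (g' t)|} from
                not_lt.1 hu)]
              refine mul_le_mul_of_nonneg_right (h3.trans ?_)
                (Real.rpow_nonneg (bracket_pos _).le _)
              rw [hf t, div_eq_mul_inv (B / b)]
              gcongr
              rw [one_div] at hκ1
              exact inv_le_of_inv_le₀ hl hκ1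
          _ ≤ ENNReal.ofReal (B / b * lam) * ENNReal.ofReal K' := by
              rw [ENNReal.tsum_mul_left]; gcongr
          _ ≤ _ := by
              rw [← ENNReal.ofReal_mul (by positivity), ← ENNReal.ofReal_mul hl.le]
              refine ENNReal.ofReal_le_ofReal ?_
              have : 1 ≤ lam ^ δ := Real.one_le_rpow hlam hδ.le
              calc B / b * lam * K' = lam * (K' / b * B * 1) := by ring
                _ ≤ lam * ((K + K') / b * B * lam ^ δ) := by gcongr; linarith
    exact SymZ.of_kpv o₁ o₂ hl hδ hδ' hVl0 (fun a n m => le_rfl) (fun a => (hS a).1)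
      (fun a => (hS a).2.1) (fun a => (hS a).2.2)
  refine (part1.add part2 hVs0 hVl0 fun n m => ?_).mono_const ?_
  · simp only [hVs, hVl]; split_ifs <;> simp
  · have hl1 : lam ^ (30 * δ) * lam ^ δ = lam ^ (31 * δ) := by
      rw [← Real.rpow_add hl]; congr 1; ring
    have hl2 : lam ^ δ ≤ lam ^ (31 * δ) :=
      Real.rpow_le_rpow_of_exponent_le hlam (by linarith)
    calc _ ≤ ENNReal.ofReal 2 * (ENNReal.ofReal (C₁ * (B * D₁ * lam ^ (30 * δ) * lam ^ δ)) +
          ENNReal.ofReal (((critConst δ).toReal + 1) * ((K + K') / b * B * lam ^ δ))) := by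
          rw [show ENNReal.ofReal 2 = 2 by simp]
          gcongr
          exact ofReal_critConst_mul hδ (by positivity)
      _ ≤ _ := by
          rw [← ENNReal.ofReal_add (by positivity) (by positivity),
            ← ENNReal.ofReal_mul (by norm_num)]
          refine ENNReal.ofReal_le_ofReal ?_
          calc 2 * (C₁ * (B * D₁ * lam ^ (30 * δ) * lam ^ δ) +
                ((critConst δ).toReal + 1) * ((K + K') / b * B * lam ^ δ))
              = 2 * (C₁ * D₁ * (B * (lam ^ (30 * δ) * lam ^ δ)) +
                ((critConst δ).toReal + 1) * ((K + K') / b) * (B * lam ^ δ)) := by ring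
            _ ≤ 2 * (C₁ * D₁ * (B * lam ^ (31 * δ)) +
                ((critConst δ).toReal + 1) * ((K + K') / b) * (B * lam ^ (31 * δ))) := by
                rw [hl1]; gcongr
            _ = _ := by ring

/-! ### The frequency regions -/

/-- The phase `φ^{α,β}` on the lattice `ℤ_λ`. -/
def wave (lam α β : ℝ) (n : ℤ) : ℝ := phase α β (freq lam n)

theorem freq_def (lam : ℝ) (n : ℤ) : freq lam n = (n : ℝ) / lam := rfl

theorem freq_neg (lam : ℝ) (n : ℤ) : freq lam (-n) = -freq lam n := by
  unfold freq; push_cast; ring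

theorem wave_neg (lam α β : ℝ) (n : ℤ) : wave lam α β (-n) = -wave lam α β n := by
  rw [wave, wave, freq_neg, phase, phase]; ring

/-- The resonance function on the hyperplane `k₁ + k₂ + k₃ = 0`: it vanishes with `k₃`, but only if
`α₁ = α₂` and `β₁ = β₂` does it vanish with `k₁` and `k₂`. -/
theorem symResonance_wave (lam α₁ α₂ β₁ β₂ : ℝ) (n m : ℤ) :
    symResonance (wave lam α₁ β₁) (wave lam α₂ β₂) n m =
      (α₂ - α₁) * freq lam (-n - m) ^ 3 +
        3 * α₁ * freq lam n * freq lam m * freq lam (-n - m) +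
        (β₁ - β₂) * freq lam (-n - m) := by
  simp only [symResonance, wave, phase, freq_neg_sub]; ring

/-- The size `1 + |k₁| + |k₂| + |k₃|` of three frequencies with sum zero. -/
def size (lam : ℝ) (n m : ℤ) : ℝ :=
  1 + |freq lam n| + |freq lam m| + |freq lam (-n - m)|

theorem SymZ.add_real {lam : ℝ} {p₁ p₂ : ℤ → ℝ} {V V₁ V₂ : ℤ → ℤ → ℝ} {a b : ℝ}
    (h₁ : SymZ lam p₁ p₂ V₁ (ENNReal.ofReal a)) (h₂ : SymZ lam p₁ p₂ V₂ (ENNReal.ofReal b))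
    (ha : 0 ≤ a) (hb : 0 ≤ b) (hV₁ : ∀ n m, 0 ≤ V₁ n m) (hV₂ : ∀ n m, 0 ≤ V₂ n m)
    (hV : ∀ n m, V n m ≤ V₁ n m + V₂ n m) : SymZ lam p₁ p₂ V (ENNReal.ofReal (2 * (a + b))) := by
  refine (h₁.add h₂ hV₁ hV₂ hV).mono_const (le_of_eq ?_)
  rw [ENNReal.ofReal_mul (by norm_num), ENNReal.ofReal_add ha hb]; simp

theorem SymZ.mono_real {lam : ℝ} {p₁ p₂ : ℤ → ℝ} {V : ℤ → ℤ → ℝ} {a b : ℝ}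
    (h : SymZ lam p₁ p₂ V (ENNReal.ofReal a)) (hab : a ≤ b) :
    SymZ lam p₁ p₂ V (ENNReal.ofReal b) := h.mono_const (ENNReal.ofReal_le_ofReal hab)

theorem abs_freq_le_abs_add (lam : ℝ) (n m : ℤ) :
    |freq lam (-n - m)| ≤ |freq lam n| + |freq lam m| := by
  rw [freq_neg_sub]; have := abs_sub (-freq lam n) (freq lam m); rwa [abs_neg] at this

/-- The frequency `k₃` is small, and the sum of the three frequencies is large. -/
theorem exists_symZ_low_third {δ α₁ α₂ : ℝ} (hδ : 0 < δ) (hδ' : δ ≤ 1 / 12) (hα₁ : α₁ ≠ 0) :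
    ∃ C₀ C : ℝ, 0 < C ∧ ∀ (lam B β₁ β₂ : ℝ) (V : ℤ → ℤ → ℝ), 1 ≤ lam → 0 ≤ B →
      |β₁ - β₂| ≤ 1 → (∀ n m, 0 ≤ V n m) →
      (∀ n m, V n m = 0 ∨ (-n - m ≠ 0 ∧ |freq lam (-n - m)| ≤ 1 ∧ C₀ ≤ size lam n m ∧
        V n m ^ 2 ≤ B * size lam n m ^ 2)) →
      SymZ lam (wave lam α₁ β₁) (wave lam α₂ β₂) V (ENNReal.ofReal (C * (B * lam ^ (31 * δ)))) := by
  have hA0 : 0 < |α₁| := abs_pos.2 hα₁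
  obtain ⟨C, hC, h⟩ := exists_symZ_of_weak (A := -(3 * α₁ / 4)) (b := 3 * |α₁| / 32) hδ hδ'
    (by simpa using hα₁) (by positivity)
  set M := |α₂| + 2 * |α₁| + 1 with hM
  have hM0 : 0 < M := by positivity
  refine ⟨4 + M * (8 / (3 * |α₁|)), C * 9, by positivity, fun lam B β₁ β₂ V hlam hB hβ hV0 hV => ?_⟩
  have hl : 0 < lam := by linarith
  have key := h lam (9 * B) 0 (fun k => (α₂ - α₁) * freq lam k ^ 3 + 3 * α₁ / 4 * freq lam k ^ 3 +
    (β₁ - β₂) * freq lam k) (wave lam α₁ β₁) (wave lam α₂ β₂) V (fun n m => -n - m)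
    (fun n m => freq lam n - freq lam m) hlam (by positivity) (by simp) (wave_neg _ _ _)
    (wave_neg _ _ _) (Or.inr (Or.inr ⟨rfl, rfl⟩)) hV0 (fun n m => by
      rw [symResonance_wave, freq_neg_sub]; ring) fun n m => ?_
  · exact key.mono_real (le_of_eq (by ring))
  rcases hV n m with h0 | ⟨h1, h2, h3, h4⟩
  · exact Or.inl h0
  right
  have hz := freq_neg_sub lam n m
  rw [symResonance_wave]
  set x := freq lam n with hx
  set y := freq lam m with hy
  set z := freq lam (-n - m) with hz'
  set u := x - y with hu
  have hsize : size lam n m ≤ 3 + |u| := by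
    have e1 : |x| ≤ (|u| + |z|) / 2 := by
      rw [show x = (u - z) / 2 by rw [hu, hz]; ring, abs_div, abs_two]
      gcongr; exact abs_sub u z
    have e2 : |y| ≤ (|u| + |z|) / 2 := by
      rw [show y = -((u + z) / 2) by rw [hu, hz]; ring, abs_neg, abs_div, abs_two]
      gcongr; exact abs_add_le u z
    unfold size; rw [← hx, ← hy, ← hz']; linarith
  have hu1 : 1 + M * (8 / (3 * |α₁|)) ≤ |u| := by linarith
  have hMα : 0 < M * (8 / (3 * |α₁|)) := by positivity
  refine ⟨h1, h2, ?_, ?_⟩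
  · have : 0 ≤ size lam n m := by unfold size; positivity
    calc V n m ^ 2 ≤ B * size lam n m ^ 2 := h4
      _ ≤ B * (3 * (1 + |u|)) ^ 2 := by gcongr; linarith
      _ = _ := by ring
  · have e : (α₂ - α₁) * z ^ 3 + 3 * α₁ * x * y * z + (β₁ - β₂) * z =
        z * (-(3 * α₁ / 4 * u ^ 2) + ((α₂ - α₁ / 4) * z ^ 2 + (β₁ - β₂))) := by
      rw [hu, hz]; ring
    have hbr : ∀ t : ℝ, |t| ≤ bracket t := fun t => by unfold bracket; linarith
    refine le_trans ?_ (hbr _)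
    rw [e, abs_mul]
    have i1 : |(α₂ - α₁ / 4) * z ^ 2 + (β₁ - β₂)| ≤ M := by
      have hz2 : z ^ 2 ≤ 1 := by rw [← sq_abs]; exact pow_le_one₀ (abs_nonneg _) h2
      calc _ ≤ |(α₂ - α₁ / 4) * z ^ 2| + |β₁ - β₂| := abs_add_le _ _
        _ ≤ (|α₂| + |α₁| / 4) * 1 + 1 := by
            rw [abs_mul, abs_of_nonneg (sq_nonneg z)]
            have := abs_sub α₂ (α₁ / 4)
            rw [abs_div, abs_of_pos (by norm_num : (0 : ℝ) < 4)] at this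
            gcongr
        _ ≤ M := by rw [hM]; linarith
    have i2 : |3 * α₁ / 4 * u ^ 2| = 3 * |α₁| / 4 * |u| ^ 2 := by
      rw [abs_mul, abs_div, abs_mul, abs_of_pos (by norm_num : (0 : ℝ) < 4),
        abs_of_pos (by norm_num : (0 : ℝ) < 3), abs_of_nonneg (sq_nonneg u), sq_abs]
    have i3 : 3 * |α₁| / 4 * |u| ^ 2 - M ≤
        |-(3 * α₁ / 4 * u ^ 2) + ((α₂ - α₁ / 4) * z ^ 2 + (β₁ - β₂))| := by
      have := abs_sub_abs_le_abs_sub (-(3 * α₁ / 4 * u ^ 2))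
        (-((α₂ - α₁ / 4) * z ^ 2 + (β₁ - β₂)))
      rw [abs_neg, abs_neg, i2, sub_neg_eq_add] at this
      linarith
    have i4 : M ≤ 3 * |α₁| / 8 * |u| ^ 2 := by
      have i5 : M * (8 / (3 * |α₁|)) ≤ |u| ^ 2 := by nlinarith
      calc M = 3 * |α₁| / 8 * (M * (8 / (3 * |α₁|))) := by field_simp
        _ ≤ _ := by gcongr
    have i6 : (1 + |u|) ^ 2 ≤ 4 * |u| ^ 2 := by nlinarith
    calc 3 * |α₁| / 32 * |z| * (1 + |u|) ^ 2 ≤ 3 * |α₁| / 32 * |z| * (4 * |u| ^ 2) := by gcongr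
      _ = |z| * (3 * |α₁| / 4 * |u| ^ 2 - 3 * |α₁| / 8 * |u| ^ 2) := by ring
      _ ≤ |z| * (3 * |α₁| / 4 * |u| ^ 2 - M) := by gcongr
      _ ≤ _ := by gcongr

/-- The analogue of `exists_symZ_low_third` for the frequencies `k₁` and `k₂`, when
`α₁ = α₂`. -/
theorem exists_symZ_low_input {δ α : ℝ} (hδ : 0 < δ) (hδ' : δ ≤ 1 / 12) (hα : α ≠ 0) :
    ∃ C : ℝ, 0 < C ∧ ∀ (lam B β₁ β₂ : ℝ) (V : ℤ → ℤ → ℝ) (c : ℤ → ℤ → ℤ) (u o : ℤ → ℤ → ℝ),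
      1 ≤ lam → 0 ≤ B → |β₁ - β₂| ≤ lam ^ (-(1 / 2) : ℝ) → (∀ n m, 0 ≤ V n m) →
      IsCoord lam c u → (∀ n m, freq lam (c n m) + o n m + freq lam (-n - m) = 0) →
      (∀ n m, u n m = freq lam (-n - m) - o n m) →
      (∀ n m, freq lam (c n m) * o n m = freq lam n * freq lam m) →
      (∀ n m, size lam n m = 1 + |freq lam (c n m)| + |o n m| + |freq lam (-n - m)|) →
      (∀ n m, V n m = 0 ∨ (c n m ≠ 0 ∧ |freq lam (c n m)| ≤ 1 ∧ 10 ≤ size lam n m ∧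
        V n m ^ 2 ≤ B * size lam n m ^ 2)) →
      SymZ lam (wave lam α β₁) (wave lam α β₂) V (ENNReal.ofReal (C * (B * lam ^ (31 * δ)))) := by
  have hA0 : 0 < |α| := abs_pos.2 hα
  obtain ⟨C, hC, h⟩ := exists_symZ_of_weak (A := -(3 * α / 4)) (b := 3 * |α| / 32) hδ hδ'
    (by simpa using hα) (by positivity)
  obtain ⟨C', hC', h'⟩ := exists_symZ_of_inv hδ hδ' one_pos
  refine ⟨2 * (C * 9 + C' * (64 * 4 / (9 * |α| ^ 2))), by positivity,
    fun lam B β₁ β₂ V c u o hlam hB hβ hV0 hc hsum hu hco hsz hV => ?_⟩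
  have hl : 0 < lam := by linarith
  have hβ1 : |β₁ - β₂| ≤ 1 :=
    hβ.trans (Real.rpow_le_one_of_one_le_of_nonpos hlam (by norm_num))
  -- the region in which `β` is negligible
  set R : ℤ → ℤ → Prop := fun n m => 2 * |β₁ - β₂| ≤ 3 * |α| * |freq lam (c n m)| * |o n m| with hR
  classical
  set V₁ : ℤ → ℤ → ℝ := fun n m => if R n m then V n m else 0 with hV₁
  set V₂ : ℤ → ℤ → ℝ := fun n m => if R n m then 0 else V n m with hV₂
  have hV₁0 : ∀ n m, 0 ≤ V₁ n m := fun n m => by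
    simp only [hV₁]; split_ifs; exacts [hV0 n m, le_rfl]
  have hV₂0 : ∀ n m, 0 ≤ V₂ n m := fun n m => by
    simp only [hV₂]; split_ifs; exacts [le_rfl, hV0 n m]
  -- `k` stands for the frequency `c` and `u` for the difference of the two others: for `|k| ≤ 1`
  -- these are comparable to `1 + |u|`
  have hgeom : ∀ n m, |freq lam (c n m)| ≤ 1 → 10 ≤ size lam n m →
      size lam n m ≤ 3 + |u n m| ∧ 7 ≤ |u n m| ∧ (1 + |u n m|) / 4 ≤ |o n m| ∧
        (1 + |u n m|) / 4 ≤ |freq lam (-n - m)| := by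
    intro n m h1 h2
    have e1 : o n m = -((freq lam (c n m) + u n m) / 2) := by
      rw [hu]; linarith [hsum n m]
    have e2 : freq lam (-n - m) = (u n m - freq lam (c n m)) / 2 := by
      rw [hu]; linarith [hsum n m]
    have e3 : |o n m| = |freq lam (c n m) + u n m| / 2 := by
      rw [e1, abs_neg, abs_div, abs_two]
    have e4 : |freq lam (-n - m)| = |u n m - freq lam (c n m)| / 2 := by
      rw [e2, abs_div, abs_two]
    have i1 := abs_add_le (freq lam (c n m)) (u n m)
    have i2 := abs_sub (u n m) (freq lam (c n m))
    have i3 := abs_sub_abs_le_abs_sub (u n m) (-freq lam (c n m))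
    have i4 := abs_sub_abs_le_abs_sub (u n m) (freq lam (c n m))
    rw [sub_neg_eq_add, abs_neg, add_comm (u n m)] at i3
    have i5 : size lam n m ≤ 3 + |u n m| := by rw [hsz, e3, e4]; linarith
    refine ⟨i5, by linarith, ?_, ?_⟩
    · rw [e3]; linarith
    · rw [e4]; linarith
  have part1 := h lam (9 * B) ((β₁ - β₂) / 2) (fun k => 3 * α / 4 * freq lam k ^ 3 -
      (β₁ - β₂) / 2 * freq lam k) (wave lam α β₁) (wave lam α β₂) V₁ c u hlam (by positivity)
    (by rw [abs_div, abs_two]; linarith [abs_nonneg (β₁ - β₂)]) (wave_neg _ _ _)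
    (wave_neg _ _ _) hc hV₁0 (fun n m => by
      have e1 : o n m = -((freq lam (c n m) + u n m) / 2) := by
        rw [hu]; linarith [hsum n m]
      have e2 : freq lam (-n - m) = (u n m - freq lam (c n m)) / 2 := by
        rw [hu]; linarith [hsum n m]
      rw [symResonance_wave, mul_assoc (3 * α), ← hco, e1, e2]; ring) fun n m => by
    by_cases hr : R n m
    swap
    · left; simp [hV₁, hr]
    rcases hV n m with h0 | ⟨h1, h2, h3, h4⟩
    · left; simp [hV₁, h0]
    right
    obtain ⟨g1, g2, g3, g4⟩ := hgeom n m h2 h3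
    simp only [hV₁, if_pos hr]
    refine ⟨h1, h2, ?_, ?_⟩
    · have : 0 ≤ size lam n m := by linarith
      calc V n m ^ 2 ≤ B * size lam n m ^ 2 := h4
        _ ≤ B * (3 * (1 + |u n m|)) ^ 2 := by gcongr; linarith
        _ = _ := by ring
    · have e : symResonance (wave lam α β₁) (wave lam α β₂) n m =
          freq lam (-n - m) * (3 * α * (freq lam (c n m) * o n m) + (β₁ - β₂)) := by
        rw [symResonance_wave, hco]; ring
      have hbr : ∀ t : ℝ, |t| ≤ bracket t := fun t => by unfold bracket; linarith
      refine le_trans ?_ (hbr _)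
      rw [e, abs_mul]
      have i1 : 3 * |α| * |freq lam (c n m)| * |o n m| / 2 ≤
          |3 * α * (freq lam (c n m) * o n m) + (β₁ - β₂)| := by
        have := abs_sub_abs_le_abs_sub (3 * α * (freq lam (c n m) * o n m)) (-(β₁ - β₂))
        rw [sub_neg_eq_add, abs_neg, abs_mul, abs_mul, abs_mul,
          abs_of_pos (by norm_num : (0 : ℝ) < 3), ← mul_assoc] at this
        simp only [hR] at hr
        linarith
      calc 3 * |α| / 32 * |freq lam (c n m)| * (1 + |u n m|) ^ 2
          = (1 + |u n m|) / 4 * (3 * |α| * |freq lam (c n m)| * ((1 + |u n m|) / 4) / 2) := by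
            ring
        _ ≤ |freq lam (-n - m)| * (3 * |α| * |freq lam (c n m)| * |o n m| / 2) := by gcongr
        _ ≤ _ := by gcongr
  -- In the complementary region the resonance function may vanish and is not used. There `|k o| ≲
  -- λ^{-1/2}`, so that the squared weight is at most `|o|² ≲ 1 / (λ k²) ≤ 1 / |k|`, by `|k| ≥ 1 /
  -- λ`; this is where the size of `β₁ - β₂` matters.
  have part2 := h' lam (B * (64 * 4 / (9 * |α| ^ 2))) (wave lam α β₁) (wave lam α β₂) V₂ c u hlam
    (by positivity) (wave_neg _ _ _) (wave_neg _ _ _) hc hV₂0 fun n m => by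
    by_cases hr : R n m
    · left; simp [hV₂, hr]
    rcases hV n m with h0 | ⟨h1, h2, h3, h4⟩
    · left; simp [hV₂, h0]
    right
    obtain ⟨g1, g2, g3, g4⟩ := hgeom n m h2 h3
    simp only [hV₂, if_neg hr]
    refine ⟨h1, h2, ?_⟩
    have hk0 : 0 < |freq lam (c n m)| := abs_pos.2 (freq_ne_zero hl h1)
    have hk1 := inv_le_abs_freq hl h1
    set k := |freq lam (c n m)| with hk
    have i0 : V n m ^ 2 * bracket (symResonance (wave lam α β₁) (wave lam α β₂) n m) ^
        (-(1 - 3 * δ)) ≤ V n m ^ 2 :=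
      mul_le_of_le_one_right (sq_nonneg _) (rpow_bracket_le_one (by linarith))
    have i1 : size lam n m ≤ 8 * |o n m| := by linarith
    have i2 : 3 * |α| * k * |o n m| ≤ 2 * lam ^ (-(1 / 2) : ℝ) := by
      have := (not_le.1 hr).le; linarith
    have i3 : (3 * |α| * k * |o n m|) ^ 2 ≤ 4 * (1 / lam) := by
      calc _ ≤ (2 * lam ^ (-(1 / 2) : ℝ)) ^ 2 := by gcongr
        _ = _ := by
          rw [mul_pow, rpow_sq hl.le, show (2 : ℝ) * -(1 / 2) = -1 by norm_num,
            Real.rpow_neg_one]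
          norm_num
    have hs0 : 0 ≤ size lam n m := by linarith
    refine i0.trans ?_
    rw [le_div_iff₀ hk0]
    calc V n m ^ 2 * k ≤ (B * (8 * |o n m|) ^ 2) * k := by
          gcongr; exact h4.trans (by gcongr)
      _ = B * 64 / (9 * |α| ^ 2) * ((3 * |α| * k * |o n m|) ^ 2) / k := by field_simp; ring
      _ ≤ B * 64 / (9 * |α| ^ 2) * (4 * k) / k := by
          gcongr; exact i3.trans (by gcongr)
      _ = _ := by field_simp
  refine (part1.add_real part2 (by positivity) (by positivity) hV₁0 hV₂0 fun n m => ?_).mono_real ?_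
  · simp only [hV₁, hV₂]; split_ifs <;> simp
  · have hl2 : lam ^ δ ≤ lam ^ (31 * δ) :=
      Real.rpow_le_rpow_of_exponent_le hlam (by linarith)
    calc _ ≤ 2 * (C * (9 * B * lam ^ (31 * δ)) +
          C' * (B * (64 * 4 / (9 * |α| ^ 2)) * lam ^ (31 * δ))) := by gcongr
      _ = _ := by ring

/-- The frequency `k₃` is not small, and the weight is dominated by the resonance function; here
`α₁ ≠ α₂`, so that the resonance function is a cubic polynomial for fixed `k₁` or `k₂`, and a
quadratic polynomial for fixed `k₃`. -/
theorem exists_symZ_high {δ α₁ α₂ : ℝ} (hδ : 0 < δ) (hδ' : δ ≤ 1 / 12) (hα₁ : α₁ ≠ 0)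
    (hα : α₁ ≠ α₂) :
    ∃ C : ℝ, 0 < C ∧ ∀ (lam B β₁ β₂ : ℝ) (V : ℤ → ℤ → ℝ), 1 ≤ lam → 0 ≤ B →
      (∀ n m, 0 ≤ V n m) →
      (∀ n m, V n m = 0 ∨ (1 < |freq lam (-n - m)| ∧
        V n m ^ 2 ≤ B * bracket (symResonance (wave lam α₁ β₁) (wave lam α₂ β₂) n m))) →
      SymZ lam (wave lam α₁ β₁) (wave lam α₂ β₂) V (ENNReal.ofReal (C * B)) := by
  set θ := 1 - 3 * δ with hθ
  obtain ⟨K, hK, hquad⟩ := exists_tsum_quadratic_le (θ := θ) (c₀ := 3 * |α₁|)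
    (by rw [hθ]; linarith) (by have := abs_pos.2 hα₁; positivity)
  obtain ⟨K', hK', hcub⟩ := exists_tsum_cubic_le (θ := θ) (c₀ := |α₂ - α₁|)
    (by rw [hθ]; linarith) (abs_pos.2 (sub_ne_zero.2 hα.symm))
  refine ⟨((critConst δ).toReal + 1) * (K + K'), by positivity,
    fun lam B β₁ β₂ V hlam hB hV0 hV => ?_⟩
  have hl : 0 < lam := by linarith
  set H := symResonance (wave lam α₁ β₁) (wave lam α₂ β₂) with hH
  have hpos : ∀ x : ℝ, 0 ≤ bracket x ^ (-θ) := fun x => Real.rpow_nonneg (bracket_pos x).le _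
  have hle : ∀ a n m, V n m ^ 2 * bracket (H n m) ^ (-1 : ℝ) * bracket (H n m - a) ^ (-θ) ≤
      if 1 < |freq lam (-n - m)| then B * bracket (H n m - a) ^ (-θ) else 0 := by
    intro a n m
    rcases hV n m with h | ⟨h, h'⟩
    · rw [h]; split_ifs
      · have := hpos (H n m - a)
        simp only [ne_eq, OfNat.ofNat_ne_zero, not_false_eq_true, zero_pow, zero_mul]; positivity
      · simp
    · rw [if_pos h]
      refine mul_le_mul_of_nonneg_right ?_ (hpos _)
      rwa [Real.rpow_neg_one, ← div_eq_mul_inv, div_le_iff₀ (bracket_pos _)]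
  have hle' : ∀ a n m, (if 1 < |freq lam (-n - m)| then B * bracket (H n m - a) ^ (-θ) else 0) ≤
      B * bracket (H n m - a) ^ (-θ) := by
    intro a n m
    have := hpos (H n m - a)
    split_ifs; exacts [le_rfl, by positivity]
  have hsum : ∀ {f g : ℤ → ℝ} {M : ℝ}, (∀ t, f t ≤ B * g t) → M ≤ K + K' →
      ∑' t, ENNReal.ofReal (g t) ≤ ENNReal.ofReal (M * lam) →
      ∑' t, ENNReal.ofReal (f t) ≤ ENNReal.ofReal lam * ENNReal.ofReal ((K + K') * B) := by
    intro f g M hfg hM hg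
    calc _ ≤ ∑' t, ENNReal.ofReal B * ENNReal.ofReal (g t) :=
          ENNReal.tsum_le_tsum fun t => by
            rw [← ENNReal.ofReal_mul hB]; exact ENNReal.ofReal_le_ofReal (hfg t)
      _ ≤ ENNReal.ofReal B * ENNReal.ofReal (M * lam) := by rw [ENNReal.tsum_mul_left]; gcongr
      _ ≤ _ := by
          rw [← ENNReal.ofReal_mul hB, ← ENNReal.ofReal_mul hl.le]
          refine ENNReal.ofReal_le_ofReal ?_
          calc B * (M * lam) ≤ B * ((K + K') * lam) := by gcongr
            _ = _ := by ring
  have key := SymZ.of_kpv (A := ENNReal.ofReal ((K + K') * B)) (wave_neg lam α₁ β₁)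
    (wave_neg lam α₂ β₂) hl hδ hδ' hV0 hle (fun a n => ?_) (fun a m => ?_) (fun a k => ?_)
  · refine key.mono_const ((ofReal_critConst_mul hδ (by positivity)).trans (le_of_eq ?_))
    congr 1; ring
  · refine hsum (hle' a n) (by linarith) (hcub lam a (-(α₂ - α₁)) (-3 * α₂ * freq lam n)
      (-3 * α₂ * freq lam n ^ 2 - (β₁ - β₂))
      (-(α₂ - α₁) * freq lam n ^ 3 - (β₁ - β₂) * freq lam n) (H n) hlam (by rw [abs_neg])
      fun m => ?_)
    rw [hH, symResonance_wave, freq_neg_sub, ← freq]; ring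
  · refine hsum (fun n => hle' a n m) (by linarith) (hcub lam a (-(α₂ - α₁))
      (-3 * α₂ * freq lam m) (-3 * α₂ * freq lam m ^ 2 - (β₁ - β₂))
      (-(α₂ - α₁) * freq lam m ^ 3 - (β₁ - β₂) * freq lam m) (fun n => H n m) hlam
      (by rw [abs_neg]) fun n => ?_)
    simp only [hH, symResonance_wave, freq_neg_sub, ← freq_def]; ring
  · by_cases hk : 1 < |freq lam (-k)|
    · refine hsum (fun n => hle' a n (k - n)) (by linarith) (hquad lam a (-3 * α₁ * freq lam (-k))
        (-3 * α₁ * freq lam (-k) ^ 2) ((α₂ - α₁) * freq lam (-k) ^ 3 + (β₁ - β₂) * freq lam (-k))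
        (fun n => H n (k - n)) hlam ?_ fun n => ?_)
      · rw [abs_mul, abs_mul, abs_neg, abs_of_pos (by norm_num : (0 : ℝ) < 3)]
        nlinarith [abs_nonneg α₁]
      · simp only [hH, symResonance_wave, ← freq_def, freq_sub, freq_neg]; ring
    · have : ∀ n, ¬ 1 < |freq lam (-n - (k - n))| := fun n => by
        rwa [show -n - (k - n) = -k by ring]
      simp [this]

/-- The counterpart of `exists_symZ_high` for `α₁ = α₂`: all three frequencies are not small, and
the resonance function is a quadratic polynomial if one of them is fixed. -/
theorem exists_symZ_high_eq {δ α : ℝ} (hδ : 0 < δ) (hδ' : δ ≤ 1 / 12) (hα : α ≠ 0) :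
    ∃ C : ℝ, 0 < C ∧ ∀ (lam B β₁ β₂ : ℝ) (V : ℤ → ℤ → ℝ), 1 ≤ lam → 0 ≤ B →
      (∀ n m, 0 ≤ V n m) →
      (∀ n m, V n m = 0 ∨ (1 < |freq lam n| ∧ 1 < |freq lam m| ∧ 1 < |freq lam (-n - m)| ∧
        V n m ^ 2 ≤ B * bracket (symResonance (wave lam α β₁) (wave lam α β₂) n m))) →
      SymZ lam (wave lam α β₁) (wave lam α β₂) V (ENNReal.ofReal (C * B)) := by
  set θ := 1 - 3 * δ with hθ
  obtain ⟨K, hK, hquad⟩ := exists_tsum_quadratic_le (θ := θ) (c₀ := 3 * |α|)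
    (by rw [hθ]; linarith) (by have := abs_pos.2 hα; positivity)
  refine ⟨((critConst δ).toReal + 1) * K, by positivity,
    fun lam B β₁ β₂ V hlam hB hV0 hV => ?_⟩
  have hl : 0 < lam := by linarith
  set H := symResonance (wave lam α β₁) (wave lam α β₂) with hH
  have hpos : ∀ x : ℝ, 0 ≤ bracket x ^ (-θ) := fun x => Real.rpow_nonneg (bracket_pos x).le _
  have hle : ∀ a n m, V n m ^ 2 * bracket (H n m) ^ (-1 : ℝ) * bracket (H n m - a) ^ (-θ) ≤
      if 1 < |freq lam n| ∧ 1 < |freq lam m| ∧ 1 < |freq lam (-n - m)| then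
        B * bracket (H n m - a) ^ (-θ) else 0 := by
    intro a n m
    rcases hV n m with h | ⟨h1, h2, h3, h'⟩
    · rw [h]; split_ifs
      · have := hpos (H n m - a)
        simp only [ne_eq, OfNat.ofNat_ne_zero, not_false_eq_true, zero_pow, zero_mul]; positivity
      · simp
    · rw [if_pos ⟨h1, h2, h3⟩]
      refine mul_le_mul_of_nonneg_right ?_ (hpos _)
      rwa [Real.rpow_neg_one, ← div_eq_mul_inv, div_le_iff₀ (bracket_pos _)]
  have hle' : ∀ a n m, (if 1 < |freq lam n| ∧ 1 < |freq lam m| ∧ 1 < |freq lam (-n - m)| then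
        B * bracket (H n m - a) ^ (-θ) else 0) ≤ B * bracket (H n m - a) ^ (-θ) := by
    intro a n m
    have := hpos (H n m - a)
    split_ifs; exacts [le_rfl, by positivity]
  have hsum : ∀ {f g : ℤ → ℝ}, (∀ t, f t ≤ B * g t) →
      ∑' t, ENNReal.ofReal (g t) ≤ ENNReal.ofReal (K * lam) →
      ∑' t, ENNReal.ofReal (f t) ≤ ENNReal.ofReal lam * ENNReal.ofReal (K * B) := by
    intro f g hfg hg
    calc _ ≤ ∑' t, ENNReal.ofReal B * ENNReal.ofReal (g t) :=
          ENNReal.tsum_le_tsum fun t => by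
            rw [← ENNReal.ofReal_mul hB]; exact ENNReal.ofReal_le_ofReal (hfg t)
      _ ≤ ENNReal.ofReal B * ENNReal.ofReal (K * lam) := by rw [ENNReal.tsum_mul_left]; gcongr
      _ = _ := by
          rw [← ENNReal.ofReal_mul hB, ← ENNReal.ofReal_mul hl.le]
          congr 1; ring
  have hlead : ∀ k, 1 < |freq lam k| → 3 * |α| ≤ |-3 * α * freq lam k| := by
    intro k hk
    rw [abs_mul, abs_mul, abs_neg, abs_of_pos (by norm_num : (0 : ℝ) < 3)]
    nlinarith [abs_nonneg α]
  have key := SymZ.of_kpv (A := ENNReal.ofReal (K * B)) (wave_neg lam α β₁)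
    (wave_neg lam α β₂) hl hδ hδ' hV0 hle (fun a n => ?_) (fun a m => ?_) (fun a k => ?_)
  · refine key.mono_const ((ofReal_critConst_mul hδ (by positivity)).trans (le_of_eq ?_))
    congr 1; ring
  · by_cases hk : 1 < |freq lam n|
    · refine hsum (hle' a n) (hquad lam a (-3 * α * freq lam n)
        (-3 * α * freq lam n ^ 2 - (β₁ - β₂)) (-(β₁ - β₂) * freq lam n) (H n) hlam (hlead _ hk)
        fun m => ?_)
      rw [hH, symResonance_wave, freq_neg_sub, ← freq]; ring
    · simp [hk]
  · by_cases hk : 1 < |freq lam m|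
    · refine hsum (fun n => hle' a n m) (hquad lam a (-3 * α * freq lam m)
        (-3 * α * freq lam m ^ 2 - (β₁ - β₂)) (-(β₁ - β₂) * freq lam m) (fun n => H n m) hlam
        (hlead _ hk) fun n => ?_)
      simp only [hH, symResonance_wave, freq_neg_sub, ← freq_def]; ring
    · simp [hk]
  · by_cases hk : 1 < |freq lam (-k)|
    · refine hsum (fun n => hle' a n (k - n)) (hquad lam a (-3 * α * freq lam (-k))
        (-3 * α * freq lam (-k) ^ 2) ((β₁ - β₂) * freq lam (-k))
        (fun n => H n (k - n)) hlam (hlead _ hk) fun n => ?_)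
      simp only [hH, symResonance_wave, ← freq_def, freq_sub, freq_neg]; ring
    · have : ∀ n, ¬ 1 < |freq lam (-n - (k - n))| := fun n => by
        rwa [show -n - (k - n) = -k by ring]
      simp [this]

/-! ### Lower bounds for the resonance function -/

theorem size_one_le (lam : ℝ) (n m : ℤ) : 1 ≤ size lam n m := by
  have h₁ := abs_nonneg (freq lam n)
  have h₂ := abs_nonneg (freq lam m)
  have h₃ := abs_nonneg (freq lam (-n - m))
  unfold size; linarith

theorem abs_le_bracket (x : ℝ) : |x| ≤ bracket x := by unfold bracket; linarith

theorem bracket_le_size (lam : ℝ) (n m : ℤ) : bracket (freq lam n) ≤ size lam n m ∧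
    bracket (freq lam m) ≤ size lam n m ∧ bracket (freq lam (-n - m)) ≤ size lam n m := by
  have h₁ := abs_nonneg (freq lam n)
  have h₂ := abs_nonneg (freq lam m)
  have h₃ := abs_nonneg (freq lam (-n - m))
  unfold bracket size
  exact ⟨by linarith, by linarith, by linarith⟩

theorem size_le_of_sum_zero {x y z : ℝ} (h : x + y + z = 0) (hz : 1 ≤ |z|) :
    1 + |x| + |y| + |z| ≤ |x - y| + 3 * |z| := by
  have e1 : |x| = |(x - y) - z| / 2 := by
    rw [show x = ((x - y) - z) / 2 by linarith, abs_div, abs_two]; congr 2; linarith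
  have e2 : |y| = |(x - y) + z| / 2 := by
    rw [show y = -(((x - y) + z) / 2) by linarith, abs_neg, abs_div, abs_two]; congr 2; linarith
  have := abs_sub (x - y) z
  have := abs_add_le (x - y) z
  linarith

/-- If `α₂ / α₁ < 1 / 4` then the resonance function is of the order `|k₃| N²` as soon as `|k₃| ≥ 1`
and the size `N` of the frequencies is large. -/
theorem exists_resonance_lower {α₁ α₂ : ℝ} (hα₁ : α₁ ≠ 0) (hr : α₂ / α₁ < 1 / 4) :
    ∃ c C₀ : ℝ, 0 < c ∧ ∀ x y z β : ℝ, x + y + z = 0 → |β| ≤ 1 → 1 ≤ |z| →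
      C₀ ≤ 1 + |x| + |y| + |z| → c * |z| * (1 + |x| + |y| + |z|) ^ 2 ≤
        |(α₂ - α₁) * z ^ 3 + 3 * α₁ * x * y * z + β * z| := by
  have ha : 0 < |α₁| := abs_pos.2 hα₁
  -- up to the sign of `α₁` the quadratic form is `e z² + (3/4) |α₁| (x - y)²`
  set r := α₂ / α₁ with hrdef
  have hα₂ : α₂ = r * α₁ := by rw [hrdef]; field_simp
  set e := min (1 / 4 - r) (3 / 4) with he
  have he0 : 0 < e := lt_min (by linarith) (by norm_num)
  set c := |α₁| * e / 36 with hc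
  have hc0 : 0 < c := by positivity
  refine ⟨c, 1 + 1 / c, hc0, fun x y z β hsum hβ hz hN => ?_⟩
  set N := 1 + |x| + |y| + |z| with hNdef
  have hle := size_le_of_sum_zero hsum hz
  rw [← hNdef] at hle
  set u := x - y with hu
  have hc1 : 0 < 1 / c := by positivity
  have hN0 : 0 < N := by linarith
  have e1 : (α₂ - α₁) * z ^ 3 + 3 * α₁ * x * y * z + β * z =
      z * (-(α₁ * ((1 / 4 - r) * z ^ 2 + 3 / 4 * u ^ 2)) + β) := by
    rw [hu, hα₂, show z = -x - y by linarith]; ring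
  have i1 : N ^ 2 ≤ 18 * (z ^ 2 + u ^ 2) := by
    rw [← sq_abs z, ← sq_abs u]
    have : N ^ 2 ≤ (|u| + 3 * |z|) ^ 2 := by gcongr
    nlinarith [sq_nonneg (3 * |u| - |z|), sq_nonneg (|u|), sq_nonneg (|z|)]
  have i2 : e * (z ^ 2 + u ^ 2) ≤ (1 / 4 - r) * z ^ 2 + 3 / 4 * u ^ 2 := by
    have h1 : e ≤ 1 / 4 - r := min_le_left _ _
    have h2 : e ≤ 3 / 4 := min_le_right _ _
    nlinarith [sq_nonneg z, sq_nonneg u]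
  have i3 : 2 * c * N ^ 2 ≤ |α₁ * ((1 / 4 - r) * z ^ 2 + 3 / 4 * u ^ 2)| := by
    rw [abs_mul, hc]
    calc 2 * (|α₁| * e / 36) * N ^ 2 = |α₁| * (e * (N ^ 2 / 18)) := by ring
      _ ≤ |α₁| * (e * (z ^ 2 + u ^ 2)) := by gcongr; linarith
      _ ≤ |α₁| * ((1 / 4 - r) * z ^ 2 + 3 / 4 * u ^ 2) := by gcongr
      _ ≤ _ := by gcongr; exact le_abs_self _
  have i4 : 1 ≤ c * N ^ 2 := by
    have : 1 / c ≤ N ^ 2 := by nlinarith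
    rwa [div_le_iff₀' hc0] at this
  rw [e1, abs_mul]
  have i5 := abs_sub_abs_le_abs_sub (-(α₁ * ((1 / 4 - r) * z ^ 2 + 3 / 4 * u ^ 2))) (-β)
  rw [abs_neg, abs_neg, sub_neg_eq_add] at i5
  calc c * |z| * N ^ 2 = |z| * (2 * c * N ^ 2 - c * N ^ 2) := by ring
    _ ≤ _ := by gcongr; linarith

/-- If `α₁ ≠ α₂` then the zeros of the resonance function with `k₃ ≠ 0` have three comparable
frequencies. -/
theorem exists_resonance_lower_or {α₁ α₂ : ℝ} (hα₁ : α₁ ≠ 0) (hα : α₁ ≠ α₂) :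
    ∃ c C₀ : ℝ, 0 < c ∧ c ≤ 1 ∧ ∀ x y z β : ℝ, x + y + z = 0 → |β| ≤ 1 → 1 ≤ |z| →
      C₀ ≤ 1 + |x| + |y| + |z| →
      c * |z| * (1 + |x| + |y| + |z|) ^ 2 ≤ |(α₂ - α₁) * z ^ 3 + 3 * α₁ * x * y * z + β * z| ∨
      (c * (1 + |x| + |y| + |z|) ≤ |x| ∧ c * (1 + |x| + |y| + |z|) ≤ |y| ∧
        c * (1 + |x| + |y| + |z|) ≤ |z|) := by
  have ha : 0 < |α₁| := abs_pos.2 hα₁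
  have hd : 0 < |α₂ - α₁| := abs_pos.2 (sub_ne_zero.2 hα.symm)
  set a := |α₁| with hadef
  set d := |α₂ - α₁| with hddef
  set c := min (1 / 16) (min (d / (128 * (a + d))) (min (d / 128) (a / (64 * (a + d))) ⊓ (a / 64)))
    with hc
  have hc0 : 0 < c := by
    refine lt_min (by norm_num) (lt_min (by positivity) (lt_min (lt_min ?_ ?_) ?_)) <;> positivity
  have c1 : c ≤ 1 / 16 := min_le_left _ _
  have c2 : c * (128 * (a + d)) ≤ d := by
    rw [← le_div_iff₀ (by positivity)]; exact (min_le_right _ _).trans (min_le_left _ _)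
  have c3 : c ≤ d / 128 := (min_le_right _ _).trans
    ((min_le_right _ _).trans ((min_le_left _ _).trans (min_le_left _ _)))
  have c4 : c * (64 * (a + d)) ≤ a := by
    rw [← le_div_iff₀ (by positivity)]
    exact (min_le_right _ _).trans ((min_le_right _ _).trans
      ((min_le_left _ _).trans (min_le_right _ _)))
  have c5 : c ≤ a / 64 := (min_le_right _ _).trans ((min_le_right _ _).trans (min_le_right _ _))
  have hc1 : 0 < 1 / c := by positivity
  -- the second summand of the threshold makes `β z` negligible
  refine ⟨c, 1 + 1 / c, hc0, by linarith, fun x y z β hsum hβ hz hN => ?_⟩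
  set N := 1 + |x| + |y| + |z| with hNdef
  have hN0 : 0 < N := by linarith
  have i4 : 1 ≤ c * N ^ 2 := by
    have : 1 / c ≤ N ^ 2 := by nlinarith
    rwa [div_le_iff₀' hc0] at this
  -- a small frequency among the first two
  have small : ∀ x y : ℝ, x + y + z = 0 → 1 + |x| + |y| + |z| = N → |x| < c * N →
      c * |z| * N ^ 2 ≤ |(α₂ - α₁) * z ^ 3 + 3 * α₁ * x * y * z + β * z| := by
    intro x y hs hN' hx
    have hy : |y| ≤ |x| + |z| := by
      rw [show y = -(x + z) by linarith, abs_neg]; exact abs_add_le _ _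
    have hxN : |x| ≤ N / 16 := by
      have : c * N ≤ 1 / 16 * N := by gcongr
      linarith
    have hz' : N / 4 ≤ |z| := by linarith
    have hyN : |y| ≤ N := by have := abs_nonneg x; linarith
    rw [show (α₂ - α₁) * z ^ 3 + 3 * α₁ * x * y * z + β * z =
      z * ((α₂ - α₁) * z ^ 2 + (3 * α₁ * x * y + β)) by ring, abs_mul]
    have j1 := abs_sub_abs_le_abs_sub ((α₂ - α₁) * z ^ 2) (-(3 * α₁ * x * y + β))
    rw [abs_neg, sub_neg_eq_add, abs_mul, ← hddef, abs_of_nonneg (sq_nonneg z)] at j1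
    have j2 : |3 * α₁ * x * y + β| ≤ 3 * a * (c * N) * N + 1 := by
      refine (abs_add_le _ _).trans (add_le_add ?_ hβ)
      rw [abs_mul, abs_mul, abs_mul, abs_of_pos (by norm_num : (0 : ℝ) < 3)]
      gcongr
    have j3 : d * (N / 4) ^ 2 ≤ d * z ^ 2 := by rw [← sq_abs z]; gcongr
    have j4 : 3 * a * (c * N) * N ≤ d / 32 * N ^ 2 := by
      have : 3 * a * c ≤ d / 32 := by
        have : 0 ≤ c * d := by positivity
        have : 0 ≤ c * a := by positivity
        linarith
      calc _ = 3 * a * c * N ^ 2 := by ring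
        _ ≤ _ := by gcongr
    have j5 : c * N ^ 2 ≤ d / 128 * N ^ 2 := by gcongr
    calc c * |z| * N ^ 2 = |z| * (c * N ^ 2) := by ring
      _ ≤ _ := by
          have j6 : 0 < d * N ^ 2 := by positivity
          gcongr; linarith
  by_cases hx : c * N ≤ |x|
  · by_cases hy : c * N ≤ |y|
    · by_cases hz' : c * N ≤ |z|
      · exact Or.inr ⟨hx, hy, hz'⟩
      · left
        push Not at hz'
        -- `z` is small compared with `N`, so that `x - y` is comparable to `N`
        have hle := size_le_of_sum_zero hsum hz
        rw [← hNdef] at hle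
        set u := x - y with hu
        rw [show (α₂ - α₁) * z ^ 3 + 3 * α₁ * x * y * z + β * z =
          z * (-(3 * α₁ / 4 * u ^ 2) + ((α₂ - α₁ + 3 * α₁ / 4) * z ^ 2 + β)) by
            rw [hu, show z = -x - y by linarith]; ring, abs_mul]
        have hu' : N / 2 ≤ |u| := by
          have : c * N ≤ 1 / 16 * N := by gcongr
          linarith
        have j1 := abs_sub_abs_le_abs_sub (-(3 * α₁ / 4 * u ^ 2))
          (-((α₂ - α₁ + 3 * α₁ / 4) * z ^ 2 + β))
        rw [abs_neg, abs_neg, sub_neg_eq_add, abs_mul, abs_div, abs_mul, ← hadef,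
          abs_of_nonneg (sq_nonneg u), abs_of_pos (by norm_num : (0 : ℝ) < 3),
          abs_of_pos (by norm_num : (0 : ℝ) < 4)] at j1
        have j2 : |(α₂ - α₁ + 3 * α₁ / 4) * z ^ 2 + β| ≤ (a + d) * (c * N) ^ 2 + 1 := by
          refine (abs_add_le _ _).trans (add_le_add ?_ hβ)
          rw [abs_mul, abs_of_nonneg (sq_nonneg z), ← sq_abs z]
          gcongr
          refine (abs_add_le _ _).trans ?_
          rw [abs_div, abs_mul, ← hadef, ← hddef, abs_of_pos (by norm_num : (0 : ℝ) < 3),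
            abs_of_pos (by norm_num : (0 : ℝ) < 4)]
          linarith
        have j3 : 3 * a / 4 * (N / 2) ^ 2 ≤ 3 * a / 4 * u ^ 2 := by rw [← sq_abs u]; gcongr
        have j4 : (a + d) * (c * N) ^ 2 ≤ a / 64 * N ^ 2 := by
          have : (a + d) * c ^ 2 ≤ a / 64 := by
            calc (a + d) * c ^ 2 = (c * (64 * (a + d))) * c / 64 := by ring
              _ ≤ a * 1 / 64 := by gcongr; linarith
              _ = a / 64 := by ring
          calc _ = (a + d) * c ^ 2 * N ^ 2 := by ring
            _ ≤ _ := by gcongr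
        have j5 : c * N ^ 2 ≤ a / 64 * N ^ 2 := by gcongr
        calc c * |z| * N ^ 2 = |z| * (c * N ^ 2) := by ring
          _ ≤ _ := by
              have j6 : 0 < a * N ^ 2 := by positivity
              gcongr; linarith
    · left
      have := small y x (by linarith) (by rw [hNdef]; ring) (not_le.1 hy)
      rwa [show 3 * α₁ * y * x * z = 3 * α₁ * x * y * z by ring] at this
  · exact Or.inl (small x y hsum rfl (not_le.1 hx))

/-! ### The bilinear estimates for general weights -/

/-- The frequency plane may be cut into a region `R` and its complement. -/
theorem SymZ.split {lam : ℝ} {p₁ p₂ : ℤ → ℝ} {V : ℤ → ℤ → ℝ} {a b : ℝ} (R : ℤ → ℤ → Prop)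
    [∀ n m, Decidable (R n m)]
    (hV : ∀ n m, 0 ≤ V n m) (ha : 0 ≤ a) (hb : 0 ≤ b)
    (h₁ : SymZ lam p₁ p₂ (fun n m => if R n m then V n m else 0) (ENNReal.ofReal a))
    (h₂ : SymZ lam p₁ p₂ (fun n m => if R n m then 0 else V n m) (ENNReal.ofReal b)) :
    SymZ lam p₁ p₂ V (ENNReal.ofReal (2 * (a + b))) := by
  refine h₁.add_real h₂ ha hb (fun n m => ?_) (fun n m => ?_) fun n m => ?_
  · exact ite_nonneg (hV n m) le_rfl
  · exact ite_nonneg le_rfl (hV n m)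
  · split_ifs <;> simp

theorem one_le_rpow_of_one_le {lam δ : ℝ} (hlam : 1 ≤ lam) (hδ : 0 < δ) : 1 ≤ lam ^ (31 * δ) :=
  Real.one_le_rpow hlam (by positivity)

/-- The case `α₁ ≠ α₂`: the weight may be as large as `⟨k₃⟩ (1 + |k₁| + |k₂| + |k₃|)²`, but it has
to be dominated by the resonance function where `k₃` is not small. -/
theorem exists_symZ_of_ne {δ α₁ α₂ : ℝ} (hδ : 0 < δ) (hδ' : δ ≤ 1 / 12) (hα₁ : α₁ ≠ 0)
    (hα : α₁ ≠ α₂) (C₁ : ℝ) :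
    ∃ C : ℝ, 0 < C ∧ ∀ (lam B β₁ β₂ : ℝ) (V : ℤ → ℤ → ℝ), 1 ≤ lam → 0 ≤ B →
      |β₁ - β₂| ≤ 1 → (∀ n m, 0 ≤ V n m) →
      (∀ n m, V n m = 0 ∨ (-n - m ≠ 0 ∧
        V n m ^ 2 ≤ B * (bracket (freq lam (-n - m)) * size lam n m ^ 2) ∧
        (1 < |freq lam (-n - m)| → C₁ ≤ size lam n m → V n m ^ 2 ≤
          B * bracket (symResonance (wave lam α₁ β₁) (wave lam α₂ β₂) n m)))) →
      SymZ lam (wave lam α₁ β₁) (wave lam α₂ β₂) V (ENNReal.ofReal (C * (B * lam ^ (31 * δ)))) := by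
  obtain ⟨C₀, Ca, hCa, ha⟩ := exists_symZ_low_third (α₂ := α₂) hδ hδ' hα₁
  obtain ⟨Cb, hCb, hb⟩ := exists_symZ_high hδ hδ' hα₁ hα
  set M := 1 + |C₀| + |C₁| with hM
  have hM0 : 0 < M := by positivity
  have hM1 : C₀ ≤ M := by have := le_abs_self C₀; have := abs_nonneg C₁; linarith
  have hM2 : C₁ ≤ M := by have := le_abs_self C₁; have := abs_nonneg C₀; linarith
  obtain ⟨Cc, hCc, hc⟩ := exists_symZ_of_bounded hδ hδ' hM0
  refine ⟨2 * (Cc * M ^ 3 + 2 * (Ca * 2 + Cb)), by positivity,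
    fun lam B β₁ β₂ V hlam hB hβ hV0 hV => ?_⟩
  have hl1 := one_le_rpow_of_one_le hlam hδ
  classical
  have g₁ : ∀ n m, 0 ≤ if size lam n m ≤ M then 0 else V n m := fun n m =>
    ite_nonneg le_rfl (hV0 n m)
  -- all frequencies bounded, `|k₃| ≤ 1`, and the remaining part
  have p1 : SymZ lam (wave lam α₁ β₁) (wave lam α₂ β₂)
      (fun n m => if size lam n m ≤ M then V n m else 0) (ENNReal.ofReal (Cc * (B * M ^ 3))) := by
    refine hc lam (B * M ^ 3) _ _ _ (fun n m => -n - m) _ hlam (by positivity) (wave_neg _ _ _)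
      (wave_neg _ _ _) (Or.inr (Or.inr ⟨rfl, rfl⟩)) (fun n m => ?_) fun n m => ?_
    · split_ifs; exacts [hV0 n m, le_rfl]
    · split_ifs with h
      · rcases hV n m with h0 | ⟨h1, h2, -⟩
        · exact Or.inl h0
        · have hb := (bracket_le_size lam n m).2.2
          have := size_one_le lam n m
          have hbp := bracket_pos (freq lam (-n - m))
          refine Or.inr ⟨(abs_le_bracket _).trans (hb.trans h), h2.trans ?_⟩
          gcongr
          calc _ ≤ M * M ^ 2 := by gcongr; exact hb.trans h
            _ = M ^ 3 := by ring
      · exact Or.inl rfl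
  have p2 : SymZ lam (wave lam α₁ β₁) (wave lam α₂ β₂) (fun n m => if |freq lam (-n - m)| ≤ 1 then
      (if size lam n m ≤ M then 0 else V n m) else 0)
      (ENNReal.ofReal (Ca * (2 * B * lam ^ (31 * δ)))) := by
    refine ha lam (2 * B) _ _ _ hlam (by positivity) hβ (fun n m => ?_) fun n m => ?_
    · split_ifs; exacts [le_rfl, hV0 n m, le_rfl]
    · split_ifs with h h'
      · exact Or.inl rfl
      · rcases hV n m with h0 | ⟨h1, h2, -⟩
        · exact Or.inl h0
        · refine Or.inr ⟨h1, h, by linarith, h2.trans ?_⟩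
          rw [mul_comm 2 B, mul_assoc]
          gcongr
          unfold bracket; linarith
      · exact Or.inl rfl
  have p3 : SymZ lam (wave lam α₁ β₁) (wave lam α₂ β₂) (fun n m => if |freq lam (-n - m)| ≤ 1 then
      0 else (if size lam n m ≤ M then 0 else V n m)) (ENNReal.ofReal (Cb * B)) := by
    refine hb lam B _ _ _ hlam hB (fun n m => ite_nonneg le_rfl (g₁ n m)) fun n m => ?_
    split_ifs with h h'
    · exact Or.inl rfl
    · exact Or.inl rfl
    · rcases hV n m with h0 | ⟨h1, h2, h3⟩
      · exact Or.inl h0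
      · exact Or.inr ⟨by linarith, h3 (by linarith) (by linarith)⟩
  refine (SymZ.split (fun n m => size lam n m ≤ M) hV0 (by positivity) (by positivity) p1
    (SymZ.split (fun n m => |freq lam (-n - m)| ≤ 1) g₁ (by positivity)
      (by positivity) p2 p3)).mono_real ?_
  calc _ = 2 * (Cc * M ^ 3 * (B * 1) + 2 * (Ca * 2 * (B * lam ^ (31 * δ)) + Cb * (B * 1))) := by
        ring
    _ ≤ 2 * (Cc * M ^ 3 * (B * lam ^ (31 * δ)) +
        2 * (Ca * 2 * (B * lam ^ (31 * δ)) + Cb * (B * lam ^ (31 * δ)))) := by gcongr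
    _ = _ := by ring

/-- The case `α₁ = α₂`, in which the resonance function vanishes at `k₁ = 0` and at `k₂ = 0`. -/
theorem exists_symZ_of_eq {δ α : ℝ} (hδ : 0 < δ) (hδ' : δ ≤ 1 / 12) (hα : α ≠ 0) :
    ∃ C : ℝ, 0 < C ∧ ∀ (lam B β₁ β₂ : ℝ) (V : ℤ → ℤ → ℝ), 1 ≤ lam → 0 ≤ B →
      |β₁ - β₂| ≤ lam ^ (-(1 / 2) : ℝ) → (∀ n m, 0 ≤ V n m) →
      (∀ n m, V n m = 0 ∨ (n ≠ 0 ∧ -n - m ≠ 0 ∧ V n m ^ 2 ≤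
        B * (bracket (freq lam n) * bracket (freq lam m) * bracket (freq lam (-n - m))) ∧
        (m = 0 → V n m ^ 2 ≤ B))) →
      SymZ lam (wave lam α β₁) (wave lam α β₂) V (ENNReal.ofReal (C * (B * lam ^ (31 * δ)))) := by
  have ha0 : 0 < |α| := abs_pos.2 hα
  obtain ⟨C₀, Ca, hCa, ha⟩ := exists_symZ_low_third (α₂ := α) hδ hδ' hα
  obtain ⟨Cb, hCb, hb⟩ := exists_symZ_low_input hδ hδ' hα
  obtain ⟨Cd, hCd, hd⟩ := exists_symZ_high_eq hδ hδ' hα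
  set M := 10 + |C₀| + 8 / (3 * |α|) with hM
  have hM0 : 0 < M := by positivity
  have hM1 : C₀ ≤ M := by
    have := le_abs_self C₀; have : 0 < 8 / (3 * |α|) := by positivity
    linarith
  have hM2 : 10 + 8 / (3 * |α|) ≤ M := by have := abs_nonneg C₀; linarith
  have hM3 : 10 ≤ M := by have : 0 < 8 / (3 * |α|) := by positivity
                          linarith
  obtain ⟨Cc, hCc, hc⟩ := exists_symZ_of_bounded hδ hδ' hM0
  set K := 16 / (3 * |α|) with hK
  refine ⟨2 * (Cc * M ^ 3 + 2 * (Cc + 2 * (Ca * 2 + 2 * (Cb * 2 + 2 * (Cb * 2 + Cd * K))))),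
    by positivity, fun lam B β₁ β₂ V hlam hB hβ hV0 hV => ?_⟩
  have hl1 := one_le_rpow_of_one_le hlam hδ
  have hl0 : 0 < lam := by linarith
  have hβ1 : |β₁ - β₂| ≤ 1 :=
    hβ.trans (Real.rpow_le_one_of_one_le_of_nonpos hlam (by norm_num))
  classical
  -- the weights that are left after removing bounded frequencies, `k₂ = 0`, `|k₃| ≤ 1` and `|k₁| ≤
  -- 1`
  set V₁ : ℤ → ℤ → ℝ := fun n m => if size lam n m ≤ M then 0 else V n m with hV₁
  set V₂ : ℤ → ℤ → ℝ := fun n m => if m = 0 then 0 else V₁ n m with hV₂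
  set V₃ : ℤ → ℤ → ℝ := fun n m => if |freq lam (-n - m)| ≤ 1 then 0 else V₂ n m with hV₃
  set V₄ : ℤ → ℤ → ℝ := fun n m => if |freq lam n| ≤ 1 then 0 else V₃ n m with hV₄
  have g₁ : ∀ n m, 0 ≤ V₁ n m := fun n m => ite_nonneg le_rfl (hV0 n m)
  have g₂ : ∀ n m, 0 ≤ V₂ n m := fun n m => ite_nonneg le_rfl (g₁ n m)
  have g₃ : ∀ n m, 0 ≤ V₃ n m := fun n m => ite_nonneg le_rfl (g₂ n m)
  have g₄ : ∀ n m, 0 ≤ V₄ n m := fun n m => ite_nonneg le_rfl (g₃ n m)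
  have f₁ : ∀ n m, V₁ n m = 0 ∨ (V₁ n m = V n m ∧ M ≤ size lam n m) := fun n m => by
    simp only [hV₁]; split_ifs with h; exacts [Or.inl rfl, Or.inr ⟨rfl, by linarith⟩]
  have f₂ : ∀ n m, V₂ n m = 0 ∨ (V₂ n m = V n m ∧ M ≤ size lam n m ∧ m ≠ 0) := fun n m => by
    simp only [hV₂]; split_ifs with h
    · exact Or.inl rfl
    · exact (f₁ n m).imp id fun h' => ⟨h'.1, h'.2, h⟩
  have f₃ : ∀ n m, V₃ n m = 0 ∨ (V₃ n m = V n m ∧ M ≤ size lam n m ∧ m ≠ 0 ∧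
      1 < |freq lam (-n - m)|) := fun n m => by
    simp only [hV₃]; split_ifs with h
    · exact Or.inl rfl
    · exact (f₂ n m).imp id fun h' => ⟨h'.1, h'.2.1, h'.2.2, by linarith⟩
  have f₄ : ∀ n m, V₄ n m = 0 ∨ (V₄ n m = V n m ∧ M ≤ size lam n m ∧ m ≠ 0 ∧
      1 < |freq lam (-n - m)| ∧ 1 < |freq lam n|) := fun n m => by
    simp only [hV₄]; split_ifs with h
    · exact Or.inl rfl
    · exact (f₃ n m).imp id fun h' => ⟨h'.1, h'.2.1, h'.2.2.1, h'.2.2.2, by linarith⟩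
  have hbd : ∀ n m, bracket (freq lam n) * bracket (freq lam m) * bracket (freq lam (-n - m)) ≤
      size lam n m ^ 3 := fun n m => by
    obtain ⟨b1, b2, b3⟩ := bracket_le_size lam n m
    have := bracket_pos (freq lam n)
    have := bracket_pos (freq lam m)
    have := bracket_pos (freq lam (-n - m))
    have := size_one_le lam n m
    calc _ ≤ size lam n m * size lam n m * size lam n m := by gcongr
      _ = _ := by ring
  have htwo : ∀ {k : ℤ}, |freq lam k| ≤ 1 → bracket (freq lam k) ≤ 2 := fun h => by
    unfold bracket; linarith
  have p1 : SymZ lam (wave lam α β₁) (wave lam α β₂)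
      (fun n m => if size lam n m ≤ M then V n m else 0) (ENNReal.ofReal (Cc * (B * M ^ 3))) := by
    refine hc lam (B * M ^ 3) _ _ _ (fun n m => -n - m) _ hlam (by positivity) (wave_neg _ _ _)
      (wave_neg _ _ _) (Or.inr (Or.inr ⟨rfl, rfl⟩)) (fun n m => ite_nonneg (hV0 n m) le_rfl) fun n m => ?_
    split_ifs with h
    · rcases hV n m with h0 | ⟨-, -, h2, -⟩
      · exact Or.inl h0
      · have hb := (bracket_le_size lam n m).2.2
        have := size_one_le lam n m
        refine Or.inr ⟨(abs_le_bracket _).trans (hb.trans h), h2.trans ?_⟩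
        gcongr
        exact (hbd n m).trans (by gcongr)
    · exact Or.inl rfl
  have p2 : SymZ lam (wave lam α β₁) (wave lam α β₂)
      (fun n m => if m = 0 then V₁ n m else 0) (ENNReal.ofReal (Cc * B)) := by
    refine hc lam B _ _ _ (fun _ m => m) _ hlam hB (wave_neg _ _ _)
      (wave_neg _ _ _) (Or.inr (Or.inl ⟨rfl, rfl⟩)) (fun n m => ite_nonneg (g₁ n m) le_rfl) fun n m => ?_
    split_ifs with h
    · rcases f₁ n m with h0 | ⟨h0, -⟩
      · exact Or.inl h0
      rw [h0]
      rcases hV n m with h0 | ⟨-, -, -, h2⟩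
      · exact Or.inl h0
      · refine Or.inr ⟨?_, h2 h⟩
        rw [h, freq]; simpa using hM0.le
    · exact Or.inl rfl
  have p3 : SymZ lam (wave lam α β₁) (wave lam α β₂)
      (fun n m => if |freq lam (-n - m)| ≤ 1 then V₂ n m else 0)
      (ENNReal.ofReal (Ca * (2 * B * lam ^ (31 * δ)))) := by
    refine ha lam (2 * B) _ _ _ hlam (by positivity) hβ1 (fun n m => ite_nonneg (g₂ n m) le_rfl) fun n m => ?_
    split_ifs with h
    · rcases f₂ n m with h0 | ⟨h0, h3, -⟩
      · exact Or.inl h0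
      rw [h0]
      rcases hV n m with h0 | ⟨-, h1, h2, -⟩
      · exact Or.inl h0
      refine Or.inr ⟨h1, h, hM1.trans h3, h2.trans ?_⟩
      obtain ⟨b1, b2, b3⟩ := bracket_le_size lam n m
      have := bracket_pos (freq lam n)
      have := bracket_pos (freq lam m)
      have := bracket_pos (freq lam (-n - m))
      have := size_one_le lam n m
      calc _ ≤ B * (size lam n m * size lam n m * 2) := by gcongr; exact htwo h
        _ = _ := by ring
    · exact Or.inl rfl
  have p4 : SymZ lam (wave lam α β₁) (wave lam α β₂)
      (fun n m => if |freq lam n| ≤ 1 then V₃ n m else 0)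
      (ENNReal.ofReal (Cb * (2 * B * lam ^ (31 * δ)))) := by
    refine hb lam (2 * B) _ _ _ (fun n _ => n) _ (fun _ m => freq lam m) hlam (by positivity) hβ
      (fun n m => ite_nonneg (g₃ n m) le_rfl) (Or.inl ⟨rfl, rfl⟩) (fun n m => ?_) (fun n m => rfl)
      (fun n m => rfl) (fun n m => rfl) fun n m => ?_
    · rw [freq_neg_sub]; ring
    split_ifs with h
    · rcases f₃ n m with h0 | ⟨h0, h3, -⟩
      · exact Or.inl h0
      rw [h0]
      rcases hV n m with h0 | ⟨h1, -, h2, -⟩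
      · exact Or.inl h0
      refine Or.inr ⟨h1, h, hM3.trans h3, h2.trans ?_⟩
      obtain ⟨b1, b2, b3⟩ := bracket_le_size lam n m
      have := bracket_pos (freq lam n)
      have := bracket_pos (freq lam m)
      have := bracket_pos (freq lam (-n - m))
      have := size_one_le lam n m
      calc _ ≤ B * (2 * size lam n m * size lam n m) := by gcongr; exact htwo h
        _ = _ := by ring
    · exact Or.inl rfl
  have p5 : SymZ lam (wave lam α β₁) (wave lam α β₂)
      (fun n m => if |freq lam m| ≤ 1 then V₄ n m else 0)
      (ENNReal.ofReal (Cb * (2 * B * lam ^ (31 * δ)))) := by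
    refine hb lam (2 * B) _ _ _ (fun _ m => m) _ (fun n _ => freq lam n) hlam (by positivity) hβ
      (fun n m => ite_nonneg (g₄ n m) le_rfl) (Or.inr (Or.inl ⟨rfl, rfl⟩)) (fun n m => ?_)
      (fun n m => rfl) (fun n m => mul_comm _ _) (fun n m => by rw [size]; ring) fun n m => ?_
    · rw [freq_neg_sub]; ring
    split_ifs with h
    · rcases f₄ n m with h0 | ⟨h0, h3, h4, -⟩
      · exact Or.inl h0
      rw [h0]
      rcases hV n m with h0 | ⟨h1, -, h2, -⟩
      · exact Or.inl h0
      refine Or.inr ⟨h4, h, hM3.trans h3, h2.trans ?_⟩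
      obtain ⟨b1, b2, b3⟩ := bracket_le_size lam n m
      have := bracket_pos (freq lam n)
      have := bracket_pos (freq lam m)
      have := bracket_pos (freq lam (-n - m))
      have := size_one_le lam n m
      calc _ ≤ B * (size lam n m * 2 * size lam n m) := by gcongr; exact htwo h
        _ = _ := by ring
    · exact Or.inl rfl
  -- all three frequencies exceed `1`, and `|H|` is comparable to `|k₁ k₂ k₃|`
  have p6 : SymZ lam (wave lam α β₁) (wave lam α β₂)
      (fun n m => if |freq lam m| ≤ 1 then 0 else V₄ n m) (ENNReal.ofReal (Cd * (B * K))) := by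
    refine hd lam (B * K) _ _ _ hlam (by positivity) (fun n m => ite_nonneg le_rfl (g₄ n m))
      fun n m => ?_
    split_ifs with h
    · exact Or.inl rfl
    rcases f₄ n m with h0 | ⟨h0, h3, h4, hz, hx⟩
    · exact Or.inl h0
    rw [h0]
    rcases hV n m with h0 | ⟨h1, -, h2, -⟩
    · exact Or.inl h0
    have hy : 1 < |freq lam m| := not_le.1 h
    refine Or.inr ⟨hx, hy, hz, h2.trans ?_⟩
    rw [mul_assoc B K]
    refine mul_le_mul_of_nonneg_left ?_ hB
    rw [symResonance_wave]
    have hs := h3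
    have htri := abs_freq_le_abs_add lam n m
    unfold size at hs
    set x := freq lam n
    set y := freq lam m
    set z := freq lam (-n - m)
    have i1 : 4 / (3 * |α|) ≤ |x| * |y| * 2 := by
      have : 8 / (3 * |α|) = 2 * (4 / (3 * |α|)) := by ring
      nlinarith
    have i2 : 2 ≤ 3 * |α| * (|x| * |y|) := by
      have : 4 / (3 * |α|) / 2 ≤ |x| * |y| := by linarith
      calc (2 : ℝ) = 3 * |α| * (4 / (3 * |α|) / 2) := by field_simp; norm_num
        _ ≤ _ := by gcongr
    have i3 := abs_sub_abs_le_abs_sub (3 * α * (x * y)) (-(β₁ - β₂))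
    rw [abs_neg, sub_neg_eq_add, abs_mul, abs_mul, abs_mul,
      abs_of_pos (by norm_num : (0 : ℝ) < 3)] at i3
    have i4 : 3 * |α| / 2 * (|x| * |y|) * |z| ≤
        bracket ((α - α) * z ^ 3 + 3 * α * x * y * z + (β₁ - β₂) * z) := by
      refine le_trans ?_ (abs_le_bracket _)
      rw [show (α - α) * z ^ 3 + 3 * α * x * y * z + (β₁ - β₂) * z =
        (3 * α * (x * y) + (β₁ - β₂)) * z by ring, abs_mul]
      gcongr
      linarith
    calc bracket x * bracket y * bracket z ≤ (2 * |x|) * (2 * |y|) * (2 * |z|) := by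
          unfold bracket; gcongr <;> linarith
      _ = K * (3 * |α| / 2 * (|x| * |y|) * |z|) := by rw [hK]; field_simp; norm_num
      _ ≤ _ := by gcongr
  refine (SymZ.split (fun n m => size lam n m ≤ M) hV0 (by positivity) (by positivity) p1
    (SymZ.split (fun n m => m = 0) g₁ (by positivity) (by positivity) p2
    (SymZ.split (fun n m => |freq lam (-n - m)| ≤ 1) g₂ (by positivity)
      (by positivity) p3
    (SymZ.split (fun n m => |freq lam n| ≤ 1) g₃ (by positivity)
      (by positivity) p4
    (SymZ.split (fun n m => |freq lam m| ≤ 1) g₄ (by positivity)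
      (by positivity) p5 p6))))).mono_real ?_
  have hBl : B ≤ B * lam ^ (31 * δ) := le_mul_of_one_le_right hB hl1
  calc _ = 2 * (Cc * M ^ 3 * B + 2 * (Cc * B + 2 * (Ca * 2 * (B * lam ^ (31 * δ)) +
        2 * (Cb * 2 * (B * lam ^ (31 * δ)) + 2 * (Cb * 2 * (B * lam ^ (31 * δ)) + Cd * K * B))))) := by
        ring
    _ ≤ 2 * (Cc * M ^ 3 * (B * lam ^ (31 * δ)) + 2 * (Cc * (B * lam ^ (31 * δ)) +
        2 * (Ca * 2 * (B * lam ^ (31 * δ)) + 2 * (Cb * 2 * (B * lam ^ (31 * δ)) +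
        2 * (Cb * 2 * (B * lam ^ (31 * δ)) + Cd * K * (B * lam ^ (31 * δ))))))) := by gcongr
    _ = _ := by ring

/-! ### The neighbourhood of the resonant lines -/

/-- Both factors decay faster than the first power, except for the factor `⟨h⟩^{-1+4δ}` in front,
which is left to be bounded pointwise. -/
theorem bracket_rpow_mul_rpow_le {δ h a : ℝ} (hδ : 0 < δ) (hδ' : δ ≤ 1 / 12) :
    bracket h ^ (-1 : ℝ) * bracket (h - a) ^ (-(1 - 3 * δ)) ≤ bracket h ^ (-(1 - 4 * δ)) *
      (bracket h ^ (-(1 + δ)) + bracket (h - a) ^ (-(1 + δ))) := by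
  have hX := bracket_pos h
  have hY := bracket_pos (h - a)
  rcases le_total (bracket h) (bracket (h - a)) with hle | hle
  · calc _ ≤ bracket h ^ (-1 : ℝ) * bracket h ^ (-(1 - 3 * δ)) := by
          gcongr ?_ * ?_
          exact Real.rpow_le_rpow_of_nonpos hX hle (by linarith)
      _ = bracket h ^ (-(1 - 4 * δ)) * bracket h ^ (-(1 + δ)) := by
          rw [← Real.rpow_add hX, ← Real.rpow_add hX]; congr 1; ring
      _ ≤ _ := by gcongr; linarith [Real.rpow_pos_of_pos hY (-(1 + δ))]
  · calc _ = bracket h ^ (-(1 - 4 * δ)) * bracket h ^ (-(4 * δ)) *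
          bracket (h - a) ^ (-(1 - 3 * δ)) := by
          rw [← Real.rpow_add hX]; congr 2; ring
      _ ≤ bracket h ^ (-(1 - 4 * δ)) * bracket (h - a) ^ (-(4 * δ)) *
          bracket (h - a) ^ (-(1 - 3 * δ)) := by
          gcongr ?_ * ?_ * ?_
          exact Real.rpow_le_rpow_of_nonpos hY hle (by linarith)
      _ = bracket h ^ (-(1 - 4 * δ)) * bracket (h - a) ^ (-(1 + δ)) := by
          rw [mul_assoc, ← Real.rpow_add hY]; congr 2; ring
      _ ≤ _ := by gcongr; linarith [Real.rpow_pos_of_pos hX (-(1 + δ))]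

/-- The sum over a slice of a neighbourhood of a resonant line, on which all frequencies are
comparable to the number `κ`. The resonance function is separated, with rate `κ² / λ`, and it is
bounded below because the slope of the resonant line is badly approximable. -/
theorem exists_tsum_resonant_le {δ μ s c₁ c₂ : ℝ} (hδ : 0 < δ) (hδ' : δ ≤ 1 / 12) (hμ : 2 ≤ μ)
    (hsμ : 4 * δ ≤ 2 * s + 1 - μ) (hc₁ : 0 < c₁) (hc₂ : 0 < c₂) :
    ∃ C : ℝ, 0 < C ∧ ∀ (lam κ B a : ℝ) (S : Set ℤ) (h v : ℤ → ℝ), 1 ≤ lam → 1 ≤ κ → 0 ≤ B →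
      (∀ t ∈ S, ∀ t' ∈ S, c₁ * κ ^ 2 / lam * |(t : ℝ) - t'| ≤ |h t - h t'|) →
      (∀ t ∈ S, c₂ * κ ^ (3 - μ) * lam ^ (-μ) ≤ |h t|) →
      (∀ t ∈ S, v t ≤ B * κ ^ (2 - 2 * s)) → (∀ t, 0 ≤ v t) →
      ∑' t, ENNReal.ofReal (S.indicator (fun t => v t * bracket (h t) ^ (-1 : ℝ) *
        bracket (h t - a) ^ (-(1 - 3 * δ))) t) ≤
        ENNReal.ofReal lam * ENNReal.ofReal (C * (B * lam ^ (μ - 1))) := by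
  obtain ⟨K, hK, hsum⟩ := exists_tsum_separated_le (γ := 1) (θ := 1 + δ) one_pos (by linarith)
    (by linarith)
  set E := (1 + c₂ ^ (-(1 - 4 * δ))) with hE
  have hE0 : 0 < c₂ ^ (-(1 - 4 * δ)) := Real.rpow_pos_of_pos hc₂ _
  have hE1 : 1 ≤ E := by linarith
  refine ⟨E * (2 * K * ((1 + 1 / c₁) * 2)), by positivity,
    fun lam κ B a S h v hlam hκ hB hsep hlow hv hv0 => ?_⟩
  have hl : 0 < lam := by linarith
  have hκ0 : 0 < κ := by linarith
  have hD : 0 < c₁ * κ ^ 2 / lam := by positivity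
  set g : ℝ → ℤ → ℝ := fun a => S.indicator fun t => bracket (h t - a) ^ (-(1 + δ)) with hg
  have hS : ∀ a, ∑' t, ENNReal.ofReal (g a t) ≤
      ENNReal.ofReal (K * (1 + lam / (c₁ * κ ^ 2))) := by
    intro a
    have := hsum S h (c₁ * κ ^ 2 / lam) a hD (fun n hn n' hn' => by
      rw [Real.rpow_one]; exact hsep n hn n' hn')
    rwa [show (-(1 / 1) : ℝ) = -1 by norm_num, Real.rpow_neg_one, inv_div] at this
  have hg0 : ∀ a t, 0 ≤ g a t := fun a t => indicator_bracket_nonneg _ _ _ _ _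
  -- two bounds for the factor in front, of which the first is used for `κ² ≤ λ`
  have main : ∀ G : ℝ, 0 ≤ G → (∀ t ∈ S, v t * bracket (h t) ^ (-(1 - 4 * δ)) ≤ G) →
      G * (2 * K * (1 + lam / (c₁ * κ ^ 2))) ≤ lam * (E * (2 * K * ((1 + 1 / c₁) * 2)) *
        (B * lam ^ (μ - 1))) →
      ∑' t, ENNReal.ofReal (S.indicator (fun t => v t * bracket (h t) ^ (-1 : ℝ) *
        bracket (h t - a) ^ (-(1 - 3 * δ))) t) ≤
        ENNReal.ofReal lam * ENNReal.ofReal (E * (2 * K * ((1 + 1 / c₁) * 2)) *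
          (B * lam ^ (μ - 1))) := by
    intro G hG hGv hGl
    calc _ ≤ ∑' t, ENNReal.ofReal G * (ENNReal.ofReal (g 0 t) + ENNReal.ofReal (g a t)) := by
          refine ENNReal.tsum_le_tsum fun t => ?_
          rw [← ENNReal.ofReal_add (hg0 _ _) (hg0 _ _), ← ENNReal.ofReal_mul hG]
          refine ENNReal.ofReal_le_ofReal ?_
          by_cases ht : t ∈ S
          · simp only [hg, Set.indicator_of_mem ht, sub_zero]
            have hX := bracket_pos (h t)
            have hY := bracket_pos (h t - a)
            calc _ = v t * (bracket (h t) ^ (-1 : ℝ) * bracket (h t - a) ^ (-(1 - 3 * δ))) := by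
                  ring
              _ ≤ v t * (bracket (h t) ^ (-(1 - 4 * δ)) *
                  (bracket (h t) ^ (-(1 + δ)) + bracket (h t - a) ^ (-(1 + δ)))) :=
                  mul_le_mul_of_nonneg_left (bracket_rpow_mul_rpow_le hδ hδ') (hv0 t)
              _ = v t * bracket (h t) ^ (-(1 - 4 * δ)) *
                  (bracket (h t) ^ (-(1 + δ)) + bracket (h t - a) ^ (-(1 + δ))) := by ring
              _ ≤ _ := by
                  gcongr ?_ * _
                  exact hGv t ht
          · simp [hg, Set.indicator_of_notMem ht]
      _ ≤ ENNReal.ofReal G * (ENNReal.ofReal (K * (1 + lam / (c₁ * κ ^ 2))) +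
            ENNReal.ofReal (K * (1 + lam / (c₁ * κ ^ 2)))) := by
          rw [ENNReal.tsum_mul_left, ENNReal.tsum_add]
          gcongr
          exacts [hS 0, hS a]
      _ ≤ _ := by
          rw [← ENNReal.ofReal_add (by positivity) (by positivity), ← ENNReal.ofReal_mul hG,
            ← ENNReal.ofReal_mul hl.le]
          refine ENNReal.ofReal_le_ofReal (le_trans (le_of_eq ?_) hGl)
          ring
  have hpow1 : 1 ≤ lam ^ (μ - 1) := Real.one_le_rpow hlam (by linarith)
  rcases le_total (κ ^ 2) lam with hκl | hκl
  -- for `κ² ≤ λ` the weight `κ^{2-2s} ≤ κ²` is compensated by the separation constant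
  · refine main (B * κ ^ (2 - 2 * s)) (by positivity) (fun t ht => ?_) ?_
    · exact (mul_le_of_le_one_right (hv0 t) (rpow_bracket_le_one (by linarith))).trans (hv t ht)
    · have h1 : κ ^ (2 - 2 * s) ≤ κ ^ 2 := by
        rw [← Real.rpow_natCast κ 2]
        exact Real.rpow_le_rpow_of_exponent_le hκ (by push_cast; linarith)
      have h2 : κ ^ 2 * (1 + lam / (c₁ * κ ^ 2)) ≤ lam * ((1 + 1 / c₁) * 2) := by
        have : κ ^ 2 * (1 + lam / (c₁ * κ ^ 2)) = κ ^ 2 + lam / c₁ := by field_simp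
        rw [this]
        have : 0 < lam / c₁ := by positivity
        have e : lam * ((1 + 1 / c₁) * 2) = 2 * lam + 2 * (lam / c₁) := by ring
        rw [e]; linarith
      calc _ ≤ B * κ ^ 2 * (2 * K * (1 + lam / (c₁ * κ ^ 2))) := by gcongr
        _ = 1 * (B * 1) * (2 * K) * (κ ^ 2 * (1 + lam / (c₁ * κ ^ 2))) := by ring
        _ ≤ E * (B * lam ^ (μ - 1)) * (2 * K) * (lam * ((1 + 1 / c₁) * 2)) := by gcongr
        _ = _ := by ring
  -- for `κ² ≥ λ` the lower bound for `|h|` is used; its power of `κ` compensates the weight because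
  -- of `μ < 2 s + 1`
  · refine main (B * (c₂ ^ (-(1 - 4 * δ)) * lam ^ μ)) (by positivity) (fun t ht => ?_) ?_
    · have hlow' := hlow t ht
      have hpos : 0 < c₂ * κ ^ (3 - μ) * lam ^ (-μ) := by positivity
      have h1 : bracket (h t) ^ (-(1 - 4 * δ)) ≤
          (c₂ * κ ^ (3 - μ) * lam ^ (-μ)) ^ (-(1 - 4 * δ)) :=
        Real.rpow_le_rpow_of_nonpos hpos (hlow'.trans (abs_le_bracket _)) (by linarith)
      rw [Real.mul_rpow (by positivity) (by positivity), Real.mul_rpow hc₂.le (by positivity),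
        ← Real.rpow_mul hκ0.le, ← Real.rpow_mul hl.le] at h1
      have h2 : lam ^ (-μ * -(1 - 4 * δ)) ≤ lam ^ μ :=
        Real.rpow_le_rpow_of_exponent_le hlam (by nlinarith)
      have h3 : κ ^ (2 - 2 * s) * κ ^ ((3 - μ) * -(1 - 4 * δ)) ≤ 1 := by
        rw [← Real.rpow_add hκ0]
        exact Real.rpow_le_one_of_one_le_of_nonpos hκ (by nlinarith)
      calc _ ≤ B * κ ^ (2 - 2 * s) * (c₂ ^ (-(1 - 4 * δ)) * κ ^ ((3 - μ) * -(1 - 4 * δ)) *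
            lam ^ (-μ * -(1 - 4 * δ))) := by
            refine mul_le_mul (hv t ht) h1 (Real.rpow_nonneg (bracket_pos _).le _) (by positivity)
        _ = B * (c₂ ^ (-(1 - 4 * δ)) * (κ ^ (2 - 2 * s) * κ ^ ((3 - μ) * -(1 - 4 * δ))) *
            lam ^ (-μ * -(1 - 4 * δ))) := by ring
        _ ≤ B * (c₂ ^ (-(1 - 4 * δ)) * 1 * lam ^ μ) := by gcongr
        _ = _ := by ring
    · have h1 : 1 + lam / (c₁ * κ ^ 2) ≤ (1 + 1 / c₁) * 2 := by
        have h3 : lam / (c₁ * κ ^ 2) ≤ 1 / c₁ := by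
          rw [div_le_div_iff₀ (by positivity) hc₁]
          nlinarith
        have : 0 < 1 / c₁ := by positivity
        linarith
      have h2 : lam ^ μ = lam * lam ^ (μ - 1) := by
        rw [Real.rpow_sub_one hl.ne']; field_simp
      calc _ ≤ B * (E * lam ^ μ) * (2 * K * ((1 + 1 / c₁) * 2)) := by
            gcongr
            linarith
        _ = _ := by rw [h2]; ring

/-- The divided difference of `z (36 x² + 36 x z - R (R + 6) z²)` with respect to `z`, near the
line `6 x = R z`. -/
theorem divided_difference_lower {R : ℝ} (hR : R ≠ 0) (hR' : R + 3 ≠ 0) :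
    ∃ η c : ℝ, 0 < η ∧ 0 < c ∧ ∀ x z z' : ℝ, |6 * x - R * z| ≤ η * |x| →
      |6 * x - R * z'| ≤ η * |x| → c * |x| ^ 2 * |z - z'| ≤
        |z * (36 * x ^ 2 + 36 * x * z - R * (R + 6) * z ^ 2) -
          z' * (36 * x ^ 2 + 36 * x * z' - R * (R + 6) * z' ^ 2)| := by
  have h3 : 0 < |R + 3| := abs_pos.2 hR'
  have h0 : 0 < |R| := abs_pos.2 hR
  set η := min 1 (36 * |R + 3| / (72 + 39 * |R + 6|)) with hη
  have hη0 : 0 < η := lt_min one_pos (by positivity)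
  have hη1 : η ≤ 1 := min_le_left _ _
  have hη2 : η * (72 + 39 * |R + 6|) ≤ 36 * |R + 3| := by
    rw [← le_div_iff₀ (by positivity)]; exact min_le_right _ _
  refine ⟨η, 36 * |R + 3| / |R|, hη0, by positivity, fun x z z' he he' => ?_⟩
  set e := 6 * x - R * z with hedef
  set e' := 6 * x - R * z' with hedef'
  have hx := abs_nonneg x
  set D := 36 * x ^ 2 + 36 * x * (z + z') - R * (R + 6) * (z ^ 2 + z * z' + z' ^ 2) with hD
  have e1 : z * (36 * x ^ 2 + 36 * x * z - R * (R + 6) * z ^ 2) -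
      z' * (36 * x ^ 2 + 36 * x * z' - R * (R + 6) * z' ^ 2) = D * (z - z') := by
    rw [hD]; ring
  -- with `e = 6 x - R z` and `e' = 6 x - R z'`, the main term is the value for `e = e' = 0`, and
  -- all other terms contain a factor `e` or `e'`
  have e2 : R * D = -(72 * (R + 3) * x ^ 2) + (-36 * x * (e + e') +
      (R + 6) * (18 * x * (e + e') - (e ^ 2 + e * e' + e' ^ 2))) := by
    rw [hD, hedef, hedef']; ring
  have b1 : |e + e'| ≤ 2 * (η * |x|) := (abs_add_le _ _).trans (by linarith)
  have b2 : |e ^ 2 + e * e' + e' ^ 2| ≤ 3 * (η * |x| ^ 2) := by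
    have hsq : ∀ p q : ℝ, |p| ≤ η * |x| → |q| ≤ η * |x| → |p * q| ≤ η * |x| ^ 2 := by
      intro p q hp hq
      rw [abs_mul]
      calc |p| * |q| ≤ (η * |x|) * (1 * |x|) := by
            gcongr; exact hq.trans (by gcongr)
        _ = _ := by ring
    have h1 := hsq e e he he
    have h2 := hsq e e' he he'
    have h3 := hsq e' e' he' he'
    rw [pow_two, pow_two]
    exact (abs_add_le _ _).trans (by linarith [abs_add_le (e * e) (e * e')])
  have b3 : |-36 * x * (e + e') + (R + 6) * (18 * x * (e + e') - (e ^ 2 + e * e' + e' ^ 2))| ≤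
      η * (72 + 39 * |R + 6|) * |x| ^ 2 := by
    have t1 : |-36 * x * (e + e')| ≤ 36 * |x| * (2 * (η * |x|)) := by
      rw [abs_mul, abs_mul, abs_neg, abs_of_pos (by norm_num : (0 : ℝ) < 36)]; gcongr
    have t2 : |18 * x * (e + e') - (e ^ 2 + e * e' + e' ^ 2)| ≤
        18 * |x| * (2 * (η * |x|)) + 3 * (η * |x| ^ 2) := by
      refine (abs_sub _ _).trans (add_le_add ?_ b2)
      rw [abs_mul, abs_mul, abs_of_pos (by norm_num : (0 : ℝ) < 18)]; gcongr
    refine (abs_add_le _ _).trans ?_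
    rw [abs_mul (R + 6)]
    calc _ ≤ 36 * |x| * (2 * (η * |x|)) +
          |R + 6| * (18 * |x| * (2 * (η * |x|)) + 3 * (η * |x| ^ 2)) := by gcongr
      _ = _ := by ring
  have b4 := abs_sub_abs_le_abs_sub (-(72 * (R + 3) * x ^ 2)) (-(-36 * x * (e + e') +
      (R + 6) * (18 * x * (e + e') - (e ^ 2 + e * e' + e' ^ 2))))
  rw [sub_neg_eq_add, ← e2, abs_neg, abs_neg, abs_mul, abs_mul, abs_mul,
    abs_of_pos (by norm_num : (0 : ℝ) < 72), abs_of_nonneg (sq_nonneg x), ← sq_abs x] at b4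
  have b5 : 36 * |R + 3| * |x| ^ 2 ≤ |R| * |D| := by
    have : η * (72 + 39 * |R + 6|) * |x| ^ 2 ≤ 36 * |R + 3| * |x| ^ 2 := by gcongr
    linarith
  rw [e1, abs_mul]
  gcongr
  rw [div_mul_eq_mul_div, div_le_iff₀ h0]
  linarith

/-- For `β₁ = β₂` the resonance function splits into linear factors: besides `k₃ = 0` its zeros are
the two resonant lines `3 (k₁ - k₂) = ± ρ k₃`, `ρ = √(12 r - 3)`. -/
theorem wave_resonance_eq {lam α₁ α₂ β ρ : ℝ} (hρ : α₁ * ρ ^ 2 = 12 * α₂ - 3 * α₁) (n m : ℤ) :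
    symResonance (wave lam α₁ β) (wave lam α₂ β) n m = -(α₁ / 12) * freq lam (-n - m) *
      ((3 * (freq lam n - freq lam m) - ρ * freq lam (-n - m)) *
        (3 * (freq lam n - freq lam m) + ρ * freq lam (-n - m))) := by
  have h2 : α₂ = (α₁ * ρ ^ 2 + 3 * α₁) / 12 := by rw [hρ]; ring
  rw [symResonance_wave, h2, freq_neg_sub]; ring

/-- The neighbourhood of a resonant line `3 (k₁ - k₂) = ρ k₃`, if `ρ` is badly approximable by
rational numbers. -/
theorem exists_symZ_resonant {δ α₁ α₂ ρ μ s c c₀ : ℝ} (hδ : 0 < δ) (hδ' : δ ≤ 1 / 12)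
    (hα₁ : α₁ ≠ 0) (hρ : α₁ * ρ ^ 2 = 12 * α₂ - 3 * α₁) (hρ0 : ρ ≠ 0) (hρ1 : ρ ≠ 3)
    (hρ2 : ρ ≠ -3) (hμ : 2 ≤ μ) (hμ' : μ ≤ 3) (hs : s ≤ 1)
    (hsμ : 4 * δ ≤ 2 * s + 1 - μ) (hc : 0 < c) (hc₀ : 0 < c₀)
    (hdio : ∀ j k : ℤ, k ≠ 0 → c₀ * |(k : ℝ)| ^ (-μ) ≤ |ρ - j / k|) :
    ∃ η₀ C : ℝ, 0 < η₀ ∧ 0 < C ∧ ∀ (η lam B β : ℝ) (V : ℤ → ℤ → ℝ), η ≤ η₀ → 1 ≤ lam → 0 ≤ B →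
      (∀ n m, 0 ≤ V n m) →
      (∀ n m, V n m = 0 ∨ (1 ≤ c * size lam n m ∧ c * size lam n m ≤ |freq lam n| ∧
        c * size lam n m ≤ |freq lam m| ∧ c * size lam n m ≤ |freq lam (-n - m)| ∧
        |3 * (freq lam n - freq lam m) - ρ * freq lam (-n - m)| ≤ η * size lam n m ∧
        V n m ^ 2 ≤ B * size lam n m ^ (2 - 2 * s))) →
      SymZ lam (wave lam α₁ β) (wave lam α₂ β) V (ENNReal.ofReal (C * (B * lam ^ (μ - 1)))) := by
  have ha : 0 < |α₁| := abs_pos.2 hα₁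
  have hr : 0 < |ρ| := abs_pos.2 hρ0
  -- in terms of `x = k₁` and `z = k₃` the resonant line is `6 x = (ρ - 3) z`, in terms of `x = k₂`
  -- it is `6 x = (-ρ - 3) z`
  obtain ⟨η₁, d₁, hη₁, hd₁, hdiff₁⟩ := divided_difference_lower (R := ρ - 3)
    (sub_ne_zero.2 hρ1) (by simpa using hρ0)
  obtain ⟨η₂, d₂, hη₂, hd₂, hdiff₂⟩ := divided_difference_lower (R := -ρ - 3)
    (fun h => hρ2 (by linarith)) (by simpa using hρ0)
  -- the rate of separation, and the lower bound for the resonance function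
  set cs := min (|α₁| * |ρ| / 2) (min (|α₁| / 12 * d₁) (|α₁| / 12 * d₂)) with hcs
  have hcs0 : 0 < cs := lt_min (by positivity) (lt_min (by positivity) (by positivity))
  set cl := |α₁| / 12 * c₀ * |ρ| * c ^ (3 - μ) with hcl
  have hcl0 : 0 < cl := by positivity
  obtain ⟨C, hC, hsum⟩ := exists_tsum_resonant_le hδ hδ' hμ hsμ hcs0 hcl0
  refine ⟨c * min (|ρ| / 2) (min η₁ η₂),
    ((critConst δ).toReal + 1) * (C * (1 / c) ^ (2 - 2 * s)), by positivity, by positivity,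
    fun η lam B β V hη hlam hB hV0 hV => ?_⟩
  have hl : 0 < lam := by linarith
  have hηρ : ∀ {N t : ℝ}, 0 ≤ N → c * N ≤ t → η * N ≤ |ρ| / 2 * t ∧ η * N ≤ η₁ * t ∧
      η * N ≤ η₂ * t := by
    intro N t hN hNt
    have h1 : η * N ≤ min (|ρ| / 2) (min η₁ η₂) * (c * N) := by
      calc η * N ≤ c * min (|ρ| / 2) (min η₁ η₂) * N := by gcongr
        _ = _ := by ring
    have h2 : 0 ≤ c * N := by positivity
    refine ⟨h1.trans ?_, h1.trans ?_, h1.trans ?_⟩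
    · exact mul_le_mul (min_le_left _ _) hNt h2 (by positivity)
    · exact mul_le_mul ((min_le_right _ _).trans (min_le_left _ _)) hNt h2 (by positivity)
    · exact mul_le_mul ((min_le_right _ _).trans (min_le_right _ _)) hNt h2 (by positivity)
  set H := symResonance (wave lam α₁ β) (wave lam α₂ β) with hH
  have hHeq : ∀ n m, H n m = -(α₁ / 12) * freq lam (-n - m) *
      ((3 * (freq lam n - freq lam m) - ρ * freq lam (-n - m)) *
        (3 * (freq lam n - freq lam m) + ρ * freq lam (-n - m))) :=
    fun n m => wave_resonance_eq hρ n m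
  set Z : Set (ℤ × ℤ) := {q | 1 ≤ c * size lam q.1 q.2 ∧ c * size lam q.1 q.2 ≤ |freq lam q.1| ∧
    c * size lam q.1 q.2 ≤ |freq lam q.2| ∧ c * size lam q.1 q.2 ≤ |freq lam (-q.1 - q.2)| ∧
    |3 * (freq lam q.1 - freq lam q.2) - ρ * freq lam (-q.1 - q.2)| ≤ η * size lam q.1 q.2 ∧
    V q.1 q.2 ^ 2 ≤ B * size lam q.1 q.2 ^ (2 - 2 * s)} with hZ
  -- the lower bound for the resonance function
  have hlow : ∀ n m, (n, m) ∈ Z → ∀ κ, 0 < κ → κ ≤ size lam n m →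
      cl * κ ^ (3 - μ) * lam ^ (-μ) ≤ |H n m| := by
    rintro n m ⟨h1, -, -, h4, h5, -⟩ κ hκ hκN
    simp only at h1 h4 h5
    have hN0 : 0 ≤ size lam n m := by have := size_one_le lam n m; linarith
    obtain ⟨r1, -, -⟩ := hηρ hN0 h4
    have hz0 : 0 < |freq lam (-n - m)| := by linarith
    have hk0 : -n - m ≠ 0 := by
      intro h; rw [h] at hz0; simp [freq] at hz0
    set z := freq lam (-n - m) with hz
    set w := 3 * (freq lam n - freq lam m) with hw
    have i1 : |ρ| * |z| ≤ |w + ρ * z| := by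
      have := abs_sub_abs_le_abs_sub (2 * (ρ * z)) (-(w - ρ * z))
      rw [abs_neg, abs_mul, abs_two, abs_mul, show 2 * (ρ * z) - -(w - ρ * z) = w + ρ * z by ring]
        at this
      nlinarith
    -- the Diophantine bound for the fraction `3 (n - m) / (-n - m)`, whose denominator is `λ |z|`
    -- in absolute value
    have i2 : c₀ * |z| ^ (1 - μ) * lam ^ (-μ) ≤ |w - ρ * z| := by
      have := hdio (3 * (n - m)) (-n - m) hk0
      have e1 : w - ρ * z = -(z * (ρ - ((3 * (n - m) : ℤ) : ℝ) / ((-n - m : ℤ) : ℝ))) := by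
        have : ((-n - m : ℤ) : ℝ) ≠ 0 := by exact_mod_cast hk0
        rw [hw, hz]
        simp only [freq]
        field_simp
        push_cast; ring
      have e2 : |((-n - m : ℤ) : ℝ)| = lam * |z| := by
        rw [hz, freq, abs_div, abs_of_pos hl]; field_simp
      rw [e2, Real.mul_rpow hl.le (abs_nonneg _)] at this
      rw [e1, abs_neg, abs_mul]
      calc c₀ * |z| ^ (1 - μ) * lam ^ (-μ) = |z| * (c₀ * (lam ^ (-μ) * |z| ^ (-μ))) := by
            rw [sub_eq_add_neg, Real.rpow_add hz0, Real.rpow_one]; ring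
        _ ≤ _ := by gcongr
    rw [hHeq, abs_mul, abs_mul, abs_mul, abs_neg, abs_div,
      abs_of_pos (by norm_num : (0 : ℝ) < 12)]
    have i3 : (c * κ) ^ (3 - μ) ≤ |z| ^ (3 - μ) := by
      refine Real.rpow_le_rpow (by positivity) ?_ (by linarith)
      exact le_trans (by gcongr) h4
    calc cl * κ ^ (3 - μ) * lam ^ (-μ)
        = |α₁| / 12 * c₀ * |ρ| * (c * κ) ^ (3 - μ) * lam ^ (-μ) := by
          rw [Real.mul_rpow hc.le hκ.le, hcl]; ring
      _ ≤ |α₁| / 12 * c₀ * |ρ| * |z| ^ (3 - μ) * lam ^ (-μ) := by gcongr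
      _ = |α₁| / 12 * |z| * ((c₀ * |z| ^ (1 - μ) * lam ^ (-μ)) * (|ρ| * |z|)) := by
          rw [show 3 - μ = (1 - μ) + 1 + 1 by ring, Real.rpow_add_one hz0.ne',
            Real.rpow_add_one hz0.ne']
          ring
      _ ≤ _ := by gcongr
  have hweight : ∀ n m, (n, m) ∈ Z → ∀ κ, c * size lam n m ≤ κ →
      V n m ^ 2 ≤ B * (1 / c) ^ (2 - 2 * s) * κ ^ (2 - 2 * s) := by
    rintro n m ⟨h1, -, -, -, -, h6⟩ κ hκ
    simp only at h1 h6
    have hN := size_one_le lam n m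
    have hκ0 : 0 < κ := by linarith
    refine h6.trans ?_
    rw [mul_assoc, ← Real.mul_rpow (by positivity) hκ0.le]
    gcongr
    · linarith
    · rw [one_div, inv_mul_eq_div, le_div_iff₀ hc]; linarith
  have hnotZ : ∀ n m, (n, m) ∉ Z → V n m = 0 := fun n m h => (hV n m).resolve_right h
  -- the sums over the slices
  have hslice : ∀ (a κ : ℝ) (f : ℤ → ℤ × ℤ), (∀ t, f t ∈ Z →
      c * size lam (f t).1 (f t).2 ≤ κ ∧ κ ≤ size lam (f t).1 (f t).2) →
      (∀ t t', f t ∈ Z → f t' ∈ Z → cs * κ ^ 2 / lam * |(t : ℝ) - t'| ≤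
        |H (f t).1 (f t).2 - H (f t').1 (f t').2|) →
      ∑' t, ENNReal.ofReal (V (f t).1 (f t).2 ^ 2 * bracket (H (f t).1 (f t).2) ^ (-1 : ℝ) *
        bracket (H (f t).1 (f t).2 - a) ^ (-(1 - 3 * δ))) ≤
        ENNReal.ofReal lam * ENNReal.ofReal (C * (B * (1 / c) ^ (2 - 2 * s) * lam ^ (μ - 1))) := by
    intro a κ f hκ hsep
    by_cases hne : ∃ t, f t ∈ Z
    · obtain ⟨t₀, ht₀⟩ := hne
      have hκ1 : 1 ≤ κ := ht₀.1.trans (hκ t₀ ht₀).1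
      have := hsum lam κ (B * (1 / c) ^ (2 - 2 * s)) a (f ⁻¹' Z) (fun t => H (f t).1 (f t).2)
        (fun t => V (f t).1 (f t).2 ^ 2) hlam hκ1 (by positivity)
        (fun t ht t' ht' => hsep t t' ht ht')
        (fun t ht => hlow _ _ ht κ (by linarith) (hκ t ht).2)
        (fun t ht => hweight _ _ ht κ (hκ t ht).1) (fun t => sq_nonneg _)
      refine le_trans (ENNReal.tsum_le_tsum fun t => ENNReal.ofReal_le_ofReal ?_) this
      by_cases ht : f t ∈ Z
      · rw [Set.indicator_of_mem (show t ∈ f ⁻¹' Z from ht)]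
      · rw [Set.indicator_of_notMem (show t ∉ f ⁻¹' Z from ht), hnotZ _ _ ht]; simp
    · push Not at hne
      have : ∀ t, V (f t).1 (f t).2 = 0 := fun t => hnotZ _ _ (hne t)
      simp [this]
  have hcs1 : cs ≤ |α₁| * |ρ| / 2 := min_le_left _ _
  have hcs2 : cs ≤ |α₁| / 12 * d₁ := (min_le_right _ _).trans (min_le_left _ _)
  have hcs3 : cs ≤ |α₁| / 12 * d₂ := (min_le_right _ _).trans (min_le_right _ _)
  have key := SymZ.of_kpv (A := ENNReal.ofReal (C * (B * (1 / c) ^ (2 - 2 * s) * lam ^ (μ - 1))))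
    (wave_neg lam α₁ β) (wave_neg lam α₂ β) hl hδ hδ' hV0 (fun a n m => le_rfl)
    (fun a n => hslice a |freq lam n| (fun m => (n, m)) (fun m hm => ⟨hm.2.1, ?_⟩) ?_)
    (fun a m => hslice a |freq lam m| (fun n => (n, m)) (fun n hn => ⟨hn.2.2.1, ?_⟩) ?_)
    (fun a k => hslice a |freq lam (-k)| (fun n => (n, k - n)) (fun n hn => ⟨?_, ?_⟩) ?_)
  · refine key.mono_const ((ofReal_critConst_mul hδ (by positivity)).trans (le_of_eq ?_))
    congr 1; ring
  · exact (by unfold bracket; linarith : |freq lam n| ≤ bracket (freq lam n)).trans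
      (bracket_le_size lam n m).1
  · rintro t t' ⟨h1, h2, -, -, h5, -⟩ ⟨h1', h2', -, -, h5', -⟩
    simp only at h1 h2 h5 h1' h2' h5' ⊢
    have hN := size_one_le lam n t
    have hN' := size_one_le lam n t'
    obtain ⟨-, r1, -⟩ := hηρ (by linarith) h2
    obtain ⟨-, r1', -⟩ := hηρ (by linarith) h2'
    have key := hdiff₁ (freq lam n) (freq lam (-n - t)) (freq lam (-n - t'))
      (le_trans (le_of_eq (by rw [freq_neg_sub]; congr 1; ring)) (h5.trans r1))
      (le_trans (le_of_eq (by rw [freq_neg_sub]; congr 1; ring)) (h5'.trans r1'))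
    have e0 : |freq lam (-n - t) - freq lam (-n - t')| = |(t : ℝ) - t'| / lam := by
      rw [freq_neg_sub, freq_neg_sub, ← abs_of_pos hl, ← abs_div, abs_of_pos hl, ← abs_neg]
      congr 1; simp only [freq]; ring
    rw [e0] at key
    have e1 : H n t - H n t' = -(α₁ / 12) * (freq lam (-n - t) * (36 * freq lam n ^ 2 +
        36 * freq lam n * freq lam (-n - t) - (ρ - 3) * (ρ - 3 + 6) * freq lam (-n - t) ^ 2) -
        freq lam (-n - t') * (36 * freq lam n ^ 2 + 36 * freq lam n * freq lam (-n - t') -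
          (ρ - 3) * (ρ - 3 + 6) * freq lam (-n - t') ^ 2)) := by
      rw [hHeq, hHeq, freq_neg_sub, freq_neg_sub]; ring
    rw [e1, abs_mul, abs_neg, abs_div, abs_of_pos (by norm_num : (0 : ℝ) < 12)]
    calc _ = cs * (|freq lam n| ^ 2 * (|(t : ℝ) - t'| / lam)) := by ring
      _ ≤ |α₁| / 12 * d₁ * (|freq lam n| ^ 2 * (|(t : ℝ) - t'| / lam)) := by gcongr
      _ = |α₁| / 12 * (d₁ * |freq lam n| ^ 2 * (|(t : ℝ) - t'| / lam)) := by ring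
      _ ≤ _ := by gcongr
  · exact (by unfold bracket; linarith : |freq lam m| ≤ bracket (freq lam m)).trans
      (bracket_le_size lam n m).2.1
  · rintro t t' ⟨h1, -, h2, -, h5, -⟩ ⟨h1', -, h2', -, h5', -⟩
    simp only at h1 h2 h5 h1' h2' h5' ⊢
    have hN := size_one_le lam t m
    have hN' := size_one_le lam t' m
    obtain ⟨-, -, r1⟩ := hηρ (by linarith) h2
    obtain ⟨-, -, r1'⟩ := hηρ (by linarith) h2'
    have key := hdiff₂ (freq lam m) (freq lam (-t - m)) (freq lam (-t' - m))
      (le_trans (le_of_eq (by rw [← abs_neg, freq_neg_sub]; congr 1; ring)) (h5.trans r1))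
      (le_trans (le_of_eq (by rw [← abs_neg, freq_neg_sub]; congr 1; ring)) (h5'.trans r1'))
    have e0 : |freq lam (-t - m) - freq lam (-t' - m)| = |(t : ℝ) - t'| / lam := by
      rw [freq_neg_sub, freq_neg_sub, ← abs_of_pos hl, ← abs_div, abs_of_pos hl, ← abs_neg]
      congr 1; simp only [freq]; ring
    rw [e0] at key
    have e1 : H t m - H t' m = -(α₁ / 12) * (freq lam (-t - m) * (36 * freq lam m ^ 2 +
        36 * freq lam m * freq lam (-t - m) - (-ρ - 3) * (-ρ - 3 + 6) * freq lam (-t - m) ^ 2) -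
        freq lam (-t' - m) * (36 * freq lam m ^ 2 + 36 * freq lam m * freq lam (-t' - m) -
          (-ρ - 3) * (-ρ - 3 + 6) * freq lam (-t' - m) ^ 2)) := by
      rw [hHeq, hHeq, freq_neg_sub, freq_neg_sub]; ring
    rw [e1, abs_mul, abs_neg, abs_div, abs_of_pos (by norm_num : (0 : ℝ) < 12)]
    calc _ = cs * (|freq lam m| ^ 2 * (|(t : ℝ) - t'| / lam)) := by ring
      _ ≤ |α₁| / 12 * d₂ * (|freq lam m| ^ 2 * (|(t : ℝ) - t'| / lam)) := by gcongr
      _ = |α₁| / 12 * (d₂ * |freq lam m| ^ 2 * (|(t : ℝ) - t'| / lam)) := by ring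
      _ ≤ _ := by gcongr
  · have := hn.2.2.2.1
    rwa [show -(n, k - n).1 - (n, k - n).2 = -k by simp only; ring] at this
  · have := (abs_le_bracket _).trans (bracket_le_size lam n (k - n)).2.2
    rwa [show -n - (k - n) = -k by ring] at this
  · rintro t t' ⟨h1, -, -, h2, h5, -⟩ ⟨h1', -, -, h2', h5', -⟩
    simp only at h1 h2 h5 h1' h2' h5' ⊢
    have hN := size_one_le lam t (k - t)
    have hN' := size_one_le lam t' (k - t')
    obtain ⟨r1, -, -⟩ := hηρ (by linarith) h2
    obtain ⟨r1', -, -⟩ := hηρ (by linarith) h2'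
    have g1 := h5.trans r1
    have g1' := h5'.trans r1'
    rw [hHeq, hHeq]
    rw [show -t - (k - t) = -k by ring] at g1 ⊢
    rw [show -t' - (k - t') = -k by ring] at g1' ⊢
    set z := freq lam (-k)
    set u := freq lam t - freq lam (k - t) with hu
    set u' := freq lam t' - freq lam (k - t') with hu'
    have e0 : |u - u'| = 2 * (|(t : ℝ) - t'| / lam) := by
      rw [show u - u' = 2 * (((t : ℝ) - t') / lam) by
        rw [hu, hu', freq_sub, freq_sub]; simp only [freq]; ring, abs_mul, abs_two, abs_div,
        abs_of_pos hl]
    have i1 : |ρ| * |z| ≤ 3 * |u + u'| := by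
      have h1 := abs_add_le (3 * u - ρ * z) (3 * u' - ρ * z)
      have h2 := abs_sub_abs_le_abs_sub (2 * (ρ * z))
        (-((3 * u - ρ * z) + (3 * u' - ρ * z)))
      rw [abs_neg, abs_mul, abs_two, abs_mul, show 2 * (ρ * z) - -((3 * u - ρ * z) +
        (3 * u' - ρ * z)) = 3 * (u + u') by ring, abs_mul 3,
        abs_of_pos (by norm_num : (0 : ℝ) < 3)] at h2
      linarith
    have e1 : -(α₁ / 12) * z * ((3 * u - ρ * z) * (3 * u + ρ * z)) -
        -(α₁ / 12) * z * ((3 * u' - ρ * z) * (3 * u' + ρ * z)) =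
        -(α₁ / 4) * z * (3 * (u + u')) * (u - u') := by ring
    rw [e1, abs_mul, abs_mul, abs_mul, abs_mul 3, abs_of_pos (by norm_num : (0 : ℝ) < 3), e0,
      abs_neg, abs_div, abs_of_pos (by norm_num : (0 : ℝ) < 4)]
    calc _ = cs * (|z| ^ 2 * (|(t : ℝ) - t'| / lam)) := by ring
      _ ≤ |α₁| * |ρ| / 2 * (|z| ^ 2 * (|(t : ℝ) - t'| / lam)) := by gcongr
      _ = |α₁| / 4 * |z| * (|ρ| * |z|) * (2 * (|(t : ℝ) - t'| / lam)) := by ring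
      _ ≤ _ := by gcongr

/-! ### The irrationality exponent -/

/-- The fractions `a / b + 1 / (b n)` approximate `a / b` with error `1 / (b n)`, to every power
below the first. -/
theorem approximableWithPower_of_rat {a b : ℤ} (hb : 0 < b) {μ : ℝ} (hμ : μ < 1) :
    ApproximableWithPower ((a : ℝ) / b) μ := by
  refine Set.infinite_of_injective_forall_mem
    (f := fun j : ℕ => (a * (j + 2) + 1, b * ((j : ℤ) + 2))) (fun j j' h => ?_) fun j => ?_
  · have h2 := (Prod.mk.inj h).2
    have := mul_left_cancel₀ hb.ne' h2
    omega
  · have hj : (0 : ℤ) < (j : ℤ) + 2 := by positivity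
    have hbR : (0 : ℝ) < b := by exact_mod_cast hb
    have hjR : (0 : ℝ) < (j : ℝ) + 2 := by positivity
    have hb1 : (1 : ℝ) ≤ b := by exact_mod_cast hb
    have hne : (b : ℝ) * ((j : ℝ) + 2) ≠ 0 := by positivity
    have h1 : (1 : ℝ) < b * ((j : ℝ) + 2) := by nlinarith [(Nat.cast_nonneg j : (0 : ℝ) ≤ j)]
    have e : (a : ℝ) / b - ((a * (j + 2) + 1 : ℤ) : ℝ) / ((b * ((j : ℤ) + 2) : ℤ) : ℝ) =
        -(1 / (b * ((j : ℝ) + 2))) := by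
      push_cast; field_simp; ring
    refine ⟨(mul_pos hb hj).ne', ?_, ?_⟩
    · simp only
      rw [e, abs_neg]; positivity
    · simp only
      rw [e, abs_neg, abs_of_pos (by positivity)]
      push_cast
      rw [abs_of_pos (by positivity)]
      gcongr
      nth_rewrite 2 [← Real.rpow_one ((b : ℝ) * ((j : ℝ) + 2))]
      exact Real.rpow_lt_rpow_of_exponent_lt h1 hμ

/-- Two distinct fractions with denominators `b` and `n` differ by at least `1 / (b |n|)`. -/
theorem not_approximableWithPower_of_rat {a b : ℤ} (hb : 0 < b) {μ : ℝ} (hμ : 1 < μ) :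
    ¬ ApproximableWithPower ((a : ℝ) / b) μ := by
  rw [ApproximableWithPower, Set.not_infinite]
  have hbR : (0 : ℝ) < b := by exact_mod_cast hb
  -- the denominators are bounded
  set M : ℝ := (b : ℝ) ^ (1 / (μ - 1)) with hM
  have hden : ∀ m n : ℤ, n ≠ 0 → 0 < |(a : ℝ) / b - m / n| →
      |(a : ℝ) / b - m / n| < 1 / |(n : ℝ)| ^ μ → |(n : ℝ)| ≤ M := by
    intro m n hn h0 h1
    have hnR : (n : ℝ) ≠ 0 := by exact_mod_cast hn
    have hn0 : 0 < |(n : ℝ)| := abs_pos.2 hnR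
    have e : (a : ℝ) / b - m / n = ((a * n - b * m : ℤ) : ℝ) / (b * n) := by
      push_cast; field_simp
    have hne : a * n - b * m ≠ 0 := by
      intro h; rw [e, h] at h0; simp at h0
    have h2 : 1 ≤ |((a * n - b * m : ℤ) : ℝ)| := by exact_mod_cast Int.one_le_abs hne
    rw [e, abs_div, abs_mul, abs_of_pos hbR, div_lt_div_iff₀ (by positivity) (by positivity)] at h1
    have h3 : |(n : ℝ)| ^ μ < b * |(n : ℝ)| := by
      have : 0 < |(n : ℝ)| ^ μ := Real.rpow_pos_of_pos hn0 _
      nlinarith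
    have h4 : |(n : ℝ)| ^ (μ - 1) ≤ b := by
      rw [Real.rpow_sub_one hn0.ne', div_le_iff₀ hn0]; exact h3.le
    calc |(n : ℝ)| = (|(n : ℝ)| ^ (μ - 1)) ^ (1 / (μ - 1)) := by
          rw [← Real.rpow_mul hn0.le, mul_one_div_cancel (by linarith), Real.rpow_one]
      _ ≤ M := Real.rpow_le_rpow (by positivity) h4 (by
          have : 0 < μ - 1 := by linarith
          positivity)
  obtain ⟨L, hL⟩ := exists_int_gt M
  obtain ⟨L', hL'⟩ := exists_int_gt ((|(a : ℝ) / b| + 1) * M)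
  refine ((Set.finite_Icc (-L') L').prod (Set.finite_Icc (-L) L)).subset ?_
  rintro ⟨m, n⟩ ⟨h1, h2, h3⟩
  simp only at h1 h2 h3
  have hn := hden m n h1 h2 h3
  have hnR : (n : ℝ) ≠ 0 := by exact_mod_cast h1
  have hn1 : 1 ≤ |(n : ℝ)| := by exact_mod_cast Int.one_le_abs h1
  have hm : |(m : ℝ)| ≤ (|(a : ℝ) / b| + 1) * M := by
    have h4 : |(m : ℝ) / n| ≤ |(a : ℝ) / b| + 1 := by
      have h5 : |(a : ℝ) / b - m / n| ≤ 1 :=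
        h3.le.trans ((div_le_one (by positivity)).2 (Real.one_le_rpow hn1 (by linarith)))
      have := abs_sub_abs_le_abs_sub ((m : ℝ) / n) (a / b)
      rw [abs_sub_comm] at this
      linarith
    calc |(m : ℝ)| = |(m : ℝ) / n| * |(n : ℝ)| := by rw [← abs_mul, div_mul_cancel₀ _ hnR]
      _ ≤ _ := by gcongr
  have hn' : |n| < L := by
    have : ((|n| : ℤ) : ℝ) < L := by push_cast; linarith
    exact_mod_cast this
  have hm' : |m| < L' := by
    have : ((|m| : ℤ) : ℝ) < L' := by push_cast; linarith
    exact_mod_cast this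
  rw [abs_lt] at hn' hm'
  exact ⟨⟨hm'.1.le, hm'.2.le⟩, ⟨hn'.1.le, hn'.2.le⟩⟩

theorem irrationalityExponent_of_rat {a b : ℤ} (hb : 0 < b) :
    irrationalityExponent ((a : ℝ) / b) = 1 := by
  refine le_antisymm (sSup_le ?_) ?_
  · rintro _ ⟨μ, hμ, rfl⟩
    have : μ ≤ 1 := not_lt.1 fun h => not_approximableWithPower_of_rat hb h hμ
    change (μ : EReal) ≤ 1
    exact_mod_cast this
  · refine le_of_forall_lt fun c hc => ?_
    obtain ⟨μ, h1, h2⟩ := EReal.lt_iff_exists_real_btwn.1 hc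
    refine h1.trans_le (le_sSup ⟨μ, approximableWithPower_of_rat hb ?_, rfl⟩)
    exact_mod_cast h2

theorem irrational_of_irrationalityExponent_ne {ρ : ℝ} (h : irrationalityExponent ρ ≠ 1) :
    Irrational ρ := by
  rintro ⟨q, rfl⟩
  apply h
  have := irrationalityExponent_of_rat (a := q.num) (b := q.den) (by exact_mod_cast q.den_pos)
  rwa [Int.cast_natCast, ← Rat.cast_def] at this

/-- Dirichlet's theorem. -/
theorem two_le_irrationalityExponent {ρ : ℝ} (h : Irrational ρ) : 2 ≤ irrationalityExponent ρ := by
  refine le_sSup ⟨2, ?_, by norm_cast⟩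
  have hinf := Real.infinite_rat_abs_sub_lt_one_div_den_sq_of_irrational h
  refine (hinf.image (f := fun q : ℚ => (q.num, (q.den : ℤ))) fun q _ q' _ hqq => ?_).mono ?_
  · have h1 := Prod.mk.inj hqq
    exact Rat.ext h1.1 (by exact_mod_cast h1.2)
  · rintro _ ⟨q, hq, rfl⟩
    have e : ((q.num : ℤ) : ℝ) / ((q.den : ℤ) : ℝ) = q := by
      rw [Int.cast_natCast, ← Rat.cast_def]
    refine ⟨Int.natCast_ne_zero.2 q.den_nz, ?_, ?_⟩
    · simp only
      rw [e]; exact abs_pos.2 (sub_ne_zero.2 (h.ne_rat q))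
    · simp only
      rw [e, show ((2 : ℝ)) = ((2 : ℕ) : ℝ) by norm_num, Real.rpow_natCast, Int.cast_natCast,
        Nat.abs_cast]
      exact hq

/-- Above the irrationality exponent there are only finitely many exceptional fractions, which are
absorbed in the constant. -/
theorem exists_lower_of_lt {ρ μ : ℝ} (h : Irrational ρ) (hμ : irrationalityExponent ρ < μ) :
    ∃ c : ℝ, 0 < c ∧ ∀ j k : ℤ, k ≠ 0 → c * |(k : ℝ)| ^ (-μ) ≤ |ρ - j / k| := by
  have hfin : ¬ ApproximableWithPower ρ μ := fun ha =>
    (le_sSup (Set.mem_image_of_mem (fun μ : ℝ => (μ : EReal)) ha)).not_gt hμ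
  rw [ApproximableWithPower, Set.not_infinite] at hfin
  have hpos : ∀ j k : ℤ, 0 < |ρ - j / k| := fun j k => by
    have := h.ne_rat ((j : ℚ) / k)
    push_cast at this
    exact abs_pos.2 (sub_ne_zero.2 this)
  obtain ⟨c, hc, hc'⟩ : ∃ c : ℝ, 0 < c ∧ ∀ q ∈ hfin.toFinset,
      c ≤ |ρ - (q.1 : ℝ) / q.2| * |(q.2 : ℝ)| ^ μ := by
    have hq : ∀ q ∈ hfin.toFinset, 0 < |ρ - (q.1 : ℝ) / q.2| * |(q.2 : ℝ)| ^ μ := by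
      intro q hq
      have : q.2 ≠ 0 := ((Set.Finite.mem_toFinset hfin).1 hq).1
      have : (q.2 : ℝ) ≠ 0 := by exact_mod_cast this
      have := hpos q.1 q.2
      positivity
    rcases hfin.toFinset.eq_empty_or_nonempty with he | hne
    · exact ⟨1, one_pos, fun q hq => by rw [he] at hq; exact absurd hq (Finset.notMem_empty q)⟩
    · obtain ⟨q₀, hq₀, hmin⟩ := hfin.toFinset.exists_min_image
        (fun q : ℤ × ℤ => |ρ - (q.1 : ℝ) / q.2| * |(q.2 : ℝ)| ^ μ) hne
      exact ⟨_, hq q₀ hq₀, hmin⟩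
  refine ⟨min 1 c, lt_min one_pos hc, fun j k hk => ?_⟩
  have hkR : 0 < |(k : ℝ)| := abs_pos.2 (by exact_mod_cast hk)
  have hkμ : 0 < |(k : ℝ)| ^ μ := Real.rpow_pos_of_pos hkR _
  rw [Real.rpow_neg hkR.le, ← div_eq_mul_inv, div_le_iff₀ hkμ]
  by_cases hq : (j, k) ∈ hfin.toFinset
  · exact (min_le_right _ _).trans (hc' _ hq)
  · rw [Set.Finite.mem_toFinset] at hq
    have : ¬ |ρ - (j : ℝ) / k| < 1 / |(k : ℝ)| ^ μ := fun h' => hq ⟨hk, hpos j k, h'⟩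
    rw [not_lt, div_le_iff₀ hkμ] at this
    exact (min_le_left _ _).trans this

/-- If `s_r < 1` then `√(12 r - 3)` is irrational, and the errors of its rational approximations are
bounded below by a power `-μ` of the denominators with `μ ≤ 3`. -/
theorem exists_exponent_of_sIndex_lt {r s p : ℝ} (h : sIndex r < 1) (hs : sIndex r < s)
    (hp : sIndex r < p) :
    Irrational (Real.sqrt (12 * r - 3)) ∧ 1 / 2 ≤ s ∧ ∃ μ : ℝ, 2 ≤ μ ∧ μ ≤ 3 ∧ μ < 2 * s + 1 ∧
      μ < 2 * p + 1 ∧ ∃ c : ℝ, 0 < c ∧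
        ∀ j k : ℤ, k ≠ 0 → c * |(k : ℝ)| ^ (-μ) ≤ |Real.sqrt (12 * r - 3) - j / k| := by
  have hσ : ¬ (sigmaIndex r = 1 ∨ 3 ≤ sigmaIndex r) := fun h' => by
    rw [sIndex, if_pos h'] at h; exact lt_irrefl _ h
  rw [sIndex, if_neg hσ] at hs hp
  push Not at hσ
  have hirr := irrational_of_irrationalityExponent_ne hσ.1
  have h2 : 2 ≤ sigmaIndex r := two_le_irrationalityExponent hirr
  have hbot : sigmaIndex r ≠ ⊥ := fun h => by
    rw [h, le_bot_iff] at h2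
    exact EReal.coe_ne_bot 2 h2
  have htop : sigmaIndex r ≠ ⊤ := ne_top_of_lt hσ.2
  have hco := EReal.coe_toReal htop hbot
  set σ := (sigmaIndex r).toReal with hσdef
  have h2' : 2 ≤ σ := EReal.coe_le_coe_iff.1 (h2.trans_eq hco.symm)
  have h3 : σ < 3 := EReal.coe_lt_coe_iff.1 (hco.trans_lt hσ.2)
  obtain ⟨μ, h4, h5⟩ := exists_between (show σ < min 3 (min (2 * s + 1) (2 * p + 1)) from
    lt_min h3 (lt_min (by linarith) (by linarith)))
  rw [lt_min_iff, lt_min_iff] at h5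
  refine ⟨hirr, by linarith, μ, by linarith, h5.1.le, h5.2.1, h5.2.2, exists_lower_of_lt hirr ?_⟩
  change sigmaIndex r < μ
  rw [← hco]; exact_mod_cast h4

/-! ### The bilinear estimates in the different ranges of `α₂ / α₁` -/

/-- Where `|H| ≳ |k₃| N²`, the square of a weight of order `⟨k₃⟩^{1/2} N` is dominated by `⟨H⟩`. -/
theorem sq_le_of_resonance_le {B c b z N h V : ℝ} (hB : 0 ≤ B) (hc : 0 < c) (hz : 1 ≤ |z|)
    (hV : V ^ 2 ≤ B * (bracket z * N ^ 2)) (hh : c * |z| * N ^ 2 ≤ |h|) (hb : 2 / c ≤ b) :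
    V ^ 2 ≤ b * B * bracket h := by
  have h1 : bracket z ≤ 2 * |z| := by unfold bracket; linarith
  have h2 := abs_le_bracket h
  have h3 : 0 < 2 / c := by positivity
  have h4 := bracket_pos h
  calc V ^ 2 ≤ B * (2 * |z| * N ^ 2) := hV.trans (by gcongr)
    _ = 2 / c * B * (c * |z| * N ^ 2) := by field_simp
    _ ≤ b * B * bracket h := by
        have : c * |z| * N ^ 2 ≤ bracket h := hh.trans h2
        have : 0 ≤ b := by linarith
        gcongr

/-- The case `α₂ / α₁ < 1 / 4`. -/
theorem exists_symZ_nonresonant {α₁ α₂ p : ℝ} (hp : 0 < p) (hα₁ : α₁ ≠ 0)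
    (hr : α₂ / α₁ < 1 / 4) :
    ∃ C : ℝ, 0 < C ∧ ∀ (lam B β₁ β₂ : ℝ) (V : ℤ → ℤ → ℝ), 1 ≤ lam → 0 ≤ B →
      |β₁ - β₂| ≤ 1 → (∀ n m, 0 ≤ V n m) →
      (∀ n m, V n m = 0 ∨ (-n - m ≠ 0 ∧
        V n m ^ 2 ≤ B * (bracket (freq lam (-n - m)) * size lam n m ^ 2))) →
      SymZ lam (wave lam α₁ β₁) (wave lam α₂ β₂) V (ENNReal.ofReal (C * (B * lam ^ (2 * p)))) := by
  obtain ⟨c, C₀, hc, hlow⟩ := exists_resonance_lower hα₁ hr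
  have hα : α₁ ≠ α₂ := by
    rintro rfl; rw [div_self hα₁] at hr; norm_num at hr
  set δ := min (1 / 12) (2 * p / 31) with hδ
  have hδ0 : 0 < δ := lt_min (by norm_num) (by positivity)
  obtain ⟨C, hC, h⟩ := exists_symZ_of_ne hδ0 (min_le_left _ _) hα₁ hα C₀
  refine ⟨C * (1 + 2 / c), by positivity, fun lam B β₁ β₂ V hlam hB hβ hV0 hV => ?_⟩
  have hl : 0 < lam := by linarith
  have hδp : 31 * δ ≤ 2 * p := by have := min_le_right (1 / 12) (2 * p / 31); linarith
  have hc' : 0 < 2 / c := by positivity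
  refine (h lam ((1 + 2 / c) * B) β₁ β₂ V hlam (by positivity) hβ hV0 fun n m => ?_).mono_real ?_
  · rcases hV n m with h0 | ⟨h1, h2⟩
    · exact Or.inl h0
    refine Or.inr ⟨h1, h2.trans ?_, fun hz hN => ?_⟩
    · have := bracket_pos (freq lam (-n - m))
      gcongr
      nlinarith
    · refine sq_le_of_resonance_le hB hc hz.le h2 ?_ (by linarith)
      rw [symResonance_wave]
      exact hlow _ _ _ _ (by rw [freq_neg_sub]; ring) hβ hz.le hN
  · calc _ ≤ C * ((1 + 2 / c) * B * lam ^ (2 * p)) := by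
          gcongr
      _ = _ := by ring

/-- The case `α₁ ≠ α₂`, for a weight that is bounded if the three frequencies are comparable. -/
theorem exists_symZ_bounded_resonance {α₁ α₂ p : ℝ} (hp : 0 < p) (hα₁ : α₁ ≠ 0) (hα : α₁ ≠ α₂) :
    ∃ c C : ℝ, 0 < c ∧ 0 < C ∧ ∀ (lam B β₁ β₂ : ℝ) (V : ℤ → ℤ → ℝ), 1 ≤ lam → 0 ≤ B →
      |β₁ - β₂| ≤ 1 → (∀ n m, 0 ≤ V n m) →
      (∀ n m, V n m = 0 ∨ (-n - m ≠ 0 ∧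
        V n m ^ 2 ≤ B * (bracket (freq lam (-n - m)) * size lam n m ^ 2) ∧
        (c * size lam n m ≤ |freq lam n| → c * size lam n m ≤ |freq lam m| →
          c * size lam n m ≤ |freq lam (-n - m)| → V n m ^ 2 ≤ B))) →
      SymZ lam (wave lam α₁ β₁) (wave lam α₂ β₂) V (ENNReal.ofReal (C * (B * lam ^ (2 * p)))) := by
  obtain ⟨c, C₀, hc, -, hlow⟩ := exists_resonance_lower_or hα₁ hα
  set δ := min (1 / 12) (2 * p / 31) with hδ
  have hδ0 : 0 < δ := lt_min (by norm_num) (by positivity)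
  obtain ⟨C, hC, h⟩ := exists_symZ_of_ne hδ0 (min_le_left _ _) hα₁ hα C₀
  refine ⟨c, C * (1 + 2 / c), hc, by positivity, fun lam B β₁ β₂ V hlam hB hβ hV0 hV => ?_⟩
  have hl : 0 < lam := by linarith
  have hδp : 31 * δ ≤ 2 * p := by have := min_le_right (1 / 12) (2 * p / 31); linarith
  have hc' : 0 < 2 / c := by positivity
  refine (h lam ((1 + 2 / c) * B) β₁ β₂ V hlam (by positivity) hβ hV0 fun n m => ?_).mono_real ?_
  · rcases hV n m with h0 | ⟨h1, h2, h3⟩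
    · exact Or.inl h0
    refine Or.inr ⟨h1, h2.trans ?_, fun hz hN => ?_⟩
    · have := bracket_pos (freq lam (-n - m))
      gcongr
      nlinarith
    · rcases hlow _ _ (freq lam (-n - m)) (β₁ - β₂) (by rw [freq_neg_sub]; ring) hβ hz.le hN with
        h4 | ⟨h4, h5, h6⟩
      · exact sq_le_of_resonance_le hB hc hz.le h2 (by rw [symResonance_wave]; exact h4)
          (by linarith)
      · have := one_le_bracket (symResonance (wave lam α₁ β₁) (wave lam α₂ β₂) n m)
        calc V n m ^ 2 ≤ 1 * B * 1 := by rw [one_mul, mul_one]; exact h3 h4 h5 h6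
          _ ≤ _ := by gcongr; linarith
  · calc _ ≤ C * ((1 + 2 / c) * B * lam ^ (2 * p)) := by
          gcongr
      _ = _ := by ring

/-- The case `β₁ = β₂`, `s_r < s ≤ 1`, `s_r < p`, for a weight of order `N^{1-s}` if the three
frequencies are comparable to `N`. -/
theorem exists_symZ_diophantine {α₁ α₂ s p : ℝ} (hα₁ : α₁ ≠ 0) (hα : α₁ ≠ α₂)
    (hr : 1 / 4 ≤ α₂ / α₁) (h1 : sIndex (α₂ / α₁) < 1) (hs : sIndex (α₂ / α₁) < s)
    (hp : sIndex (α₂ / α₁) < p) (hs' : s ≤ 1) :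
    ∃ c C : ℝ, 0 < c ∧ 0 < C ∧ ∀ (lam B β : ℝ) (V : ℤ → ℤ → ℝ), 1 ≤ lam → 0 ≤ B →
      (∀ n m, 0 ≤ V n m) →
      (∀ n m, V n m = 0 ∨ (-n - m ≠ 0 ∧
        V n m ^ 2 ≤ B * (bracket (freq lam (-n - m)) * size lam n m ^ 2) ∧
        (c * size lam n m ≤ |freq lam n| → c * size lam n m ≤ |freq lam m| →
          c * size lam n m ≤ |freq lam (-n - m)| →
            V n m ^ 2 ≤ B * size lam n m ^ (2 - 2 * s)))) →
      SymZ lam (wave lam α₁ β) (wave lam α₂ β) V (ENNReal.ofReal (C * (B * lam ^ (2 * p)))) := by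
  obtain ⟨hirr, -, μ, hμ, hμ', hμs, hμp, c₀, hc₀, hdio⟩ := exists_exponent_of_sIndex_lt h1 hs hp
  set ρ := Real.sqrt (12 * (α₂ / α₁) - 3) with hρdef
  have hρ : α₁ * ρ ^ 2 = 12 * α₂ - 3 * α₁ := by
    rw [hρdef, Real.sq_sqrt (by linarith)]; field_simp
  have hρ' : α₁ * (-ρ) ^ 2 = 12 * α₂ - 3 * α₁ := by rw [neg_sq, hρ]
  have hρ0 : ρ ≠ 0 := hirr.ne_zero
  have hρ3 : ρ ≠ 3 := by simpa using hirr.ne_nat 3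
  have hρ3' : ρ ≠ -3 := by simpa using hirr.ne_int (-3)
  have hdio' : ∀ j k : ℤ, k ≠ 0 → c₀ * |(k : ℝ)| ^ (-μ) ≤ |-ρ - j / k| := fun j k hk => by
    have := hdio (-j) k hk
    rwa [← abs_neg (ρ - _), show -(ρ - ((-j : ℤ) : ℝ) / k) = -ρ - j / k by push_cast; ring] at this
  obtain ⟨c, C₀, hc, -, hlow⟩ := exists_resonance_lower_or hα₁ hα
  have hp0 : 0 < p := by linarith
  -- `31 δ ≤ 2 p` keeps the power of `λ` below `λ^{2 p}`, and `4 δ ≤ 2 s + 1 - μ` makes the sums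
  -- along the resonant lines converge
  set δ := min (1 / 12) (min (2 * p / 31) ((2 * s + 1 - μ) / 4)) with hδ
  have hδ0 : 0 < δ :=
    lt_min (by norm_num) (lt_min (by positivity) (by linarith))
  have hδ1 : δ ≤ 1 / 12 := min_le_left _ _
  have hδp : 31 * δ ≤ 2 * p := by
    have : δ ≤ 2 * p / 31 := (min_le_right _ _).trans (min_le_left _ _)
    linarith
  have hδs : 4 * δ ≤ 2 * s + 1 - μ := by
    have : δ ≤ (2 * s + 1 - μ) / 4 := (min_le_right _ _).trans (min_le_right _ _)
    linarith
  obtain ⟨η₁, C₁, hη₁, hC₁, hres₁⟩ := exists_symZ_resonant hδ0 hδ1 hα₁ hρ hρ0 hρ3 hρ3' hμ hμ' hs'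
    hδs hc hc₀ hdio
  obtain ⟨η₂, C₂, hη₂, hC₂, hres₂⟩ := exists_symZ_resonant hδ0 hδ1 hα₁ hρ' (neg_ne_zero.2 hρ0)
    (fun h => hρ3' (by linarith)) (fun h => hρ3 (by linarith)) hμ hμ' hs' hδs hc hc₀ hdio'
  set η := min η₁ η₂ with hη
  have hη0 : 0 < η := lt_min hη₁ hη₂
  have ha : 0 < |α₁| := abs_pos.2 hα₁
  obtain ⟨C₃, hC₃, hne⟩ := exists_symZ_of_ne hδ0 hδ1 hα₁ hα (|C₀| + 1 / c)
  set c₃ := |α₁| / 12 * η ^ 2 with hc₃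
  have hc₃0 : 0 < c₃ := by positivity
  set K := 1 + 2 / c + 2 / c₃ with hK
  have hK1 : 0 < 2 / c := by positivity
  have hK2 : 0 < 2 / c₃ := by positivity
  refine ⟨c, 2 * (C₁ + 2 * (C₂ + C₃ * K)), hc, by positivity, fun lam B β V hlam hB hV0 hV => ?_⟩
  have hl : 0 < lam := by linarith
  -- the neighbourhoods of the resonant lines `3 (k₁ - k₂) = ± ρ k₃`, all three frequencies being
  -- comparable
  set P : ℝ → ℤ → ℤ → Prop := fun ρ n m => 1 ≤ c * size lam n m ∧
    c * size lam n m ≤ |freq lam n| ∧ c * size lam n m ≤ |freq lam m| ∧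
    c * size lam n m ≤ |freq lam (-n - m)| ∧
    |3 * (freq lam n - freq lam m) - ρ * freq lam (-n - m)| ≤ η * size lam n m with hP
  classical
  have g₁ : ∀ n m, 0 ≤ if P ρ n m then 0 else V n m := fun n m => ite_nonneg le_rfl (hV0 n m)
  have p1 : SymZ lam (wave lam α₁ β) (wave lam α₂ β) (fun n m => if P ρ n m then V n m else 0)
      (ENNReal.ofReal (C₁ * (B * lam ^ (μ - 1)))) := by
    refine hres₁ η lam B β _ (min_le_left _ _) hlam hB (fun n m => ite_nonneg (hV0 n m) le_rfl)
      fun n m => ?_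
    split_ifs with h
    · refine (hV n m).imp id fun h' => ?_
      obtain ⟨k1, k2, k3, k4, k5⟩ := h
      exact ⟨k1, k2, k3, k4, k5, h'.2.2 k2 k3 k4⟩
    · exact Or.inl rfl
  have p2 : SymZ lam (wave lam α₁ β) (wave lam α₂ β)
      (fun n m => if P (-ρ) n m then (if P ρ n m then 0 else V n m) else 0)
      (ENNReal.ofReal (C₂ * (B * lam ^ (μ - 1)))) := by
    refine hres₂ η lam B β _ (min_le_right _ _) hlam hB (fun n m => ite_nonneg (g₁ n m) le_rfl)
      fun n m => ?_
    split_ifs with h h''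
    · exact Or.inl rfl
    · refine (hV n m).imp id fun h' => ?_
      obtain ⟨k1, k2, k3, k4, k5⟩ := h
      exact ⟨k1, k2, k3, k4, k5, h'.2.2 k2 k3 k4⟩
    · exact Or.inl rfl
  -- away from both lines the linear factors of the resonance function are comparable to `N`, or at
  -- least one frequency is small and `|H| ≳ |k₃| N²` holds anyway
  have p3 : SymZ lam (wave lam α₁ β) (wave lam α₂ β)
      (fun n m => if P (-ρ) n m then 0 else (if P ρ n m then 0 else V n m))
      (ENNReal.ofReal (C₃ * (K * B * lam ^ (31 * δ)))) := by
    refine hne lam (K * B) β β _ hlam (by positivity) (by simp)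
      (fun n m => ite_nonneg le_rfl (g₁ n m)) fun n m => ?_
    split_ifs with h h'
    · exact Or.inl rfl
    · exact Or.inl rfl
    rcases hV n m with h0 | ⟨k1, k2, -⟩
    · exact Or.inl h0
    have hbz := bracket_pos (freq lam (-n - m))
    have hK1' : 1 ≤ K := by linarith
    refine Or.inr ⟨k1, k2.trans ?_, fun hz hN => ?_⟩
    · gcongr
      nlinarith
    have hN0 : C₀ ≤ size lam n m := by
      have := le_abs_self C₀; have : 0 < 1 / c := by positivity
      linarith
    have hN1 : 1 ≤ c * size lam n m := by
      have : 1 / c ≤ size lam n m := by have := abs_nonneg C₀; linarith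
      rwa [div_le_iff₀' hc] at this
    rcases hlow _ _ (freq lam (-n - m)) (β - β) (by rw [freq_neg_sub]; ring) (by simp) hz.le hN0
      with h4 | ⟨h4, h5, h6⟩
    · exact sq_le_of_resonance_le hB hc hz.le k2 (by rw [symResonance_wave]; exact h4)
        (by linarith)
    · have i1 : η * size lam n m ≤
          |3 * (freq lam n - freq lam m) - ρ * freq lam (-n - m)| := by
        by_contra hcon
        exact h' ⟨hN1, h4, h5, h6, (not_le.1 hcon).le⟩
      have i2 : η * size lam n m ≤
          |3 * (freq lam n - freq lam m) + ρ * freq lam (-n - m)| := by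
        by_contra hcon
        refine h ⟨hN1, h4, h5, h6, ?_⟩
        rw [neg_mul, sub_neg_eq_add]
        exact (not_le.1 hcon).le
      have hsz := size_one_le lam n m
      refine sq_le_of_resonance_le (N := size lam n m) hB hc₃0 hz.le k2 ?_ (by linarith)
      rw [wave_resonance_eq hρ, abs_mul, abs_mul, abs_mul, abs_neg, abs_div,
        abs_of_pos (by norm_num : (0 : ℝ) < 12)]
      calc _ = |α₁| / 12 * |freq lam (-n - m)| *
            ((η * size lam n m) * (η * size lam n m)) := by rw [hc₃]; ring
        _ ≤ _ := by gcongr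
  refine (SymZ.split (P ρ) hV0 (by positivity) (by positivity) p1
    (SymZ.split (P (-ρ)) g₁ (by positivity) (by positivity) p2 p3)).mono_real ?_
  have hl1 : lam ^ (μ - 1) ≤ lam ^ (2 * p) :=
    Real.rpow_le_rpow_of_exponent_le hlam (by linarith)
  calc _ ≤ 2 * (C₁ * (B * lam ^ (2 * p)) + 2 * (C₂ * (B * lam ^ (2 * p)) +
        C₃ * (K * B * lam ^ (2 * p)))) := by gcongr
    _ = _ := by ring

/-- The estimates in all ranges of the parameters, for a weight `U` that satisfies the bounds which
are needed there, and its restrictions `V` to sets of frequencies. -/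
theorem exists_symZ_of_range {α₁ α₂ a b s p : ℝ} (hα₁ : α₁ ≠ 0) (ha : a ≤ 0)
    {U : ℝ → ℤ → ℤ → ℝ} (hU0 : ∀ lam n m, 0 ≤ U lam n m)
    (hUa : a ≤ s → ∀ lam n m,
      U lam n m ^ 2 ≤ bracket (freq lam (-n - m)) * size lam n m ^ 2)
    (hUb : b ≤ s → ∀ lam n m, U lam n m ^ 2 ≤
      bracket (freq lam n) * bracket (freq lam m) * bracket (freq lam (-n - m)))
    (hUc : ∀ c t : ℝ, 0 < c → 0 ≤ t → t ≤ 1 → t ≤ s → ∀ lam n m,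
      c * size lam n m ≤ |freq lam n| → c * size lam n m ≤ |freq lam m| →
      c * size lam n m ≤ |freq lam (-n - m)| →
      U lam n m ^ 2 ≤ (1 + c ^ (-4 : ℝ)) * size lam n m ^ (2 - 2 * t)) :
    ∃ C : ℝ, 0 < C ∧ ∀ (lam β₁ β₂ : ℝ) (V : ℤ → ℤ → ℝ), 1 ≤ lam →
      |β₁| + |β₂| ≤ lam ^ (-(1 / 2) : ℝ) →
      (∀ n m, V n m = 0 ∨ (-n - m ≠ 0 ∧ V n m = U lam n m)) →
      ((α₂ / α₁ < 1 / 4 ∧ a ≤ s ∧ 0 < p) ∨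
        (α₂ / α₁ = 1 ∧ b ≤ s ∧ 0 < p ∧
          ∀ n m, V n m = 0 ∨ (n ≠ 0 ∧ (m = 0 → V n m ^ 2 ≤ 1))) ∨
        ResonantRange (α₂ / α₁) s p β₁ β₂) →
      SymZ lam (wave lam α₁ β₁) (wave lam α₂ β₂) V (ENNReal.ofReal (C * lam ^ (2 * p))) := by
  have hβle : ∀ {lam β₁ β₂ : ℝ}, |β₁| + |β₂| ≤ lam ^ (-(1 / 2) : ℝ) →
      |β₁ - β₂| ≤ lam ^ (-(1 / 2) : ℝ) := fun h => (abs_sub _ _).trans h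
  have hlam1 : ∀ {lam : ℝ}, 1 ≤ lam → lam ^ (-(1 / 2) : ℝ) ≤ 1 := fun h =>
    Real.rpow_le_one_of_one_le_of_nonpos h (by norm_num)
  have hV0 : ∀ {lam : ℝ} {V : ℤ → ℤ → ℝ},
      (∀ n m, V n m = 0 ∨ (-n - m ≠ 0 ∧ V n m = U lam n m)) → ∀ n m, 0 ≤ V n m := by
    intro lam V h n m
    rcases h n m with h | ⟨-, h⟩ <;> rw [h]
    exact hU0 _ _ _
  -- The constant may depend on `α₁`, `α₂`, `s`, `p` only, so that the ranges of these are
  -- distinguished first; outside of all ranges the hypothesis on `β₁`, `β₂`, `V` is contradictory,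
  -- and any constant will do.
  by_cases hr : α₂ / α₁ < 1 / 4
  · by_cases hsp : a ≤ s ∧ 0 < p
    · obtain ⟨C, hC, h⟩ := exists_symZ_nonresonant hsp.2 hα₁ hr
      refine ⟨C, hC, fun lam β₁ β₂ V hlam hβ hV _ => ?_⟩
      have := h lam 1 β₁ β₂ V hlam zero_le_one ((hβle hβ).trans (hlam1 hlam)) (hV0 hV) fun n m => by
        refine (hV n m).imp id fun h' => ⟨h'.1, ?_⟩
        rw [h'.2, one_mul]; exact hUa hsp.1 _ _ _
      rwa [one_mul] at this
    · refine ⟨1, one_pos, fun lam β₁ β₂ V _ _ _ h => ?_⟩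
      rcases h with h | h | h
      · exact absurd h.2 hsp
      · rw [h.1] at hr; norm_num at hr
      · exact absurd h.1 (not_le.2 hr)
  by_cases hr1 : α₂ / α₁ = 1
  · have hα : α₂ = α₁ := by rwa [div_eq_one_iff_eq hα₁] at hr1
    subst hα
    by_cases hsp : b ≤ s ∧ 0 < p
    · set δ := min (1 / 12) (2 * p / 31) with hδ
      have hδ0 : 0 < δ := lt_min (by norm_num) (by have := hsp.2; positivity)
      have hδp : 31 * δ ≤ 2 * p := by have := min_le_right (1 / 12) (2 * p / 31); linarith
      obtain ⟨C, hC, h⟩ := exists_symZ_of_eq hδ0 (min_le_left _ _) hα₁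
      refine ⟨C, hC, fun lam β₁ β₂ V hlam hβ hV hcond => ?_⟩
      have hcond' : ∀ n m, V n m = 0 ∨ (n ≠ 0 ∧ (m = 0 → V n m ^ 2 ≤ 1)) := by
        rcases hcond with h | h | h
        · exact absurd h.1 hr
        · exact h.2.2.2
        · exact absurd hr1 h.2.1
      have := h lam 1 β₁ β₂ V hlam zero_le_one (hβle hβ) (hV0 hV) fun n m => by
        rcases hV n m with h0 | ⟨h1, h2⟩
        · exact Or.inl h0
        refine (hcond' n m).imp id fun h3 => ⟨h3.1, h1, ?_, h3.2⟩
        rw [h2, one_mul]; exact hUb hsp.1 _ _ _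
      rw [one_mul] at this
      exact this.mono_real (by gcongr)
    · refine ⟨1, one_pos, fun lam β₁ β₂ V _ _ _ h => ?_⟩
      rcases h with h | h | h
      · exact absurd h.1 hr
      · exact absurd ⟨h.2.1, h.2.2.1⟩ hsp
      · exact absurd hr1 h.2.1
  have hα : α₁ ≠ α₂ := fun h => hr1 (by rw [← h, div_self hα₁])
  by_cases hsp : 1 ≤ s ∧ 0 < p
  · obtain ⟨c, C, hc, hC, h⟩ := exists_symZ_bounded_resonance hsp.2 hα₁ hα
    refine ⟨C * (1 + c ^ (-4 : ℝ)), by positivity, fun lam β₁ β₂ V hlam hβ hV _ => ?_⟩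
    have := h lam (1 + c ^ (-4 : ℝ)) β₁ β₂ V hlam (by positivity)
      ((hβle hβ).trans (hlam1 hlam)) (hV0 hV) fun n m => by
        refine (hV n m).imp id fun h' => ⟨h'.1, ?_, fun k1 k2 k3 => ?_⟩
        · rw [h'.2]
          refine (hUa (by linarith) _ _ _).trans (le_mul_of_one_le_left ?_ ?_)
          · have := bracket_pos (freq lam (-n - m)); positivity
          · have : 0 < c ^ (-4 : ℝ) := by positivity
            linarith
        · rw [h'.2]
          have := hUc c 1 hc zero_le_one le_rfl hsp.1 lam n m k1 k2 k3
          rwa [show (2 : ℝ) - 2 * 1 = 0 by norm_num, Real.rpow_zero, mul_one] at this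
    exact this.mono_real (le_of_eq (by ring))
  by_cases hd : sIndex (α₂ / α₁) < 1 ∧ sIndex (α₂ / α₁) < s ∧ sIndex (α₂ / α₁) < p
  · obtain ⟨-, hs2, μ, hμ, -, -, hμp, -⟩ := exists_exponent_of_sIndex_lt hd.1 hd.2.1 hd.2.2
    have hs1 : s ≤ 1 := by
      by_contra hcon
      exact hsp ⟨(not_le.1 hcon).le, by linarith⟩
    obtain ⟨c, C, hc, hC, h⟩ := exists_symZ_diophantine hα₁ hα (not_lt.1 hr) hd.1 hd.2.1 hd.2.2 hs1
    refine ⟨C * (1 + c ^ (-4 : ℝ)), by positivity, fun lam β₁ β₂ V hlam hβ hV hcond => ?_⟩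
    have hβ' : β₁ = β₂ := by
      rcases hcond with h | h | ⟨-, -, h | h⟩
      · exact absurd h.1 hr
      · exact absurd h.1 hr1
      · exact absurd h hsp
      · exact h.1
    subst hβ'
    have := h lam (1 + c ^ (-4 : ℝ)) β₁ V hlam (by positivity) (hV0 hV) fun n m => by
      refine (hV n m).imp id fun h' => ⟨h'.1, ?_, fun k1 k2 k3 => ?_⟩
      · rw [h'.2]
        refine (hUa (by linarith) _ _ _).trans (le_mul_of_one_le_left ?_ ?_)
        · have := bracket_pos (freq lam (-n - m)); positivity
        · have : 0 < c ^ (-4 : ℝ) := by positivity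
          linarith
      · rw [h'.2]
        exact hUc c s hc (by linarith) hs1 le_rfl lam n m k1 k2 k3
    exact this.mono_real (le_of_eq (by ring))
  · refine ⟨1, one_pos, fun lam β₁ β₂ V _ _ _ h => ?_⟩
    rcases h with h | h | ⟨-, -, h | ⟨-, h | h⟩⟩
    · exact absurd h.1 hr
    · exact absurd h.1 hr1
    · exact absurd h hsp
    · exact absurd h.2 hsp
    · exact absurd h hd

/-! ### The frequency weights -/

/-- The brackets of three numbers with sum zero are bounded by products of each other. -/
theorem bracket_le_mul {x y z : ℝ} (h : x + y + z = 0) : bracket x ≤ bracket y * bracket z := by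
  have h1 : |x| ≤ |y| + |z| := by
    rw [show x = -(y + z) by linarith, abs_neg]; exact abs_add_le _ _
  unfold bracket
  nlinarith [mul_nonneg (abs_nonneg y) (abs_nonneg z)]

/-- The quotient `⟨z⟩ / (⟨x⟩ ⟨y⟩)`; its power with exponent `s` is the weight in the trilinear form
that comes from the norms of regularity `s`, with the output at the frequency `z`. -/
def bracketQuot (x y z : ℝ) : ℝ := bracket z / (bracket x * bracket y)

theorem bracketQuot_pos (x y z : ℝ) : 0 < bracketQuot x y z :=
  div_pos (bracket_pos _) (mul_pos (bracket_pos _) (bracket_pos _))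

/-- The quotient is at most `1` if the frequencies have sum zero, so that its powers decrease in `s`
and only the smallest exponent of a range has to be considered. -/
theorem bracketQuot_rpow_anti {x y z s t : ℝ} (h : x + y + z = 0) (hts : t ≤ s) :
    bracketQuot x y z ^ s ≤ bracketQuot x y z ^ t := by
  refine Real.rpow_le_rpow_of_exponent_ge (bracketQuot_pos _ _ _) ?_ hts
  exact (div_le_one (mul_pos (bracket_pos _) (bracket_pos _))).2 (bracket_le_mul (by linarith))

theorem bracketQuot_neg_half (x y z : ℝ) :
    (bracketQuot x y z ^ (-(1 / 2) : ℝ)) ^ 2 = bracket x * bracket y / bracket z := by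
  rw [rpow_sq (bracketQuot_pos _ _ _).le, show (2 : ℝ) * -(1 / 2) = -1 by norm_num,
    Real.rpow_neg_one, bracketQuot, inv_div]

theorem bracketQuot_half (x y z : ℝ) :
    (bracketQuot x y z ^ (1 / 2 : ℝ)) ^ 2 = bracket z / (bracket x * bracket y) := by
  rw [rpow_sq (bracketQuot_pos _ _ _).le, show (2 : ℝ) * (1 / 2) = 1 by norm_num,
    Real.rpow_one, bracketQuot]

/-- The weight of a product with derivative on the output frequency `z`. -/
theorem outWeight_sq_le {x y z s : ℝ} (h : x + y + z = 0) (hs : -(1 / 2) ≤ s) :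
    (|z| * bracketQuot x y z ^ s) ^ 2 ≤ bracket x * bracket y * bracket z := by
  have hx := bracket_pos x
  have hy := bracket_pos y
  have hz := bracket_pos z
  calc _ ≤ (|z| * bracketQuot x y z ^ (-(1 / 2) : ℝ)) ^ 2 := by
        have := (bracketQuot_pos x y z)
        gcongr (|z| * ?_) ^ 2; exact bracketQuot_rpow_anti h hs
    _ = |z| ^ 2 * (bracket x * bracket y / bracket z) := by rw [mul_pow, bracketQuot_neg_half]
    _ ≤ bracket z ^ 2 * (bracket x * bracket y / bracket z) := by
        gcongr; exact abs_le_bracket z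
    _ = _ := by field_simp

/-- The weight of a product with derivative on the input frequency `x`. -/
theorem inWeight_sq_le {x y z s : ℝ} (h : x + y + z = 0) (hs : 1 / 2 ≤ s) :
    (|x| * bracketQuot x y z ^ s) ^ 2 ≤ bracket x * bracket z / bracket y := by
  have hx := bracket_pos x
  have hy := bracket_pos y
  have hz := bracket_pos z
  calc _ ≤ (|x| * bracketQuot x y z ^ (1 / 2 : ℝ)) ^ 2 := by
        have := (bracketQuot_pos x y z)
        gcongr (|x| * ?_) ^ 2; exact bracketQuot_rpow_anti h hs
    _ = |x| ^ 2 * (bracket z / (bracket x * bracket y)) := by rw [mul_pow, bracketQuot_half]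
    _ ≤ bracket x ^ 2 * (bracket z / (bracket x * bracket y)) := by
        gcongr; exact abs_le_bracket x
    _ = _ := by field_simp

/-- At the exponent `-1/4` the square of the weight is `|w|² (⟨x⟩ ⟨y⟩ / ⟨z⟩)^{1/2}`, and the
fraction is at most `⟨x⟩²` and at most `⟨y⟩²`. -/
theorem inWeight_sq_le_of_neg {x y z s : ℝ} (h : x + y + z = 0) (hs : -(1 / 4) ≤ s) (w : ℝ) :
    (|w| * bracketQuot x y z ^ s) ^ 2 ≤ |w| ^ 2 * bracket x ∧
      (|w| * bracketQuot x y z ^ s) ^ 2 ≤ |w| ^ 2 * bracket y := by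
  have hx := bracket_pos x
  have hy := bracket_pos y
  have hz := bracket_pos z
  have hq := bracketQuot_pos x y z
  have h0 : (|w| * bracketQuot x y z ^ s) ^ 2 ≤
      |w| ^ 2 * (bracket x * bracket y / bracket z) ^ (1 / 2 : ℝ) := by
    calc _ ≤ (|w| * bracketQuot x y z ^ (-(1 / 4) : ℝ)) ^ 2 := by
          gcongr (|w| * ?_) ^ 2; exact bracketQuot_rpow_anti h hs
      _ = _ := by
          rw [mul_pow, rpow_sq hq.le, ← inv_div (bracket z), ← bracketQuot,
            ← Real.rpow_neg_eq_inv_rpow]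
          norm_num
  have hsq : ∀ {t u : ℝ}, 0 < t → 0 ≤ u → u ≤ t ^ 2 → u ^ (1 / 2 : ℝ) ≤ t := by
    intro t u ht hu h
    rw [← Real.sqrt_eq_rpow]
    exact Real.sqrt_le_iff.2 ⟨ht.le, h⟩
  constructor
  · refine h0.trans (mul_le_mul_of_nonneg_left (hsq hx (by positivity) ?_) (by positivity))
    rw [div_le_iff₀ hz]
    calc bracket x * bracket y ≤ bracket x * (bracket x * bracket z) := by
          gcongr; exact bracket_le_mul (by linarith)
      _ = _ := by ring
  · refine h0.trans (mul_le_mul_of_nonneg_left (hsq hy (by positivity) ?_) (by positivity))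
    rw [div_le_iff₀ hz]
    calc bracket x * bracket y ≤ (bracket y * bracket z) * bracket y := by
          gcongr; exact bracket_le_mul (by linarith)
      _ = _ := by ring

/-- For comparable frequencies the quotient of the brackets is of order `1 / N`. -/
theorem weight_sq_le_of_comparable {x y z w N c s t : ℝ} (h : x + y + z = 0) (hc : 0 < c)
    (hN : 1 ≤ N) (ht0 : 0 ≤ t) (ht1 : t ≤ 1) (hts : t ≤ s) (hx : c * N ≤ |x|) (hy : c * N ≤ |y|)
    (hz : bracket z ≤ N) (hw : |w| ≤ N) :
    (|w| * bracketQuot x y z ^ s) ^ 2 ≤ (1 + c ^ (-4 : ℝ)) * N ^ (2 - 2 * t) := by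
  have hN0 : 0 < N := by linarith
  have hq := bracketQuot_pos x y z
  have hcN : 0 < c * N := by positivity
  have i1 : bracketQuot x y z ≤ c ^ (-2 : ℝ) * N ^ (-1 : ℝ) := by
    rw [Real.rpow_neg_one, Real.rpow_neg hc.le, show (2 : ℝ) = ((2 : ℕ) : ℝ) by norm_num,
      Real.rpow_natCast]
    calc bracketQuot x y z ≤ N / ((c * N) * (c * N)) := by
          have := bracket_pos x
          unfold bracketQuot
          gcongr
          exacts [hx.trans (abs_le_bracket x), hy.trans (abs_le_bracket y)]
      _ = _ := by field_simp
  have i2 : (c ^ (-4 : ℝ)) ^ t ≤ 1 + c ^ (-4 : ℝ) := by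
    have hc4 : 0 < c ^ (-4 : ℝ) := by positivity
    calc (c ^ (-4 : ℝ)) ^ t ≤ (1 + c ^ (-4 : ℝ)) ^ t := by gcongr; linarith
      _ ≤ (1 + c ^ (-4 : ℝ)) ^ (1 : ℝ) :=
          Real.rpow_le_rpow_of_exponent_le (by linarith) ht1
      _ = _ := Real.rpow_one _
  calc _ ≤ (N * (c ^ (-2 : ℝ) * N ^ (-1 : ℝ)) ^ t) ^ 2 := by
        gcongr
        exact (bracketQuot_rpow_anti h hts).trans (by gcongr)
    _ = (c ^ (-4 : ℝ)) ^ t * N ^ (2 - 2 * t) := by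
        rw [Real.mul_rpow (by positivity) (by positivity), ← Real.rpow_mul hc.le,
          ← Real.rpow_mul hN0.le, ← Real.rpow_mul hc.le, mul_pow, mul_pow, rpow_sq hc.le,
          rpow_sq hN0.le, ← Real.rpow_natCast N 2, mul_left_comm, ← Real.rpow_add hN0]
        congr 2 <;> push_cast <;> ring
    _ ≤ _ := by gcongr

/-! ### Products of functions on `ℤ_λ × ℝ` -/

theorem measurable_prod_int {E : Type*} [MeasurableSpace E] {f : ℤ → ℝ → E}
    (hf : ∀ n, Measurable (f n)) : Measurable fun q : ℤ × ℝ => f q.1 q.2 :=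
  measurable_from_prod_countable_right hf

/-- Almost every point of `ℤ_λ × ℝ` means almost every point of each line. -/
theorem ae_phaseMeasure_of_forall {lam : ℝ} {P : ℤ → ℝ → Prop}
    (hP : ∀ n, ∀ᵐ τ : ℝ, P n τ) : ∀ᵐ q ∂(phaseMeasure lam), P q.1 q.2 := by
  choose t ht hmt htm using fun n => exists_measurable_superset_of_null (hP n)
  have hm : MeasurableSet {q : ℤ × ℝ | q.2 ∈ t q.1} := by
    have : {q : ℤ × ℝ | q.2 ∈ t q.1} = ⋃ n, ({n} : Set ℤ) ×ˢ t n := by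
      ext ⟨n, τ⟩; simp
    rw [this]
    exact MeasurableSet.iUnion fun n => (measurableSet_singleton n).prod (hmt n)
  refine measure_mono_null (t := {q : ℤ × ℝ | q.2 ∈ t q.1}) (fun q hq => ht _ hq) ?_
  rw [Measure.prod_apply hm]
  simp [htm]

theorem ae_mul_congr {lam : ℝ} {f f' g g' : ℤ → ℝ → ℂ} (hf : ∀ n, f n =ᵐ[volume] f' n)
    (hg : ∀ n, g n =ᵐ[volume] g' n) (n : ℤ) (τ : ℝ) :
    (fun q : ℤ × ℝ => f q.1 q.2 * g (n - q.1) (τ - q.2)) =ᵐ[phaseMeasure lam]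
      fun q => f' q.1 q.2 * g' (n - q.1) (τ - q.2) := by
  refine ae_phaseMeasure_of_forall (P := fun m t => f m t * g (n - m) (τ - t) =
    f' m t * g' (n - m) (τ - t)) fun m => ?_
  have h2 := ((Measure.measurePreserving_sub_left (volume : Measure ℝ)
    τ).quasiMeasurePreserving).ae (hg (n - m))
  filter_upwards [hf m, h2] with t h1 h2
  rw [h1, h2]

theorem fourierMul_congr {lam : ℝ} {f f' g g' : ℤ → ℝ → ℂ} (hf : ∀ n, f n =ᵐ[volume] f' n)
    (hg : ∀ n, g n =ᵐ[volume] g' n) (n : ℤ) (τ : ℝ) :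
    fourierMul lam f g n τ = fourierMul lam f' g' n τ := by
  rw [fourierMul, fourierMul, integral_congr_ae (ae_mul_congr hf hg n τ)]

theorem convConverges_congr {lam : ℝ} {f f' g g' : ℤ → ℝ → ℂ} (hf : ∀ n, f n =ᵐ[volume] f' n)
    (hg : ∀ n, g n =ᵐ[volume] g' n) (n : ℤ) (τ : ℝ) :
    ConvConverges lam f g n τ ↔ ConvConverges lam f' g' n τ :=
  integrable_congr (ae_mul_congr hf hg n τ)

/-- The integrand of the square of the norm of `X_{s,1/2}`. -/
def xDensity (lam : ℝ) (p : ℤ → ℝ) (s : ℝ) (f : ℤ → ℝ → ℂ) (x : ℤ × ℝ) : ℝ≥0∞ :=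
  ENNReal.ofReal (bracket (freq lam x.1) ^ s * modulation p x ^ (1 / 2 : ℝ) * ‖f x.1 x.2‖)

theorem measurable_xDensity {lam : ℝ} {p : ℤ → ℝ} {s : ℝ} {f : ℤ → ℝ → ℂ}
    (hf : ∀ n, Measurable (f n)) : Measurable (xDensity lam p s f) :=
  (((measurable_of_countable fun n : ℤ => bracket (freq lam n) ^ s).comp measurable_fst).mul
    ((measurable_modulation p).pow_const _) |>.mul (measurable_prod_int hf).norm).ennreal_ofReal

theorem lintegral_xDensity {lam α β s : ℝ} {f f' : ℤ → ℝ → ℂ} (hf' : ∀ n, Measurable (f' n))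
    (hf : ∀ n, f n =ᵐ[volume] f' n) :
    ∫⁻ x, xDensity lam (wave lam α β) s f' x ^ 2 ∂(phaseMeasure lam) =
      xNorm lam α β s (1 / 2) f ^ 2 := by
  rw [xNorm, ← ENNReal.rpow_two, ← ENNReal.rpow_mul, show (1 / 2 : ℝ) * 2 = 1 by norm_num,
    ENNReal.rpow_one, lintegral_prod _ ((measurable_xDensity hf').pow_const 2).aemeasurable]
  refine lintegral_congr fun n => lintegral_congr_ae ?_
  filter_upwards [hf n] with τ h
  rw [ENNReal.rpow_two, h]
  rfl

/-- The modulation weights `M`, `R` and the frequency weights `P`, `Q` of the two factors are moved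
from the densities to the kernel. -/
theorem kernel_le {a b w W P Q L M R F G κ : ℝ} (hP : 0 < P) (hQ : 0 < Q) (hM : 0 < M)
    (hR : 0 < R) (hL : 0 ≤ L) (hF : 0 ≤ F) (hG : 0 ≤ G)
    (h : F = 0 ∨ G = 0 ∨ κ * a * b * w * P⁻¹ * Q⁻¹ ≤ W) :
    w * L * κ * ((a * F) * (b * G)) ≤
      W * (L * (M * R) ^ (-(1 / 2) : ℝ)) * ((P * M ^ (1 / 2 : ℝ) * F) *
        (Q * R ^ (1 / 2 : ℝ) * G)) := by
  have hM2 : 0 < M ^ (1 / 2 : ℝ) := Real.rpow_pos_of_pos hM _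
  have hR2 : 0 < R ^ (1 / 2 : ℝ) := Real.rpow_pos_of_pos hR _
  rcases h with h | h | h
  · simp [h]
  · simp [h]
  rw [Real.rpow_neg (by positivity), Real.mul_rpow hM.le hR.le]
  calc _ = (κ * a * b * w * P⁻¹ * Q⁻¹) * (L * P * Q * F * G) := by field_simp
    _ ≤ W * (L * P * Q * F * G) := by gcongr
    _ = _ := by field_simp

/-- The passage from the bilinear estimates for nonnegative functions to the estimates in the
Fourier restriction spaces: `u = c f` and `v = d g` are the factors, and `h` is their product, up to
a multiplier that is bounded by `κ`. -/
theorem ZBdd.zNorm_le {lam α β α' β' α'' β'' s : ℝ} (hlam : 0 < lam) {f g u v h : ℤ → ℝ → ℂ}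
    {c d : ℤ → ℂ} {κ : ℤ → ℝ} {W : ℤ → ℤ → ℝ} {A : ℝ≥0∞} (hA : A ≠ ⊤)
    (hf : MemX lam α β s (1 / 2) f) (hg : MemX lam α' β' s (1 / 2) g)
    (hu : ∀ n τ, u n τ = c n * f n τ) (hv : ∀ n τ, v n τ = d n * g n τ)
    (hκ : ∀ n, 0 ≤ κ n) (hh : ∀ n τ, ‖h n τ‖ ≤ κ n * ‖fourierMul lam u v n τ‖)
    (hW : ∀ n m, (n = 0 ∧ ZeroMean f) ∨ (m = 0 ∧ ZeroMean g) ∨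
      κ (n + m) * ‖c n‖ * ‖d m‖ * bracket (freq lam (n + m)) ^ s * (bracket (freq lam n) ^ s)⁻¹ *
        (bracket (freq lam m) ^ s)⁻¹ ≤ W n m)
    (hZ : ZBdd lam (wave lam α β) (wave lam α' β') (wave lam α'' β'') W A) :
    (∀ n, κ n ≠ 0 → ∀ᵐ τ : ℝ, ConvConverges lam u v n τ) ∧
      zNorm lam α'' β'' s h ≤ 2 * A ^ (1 / 2 : ℝ) *
        (xNorm lam α β s (1 / 2) f * xNorm lam α' β' s (1 / 2) g) := by
  -- measurable representatives, which vanish at the frequency zero if the mean is zero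
  have rep : ∀ {α β : ℝ} {f : ℤ → ℝ → ℂ}, MemX lam α β s (1 / 2) f → ∃ f' : ℤ → ℝ → ℂ,
      (∀ n, Measurable (f' n)) ∧ (∀ n, f n =ᵐ[volume] f' n) ∧
        (ZeroMean f → ∀ τ, f' 0 τ = 0) := by
    intro α β f hf
    classical
    refine ⟨fun n => if n = 0 ∧ ZeroMean f then 0 else (hf.measurable n).mk (f n),
      fun n => ?_, fun n => ?_, fun hz τ => ?_⟩
    · dsimp only; split_ifs
      exacts [measurable_const, (hf.measurable n).stronglyMeasurable_mk.measurable]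
    · dsimp only; split_ifs with hn
      · rw [hn.1]; exact hn.2
      · exact (hf.measurable n).ae_eq_mk
    · simp [hz]
  obtain ⟨f', hfm, hff, hf0⟩ := rep hf
  obtain ⟨g', hgm, hgg, hg0⟩ := rep hg
  set u' : ℤ → ℝ → ℂ := fun n τ => c n * f' n τ with hu'
  set v' : ℤ → ℝ → ℂ := fun n τ => d n * g' n τ with hv'
  have hum : ∀ n, Measurable (u' n) := fun n => (hfm n).const_mul _
  have hvm : ∀ n, Measurable (v' n) := fun n => (hgm n).const_mul _
  have huu : ∀ n, u n =ᵐ[volume] u' n := fun n => by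
    filter_upwards [hff n] with τ hτ
    rw [hu, hτ]
  have hvv : ∀ n, v n =ᵐ[volume] v' n := fun n => by
    filter_upwards [hgg n] with τ hτ
    rw [hv, hτ]
  set F := xDensity lam (wave lam α β) s f' with hF
  set G := xDensity lam (wave lam α' β') s g' with hG
  have hFm : Measurable F := measurable_xDensity hfm
  have hGm : Measurable G := measurable_xDensity hgm
  obtain ⟨hZx, hZl⟩ := hZ F G hFm hGm
  rw [hF, hG, lintegral_xDensity hfm hff, lintegral_xDensity hgm hgg, ← hF, ← hG] at hZx hZl
  set X := xNorm lam α β s (1 / 2) f with hX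
  set Y := xNorm lam α' β' s (1 / 2) g with hY
  have hfin : A * (X ^ 2 * Y ^ 2) < ⊤ :=
    ENNReal.mul_lt_top hA.lt_top (ENNReal.mul_lt_top (ENNReal.pow_lt_top hf.finite)
      (ENNReal.pow_lt_top hg.finite))
  set J : ℤ × ℝ → ℝ≥0∞ := fun z =>
    ∫⁻ q, ‖u' q.1 q.2 * v' (z.1 - q.1) (z.2 - q.2)‖ₑ ∂(phaseMeasure lam) with hJ
  have hmeas : ∀ z : ℤ × ℝ, Measurable fun q : ℤ × ℝ =>
      u' q.1 q.2 * v' (z.1 - q.1) (z.2 - q.2) := fun z =>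
    (measurable_prod_int hum).mul ((measurable_prod_int hvm).comp (measurable_const.sub measurable_id
      : Measurable fun q : ℤ × ℝ => z - q))
  set Lo := modulation (wave lam α'' β'') with hLo
  -- the pointwise bounds by the bilinear operators
  have hcore : ∀ (L : ℝ) (z q : ℤ × ℝ), 0 ≤ L →
      ENNReal.ofReal (bracket (freq lam z.1) ^ s * L * κ z.1) *
        ‖u' q.1 q.2 * v' (z.1 - q.1) (z.2 - q.2)‖ₑ ≤
      ENNReal.ofReal (W q.1 (z - q).1 * (L * (modulation (wave lam α β) q *
        modulation (wave lam α' β') (z - q)) ^ (-(1 / 2) : ℝ))) * (F q * G (z - q)) := by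
    intro L z q hL
    have hP : 0 < bracket (freq lam q.1) ^ s := Real.rpow_pos_of_pos (bracket_pos _) _
    have hQ : 0 < bracket (freq lam (z - q).1) ^ s := Real.rpow_pos_of_pos (bracket_pos _) _
    have h1 := kernel_le (a := ‖c q.1‖) (b := ‖d (z - q).1‖) (w := bracket (freq lam z.1) ^ s)
      (W := W q.1 (z - q).1) (κ := κ z.1) hP hQ (modulation_pos (wave lam α β) q)
      (modulation_pos (wave lam α' β') (z - q)) hL (norm_nonneg (f' q.1 q.2))
      (norm_nonneg (g' (z - q).1 (z - q).2)) (by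
        rcases hW q.1 (z - q).1 with ⟨h, h'⟩ | ⟨h, h'⟩ | h
        · left; rw [h, hf0 h', norm_zero]
        · right; left; rw [h, hg0 h', norm_zero]
        · right; right
          rwa [show q.1 + (z - q).1 = z.1 by simp] at h)
    have e1 : ‖u' q.1 q.2 * v' (z.1 - q.1) (z.2 - q.2)‖ₑ =
        ENNReal.ofReal ((‖c q.1‖ * ‖f' q.1 q.2‖) *
          (‖d (z - q).1‖ * ‖g' (z - q).1 (z - q).2‖)) := by
      rw [← ofReal_norm, norm_mul, hu', hv', norm_mul, norm_mul]; rfl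
    have hw0 : 0 ≤ bracket (freq lam z.1) ^ s * L * κ z.1 := by
      have := hκ z.1
      have := bracket_pos (freq lam z.1)
      positivity
    rw [e1, ← ENNReal.ofReal_mul hw0, hF, hG, xDensity, xDensity,
      ← ENNReal.ofReal_mul (by
        have := modulation_pos (wave lam α β) q
        positivity), ← ENNReal.ofReal_mul' (by
        have := modulation_pos (wave lam α β) q
        have := modulation_pos (wave lam α' β') (z - q)
        positivity)]
    exact ENNReal.ofReal_le_ofReal h1
  have hint : ∀ (L : ℝ) (z : ℤ × ℝ), 0 ≤ L →
      ENNReal.ofReal (bracket (freq lam z.1) ^ s * L * κ z.1) * J z ≤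
      ∫⁻ q, ENNReal.ofReal (W q.1 (z - q).1 * (L * (modulation (wave lam α β) q *
        modulation (wave lam α' β') (z - q)) ^ (-(1 / 2) : ℝ))) * (F q * G (z - q))
        ∂(phaseMeasure lam) := by
    intro L z hL
    rw [hJ, ← lintegral_const_mul _ (hmeas z).enorm]
    exact lintegral_mono fun q => hcore L z q hL
  have hxle : ∀ z, ENNReal.ofReal (bracket (freq lam z.1) ^ s * Lo z ^ (-(1 / 2) : ℝ) * κ z.1) *
      J z ≤ bil lam (xKernel (wave lam α β) (wave lam α' β') (wave lam α'' β'') W) F G z := by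
    intro z
    have h0 : 0 < Lo z := modulation_pos _ _
    refine (hint _ z (by positivity)).trans (le_of_eq (lintegral_congr fun q => ?_))
    have h1 := modulation_pos (wave lam α β) q
    have h2 := modulation_pos (wave lam α' β') (z - q)
    rw [xKernel, add_sub_cancel, mul_assoc (modulation _ z),
      Real.mul_rpow (modulation_pos (wave lam α'' β'') z).le (by positivity)]
  have hlle : ∀ z, ENNReal.ofReal (bracket (freq lam z.1) ^ s * Lo z ^ (-1 : ℝ) * κ z.1) *
      J z ≤ bil lam (lKernel (wave lam α β) (wave lam α' β') (wave lam α'' β'') W) F G z := by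
    intro z
    have h0 : 0 < Lo z := modulation_pos _ _
    refine (hint _ z (by positivity)).trans (le_of_eq (lintegral_congr fun q => ?_))
    rw [lKernel, add_sub_cancel]
  have hmul : ∀ z : ℤ × ℝ, ‖fourierMul lam u v z.1 z.2‖ₑ ≤ J z := by
    intro z
    rw [fourierMul_congr huu hvv, fourierMul, enorm_mul]
    have h1 : ‖((1 / (4 * Real.pi ^ 2) : ℝ) : ℂ)‖ₑ ≤ 1 := by
      rw [← ofReal_norm, Complex.norm_real, Real.norm_eq_abs, abs_of_pos (by positivity),
        ENNReal.ofReal_le_one]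
      rw [div_le_one (by positivity)]
      nlinarith [Real.pi_gt_three]
    calc _ ≤ 1 * J z := by gcongr; exact enorm_integral_le_lintegral_enorm _
      _ = _ := one_mul _
  have hnorm : ∀ (L : ℝ) (z : ℤ × ℝ), 0 ≤ L →
      ENNReal.ofReal (bracket (freq lam z.1) ^ s * L * ‖h z.1 z.2‖) ≤
        ENNReal.ofReal (bracket (freq lam z.1) ^ s * L * κ z.1) * J z := by
    intro L z hL
    have hb := bracket_pos (freq lam z.1)
    have h1 := hκ z.1
    calc _ ≤ ENNReal.ofReal (bracket (freq lam z.1) ^ s * L * κ z.1 *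
          ‖fourierMul lam u v z.1 z.2‖) := by
          refine ENNReal.ofReal_le_ofReal ?_
          rw [mul_assoc _ (κ z.1)]
          gcongr
          exact hh _ _
      _ = ENNReal.ofReal (bracket (freq lam z.1) ^ s * L * κ z.1) *
          ‖fourierMul lam u v z.1 z.2‖ₑ := by
          rw [ENNReal.ofReal_mul (by positivity), ofReal_norm]
      _ ≤ _ := by gcongr; exact hmul z
  have hbm := measurable_bil (lam := lam) (measurable_xKernel (wave lam α β) (wave lam α' β')
    (wave lam α'' β'') W) hFm hGm
  have hroot : (A * (X ^ 2 * Y ^ 2)) ^ (1 / 2 : ℝ) = A ^ (1 / 2 : ℝ) * (X * Y) := by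
    rw [ENNReal.mul_rpow_of_nonneg _ _ (by norm_num), ← mul_pow, ← ENNReal.rpow_two,
      ← ENNReal.rpow_mul, show (2 : ℝ) * (1 / 2) = 1 by norm_num, ENNReal.rpow_one]
  constructor
  -- the bilinear operator has a finite `L²` norm, hence is finite almost everywhere, and it
  -- dominates the absolute convolution integral wherever `κ n ≠ 0`
  · intro n hn
    have h1 : ∫⁻ τ, bil lam (xKernel (wave lam α β) (wave lam α' β') (wave lam α'' β'') W) F G
        (n, τ) ^ 2 < ⊤ := by
      have h2 := hZx.trans_lt hfin
      rw [lintegral_phaseMeasure lam (hbm.pow_const 2)] at h2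
      have h3 := ENNReal.lt_top_of_mul_ne_top_right h2.ne (by
        rw [ne_eq, ENNReal.ofReal_eq_zero, not_le]; positivity)
      exact (ENNReal.le_tsum n).trans_lt h3
    have h2 := ae_lt_top ((hbm.comp measurable_prodMk_left).pow_const 2) h1.ne
    filter_upwards [h2] with τ hτ
    rw [convConverges_congr huu hvv]
    refine ⟨(hmeas (n, τ)).aestronglyMeasurable, ?_⟩
    have h3 : bil lam (xKernel (wave lam α β) (wave lam α' β') (wave lam α'' β'') W) F G (n, τ) < ⊤ := by
      by_contra hcon
      simp only [Function.comp, not_lt_top_iff.1 hcon] at hτ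
      simp at hτ
    have h4 := (hxle (n, τ)).trans_lt h3
    refine ENNReal.lt_top_of_mul_ne_top_right h4.ne ?_
    have hb := bracket_pos (freq lam n)
    have hκn : 0 < κ n := lt_of_le_of_ne (hκ n) (Ne.symm hn)
    have h0 : 0 < Lo (n, τ) := modulation_pos _ _
    rw [ne_eq, ENNReal.ofReal_eq_zero, not_le]
    positivity
  · have e1 : xNorm lam α'' β'' s (-(1 / 2)) h ≤ A ^ (1 / 2 : ℝ) * (X * Y) := by
      rw [← hroot, xNorm]
      refine ENNReal.rpow_le_rpow (le_trans ?_ hZx) (by norm_num)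
      rw [lintegral_prod _ (hbm.pow_const 2).aemeasurable]
      refine lintegral_mono fun n => lintegral_mono fun τ => ?_
      simp only
      rw [ENNReal.rpow_two]
      gcongr
      exact (hnorm _ (n, τ) (Real.rpow_nonneg (bracket_pos _).le _)).trans (hxle (n, τ))
    have e2 : l2l1Norm lam α'' β'' s h ≤ A ^ (1 / 2 : ℝ) * (X * Y) := by
      rw [← hroot, l2l1Norm]
      refine ENNReal.rpow_le_rpow (le_trans ?_ hZl) (by norm_num)
      refine lintegral_mono fun n => ?_
      simp only
      rw [ENNReal.rpow_two]
      gcongr with τ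
      refine le_trans (le_of_eq ?_) ((hnorm (Lo (n, τ) ^ (-1 : ℝ)) (n, τ)
        (Real.rpow_nonneg (bracket_pos _).le _)).trans (hlle (n, τ)))
      rw [Real.rpow_neg_one]
      congr 1
      rw [mul_right_comm, ← div_eq_mul_inv]
      rfl
    rw [zNorm]
    calc _ ≤ A ^ (1 / 2 : ℝ) * (X * Y) + A ^ (1 / 2 : ℝ) * (X * Y) := add_le_add e1 e2
      _ = _ := by ring

/-! ### The four bilinear estimates -/

theorem two_mul_rpow_half {C lam p : ℝ} (hC : 0 < C) (hlam : 0 < lam) :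
    2 * ENNReal.ofReal (C * lam ^ (2 * p)) ^ (1 / 2 : ℝ) =
      ENNReal.ofReal (2 * C ^ (1 / 2 : ℝ) * lam ^ p) := by
  rw [ENNReal.ofReal_rpow_of_nonneg (by positivity) (by norm_num),
    Real.mul_rpow hC.le (by positivity), ← Real.rpow_mul hlam.le,
    show 2 * p * (1 / 2) = p by ring, mul_assoc 2, ENNReal.ofReal_mul zero_le_two,
    ENNReal.ofReal_ofNat]

theorem norm_fourierDx (lam : ℝ) (f : ℤ → ℝ → ℂ) (n : ℤ) (τ : ℝ) :
    ‖fourierDx lam f n τ‖ = |freq lam n| * ‖f n τ‖ := by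
  rw [fourierDx, norm_mul, norm_mul, Complex.norm_I, one_mul, Complex.norm_real,
    Real.norm_eq_abs, freq]

theorem bracketQuot_comm (x y z : ℝ) : bracketQuot x y z = bracketQuot y x z := by
  rw [bracketQuot, bracketQuot, mul_comm]

theorem bracketQuot_rpow (x y z s : ℝ) :
    bracketQuot x y z ^ s = bracket z ^ s * (bracket x ^ s)⁻¹ * (bracket y ^ s)⁻¹ := by
  have hx := bracket_pos x
  have hy := bracket_pos y
  have hz := bracket_pos z
  rw [bracketQuot, Real.div_rpow hz.le (by positivity), Real.mul_rpow hx.le hy.le]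
  field_simp

theorem freq_sum (lam : ℝ) (n m : ℤ) : freq lam n + freq lam m + freq lam (-n - m) = 0 := by
  rw [freq_neg_sub]; ring

theorem abs_le_size (lam : ℝ) (n m : ℤ) : |freq lam n| ≤ size lam n m ∧
    |freq lam m| ≤ size lam n m ∧ |freq lam (-n - m)| ≤ size lam n m := by
  obtain ⟨h1, h2, h3⟩ := bracket_le_size lam n m
  exact ⟨(abs_le_bracket _).trans h1, (abs_le_bracket _).trans h2, (abs_le_bracket _).trans h3⟩

theorem bracket_prod_le (lam : ℝ) (n m : ℤ) :
    bracket (freq lam n) * bracket (freq lam m) * bracket (freq lam (-n - m)) ≤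
      bracket (freq lam (-n - m)) * size lam n m ^ 2 := by
  obtain ⟨h1, h2, h3⟩ := bracket_le_size lam n m
  have k1 := bracket_pos (freq lam n)
  have k2 := bracket_pos (freq lam m)
  have k3 := bracket_pos (freq lam (-n - m))
  have := size_one_le lam n m
  calc _ = bracket (freq lam (-n - m)) * (bracket (freq lam n) * bracket (freq lam m)) := by ring
    _ ≤ bracket (freq lam (-n - m)) * (size lam n m * size lam n m) := by gcongr
    _ = _ := by ring

theorem freq_zero (lam : ℝ) : freq lam 0 = 0 := by simp [freq]

section Estimates

variable {α₁ α₂ s p : ℝ}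

theorem exists_div1_le (hα₁ : α₁ ≠ 0) : ∃ C : ℝ, 0 < C ∧ ∀ lam β₁ β₂ : ℝ, 1 ≤ lam →
    |β₁| + |β₂| ≤ lam ^ (-(1 / 2) : ℝ) → ∀ f g : ℤ → ℝ → ℂ, MemX lam α₁ β₁ s (1 / 2) f →
      MemX lam α₁ β₁ s (1 / 2) g → Div1Cond (α₂ / α₁) s p β₁ β₂ f g →
      (∀ n : ℤ, n ≠ 0 → ∀ᵐ τ : ℝ, ConvConverges lam f g n τ) ∧
      zNorm lam α₂ β₂ s (fourierDx lam (fourierMul lam f g)) ≤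
        ENNReal.ofReal (C * lam ^ p) *
          (xNorm lam α₁ β₁ s (1 / 2) f * xNorm lam α₁ β₁ s (1 / 2) g) := by
  set U : ℝ → ℤ → ℤ → ℝ := fun lam n m => |freq lam (-n - m)| *
    bracketQuot (freq lam n) (freq lam m) (freq lam (-n - m)) ^ s with hU
  obtain ⟨C, hC, h⟩ := exists_symZ_of_range (α₂ := α₂) (a := -(1 / 2)) (b := -(1 / 2)) (s := s)
    (p := p) (U := U) hα₁ (by norm_num)
    (fun lam n m => mul_nonneg (abs_nonneg _) (Real.rpow_nonneg (bracketQuot_pos _ _ _).le _))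
    (fun hs lam n m => (outWeight_sq_le (freq_sum lam n m) hs).trans (bracket_prod_le lam n m))
    (fun hs lam n m => outWeight_sq_le (freq_sum lam n m) hs)
    (fun c t hc ht0 ht1 hts lam n m h1 h2 h3 => weight_sq_le_of_comparable (freq_sum lam n m) hc
      (size_one_le lam n m) ht0 ht1 hts h1 h2 (bracket_le_size lam n m).2.2
      (abs_le_size lam n m).2.2)
  refine ⟨2 * C ^ (1 / 2 : ℝ), by positivity, fun lam β₁ β₂ hlam hβ f g hf hg hcond => ?_⟩
  have hl : 0 < lam := by linarith
  classical
  -- the weight may be cut off where a factor has mean zero and where `∂_x` vanishes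
  have hS := h lam β₁ β₂ (fun n m => if (n = 0 ∧ ZeroMean f) ∨ (m = 0 ∧ ZeroMean g) ∨
      -n - m = 0 then 0 else U lam n m) hlam hβ (fun n m => by
    split_ifs with h0
    · exact Or.inl rfl
    · push Not at h0; exact Or.inr ⟨h0.2.2, rfl⟩) (by
    rcases hcond with h1 | ⟨h1, h2, h3, hf0, hg0⟩ | h1
    · exact Or.inl h1
    · refine Or.inr (Or.inl ⟨h1, h2, h3, fun n m => ?_⟩)
      split_ifs with h0
      · exact Or.inl rfl
      · push Not at h0
        exact Or.inr ⟨fun hn => h0.1 hn hf0, fun hm => absurd hg0 (h0.2.1 hm)⟩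
    · exact Or.inr (Or.inr h1))
  have key := ZBdd.zNorm_le (h := fourierDx lam (fourierMul lam f g)) (c := fun _ => 1)
    (d := fun _ => 1) (κ := fun n => |freq lam n|) hl ENNReal.ofReal_ne_top hf hg
    (fun n τ => (one_mul _).symm) (fun n τ => (one_mul _).symm) (fun n => abs_nonneg _)
    (fun n τ => (norm_fourierDx _ _ _ _).le) (fun n m => ?_) hS.1
  · rw [two_mul_rpow_half hC hl] at key
    exact ⟨fun n hn => key.1 n (abs_ne_zero.2 (freq_ne_zero hl hn)), key.2⟩
  · by_cases h1 : n = 0 ∧ ZeroMean f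
    · exact Or.inl h1
    by_cases h2 : m = 0 ∧ ZeroMean g
    · exact Or.inr (Or.inl h2)
    refine Or.inr (Or.inr ?_)
    have e : freq lam (n + m) = -freq lam (-n - m) := by rw [← freq_neg]; congr 1; ring
    rw [e, abs_neg, bracket_neg]
    split_ifs with h0
    · rcases h0 with h0 | h0 | h0
      · exact absurd h0 h1
      · exact absurd h0 h2
      · rw [h0, freq_zero]; simp
    · refine le_of_eq ?_
      simp only [hU, norm_one]
      rw [bracketQuot_rpow]; ring

/-- The estimates with factors in the spaces of `(α₁, β₁)` and `(α₂, β₂)`, where `|w|` is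
the factor that comes from the derivative, as a function of the frequency of the first factor and
the negative of the frequency of the product. The full weight is `|w|` times a power of
`bracketQuot`. The three cases correspond to `α₂ / α₁ < 1 / 4`, `α₂ / α₁ = 1` and the resonant
range. -/
theorem exists_mixed_le {a b : ℝ} (hα₁ : α₁ ≠ 0) (ha : a ≤ 0) {w : ℝ → ℤ → ℤ → ℝ}
    (hw : ∀ lam n m, |w lam n m| ≤ size lam n m)
    (hUa : a ≤ s → ∀ lam n m, (|w lam n m| * bracketQuot (freq lam n) (freq lam (-n - m))
      (freq lam m) ^ s) ^ 2 ≤ bracket (freq lam (-n - m)) * size lam n m ^ 2)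
    (hUb : b ≤ s → ∀ lam n m, (|w lam n m| * bracketQuot (freq lam n) (freq lam (-n - m))
      (freq lam m) ^ s) ^ 2 ≤
      bracket (freq lam n) * bracket (freq lam m) * bracket (freq lam (-n - m)))
    (hUz : b ≤ s → ∀ lam n, (|w lam n 0| * bracketQuot (freq lam n) (freq lam (-n - 0))
      (freq lam 0) ^ s) ^ 2 ≤ 1) :
    ∃ C : ℝ, 0 < C ∧ ∀ lam β₁ β₂ : ℝ, 1 ≤ lam → |β₁| + |β₂| ≤ lam ^ (-(1 / 2) : ℝ) →
      ∀ (f g u v h : ℤ → ℝ → ℂ) (c d : ℤ → ℂ) (κ : ℤ → ℝ), MemX lam α₁ β₁ s (1 / 2) f →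
      MemX lam α₂ β₂ s (1 / 2) g → (∀ n τ, u n τ = c n * f n τ) → (∀ n τ, v n τ = d n * g n τ) →
      (∀ n, 0 ≤ κ n) → (∀ n τ, ‖h n τ‖ ≤ κ n * ‖fourierMul lam u v n τ‖) →
      (∀ n m, κ (n + m) * ‖c n‖ * ‖d m‖ = |w lam n (-n - m)|) →
      (∀ n, ZeroMean g ∨ w lam n (-n) = 0) →
      ((α₂ / α₁ < 1 / 4 ∧ a ≤ s ∧ 0 < p) ∨
        (α₂ / α₁ = 1 ∧ b ≤ s ∧ 0 < p ∧ (ZeroMean f ∨ ∀ m, w lam 0 m = 0)) ∨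
        ResonantRange (α₂ / α₁) s p β₁ β₂) →
      (∀ n, κ n ≠ 0 → ∀ᵐ τ : ℝ, ConvConverges lam u v n τ) ∧
      zNorm lam α₁ β₁ s h ≤ ENNReal.ofReal (C * lam ^ p) *
          (xNorm lam α₁ β₁ s (1 / 2) f * xNorm lam α₂ β₂ s (1 / 2) g) := by
  set U : ℝ → ℤ → ℤ → ℝ := fun lam n m => |w lam n m| *
    bracketQuot (freq lam n) (freq lam (-n - m)) (freq lam m) ^ s with hU
  obtain ⟨C, hC, h⟩ := exists_symZ_of_range (α₂ := α₂) (a := a) (b := b) (s := s)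
    (p := p) (U := U) hα₁ ha
    (fun lam n m => mul_nonneg (abs_nonneg _) (Real.rpow_nonneg (bracketQuot_pos _ _ _).le _))
    hUa hUb
    (fun c t hc ht0 ht1 hts lam n m h1 h2 h3 => weight_sq_le_of_comparable
      (by linarith [freq_sum lam n m]) hc (size_one_le lam n m) ht0 ht1 hts h1 h3
      (bracket_le_size lam n m).2.1 (hw lam n m))
  refine ⟨2 * C ^ (1 / 2 : ℝ), by positivity, fun lam β₁ β₂ hlam hβ f g u v h' c d κ hf hg hu hv
    hκ hh hcd hz hcond => ?_⟩
  have hl : 0 < lam := by linarith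
  classical
  have hS := h lam β₁ β₂ (fun n m => if n = 0 ∧ (ZeroMean f ∨ ∀ m, w lam 0 m = 0) ∨
      -n - m = 0 then 0 else U lam n m) hlam hβ (fun n m => by
    split_ifs with h0
    · exact Or.inl rfl
    · push Not at h0; exact Or.inr ⟨h0.2, rfl⟩) (by
    rcases hcond with h1 | ⟨h1, h2, h3, hf0⟩ | h1
    · exact Or.inl h1
    · refine Or.inr (Or.inl ⟨h1, h2, h3, fun n m => ?_⟩)
      split_ifs with h0
      · exact Or.inl rfl
      · refine Or.inr ⟨fun hn => h0 (Or.inl ⟨hn, hf0⟩), fun hm => ?_⟩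
        rw [hm]; exact hUz h2 lam n
    · exact Or.inr (Or.inr h1))
  have key := ZBdd.zNorm_le (h := h') hl ENNReal.ofReal_ne_top hf hg hu hv hκ hh
    (fun n m => ?_) hS.2
  · rwa [two_mul_rpow_half hC hl] at key
  · rw [hcd]
    have hswap : -n - (-n - m) = m := by ring
    simp only [hswap]
    by_cases h1 : n = 0 ∧ ZeroMean f
    · exact Or.inl h1
    by_cases h2 : m = 0 ∧ ZeroMean g
    · exact Or.inr (Or.inl h2)
    refine Or.inr (Or.inr ?_)
    have e : freq lam (n + m) = -freq lam (-n - m) := by rw [← freq_neg]; congr 1; ring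
    rw [e, bracket_neg]
    split_ifs with h0
    · have hw0 : w lam n (-n - m) = 0 := by
        rcases h0 with ⟨hn, h0 | h0⟩ | h0
        · exact absurd ⟨hn, h0⟩ h1
        · rw [hn, h0]
        · rw [h0, sub_zero]
          exact (hz n).resolve_left fun hg0 => h2 ⟨h0, hg0⟩
      rw [hw0]; simp
    · refine le_of_eq ?_
      simp only [hU]
      rw [hswap, bracketQuot_rpow]; ring

theorem freq_sum' (lam : ℝ) (n m : ℤ) : freq lam n + freq lam (-n - m) + freq lam m = 0 := by
  rw [freq_neg_sub]; ring

theorem exists_div2_le (hα₁ : α₁ ≠ 0) : ∃ C : ℝ, 0 < C ∧ ∀ lam β₁ β₂ : ℝ, 1 ≤ lam →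
    |β₁| + |β₂| ≤ lam ^ (-(1 / 2) : ℝ) → ∀ f g : ℤ → ℝ → ℂ, MemX lam α₁ β₁ s (1 / 2) f →
      MemX lam α₂ β₂ s (1 / 2) g → Div2Cond (α₂ / α₁) s p β₁ β₂ f g →
      (∀ n : ℤ, n ≠ 0 → ∀ᵐ τ : ℝ, ConvConverges lam f g n τ) ∧
      zNorm lam α₁ β₁ s (fourierDx lam (fourierMul lam f g)) ≤
        ENNReal.ofReal (C * lam ^ p) *
          (xNorm lam α₁ β₁ s (1 / 2) f * xNorm lam α₂ β₂ s (1 / 2) g) := by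
  have hb : -(1 / 2) ≤ s → ∀ lam n m, (|freq lam m| * bracketQuot (freq lam n) (freq lam (-n - m))
      (freq lam m) ^ s) ^ 2 ≤
      bracket (freq lam n) * bracket (freq lam m) * bracket (freq lam (-n - m)) := fun hs lam n m =>
    (outWeight_sq_le (freq_sum' lam n m) hs).trans (le_of_eq (by ring))
  obtain ⟨C, hC, h⟩ := exists_mixed_le (α₂ := α₂) (a := -(1 / 2)) (b := -(1 / 2)) (s := s)
    (p := p) (w := fun lam _ m => freq lam m) hα₁ (by norm_num)
    (fun lam n m => (abs_le_size lam n m).2.1)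
    (fun hs lam n m => (hb hs lam n m).trans (bracket_prod_le lam n m)) hb
    (fun _ lam n => by simp [freq_zero])
  refine ⟨C, hC, fun lam β₁ β₂ hlam hβ f g hf hg ⟨hg0, hcond⟩ => ?_⟩
  have key := h lam β₁ β₂ hlam hβ f g f g (fourierDx lam (fourierMul lam f g)) (fun _ => 1)
    (fun _ => 1) (fun n => |freq lam n|) hf hg (fun n τ => (one_mul _).symm)
    (fun n τ => (one_mul _).symm) (fun n => abs_nonneg _)
    (fun n τ => (norm_fourierDx _ _ _ _).le)
    (fun n m => by
      rw [← abs_neg (freq lam (-n - m)), ← freq_neg, show -(-n - m) = n + m by ring]; simp)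
    (fun n => Or.inl hg0)
    (hcond.imp id (Or.imp (fun h => ⟨h.1, h.2.1, h.2.2.1, Or.inl h.2.2.2⟩) id))
  exact ⟨fun n hn => key.1 n (abs_ne_zero.2 (freq_ne_zero (by linarith) hn)), key.2⟩

theorem exists_nondiv1_le (hα₁ : α₁ ≠ 0) : ∃ C : ℝ, 0 < C ∧ ∀ lam β₁ β₂ : ℝ, 1 ≤ lam →
    |β₁| + |β₂| ≤ lam ^ (-(1 / 2) : ℝ) → ∀ f g : ℤ → ℝ → ℂ, MemX lam α₁ β₁ s (1 / 2) f →
      MemX lam α₂ β₂ s (1 / 2) g → Nondiv1Cond (α₂ / α₁) s p β₁ β₂ g →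
      (∀ n : ℤ, ∀ᵐ τ : ℝ, ConvConverges lam (fourierDx lam f) g n τ) ∧
      zNorm lam α₁ β₁ s (fourierMul lam (fourierDx lam f) g) ≤
        ENNReal.ofReal (C * lam ^ p) *
          (xNorm lam α₁ β₁ s (1 / 2) f * xNorm lam α₂ β₂ s (1 / 2) g) := by
  have hb : 1 / 2 ≤ s → ∀ lam n m, (|freq lam n| * bracketQuot (freq lam n) (freq lam (-n - m))
      (freq lam m) ^ s) ^ 2 ≤ bracket (freq lam n) * bracket (freq lam m) /
        bracket (freq lam (-n - m)) := fun hs lam n m => inWeight_sq_le (freq_sum' lam n m) hs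
  obtain ⟨C, hC, h⟩ := exists_mixed_le (α₂ := α₂) (a := -(1 / 4)) (b := 1 / 2) (s := s)
    (p := p) (w := fun lam n _ => freq lam n) hα₁ (by norm_num)
    (fun lam n m => (abs_le_size lam n m).1)
    (fun hs lam n m => by
      refine (inWeight_sq_le_of_neg (freq_sum' lam n m) hs _).2.trans ?_
      have := bracket_pos (freq lam (-n - m))
      rw [mul_comm]
      gcongr
      exact (abs_le_size lam n m).1)
    (fun hs lam n m => (hb hs lam n m).trans (by
      have h1 := bracket_pos (freq lam n)
      have h2 := bracket_pos (freq lam m)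
      have h3 := one_le_bracket (freq lam (-n - m))
      calc _ ≤ bracket (freq lam n) * bracket (freq lam m) / 1 := by gcongr
        _ = bracket (freq lam n) * bracket (freq lam m) * 1 := by ring
        _ ≤ _ := by gcongr))
    (fun hs lam n => (hb hs lam n 0).trans (by
      rw [sub_zero, freq_neg, bracket_neg, freq_zero]
      have h1 := bracket_pos (freq lam n)
      rw [div_le_one h1]
      simp [bracket]))
  refine ⟨C, hC, fun lam β₁ β₂ hlam hβ f g hf hg ⟨hg0, hcond⟩ => ?_⟩
  have key := h lam β₁ β₂ hlam hβ f g (fourierDx lam f) g (fourierMul lam (fourierDx lam f) g)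
    (fun n => Complex.I * (((n : ℝ) / lam : ℝ) : ℂ))
    (fun _ => 1) (fun _ => 1) hf hg (fun n τ => rfl)
    (fun n τ => (one_mul _).symm) (fun n => zero_le_one)
    (fun n τ => by rw [one_mul])
    (fun n m => by
      rw [norm_mul, Complex.norm_I, Complex.norm_real, Real.norm_eq_abs, ← freq_def]; simp)
    (fun n => Or.inl hg0)
    (hcond.imp id (Or.imp (fun h => ⟨h.1, h.2.1, h.2.2, Or.inr fun _ => freq_zero lam⟩) id))
  exact ⟨fun n => key.1 n one_ne_zero, key.2⟩

theorem exists_nondiv2_le (hα₁ : α₁ ≠ 0) : ∃ C : ℝ, 0 < C ∧ ∀ lam β₁ β₂ : ℝ, 1 ≤ lam →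
    |β₁| + |β₂| ≤ lam ^ (-(1 / 2) : ℝ) → ∀ f g : ℤ → ℝ → ℂ, MemX lam α₁ β₁ s (1 / 2) f →
      MemX lam α₂ β₂ s (1 / 2) g → Nondiv2Cond (α₂ / α₁) s p β₁ β₂ f →
      (∀ n : ℤ, ∀ᵐ τ : ℝ, ConvConverges lam f (fourierDx lam g) n τ) ∧
      zNorm lam α₁ β₁ s (fourierMul lam f (fourierDx lam g)) ≤
        ENNReal.ofReal (C * lam ^ p) *
          (xNorm lam α₁ β₁ s (1 / 2) f * xNorm lam α₂ β₂ s (1 / 2) g) := by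
  have hb : 1 / 2 ≤ s → ∀ lam n m, (|freq lam (-n - m)| * bracketQuot (freq lam n)
      (freq lam (-n - m)) (freq lam m) ^ s) ^ 2 ≤ bracket (freq lam (-n - m)) *
        bracket (freq lam m) / bracket (freq lam n) := fun hs lam n m => by
    rw [bracketQuot_comm]
    exact inWeight_sq_le (by linarith [freq_sum' lam n m]) hs
  obtain ⟨C, hC, h⟩ := exists_mixed_le (α₂ := α₂) (a := -(1 / 4)) (b := 1 / 2) (s := s)
    (p := p) (w := fun lam n m => freq lam (-n - m)) hα₁ (by norm_num)
    (fun lam n m => (abs_le_size lam n m).2.2)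
    (fun hs lam n m => by
      refine (inWeight_sq_le_of_neg (freq_sum' lam n m) hs _).2.trans ?_
      have := bracket_pos (freq lam (-n - m))
      rw [mul_comm]
      gcongr
      exact (abs_le_size lam n m).2.2)
    (fun hs lam n m => (hb hs lam n m).trans (by
      have h1 := bracket_pos (freq lam (-n - m))
      have h2 := bracket_pos (freq lam m)
      have h3 := one_le_bracket (freq lam n)
      calc _ ≤ bracket (freq lam (-n - m)) * bracket (freq lam m) / 1 := by gcongr
        _ = 1 * bracket (freq lam m) * bracket (freq lam (-n - m)) := by ring
        _ ≤ _ := by gcongr))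
    (fun hs lam n => (hb hs lam n 0).trans (by
      rw [sub_zero, freq_neg, bracket_neg, freq_zero]
      have h1 := bracket_pos (freq lam n)
      rw [div_le_one h1]
      simp [bracket]))
  refine ⟨C, hC, fun lam β₁ β₂ hlam hβ f g hf hg hcond => ?_⟩
  have key := h lam β₁ β₂ hlam hβ f g f (fourierDx lam g) (fourierMul lam f (fourierDx lam g))
    (fun _ => 1) (fun n => Complex.I * (((n : ℝ) / lam : ℝ) : ℂ))
    (fun _ => 1) hf hg (fun n τ => (one_mul _).symm) (fun n τ => rfl)
    (fun n => zero_le_one)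
    (fun n τ => by rw [one_mul])
    (fun n m => by
      rw [norm_mul, Complex.norm_I, Complex.norm_real, Real.norm_eq_abs, ← freq_def,
        show -n - (-n - m) = m by ring]; simp)
    (fun n => Or.inr (by rw [show -n - -n = 0 by ring, freq_zero]))
    (hcond.imp id (Or.imp (fun h => ⟨h.1, h.2.1, h.2.2.1, Or.inl h.2.2.2⟩) id))
  exact ⟨fun n => key.1 n one_ne_zero, key.2⟩

end Estimates

/-! ### Schwartz functions and their transforms -/

section Schwartz

variable {lam : ℝ} {w w₁ w₂ : ℝ → ℝ → ℂ}

theorem IsSchwartz.fderiv_apply (hw : IsSchwartz lam w) (e : ℝ × ℝ) :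
    IsSchwartz lam fun x t => fderiv ℝ (fun q : ℝ × ℝ => w q.1 q.2) (x, t) e where
  smooth := (hw.smooth.fderiv_right (m := (⊤ : ℕ∞)) (by simp)).clm_apply contDiff_const
  periodic x t := by
    have h : (fun q : ℝ × ℝ => (fun q : ℝ × ℝ => w q.1 q.2) (q + (2 * Real.pi * lam, 0))) =
        fun q : ℝ × ℝ => w q.1 q.2 := by
      ext q; simp [hw.periodic]
    have h2 := fderiv_comp_add_right (𝕜 := ℝ) (f := fun q : ℝ × ℝ => w q.1 q.2) (x := (x, t))
      ((2 * Real.pi * lam, 0) : ℝ × ℝ)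
    rw [h] at h2
    simp only [h2, Prod.mk_add_mk, add_zero]
  decay m j := by
    obtain ⟨K, hK⟩ := hw.decay m (j + 1)
    refine ⟨‖e‖ * K, fun x t => ?_⟩
    have h1 : ‖iteratedFDeriv ℝ j (fun q : ℝ × ℝ =>
        fderiv ℝ (fun q : ℝ × ℝ => w q.1 q.2) q e) (x, t)‖ ≤
        ‖e‖ * ‖iteratedFDeriv ℝ j (fderiv ℝ (fun q : ℝ × ℝ => w q.1 q.2)) (x, t)‖ :=
      norm_iteratedFDeriv_clm_apply_const (N := (⊤ : ℕ∞))
        (hw.smooth.fderiv_right (m := (⊤ : ℕ∞)) (by simp)).contDiffAt (by exact_mod_cast le_top)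
    rw [norm_iteratedFDeriv_fderiv] at h1
    calc _ ≤ |t| ^ m * (‖e‖ * ‖iteratedFDeriv ℝ (j + 1) (fun q : ℝ × ℝ => w q.1 q.2) (x, t)‖) := by
          gcongr
      _ = ‖e‖ * (|t| ^ m * ‖iteratedFDeriv ℝ (j + 1) (fun q : ℝ × ℝ => w q.1 q.2) (x, t)‖) := by
          ring
      _ ≤ _ := by gcongr; exact hK x t

theorem IsSchwartz.mul (h₁ : IsSchwartz lam w₁) (h₂ : IsSchwartz lam w₂) :
    IsSchwartz lam fun x t => w₁ x t * w₂ x t where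
  smooth := h₁.smooth.mul h₂.smooth
  periodic x t := by rw [h₁.periodic, h₂.periodic]
  decay m j := by
    choose K hK using fun i => h₁.decay m i
    choose L hL using fun i => h₂.decay 0 i
    refine ⟨∑ i ∈ Finset.range (j + 1), (j.choose i : ℝ) * (K i * L (j - i)), fun x t => ?_⟩
    have h := norm_iteratedFDeriv_mul_le (𝕜 := ℝ) h₁.smooth h₂.smooth (x, t) (n := j)
      (by exact_mod_cast le_top)
    calc _ ≤ |t| ^ m * _ := mul_le_mul_of_nonneg_left h (by positivity)
      _ ≤ _ := by
        rw [Finset.mul_sum]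
        refine Finset.sum_le_sum fun i _ => ?_
        have k1 := hK i x t
        have k2 := hL (j - i) x t
        rw [pow_zero, one_mul] at k2
        have k0 : 0 ≤ K i := le_trans (by positivity) k1
        calc _ = (j.choose i : ℝ) * ((|t| ^ m * ‖iteratedFDeriv ℝ i
              (fun q : ℝ × ℝ => w₁ q.1 q.2) (x, t)‖) * ‖iteratedFDeriv ℝ (j - i)
              (fun q : ℝ × ℝ => w₂ q.1 q.2) (x, t)‖) := by ring
          _ ≤ _ := by gcongr

theorem IsSchwartz.hasDerivAt_fst (hw : IsSchwartz lam w) (x t : ℝ) :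
    HasDerivAt (fun y => w y t) (fderiv ℝ (fun q : ℝ × ℝ => w q.1 q.2) (x, t) (1, 0)) x := by
  have h : HasFDerivAt (fun q : ℝ × ℝ => w q.1 q.2) _ (x, t) :=
    (hw.smooth.differentiable (by simp) (x, t)).hasFDerivAt
  exact h.comp_hasDerivAt x ((hasDerivAt_id x).prodMk (hasDerivAt_const x t))

theorem IsSchwartz.hasDerivAt_snd (hw : IsSchwartz lam w) (x t : ℝ) :
    HasDerivAt (fun u => w x u) (fderiv ℝ (fun q : ℝ × ℝ => w q.1 q.2) (x, t) (0, 1)) t := by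
  have h : HasFDerivAt (fun q : ℝ × ℝ => w q.1 q.2) _ (x, t) :=
    (hw.smooth.differentiable (by simp) (x, t)).hasFDerivAt
  exact h.comp_hasDerivAt t ((hasDerivAt_const t x).prodMk (hasDerivAt_id t))

theorem IsSchwartz.dx_eq (hw : IsSchwartz lam w) :
    dx w = fun x t => fderiv ℝ (fun q : ℝ × ℝ => w q.1 q.2) (x, t) (1, 0) := by
  ext x t; exact (hw.hasDerivAt_fst x t).deriv

theorem IsSchwartz.dx (hw : IsSchwartz lam w) : IsSchwartz lam (dx w) := by
  rw [hw.dx_eq]; exact hw.fderiv_apply _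

/-- The derivative in the time variable `t`. -/
def dt (w : ℝ → ℝ → ℂ) (x t : ℝ) : ℂ := deriv (fun u => w x u) t

theorem IsSchwartz.dt_eq (hw : IsSchwartz lam w) :
    dt w = fun x t => fderiv ℝ (fun q : ℝ × ℝ => w q.1 q.2) (x, t) (0, 1) := by
  ext x t; exact (hw.hasDerivAt_snd x t).deriv

theorem IsSchwartz.dt (hw : IsSchwartz lam w) : IsSchwartz lam (dt w) := by
  rw [hw.dt_eq]; exact hw.fderiv_apply _

theorem IsSchwartz.exists_norm_le (hw : IsSchwartz lam w) :
    ∃ K : ℝ, 0 ≤ K ∧ ∀ x t, ‖w x t‖ ≤ K * (1 + t ^ 2)⁻¹ := by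
  obtain ⟨K, hK⟩ := hw.decay 0 0
  obtain ⟨L, hL⟩ := hw.decay 2 0
  have key : ∀ x t, ‖w x t‖ ≤ (K + L) * (1 + t ^ 2)⁻¹ := by
    intro x t
    have h1 := hK x t
    have h2 := hL x t
    rw [norm_iteratedFDeriv_zero] at h1 h2
    rw [pow_zero, one_mul] at h1
    rw [sq_abs] at h2
    rw [← div_eq_mul_inv, le_div_iff₀ (by positivity)]
    linarith
  refine ⟨K + L, ?_, key⟩
  have := (norm_nonneg _).trans (key 0 0)
  simpa using this

/-- The measure `dt dx` on the cylinder `𝕋_λ × ℝ`, in the coordinates `(t, x)`. -/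
def cylinder (lam : ℝ) : Measure (ℝ × ℝ) :=
  (volume : Measure ℝ).prod (volume.restrict (Set.Ioc 0 (2 * Real.pi * lam)))

/-- The character `e^{-i(τ t + k x)}`, `k = n / λ`, at the point `(t, x)`. -/
def waveChar (lam : ℝ) (n : ℤ) (τ : ℝ) (q : ℝ × ℝ) : ℂ :=
  Complex.exp (-Complex.I * ((τ * q.1 + (n : ℝ) / lam * q.2 : ℝ) : ℂ))

theorem norm_waveChar (lam : ℝ) (n : ℤ) (τ : ℝ) (q : ℝ × ℝ) : ‖waveChar lam n τ q‖ = 1 := by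
  rw [waveChar, Complex.norm_exp]; simp

theorem waveChar_add (lam : ℝ) (n m : ℤ) (τ σ : ℝ) (q : ℝ × ℝ) :
    waveChar lam (n + m) (τ + σ) q = waveChar lam n τ q * waveChar lam m σ q := by
  rw [waveChar, waveChar, waveChar, ← Complex.exp_add]
  congr 1; push_cast; ring

theorem continuous_waveChar (lam : ℝ) (n : ℤ) :
    Continuous fun y : ℝ × (ℝ × ℝ) => waveChar lam n y.1 y.2 := by
  unfold waveChar; fun_prop

theorem measurable_waveChar (lam : ℝ) :
    Measurable fun y : (ℤ × ℝ) × (ℝ × ℝ) => waveChar lam y.1.1 y.1.2 y.2 := by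
  have h : Measurable fun y : (ℤ × ℝ) × (ℝ × ℝ) => (y.1.1 : ℝ) :=
    (measurable_of_countable fun n : ℤ => (n : ℝ)).comp (measurable_fst.comp measurable_fst)
  unfold waveChar
  exact (((((measurable_snd.comp measurable_fst).mul (measurable_fst.comp measurable_snd)).add
    ((h.div_const lam).mul (measurable_snd.comp measurable_snd))).complex_ofReal).const_mul
      _).cexp

theorem IsSchwartz.continuous (hw : IsSchwartz lam w) :
    Continuous fun q : ℝ × ℝ => w q.2 q.1 :=
  hw.smooth.continuous.comp continuous_swap

theorem IsSchwartz.integrable (hw : IsSchwartz lam w) :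
    Integrable (fun q : ℝ × ℝ => w q.2 q.1) (cylinder lam) := by
  obtain ⟨K, -, hK⟩ := hw.exists_norm_le
  have h : Integrable (fun q : ℝ × ℝ => (1 + q.1 ^ 2)⁻¹ * K) (cylinder lam) :=
    integrable_inv_one_add_sq.mul_prod (integrable_const K)
  refine h.mono' hw.continuous.aestronglyMeasurable (Filter.Eventually.of_forall fun q => ?_)
  rw [mul_comm]; exact hK _ _

theorem IsSchwartz.integrable_waveChar_mul (hw : IsSchwartz lam w) (n : ℤ) (τ : ℝ) :
    Integrable (fun q : ℝ × ℝ => waveChar lam n τ q * w q.2 q.1) (cylinder lam) := by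
  refine hw.integrable.mono ?_ (Filter.Eventually.of_forall fun q => ?_)
  · exact (((continuous_waveChar lam n).comp (Continuous.prodMk_right τ)).mul
      hw.continuous).aestronglyMeasurable
  · rw [norm_mul, norm_waveChar, one_mul]

theorem IsSchwartz.spaceTimeFT_eq (hlam : 0 < lam) (hw : IsSchwartz lam w) (n : ℤ) (τ : ℝ) :
    spaceTimeFT lam w n τ = ∫ q, waveChar lam n τ q * w q.2 q.1 ∂(cylinder lam) := by
  rw [cylinder, integral_prod _ (hw.integrable_waveChar_mul n τ), spaceTimeFT]
  refine integral_congr_ae (Filter.Eventually.of_forall fun t => ?_)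
  simp only [waveChar]
  rw [intervalIntegral.integral_of_le (by positivity)]

theorem IsSchwartz.exists_norm_spaceTimeFT_le (hlam : 0 < lam) (hw : IsSchwartz lam w) :
    ∃ K : ℝ, ∀ n τ, ‖spaceTimeFT lam w n τ‖ ≤ K := by
  refine ⟨∫ q, ‖w q.2 q.1‖ ∂(cylinder lam), fun n τ => ?_⟩
  rw [hw.spaceTimeFT_eq hlam]
  refine (norm_integral_le_integral_norm _).trans (le_of_eq (integral_congr_ae
    (Filter.Eventually.of_forall fun q => ?_)))
  simp only [norm_mul, norm_waveChar, one_mul]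

theorem hasDerivAt_waveChar_snd (lam : ℝ) (n : ℤ) (τ t x : ℝ) :
    HasDerivAt (fun x => waveChar lam n τ (t, x))
      (-Complex.I * ((n : ℝ) / lam : ℝ) * waveChar lam n τ (t, x)) x := by
  have h := (((((hasDerivAt_id x).const_mul ((n : ℝ) / lam)).const_add (τ * t)).ofReal_comp).const_mul
    (-Complex.I)).cexp
  convert! h using 1
  simp [waveChar, mul_comm]

theorem hasDerivAt_waveChar_fst (lam : ℝ) (n : ℤ) (τ t x : ℝ) :
    HasDerivAt (fun t => waveChar lam n τ (t, x))
      (-Complex.I * (τ : ℂ) * waveChar lam n τ (t, x)) t := by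
  have h := (((((hasDerivAt_id t).const_mul τ).add_const ((n : ℝ) / lam * x)).ofReal_comp).const_mul
    (-Complex.I)).cexp
  convert! h using 1
  simp [waveChar, mul_comm]

theorem waveChar_period (hlam : 0 < lam) (n : ℤ) (τ t : ℝ) :
    waveChar lam n τ (t, 2 * Real.pi * lam) = waveChar lam n τ (t, 0) := by
  rw [waveChar, waveChar]
  have : -Complex.I * ((τ * t + (n : ℝ) / lam * (2 * Real.pi * lam) : ℝ) : ℂ) =
      -Complex.I * ((τ * t + (n : ℝ) / lam * 0 : ℝ) : ℂ) + ((-n : ℤ) : ℂ) *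
        (2 * Real.pi * Complex.I) := by
    have hl : (lam : ℂ) ≠ 0 := by exact_mod_cast hlam.ne'
    push_cast; field_simp; ring
  simp only [this, Complex.exp_add, Complex.exp_int_mul_two_pi_mul_I, mul_one]

theorem IsSchwartz.spaceTimeFT_dx (hlam : 0 < lam) (hw : IsSchwartz lam w) :
    spaceTimeFT lam (CoupledKdV.dx w) = fourierDx lam (spaceTimeFT lam w) := by
  ext n τ
  rw [fourierDx, spaceTimeFT, spaceTimeFT, ← integral_const_mul]
  refine integral_congr_ae (Filter.Eventually.of_forall fun t => ?_)
  have hc : Continuous fun x : ℝ => waveChar lam n τ (t, x) :=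
    (continuous_waveChar lam n).comp (by fun_prop : Continuous fun x : ℝ => (τ, (t, x)))
  have hd : Continuous fun x : ℝ => CoupledKdV.dx w x t :=
    hw.dx.smooth.continuous.comp (by fun_prop : Continuous fun x : ℝ => (x, t))
  have h := intervalIntegral.integral_mul_deriv_eq_deriv_mul (a := 0) (b := 2 * Real.pi * lam)
    (u := fun x => waveChar lam n τ (t, x)) (v := fun x => w x t)
    (fun x _ => hasDerivAt_waveChar_snd lam n τ t x) (fun x _ => by
      have := hw.hasDerivAt_fst x t
      rw [← this.deriv] at this; exact this) ((hc.const_mul _).intervalIntegrable _ _)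
    (hd.intervalIntegrable _ _)
  have hp : w (2 * Real.pi * lam) t = w 0 t := by simpa using hw.periodic 0 t
  rw [waveChar_period hlam, hp, sub_self, zero_sub] at h
  simp only
  refine h.trans ?_
  rw [← intervalIntegral.integral_neg, ← intervalIntegral.integral_const_mul]
  refine intervalIntegral.integral_congr fun x _ => ?_
  simp only [waveChar]; ring

theorem IsSchwartz.spaceTimeFT_dt (hlam : 0 < lam) (hw : IsSchwartz lam w) (n : ℤ) (τ : ℝ) :
    spaceTimeFT lam (CoupledKdV.dt w) n τ = Complex.I * (τ : ℂ) * spaceTimeFT lam w n τ := by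
  have hint : ∀ {w : ℝ → ℝ → ℂ}, IsSchwartz lam w → ∀ x,
      Integrable fun t => waveChar lam n τ (t, x) * w x t := by
    intro w hw x
    obtain ⟨K, -, hK⟩ := hw.exists_norm_le
    refine (integrable_inv_one_add_sq.const_mul K).mono' ?_
      (Filter.Eventually.of_forall fun t => ?_)
    · exact (((continuous_waveChar lam n).comp (by fun_prop : Continuous fun t : ℝ => (τ, (t, x)))).mul
        (hw.continuous.comp (by fun_prop : Continuous fun t : ℝ => (t, x)))).aestronglyMeasurable
    · rw [norm_mul, norm_waveChar, one_mul]; exact hK x t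
  rw [hw.dt.spaceTimeFT_eq hlam, hw.spaceTimeFT_eq hlam, cylinder,
    integral_prod_symm _ (hw.dt.integrable_waveChar_mul n τ),
    integral_prod_symm _ (hw.integrable_waveChar_mul n τ), ← integral_const_mul]
  refine integral_congr_ae (Filter.Eventually.of_forall fun x => ?_)
  have h := integral_mul_deriv_eq_deriv_mul_of_integrable
    (u := fun t => waveChar lam n τ (t, x)) (v := fun t => w x t)
    (fun t _ => hasDerivAt_waveChar_fst lam n τ t x) (fun t _ => by
      have := hw.hasDerivAt_snd x t
      rw [← this.deriv] at this; exact this) (hint hw.dt x)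
    (((hint hw x).const_mul (-Complex.I * τ)).congr (Filter.Eventually.of_forall fun t => by
      simp [mul_assoc])) (hint hw x)
  simp only
  refine h.trans ?_
  rw [← integral_neg, ← integral_const_mul]
  refine integral_congr_ae (Filter.Eventually.of_forall fun t => ?_)
  simp only; ring

/-- The transform of a Schwartz function decays rapidly. -/
theorem IsSchwartz.exists_decay (hlam : 0 < lam) (a b : ℕ) :
    ∀ {w : ℝ → ℝ → ℂ}, IsSchwartz lam w → ∃ K : ℝ, ∀ n τ,
      bracket (freq lam n) ^ a * bracket τ ^ b * ‖spaceTimeFT lam w n τ‖ ≤ K := by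
  induction a with
  | zero =>
    induction b with
    | zero =>
      intro w hw
      obtain ⟨K, hK⟩ := hw.exists_norm_spaceTimeFT_le hlam
      exact ⟨K, fun n τ => by simpa using hK n τ⟩
    | succ b ih =>
      intro w hw
      obtain ⟨K, hK⟩ := ih hw
      obtain ⟨L, hL⟩ := ih hw.dt
      refine ⟨K + L, fun n τ => ?_⟩
      have h1 := hK n τ
      have h2 := hL n τ
      rw [hw.spaceTimeFT_dt hlam, norm_mul, norm_mul, Complex.norm_I, one_mul, Complex.norm_real,
        Real.norm_eq_abs] at h2
      calc _ = bracket (freq lam n) ^ 0 * bracket τ ^ b * ‖spaceTimeFT lam w n τ‖ +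
            bracket (freq lam n) ^ 0 * bracket τ ^ b * (|τ| * ‖spaceTimeFT lam w n τ‖) := by
            rw [pow_succ]; nth_rewrite 3 [bracket]; ring
        _ ≤ _ := add_le_add h1 h2
  | succ a ih =>
    intro w hw
    obtain ⟨K, hK⟩ := ih hw
    obtain ⟨L, hL⟩ := ih hw.dx
    refine ⟨K + L, fun n τ => ?_⟩
    have h1 := hK n τ
    have h2 := hL n τ
    rw [hw.spaceTimeFT_dx hlam, norm_fourierDx] at h2
    calc _ = bracket (freq lam n) ^ a * bracket τ ^ b * ‖spaceTimeFT lam w n τ‖ +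
          bracket (freq lam n) ^ a * bracket τ ^ b *
            (|freq lam n| * ‖spaceTimeFT lam w n τ‖) := by
          rw [pow_succ]; nth_rewrite 2 [bracket]; ring
      _ ≤ _ := add_le_add h1 h2

theorem IsSchwartz.continuous_spaceTimeFT (hlam : 0 < lam) (hw : IsSchwartz lam w) (n : ℤ) :
    Continuous (spaceTimeFT lam w n) := by
  have : spaceTimeFT lam w n = fun τ => ∫ q, waveChar lam n τ q * w q.2 q.1 ∂(cylinder lam) :=
    funext fun τ => hw.spaceTimeFT_eq hlam n τ
  rw [this]
  refine continuous_of_dominated (bound := fun q => ‖w q.2 q.1‖)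
    (fun τ => (hw.integrable_waveChar_mul n τ).aestronglyMeasurable)
    (fun τ => Filter.Eventually.of_forall fun q => ?_) hw.integrable.norm
    (Filter.Eventually.of_forall fun q => ?_)
  · rw [norm_mul, norm_waveChar, one_mul]
  · exact ((continuous_waveChar lam n).comp (by fun_prop : Continuous fun τ : ℝ => (τ, q))).mul
      continuous_const

end Schwartz

/-! ### Schwartz functions in the Fourier restriction spaces -/

section SchwartzInversion

variable {lam : ℝ} {w w₁ w₂ : ℝ → ℝ → ℂ}

theorem tsum_bracket_freq_lt_top (hlam : 0 < lam) :
    ∑' n : ℤ, ENNReal.ofReal (bracket (freq lam n) ^ (-2 : ℝ)) < ⊤ := by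
  obtain ⟨K, -, hK⟩ := exists_tsum_bracket_le (q := 2) (by norm_num)
  refine lt_of_le_of_lt (le_of_eq (tsum_congr fun n => ?_))
    ((hK (1 / lam) 0 (by positivity)).trans_lt ENNReal.ofReal_lt_top)
  rw [sub_zero, freq, one_div_mul_eq_div]

theorem integrable_bracket_rpow_neg_two : Integrable fun τ : ℝ => bracket τ ^ (-2 : ℝ) := by
  refine ⟨(measurable_bracket.pow_const _).aestronglyMeasurable, ?_⟩
  rw [hasFiniteIntegral_iff_ofReal (Filter.Eventually.of_forall fun τ =>
    Real.rpow_nonneg (bracket_pos τ).le _)]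
  have := modulationMass_lt_top one_pos
  rwa [modulationMass, show (-1 - 1 : ℝ) = -2 by norm_num] at this

theorem integrable_bracket_freq (hlam : 0 < lam) :
    Integrable (fun n : ℤ => bracket (freq lam n) ^ (-2 : ℝ)) (latticeMeasure lam) := by
  refine ⟨(measurable_of_countable _).aestronglyMeasurable, ?_⟩
  rw [hasFiniteIntegral_iff_ofReal (Filter.Eventually.of_forall fun n =>
    Real.rpow_nonneg (bracket_pos _).le _), lintegral_latticeMeasure]
  exact ENNReal.mul_lt_top ENNReal.ofReal_lt_top (tsum_bracket_freq_lt_top hlam)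

/-- The modulation weight is of polynomial growth. -/
theorem bracket_sub_phase_le (α β k τ : ℝ) :
    bracket (τ - phase α β k) ≤ (1 + |α| + |β|) * bracket k ^ 3 * bracket τ := by
  have h1 : bracket (τ - phase α β k) ≤ bracket (phase α β k) * bracket τ := by
    have := abs_sub τ (phase α β k)
    unfold bracket
    nlinarith [abs_nonneg τ, abs_nonneg (phase α β k)]
  have h2 : bracket (phase α β k) ≤ (1 + |α| + |β|) * bracket k ^ 3 := by
    have h3 : |phase α β k| ≤ |α| * |k| ^ 3 + |β| * |k| := by
      rw [phase]
      refine (abs_sub _ _).trans (le_of_eq ?_)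
      rw [abs_mul, abs_mul, abs_pow]
    have h4 : |k| ^ 3 ≤ bracket k ^ 3 := by gcongr; unfold bracket; linarith
    have h5 : |k| ≤ bracket k ^ 3 :=
      (by unfold bracket; linarith : |k| ≤ bracket k).trans
        (le_self_pow₀ (one_le_bracket k) (by norm_num))
    have h6 : 1 ≤ bracket k ^ 3 := one_le_pow₀ (one_le_bracket k)
    have h7 := mul_le_mul_of_nonneg_left h4 (abs_nonneg α)
    have h8 := mul_le_mul_of_nonneg_left h5 (abs_nonneg β)
    rw [bracket]
    linarith
  exact h1.trans (mul_le_mul_of_nonneg_right h2 (bracket_pos τ).le)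

/-- The rapid decay of the transform outweighs the polynomial growth of the weights. -/
theorem IsSchwartz.memX (hlam : 0 < lam) (hw : IsSchwartz lam w) (α β s : ℝ) :
    MemX lam α β s (1 / 2) (spaceTimeFT lam w) where
  measurable n := (hw.continuous_spaceTimeFT hlam n).aestronglyMeasurable
  finite := by
    obtain ⟨a, ha⟩ := exists_nat_ge (s + 4)
    obtain ⟨K, hK⟩ := hw.exists_decay hlam a 2
    have hK0 : 0 ≤ K := le_trans (mul_nonneg (mul_nonneg (pow_nonneg (bracket_pos _).le _)
      (pow_nonneg (bracket_pos _).le _)) (norm_nonneg _)) (hK 0 0)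
    set M : ℝ := (1 + |α| + |β|) * K with hM
    have hpt : ∀ n τ, bracket (freq lam n) ^ s *
        bracket (τ - phase α β (freq lam n)) ^ (1 / 2 : ℝ) * ‖spaceTimeFT lam w n τ‖ ≤
        M * (bracket (freq lam n))⁻¹ * (bracket τ)⁻¹ := by
      intro n τ
      set k := bracket (freq lam n)
      have hk : 1 ≤ k := one_le_bracket _
      have hk0 : 0 < k := bracket_pos _
      have ht0 : 0 < bracket τ := bracket_pos _
      have h1 : bracket (τ - phase α β (freq lam n)) ^ (1 / 2 : ℝ) ≤
          (1 + |α| + |β|) * k ^ 3 * bracket τ := by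
        refine le_trans ?_ (bracket_sub_phase_le α β _ τ)
        calc _ ≤ bracket (τ - phase α β (freq lam n)) ^ (1 : ℝ) :=
              Real.rpow_le_rpow_of_exponent_le (one_le_bracket _) (by norm_num)
          _ = _ := Real.rpow_one _
      have h2 : k ^ s * k ^ 4 ≤ k ^ a := by
        rw [← Real.rpow_natCast k 4, ← Real.rpow_add hk0, ← Real.rpow_natCast k a]
        exact Real.rpow_le_rpow_of_exponent_le hk (by exact_mod_cast ha)
      calc _ ≤ k ^ s * ((1 + |α| + |β|) * k ^ 3 * bracket τ) * ‖spaceTimeFT lam w n τ‖ := by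
            gcongr
        _ = (1 + |α| + |β|) * ((k ^ s * k ^ 4) * bracket τ ^ 2 * ‖spaceTimeFT lam w n τ‖) *
            k⁻¹ * (bracket τ)⁻¹ := by field_simp
        _ ≤ (1 + |α| + |β|) * (k ^ a * bracket τ ^ 2 * ‖spaceTimeFT lam w n τ‖) *
            k⁻¹ * (bracket τ)⁻¹ := by gcongr
        _ ≤ (1 + |α| + |β|) * K * k⁻¹ * (bracket τ)⁻¹ := by gcongr; exact hK n τ
    rw [xNorm]
    refine ENNReal.rpow_lt_top_of_nonneg (by norm_num) (ne_of_lt ?_)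
    calc _ ≤ ∫⁻ n : ℤ, ENNReal.ofReal (M ^ 2) * (ENNReal.ofReal (bracket (freq lam n) ^ (-2 : ℝ)) *
          modulationMass 1) ∂(latticeMeasure lam) := by
          refine lintegral_mono fun n => ?_
          rw [modulationMass, ← lintegral_const_mul' _ _ ENNReal.ofReal_ne_top,
            ← lintegral_const_mul' _ _ ENNReal.ofReal_ne_top]
          refine lintegral_mono fun τ => ?_
          have hk0 : 0 < bracket (freq lam n) := bracket_pos _
          have ht0 : 0 < bracket τ := bracket_pos _
          rw [← ENNReal.ofReal_mul (by positivity), ← ENNReal.ofReal_mul (by positivity),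
            ENNReal.ofReal_rpow_of_nonneg (mul_nonneg (mul_nonneg (Real.rpow_nonneg
              (bracket_pos _).le _) (Real.rpow_nonneg (bracket_pos _).le _)) (norm_nonneg _))
              (by norm_num)]
          refine ENNReal.ofReal_le_ofReal ?_
          rw [Real.rpow_two]
          refine (pow_le_pow_left₀ (mul_nonneg (mul_nonneg (Real.rpow_nonneg
              (bracket_pos _).le _) (Real.rpow_nonneg (bracket_pos _).le _)) (norm_nonneg _))
              (hpt n τ) 2).trans (le_of_eq ?_)
          rw [show (-1 - 1 : ℝ) = -2 by norm_num, Real.rpow_neg hk0.le, Real.rpow_neg ht0.le,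
            Real.rpow_two, Real.rpow_two]
          ring
      _ < ⊤ := by
          rw [lintegral_const_mul' _ _ ENNReal.ofReal_ne_top, lintegral_mul_const'
            _ _ (modulationMass_lt_top one_pos).ne, lintegral_latticeMeasure]
          exact ENNReal.mul_lt_top ENNReal.ofReal_lt_top (ENNReal.mul_lt_top (ENNReal.mul_lt_top
            ENNReal.ofReal_lt_top (tsum_bracket_freq_lt_top hlam)) (modulationMass_lt_top one_pos))

theorem IsSchwartz.exists_norm_spaceTimeFT_le_rpow (hlam : 0 < lam) (hw : IsSchwartz lam w) :
    ∃ K : ℝ, 0 ≤ K ∧ ∀ n τ, ‖spaceTimeFT lam w n τ‖ ≤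
      bracket (freq lam n) ^ (-2 : ℝ) * (bracket τ ^ (-2 : ℝ) * K) := by
  obtain ⟨K, hK⟩ := hw.exists_decay hlam 2 2
  refine ⟨K, le_trans (mul_nonneg (mul_nonneg (pow_nonneg (bracket_pos _).le _)
      (pow_nonneg (bracket_pos _).le _)) (norm_nonneg _)) (hK 0 0), fun n τ => ?_⟩
  have hk0 : 0 < bracket (freq lam n) := bracket_pos _
  have ht0 : 0 < bracket τ := bracket_pos _
  rw [Real.rpow_neg hk0.le, Real.rpow_neg ht0.le, Real.rpow_two, Real.rpow_two]
  have := hK n τ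
  calc _ = (bracket (freq lam n) ^ 2)⁻¹ * ((bracket τ ^ 2)⁻¹ *
      (bracket (freq lam n) ^ 2 * bracket τ ^ 2 * ‖spaceTimeFT lam w n τ‖)) := by field_simp
    _ ≤ _ := by gcongr

theorem IsSchwartz.integrable_spaceTimeFT (hlam : 0 < lam) (hw : IsSchwartz lam w) :
    Integrable (fun q : ℤ × ℝ => spaceTimeFT lam w q.1 q.2) (phaseMeasure lam) := by
  obtain ⟨K, -, hK⟩ := hw.exists_norm_spaceTimeFT_le_rpow hlam
  have h := (integrable_bracket_freq hlam).mul_prod (integrable_bracket_rpow_neg_two.mul_const K)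
  refine h.mono' (Measurable.aestronglyMeasurable ?_)
    (Filter.Eventually.of_forall fun q => hK q.1 q.2)
  exact measurable_from_prod_countable_right fun n => (hw.continuous_spaceTimeFT hlam n).measurable

/-- Fourier inversion on the line, in the normalization of the angular frequency. -/
theorem eq_integral_of_continuous {g G : ℝ → ℂ} (hc : Continuous g) (hi : Integrable g)
    (hG : ∀ τ, G τ = ∫ t, Complex.exp (-Complex.I * ((τ * t : ℝ) : ℂ)) * g t)
    (hGi : Integrable G) (t : ℝ) :
    g t = ((1 / (2 * Real.pi) : ℝ) : ℂ) * ∫ τ, Complex.exp (Complex.I * ((τ * t : ℝ) : ℂ)) * G τ := by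
  have hF : FourierTransform.fourier g = fun ξ => G (2 * Real.pi * ξ) := by
    ext ξ
    rw [Real.fourier_eq', hG]
    refine integral_congr_ae (Filter.Eventually.of_forall fun u => ?_)
    simp only [smul_eq_mul]
    congr 2
    simp only [RCLike.inner_apply, conj_trivial]
    push_cast; ring
  have h2 : (2 * Real.pi) ≠ 0 := by positivity
  have hinv := congrFun (hc.fourierInv_fourier_eq hi (by rw [hF]; exact hGi.comp_mul_left' h2)) t
  rw [← hinv, hF, Real.fourierInv_eq']
  have h3 := Measure.integral_comp_mul_left
    (fun τ => Complex.exp (Complex.I * ((τ * t : ℝ) : ℂ)) * G τ) (2 * Real.pi)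
  rw [abs_of_pos (by positivity), Complex.real_smul, ← one_div] at h3
  rw [← h3]
  refine integral_congr_ae (Filter.Eventually.of_forall fun ξ => ?_)
  simp only [smul_eq_mul]
  congr 2
  simp only [RCLike.inner_apply, conj_trivial]
  push_cast; ring

end SchwartzInversion

/-! ### Fourier inversion and products of Schwartz functions -/

section SchwartzProduct

variable {lam : ℝ} {w w₁ w₂ : ℝ → ℝ → ℂ}

/-- The transform in the space variable alone, at the frequency `k = n / λ`. -/
def sliceFT (lam : ℝ) (w : ℝ → ℝ → ℂ) (n : ℤ) (t : ℝ) : ℂ :=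
  ∫ x in (0 : ℝ)..(2 * Real.pi * lam), waveChar lam n 0 (t, x) * w x t

theorem IsSchwartz.continuous_sliceFT (hw : IsSchwartz lam w) (n : ℤ) :
    Continuous (sliceFT lam w n) := by
  refine intervalIntegral.continuous_parametric_intervalIntegral_of_continuous' (μ := volume)
    (f := fun t x => waveChar lam n 0 (t, x) * w x t) ?_ 0 (2 * Real.pi * lam)
  exact ((continuous_waveChar lam n).comp (Continuous.prodMk_right (0 : ℝ))).mul hw.continuous

theorem IsSchwartz.integrable_sliceFT (hlam : 0 < lam) (hw : IsSchwartz lam w) (n : ℤ) :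
    Integrable (sliceFT lam w n) := by
  have h := (hw.integrable_waveChar_mul n 0).integral_prod_left
  refine h.congr (Filter.Eventually.of_forall fun t => ?_)
  simp only [sliceFT]
  rw [intervalIntegral.integral_of_le (by positivity)]

theorem spaceTimeFT_eq_integral_sliceFT (lam : ℝ) (w : ℝ → ℝ → ℂ) (n : ℤ) (τ : ℝ) :
    spaceTimeFT lam w n τ =
      ∫ t, Complex.exp (-Complex.I * ((τ * t : ℝ) : ℂ)) * sliceFT lam w n t := by
  rw [spaceTimeFT]
  refine integral_congr_ae (Filter.Eventually.of_forall fun t => ?_)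
  simp only [sliceFT]
  rw [← intervalIntegral.integral_const_mul]
  refine intervalIntegral.integral_congr fun x _ => ?_
  simp only [waveChar]
  rw [← mul_assoc, ← Complex.exp_add]
  congr 2; push_cast; ring

theorem IsSchwartz.sliceFT_eq (hlam : 0 < lam) (hw : IsSchwartz lam w) (n : ℤ) (t : ℝ) :
    sliceFT lam w n t = ((1 / (2 * Real.pi) : ℝ) : ℂ) *
      ∫ τ, Complex.exp (Complex.I * ((τ * t : ℝ) : ℂ)) * spaceTimeFT lam w n τ := by
  refine eq_integral_of_continuous (hw.continuous_sliceFT n) (hw.integrable_sliceFT hlam n)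
    (fun τ => spaceTimeFT_eq_integral_sliceFT lam w n τ) ?_ t
  obtain ⟨K, -, hK⟩ := hw.exists_norm_spaceTimeFT_le_rpow hlam
  exact ((integrable_bracket_rpow_neg_two.mul_const K).const_mul _).mono'
    (hw.continuous_spaceTimeFT hlam n).aestronglyMeasurable (Filter.Eventually.of_forall (hK n))

theorem summable_bracket_freq (hlam : 0 < lam) :
    Summable fun n : ℤ => bracket (freq lam n) ^ (-2 : ℝ) := by
  have h := ENNReal.summable_toReal (tsum_bracket_freq_lt_top hlam).ne
  refine h.congr fun n => ?_
  rw [ENNReal.toReal_ofReal (Real.rpow_nonneg (bracket_pos _).le _)]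

/-- The Fourier series in the space variable converges absolutely. -/
theorem IsSchwartz.summable_sliceFT (hlam : 0 < lam) (hw : IsSchwartz lam w) (t : ℝ) :
    Summable fun n => sliceFT lam w n t := by
  obtain ⟨K, -, hK⟩ := hw.exists_norm_spaceTimeFT_le_rpow hlam
  refine Summable.of_norm_bounded ((summable_bracket_freq hlam).mul_right
    (1 / (2 * Real.pi) * ∫ τ, bracket τ ^ (-2 : ℝ) * K)) fun n => ?_
  rw [hw.sliceFT_eq hlam, norm_mul, Complex.norm_real, Real.norm_eq_abs,
    abs_of_pos (by positivity), mul_left_comm]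
  refine mul_le_mul_of_nonneg_left ?_ (by positivity)
  rw [← integral_const_mul]
  refine norm_integral_le_of_norm_le ((integrable_bracket_rpow_neg_two.mul_const K).const_mul _)
    (Filter.Eventually.of_forall fun τ => ?_)
  rw [norm_mul, Complex.norm_exp]
  simpa using hK n τ

/-- The Fourier series of a Schwartz function in the space variable. -/
theorem IsSchwartz.hasSum_sliceFT (hlam : 0 < lam) (hw : IsSchwartz lam w) (x t : ℝ) :
    HasSum (fun n => ((1 / (2 * Real.pi * lam) : ℝ) : ℂ) * sliceFT lam w n t *
      waveChar lam (-n) 0 (t, x)) (w x t) := by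
  have hT : 0 < 2 * Real.pi * lam := by positivity
  have : Fact (0 < 2 * Real.pi * lam) := ⟨hT⟩
  have hl : (lam : ℂ) ≠ 0 := by exact_mod_cast hlam.ne'
  have hpi : (Real.pi : ℂ) ≠ 0 := by exact_mod_cast Real.pi_ne_zero
  have hper : Function.Periodic (fun y => w y t) (2 * Real.pi * lam) := fun y => hw.periodic y t
  have hcont : Continuous (Function.Periodic.lift hper) :=
    continuous_coinduced_dom.mpr
      (hw.continuous.comp (by fun_prop : Continuous fun y : ℝ => (t, y)))
  have hchar : ∀ (n : ℤ) (y : ℝ), fourier n (y : AddCircle (2 * Real.pi * lam)) =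
      waveChar lam (-n) 0 (t, y) := by
    intro n y
    rw [fourier_coe_apply, waveChar]
    congr 1; push_cast; field_simp; ring
  let f : C(AddCircle (2 * Real.pi * lam), ℂ) := ⟨Function.Periodic.lift hper, hcont⟩
  have hf : ∀ y : ℝ, f (y : AddCircle (2 * Real.pi * lam)) = w y t := fun y =>
    Function.Periodic.lift_coe hper y
  have hcoef : ∀ n, fourierCoeff f n = ((1 / (2 * Real.pi * lam) : ℝ) : ℂ) * sliceFT lam w n t := by
    intro n
    rw [fourierCoeff_eq_intervalIntegral f n 0, zero_add, sliceFT, Complex.real_smul]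
    congr 1
    refine intervalIntegral.integral_congr fun y _ => ?_
    simp only [hf, hchar, neg_neg, smul_eq_mul]
  have hs : Summable (fourierCoeff f) := by
    rw [show fourierCoeff f = _ from funext hcoef]
    exact (hw.summable_sliceFT hlam t).mul_left _
  have h := has_pointwise_sum_fourier_series_of_summable hs (x : AddCircle (2 * Real.pi * lam))
  rw [hf] at h
  refine h.congr_fun fun n => ?_
  rw [hcoef, hchar, smul_eq_mul]

/-- Fourier inversion for Schwartz functions on `𝕋_λ × ℝ`. -/
theorem IsSchwartz.eq_integral_spaceTimeFT (hlam : 0 < lam) (hw : IsSchwartz lam w) (x t : ℝ) :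
    w x t = ((1 / (4 * Real.pi ^ 2) : ℝ) : ℂ) *
      ∫ q : ℤ × ℝ, spaceTimeFT lam w q.1 q.2 * waveChar lam (-q.1) (-q.2) (t, x)
        ∂(phaseMeasure lam) := by
  have hm : AEStronglyMeasurable (fun q : ℤ × ℝ => spaceTimeFT lam w q.1 q.2 *
      waveChar lam (-q.1) (-q.2) (t, x)) (phaseMeasure lam) := by
    refine (hw.integrable_spaceTimeFT hlam).aestronglyMeasurable.mul
      (Measurable.aestronglyMeasurable ?_)
    exact (measurable_waveChar lam).comp
      (((measurable_fst.neg).prodMk measurable_snd.neg).prodMk measurable_const)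
  have hi : Integrable (fun q : ℤ × ℝ => spaceTimeFT lam w q.1 q.2 *
      waveChar lam (-q.1) (-q.2) (t, x)) (phaseMeasure lam) := by
    refine (hw.integrable_spaceTimeFT hlam).mono hm (Filter.Eventually.of_forall fun q => ?_)
    rw [norm_mul, norm_waveChar, mul_one]
  have hmass : ∀ n : ℤ, (latticeMeasure lam).real {n} = 1 / lam := by
    intro n
    rw [latticeMeasure, measureReal_ennreal_smul_apply, ENNReal.toReal_ofReal (by positivity)]
    simp [measureReal_def]
  rw [integral_prod _ hi, integral_countable hi.integral_prod_left, ← tsum_mul_left,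
    ← (hw.hasSum_sliceFT hlam x t).tsum_eq]
  refine tsum_congr fun n => ?_
  have hsplit : ∀ τ, spaceTimeFT lam w n τ * waveChar lam (-n) (-τ) (t, x) =
      Complex.exp (Complex.I * ((τ * t : ℝ) : ℂ)) * spaceTimeFT lam w n τ *
        waveChar lam (-n) 0 (t, x) := by
    intro τ
    rw [waveChar, waveChar, mul_comm (spaceTimeFT lam w n τ), mul_right_comm, ← Complex.exp_add]
    congr 2; push_cast; ring
  simp only [hsplit]
  rw [integral_mul_const, hw.sliceFT_eq hlam, hmass, Complex.real_smul]
  have hl : (lam : ℂ) ≠ 0 := by exact_mod_cast hlam.ne'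
  have hpi : (Real.pi : ℂ) ≠ 0 := by exact_mod_cast Real.pi_ne_zero
  generalize (∫ τ, Complex.exp (Complex.I * ((τ * t : ℝ) : ℂ)) * spaceTimeFT lam w n τ) = J
  push_cast
  field_simp
  ring

instance cylinder_sFinite (lam : ℝ) : SFinite (cylinder lam) := by
  unfold cylinder; infer_instance

/-- The transform of a pointwise product is the convolution of the transforms. -/
theorem IsSchwartz.spaceTimeFT_mul (hlam : 0 < lam) (h₁ : IsSchwartz lam w₁)
    (h₂ : IsSchwartz lam w₂) :
    spaceTimeFT lam (fun x t => w₁ x t * w₂ x t) =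
      fourierMul lam (spaceTimeFT lam w₁) (spaceTimeFT lam w₂) := by
  ext n τ
  rw [(h₁.mul h₂).spaceTimeFT_eq hlam, fourierMul]
  have hint : Integrable (Function.uncurry fun (q : ℝ × ℝ) (y : ℤ × ℝ) =>
      (waveChar lam (n - y.1) (τ - y.2) q) * (w₂ q.2 q.1 * spaceTimeFT lam w₁ y.1 y.2))
      ((cylinder lam).prod (phaseMeasure lam)) := by
    have h := h₂.integrable.mul_prod (h₁.integrable_spaceTimeFT hlam)
    refine h.mono (AEStronglyMeasurable.mul (Measurable.aestronglyMeasurable ?_)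
      h.aestronglyMeasurable) (Filter.Eventually.of_forall fun z => ?_)
    · exact (measurable_waveChar lam).comp
        (((measurable_const.sub (measurable_fst.comp measurable_snd)).prodMk
          (measurable_const.sub (measurable_snd.comp measurable_snd))).prodMk measurable_fst)
    · simp only [Function.uncurry]
      rw [norm_mul, norm_waveChar, one_mul]
  -- the inversion formula for `w₁` is inserted, and the integrals are interchanged
  calc _ = ∫ q, ((1 / (4 * Real.pi ^ 2) : ℝ) : ℂ) * ∫ y : ℤ × ℝ,
        (waveChar lam (n - y.1) (τ - y.2) q) * (w₂ q.2 q.1 * spaceTimeFT lam w₁ y.1 y.2)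
          ∂(phaseMeasure lam) ∂(cylinder lam) := by
        refine integral_congr_ae (Filter.Eventually.of_forall fun q => ?_)
        simp only
        rw [h₁.eq_integral_spaceTimeFT hlam, mul_assoc, mul_left_comm, ← integral_mul_const,
          ← integral_const_mul]
        congr 1
        refine integral_congr_ae (Filter.Eventually.of_forall fun y => ?_)
        simp only [sub_eq_add_neg, waveChar_add]
        ring
    _ = _ := by
        rw [integral_const_mul, integral_integral_swap hint]
        congr 1
        refine integral_congr_ae (Filter.Eventually.of_forall fun y => ?_)
        simp only
        rw [h₂.spaceTimeFT_eq hlam, ← integral_const_mul]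
        refine integral_congr_ae (Filter.Eventually.of_forall fun q => ?_)
        simp only
        ring

end SchwartzProduct

end CoupledKdV

end

open CoupledKdV in
theorem mainTheorem8 (α₁ α₂ : ℝ) (hα₁ : α₁ ≠ 0) (hα₂ : α₂ ≠ 0) :
    ∃ ε : ℝ, 0 < ε ∧ ∀ s p : ℝ, ∃ C : ℝ, 0 < C ∧
      ∀ lam β₁ β₂ : ℝ, 1 ≤ lam → |β₁| + |β₂| ≤ lam ^ (-(1 / 2) : ℝ) * ε →
      -- all elements of the Fourier restriction spaces
      (∀ f g : ℤ → ℝ → ℂ, MemX lam α₁ β₁ s (1 / 2) f → MemX lam α₁ β₁ s (1 / 2) g →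
        Div1Cond (α₂ / α₁) s p β₁ β₂ f g →
        (∀ n : ℤ, n ≠ 0 → ∀ᵐ τ : ℝ, ConvConverges lam f g n τ) ∧
        zNorm lam α₂ β₂ s (fourierDx lam (fourierMul lam f g)) ≤
          ENNReal.ofReal (C * lam ^ p) *
            (xNorm lam α₁ β₁ s (1 / 2) f * xNorm lam α₁ β₁ s (1 / 2) g)) ∧
      (∀ f g : ℤ → ℝ → ℂ, MemX lam α₁ β₁ s (1 / 2) f → MemX lam α₂ β₂ s (1 / 2) g →
        Div2Cond (α₂ / α₁) s p β₁ β₂ f g →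
        (∀ n : ℤ, n ≠ 0 → ∀ᵐ τ : ℝ, ConvConverges lam f g n τ) ∧
        zNorm lam α₁ β₁ s (fourierDx lam (fourierMul lam f g)) ≤
          ENNReal.ofReal (C * lam ^ p) *
            (xNorm lam α₁ β₁ s (1 / 2) f * xNorm lam α₂ β₂ s (1 / 2) g)) ∧
      (∀ f g : ℤ → ℝ → ℂ, MemX lam α₁ β₁ s (1 / 2) f → MemX lam α₂ β₂ s (1 / 2) g →
        Nondiv1Cond (α₂ / α₁) s p β₁ β₂ g →
        (∀ n : ℤ, ∀ᵐ τ : ℝ, ConvConverges lam (fourierDx lam f) g n τ) ∧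
        zNorm lam α₁ β₁ s (fourierMul lam (fourierDx lam f) g) ≤
          ENNReal.ofReal (C * lam ^ p) *
            (xNorm lam α₁ β₁ s (1 / 2) f * xNorm lam α₂ β₂ s (1 / 2) g)) ∧
      (∀ f g : ℤ → ℝ → ℂ, MemX lam α₁ β₁ s (1 / 2) f → MemX lam α₂ β₂ s (1 / 2) g →
        Nondiv2Cond (α₂ / α₁) s p β₁ β₂ f →
        (∀ n : ℤ, ∀ᵐ τ : ℝ, ConvConverges lam f (fourierDx lam g) n τ) ∧
        zNorm lam α₁ β₁ s (fourierMul lam f (fourierDx lam g)) ≤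
          ENNReal.ofReal (C * lam ^ p) *
            (xNorm lam α₁ β₁ s (1 / 2) f * xNorm lam α₂ β₂ s (1 / 2) g)) ∧
      -- Schwartz functions, with pointwise products and derivatives
      (∀ w₁ w₂ : ℝ → ℝ → ℂ, IsSchwartz lam w₁ → IsSchwartz lam w₂ →
        (Div1Cond (α₂ / α₁) s p β₁ β₂ (spaceTimeFT lam w₁) (spaceTimeFT lam w₂) →
          zNorm lam α₂ β₂ s (spaceTimeFT lam (dx fun x t => w₁ x t * w₂ x t)) ≤
            ENNReal.ofReal (C * lam ^ p) *
              (xNorm lam α₁ β₁ s (1 / 2) (spaceTimeFT lam w₁) *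
                xNorm lam α₁ β₁ s (1 / 2) (spaceTimeFT lam w₂))) ∧
        (Div2Cond (α₂ / α₁) s p β₁ β₂ (spaceTimeFT lam w₁) (spaceTimeFT lam w₂) →
          zNorm lam α₁ β₁ s (spaceTimeFT lam (dx fun x t => w₁ x t * w₂ x t)) ≤
            ENNReal.ofReal (C * lam ^ p) *
              (xNorm lam α₁ β₁ s (1 / 2) (spaceTimeFT lam w₁) *
                xNorm lam α₂ β₂ s (1 / 2) (spaceTimeFT lam w₂))) ∧
        (Nondiv1Cond (α₂ / α₁) s p β₁ β₂ (spaceTimeFT lam w₂) →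
          zNorm lam α₁ β₁ s (spaceTimeFT lam fun x t => dx w₁ x t * w₂ x t) ≤
            ENNReal.ofReal (C * lam ^ p) *
              (xNorm lam α₁ β₁ s (1 / 2) (spaceTimeFT lam w₁) *
                xNorm lam α₂ β₂ s (1 / 2) (spaceTimeFT lam w₂))) ∧
        (Nondiv2Cond (α₂ / α₁) s p β₁ β₂ (spaceTimeFT lam w₁) →
          zNorm lam α₁ β₁ s (spaceTimeFT lam fun x t => w₁ x t * dx w₂ x t) ≤
            ENNReal.ofReal (C * lam ^ p) *
              (xNorm lam α₁ β₁ s (1 / 2) (spaceTimeFT lam w₁) *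
                xNorm lam α₂ β₂ s (1 / 2) (spaceTimeFT lam w₂)))) := by
  refine ⟨1, one_pos, fun s p => ?_⟩
  obtain ⟨C₁, hC₁, H₁⟩ := exists_div1_le (α₂ := α₂) (s := s) (p := p) hα₁
  obtain ⟨C₂, hC₂, H₂⟩ := exists_div2_le (α₂ := α₂) (s := s) (p := p) hα₁
  obtain ⟨C₃, hC₃, H₃⟩ := exists_nondiv1_le (α₂ := α₂) (s := s) (p := p) hα₁
  obtain ⟨C₄, hC₄, H₄⟩ := exists_nondiv2_le (α₂ := α₂) (s := s) (p := p) hα₁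
  refine ⟨C₁ + C₂ + C₃ + C₄, by positivity, fun lam β₁ β₂ hlam hβ => ?_⟩
  rw [mul_one] at hβ
  have hl : 0 < lam := by linarith
  have mono : ∀ {C : ℝ} {A B : ℝ≥0∞}, C ≤ C₁ + C₂ + C₃ + C₄ →
      A ≤ ENNReal.ofReal (C * lam ^ p) * B →
      A ≤ ENNReal.ofReal ((C₁ + C₂ + C₃ + C₄) * lam ^ p) * B := fun hC h =>
    h.trans (mul_le_mul_left (ENNReal.ofReal_le_ofReal
      (mul_le_mul_of_nonneg_right hC (Real.rpow_nonneg hl.le p))) _)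
  have D₁ := fun f g hf hg hc => (H₁ lam β₁ β₂ hlam hβ f g hf hg hc).imp_right
    (mono (by linarith))
  have D₂ := fun f g hf hg hc => (H₂ lam β₁ β₂ hlam hβ f g hf hg hc).imp_right
    (mono (by linarith))
  have N₁ := fun f g hf hg hc => (H₃ lam β₁ β₂ hlam hβ f g hf hg hc).imp_right
    (mono (by linarith))
  have N₂ := fun f g hf hg hc => (H₄ lam β₁ β₂ hlam hβ f g hf hg hc).imp_right
    (mono (by linarith))
  refine ⟨D₁, D₂, N₁, N₂, fun w₁ w₂ h₁ h₂ => ⟨fun hc => ?_, fun hc => ?_, fun hc => ?_,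
    fun hc => ?_⟩⟩
  · rw [(h₁.mul h₂).spaceTimeFT_dx hl, h₁.spaceTimeFT_mul hl h₂]
    exact (D₁ _ _ (h₁.memX hl _ _ _) (h₂.memX hl _ _ _) hc).2
  · rw [(h₁.mul h₂).spaceTimeFT_dx hl, h₁.spaceTimeFT_mul hl h₂]
    exact (D₂ _ _ (h₁.memX hl _ _ _) (h₂.memX hl _ _ _) hc).2
  · rw [h₁.dx.spaceTimeFT_mul hl h₂, h₁.spaceTimeFT_dx hl]
    exact (N₁ _ _ (h₁.memX hl _ _ _) (h₂.memX hl _ _ _) hc).2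
  · rw [h₁.spaceTimeFT_mul hl h₂.dx, h₂.spaceTimeFT_dx hl]
    exact (N₂ _ _ (h₁.memX hl _ _ _) (h₂.memX hl _ _ _) hc).2
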